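/- **Setting.** Let $m\ge 0$, $p=p_1+p_2$ with $p_1,p_2\ge 0$, and let $\Theta\subset\mathbb{R}^{p}$ be open. Write parameters in block form as $\theta=\binom{\omega}{\nu}$ with $\omega\in\mathbb{R}^{p_1}$, $\nu\in\mathbb{R}^{p_2}$. For $\theta\in\Theta$ let $Y_\theta$ be a random column vector in $\mathbb{R}^m$, and for $n\ge1$ let $X_\theta=\sum_{i=1}^n Y_\theta^{(i)}$ be the sum of $n$ i.i.d. copies of $Y_\theta$. For row vectors $s$ put $M_0(s;\theta)=\mathbb{E}(e^{sY_\theta})$, $K_0=\log M_0$, $K=nK_0$, and $\mathcal{S}=\{(s,\theta): \theta\in\Theta,\ s\in\mathbb{R}^{1\times m},\ M_0(s;\theta)<\infty\}$; $M_0(s+\mathrm{i}\phi;\theta)=\mathbb{E}(e^{(s+\mathrm{i}\phi)Y_\theta})$ for $(s,\theta)\in\mathcal S$, $\phi\in\mathbb{R}^{1\times m}$. $K_0'$ and $K_0''$ denote the gradient (a column vector) and the Hessian of $K_0$ in $s$. Assume: (D) there is a continuous $\delta:\operatorname{int}\mathcal{S}\to(0,\infty)$ with $\left|\frac{M_0(s+\mathrm{i}\phi;\theta)}{M_0(s;\theta)}\right|\le(1+\delta(s,\theta)|\phi|^2)^{-\delta(s,\theta)}$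 for all $\phi\in\mathbb{R}^{1\times m}$, $(s,\theta)\in\operatorname{int}\mathcal{S}$; (G) there is a continuous $\gamma:\operatorname{int}\mathcal{S}\to(0,\infty)$ such that, for $k\in\{0,1\}$, $1\le k+\ell\le 6$ and for $k=2$, $0\le\ell\le2$, all the partial derivatives $\frac{\partial^{k+\ell}M_0}{\partial\theta_{i_1}\cdots\partial\theta_{i_k}\partial s_{j_1}\cdots\partial s_{j_\ell}}(s+\mathrm{i}\phi;\theta)$ exist, are continuous in $(s,\phi,\theta)$, and are bounded in absolute value by $\gamma(s,\theta)(1+|\phi|)^{\gamma(s,\theta)}$, for $\phi\in\mathbb{R}^{1\times m}$ and $(s,\theta)\in\operatorname{int}\mathcal{S}$; and that $K_0'(0;\theta)=\mathbb{E}(Y_\theta)$ depends only on $\omega$ (for $\theta$ with $(0,\theta)\in\operatorname{int}\mathcal S$). Let $\theta_0=\binom{\omega_0}{\nu_0}$ satisfy $(0,\theta_0)\in\operatorname{int}\mathcal{S}$. Put $A=K_0''(0;\theta_0)$ and let $B_\omega$ be the $m\times p_1$ matrix with entries $\frac{\partial^2K_0}{\partial s_i\partial\omega_j}(0;\theta_0)$.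 Suppose $B_\omega$ has rank $p_1$ and put $J=A^{-1}-A^{-1}B_\omega(B_\omega^TA^{-1}B_\omega)^{-1}B_\omega^TA^{-1}$. Suppose $\xi_0\in\mathbb{R}^m$ satisfies $$\xi_0^TJ\frac{\partial K_0''}{\partial\nu_j}(0;\theta_0)J\xi_0=\operatorname{tr}\Big(A^{-1}\frac{\partial K_0''}{\partial\nu_j}(0;\theta_0)\Big),\qquad j=1,\dots,p_2,$$ and that the symmetric $p_2\times p_2$ matrix $E$ with entries $$E_{ij}=\xi_0^TJ\Big(\tfrac12\tfrac{\partial^2K_0''}{\partial\nu_i\partial\nu_j}-\tfrac{\partial K_0''}{\partial\nu_i}J\tfrac{\partial K_0''}{\partial\nu_j}\Big)J\xi_0-\tfrac12\operatorname{tr}\Big(A^{-1}\tfrac{\partial^2K_0''}{\partial\nu_i\partial\nu_j}-A^{-2}\tfrac{\partial K_0''}{\partial\nu_i}\tfrac{\partial K_0''}{\partial\nu_j}\Big)$$ (derivatives of $K_0''$ evaluated at $(0;\theta_0)$) is negative definite. **Theorem (MLE error bound – normal approximations).** Let $L(\theta;x)$ be the true likelihood, i.e. the continuous density function of $X_\theta$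 at $x$, and let $\tilde L(\theta;x)$ be the likelihood (density at $x$) of the normal approximation $\mathcal{N}(K'(0;\theta),K''(0;\theta))$, where $K=nK_0$. Under the above assumptions there exist $n_0\in\mathbb{N}$, open neighbourhoods $U,U'\subset\Theta$ of $\theta_0$ and $\tilde V\subset\mathbb{R}^m$ of $\xi_0$, and a constant $C$, such that for all $n\ge n_0$ the vector $X_\theta$ has a continuous density for every $\theta\in U$, and, for all $\omega'\in\mathbb{R}^{p_1}$ with $\binom{\omega'}{\nu_0}\in U'$ and all $\xi\in\tilde V$, with $$x=nK_0'\big(0;\tbinom{\omega'}{\nu_0}\big)+\sqrt n\,\xi,$$ the functions $\theta\mapsto\tilde L(\theta;x)$ and $\theta\mapsto L(\theta;x)$ each have a unique local maximiser in $U$, at which the function attains its maximum over $U$; and, writing these as $\tilde\theta=\binom{\tilde\omega}{\tilde\nu}$ and $\theta_{\mathrm{MLE}}=\binom{\omega_{\mathrm{MLE}}}{\nu_{\mathrm{MLE}}}$, $$|\tilde\omega-\omega_{\mathrm{MLE}}|\le \frac Cn,\qquad |\tilde\nu-\nu_{\mathrm{MLE}}|\le\frac{C}{\sqrt n}.$$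 -/

import Mathlib

open MeasureTheory Set
open scoped Matrix

noncomputable section

namespace MLE

/-- Vectors of dimension `d` with the Euclidean norm. -/
abbrev Vec (d : ℕ) : Type := EuclideanSpace ℝ (Fin d)

/-- Parameter vectors `θ = (ω, ν)`, split into blocks of dimension `p₁` and `p₂`. -/
abbrev Param (p₁ p₂ : ℕ) : Type := Vec p₁ × Vec p₂

/-- A parametric family of probability distributions `law θ` (the distribution of `Y_θ`) on
`ℝ^m`, indexed by an open set of parameters.  Values of `law` outside `domain` are never used. -/
structure Model (m p₁ p₂ : ℕ) where
  domain : Set (Param p₁ p₂)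
  isOpen_domain : IsOpen domain
  law : Param p₁ p₂ → Measure (Vec m)
  isProbabilityMeasure_law : ∀ θ ∈ domain, IsProbabilityMeasure (law θ)

section PartialDerivatives

variable {V F : Type*} [NormedAddCommGroup V] [NormedSpace ℝ V]
  [NormedAddCommGroup F] [NormedSpace ℝ F]

/-- Iterated directional derivative; the head of the list is the outermost differentiation. -/
def iterDeriv (f : V → F) : List V → V → F
  | [] => f
  | v :: l => fun x => lineDeriv ℝ (iterDeriv f l) x v

/-- All the directional derivatives taken in forming `iterDeriv f l` exist on the set `O`. -/
def IterDiffOn (f : V → F) (O : Set V) : List V → Prop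
  | [] => True
  | v :: l => IterDiffOn f O l ∧ ∀ x ∈ O, LineDifferentiableAt ℝ (iterDeriv f l) x v

end PartialDerivatives

section Directions

variable {m p₁ p₂ : ℕ}

/-- The direction of the coordinate `s_j` in the space of pairs `(s, θ)`. -/
def dS (j : Fin m) : Vec m × Param p₁ p₂ := (EuclideanSpace.single j 1, 0)

/-- The direction of the coordinate `ω_i` in the space of pairs `(s, θ)`. -/
def dOmega (i : Fin p₁) : Vec m × Param p₁ p₂ := (0, (EuclideanSpace.single i 1, 0))

/-- The direction of the coordinate `ν_i` in the space of pairs `(s, θ)`. -/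
def dNu (i : Fin p₂) : Vec m × Param p₁ p₂ := (0, (0, EuclideanSpace.single i 1))

/-- The direction of a coordinate of `θ`, in either block. -/
def dTheta : Fin p₁ ⊕ Fin p₂ → Vec m × Param p₁ p₂
  | Sum.inl i => dOmega i
  | Sum.inr i => dNu i

end Directions

namespace Model

variable {m p₁ p₂ : ℕ} (Y : Model m p₁ p₂)

/-- The set `𝒮` of pairs `(s, θ)` for which `E exp(s Y_θ)` is finite. -/
def convSet : Set (Vec m × Param p₁ p₂) :=
  {z | z.2 ∈ Y.domain ∧ Integrable (fun x => Real.exp (inner ℝ z.1 x)) (Y.law z.2)}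

/-- The moment generating function `M₀(s; θ) = E exp(s Y_θ)` at real `s`, with `z = (s, θ)`. -/
def mgf (z : Vec m × Param p₁ p₂) : ℝ :=
  ∫ x, Real.exp (inner ℝ z.1 x) ∂(Y.law z.2)

/-- The moment generating function `M₀(s + i φ; θ)` at complex arguments, with `z = (s, θ)`. -/
def complexMGF (φ : Vec m) (z : Vec m × Param p₁ p₂) : ℂ :=
  ∫ x, Complex.exp (((inner ℝ z.1 x : ℝ) : ℂ) + ((inner ℝ φ x : ℝ) : ℂ) * Complex.I)
    ∂(Y.law z.2)

/-- The cumulant generating function `K₀(s; θ) = log M₀(s; θ)`. -/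
def cgf (z : Vec m × Param p₁ p₂) : ℝ := Real.log (Y.mgf z)

/-- The decay bound for `M₀` in imaginary directions. -/
def DecayBound : Prop :=
  ∃ δ : Vec m × Param p₁ p₂ → ℝ,
    ContinuousOn δ (interior Y.convSet) ∧
    (∀ z ∈ interior Y.convSet, 0 < δ z) ∧
    ∀ z ∈ interior Y.convSet, ∀ φ : Vec m,
      ‖Y.complexMGF φ z / (Y.mgf z : ℂ)‖ ≤ (1 + δ z * ‖φ‖ ^ 2) ^ (-δ z)

/-- The orders `(k, ℓ)` of differentiation in `θ` and `s` that occur in the growth bound. -/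
def AdmissibleOrder (k l : ℕ) : Prop :=
  (k ≤ 1 ∧ 1 ≤ k + l ∧ k + l ≤ 6) ∨ (k = 2 ∧ l ≤ 2)

/-- The growth bound: the partial derivatives
`∂^(k+ℓ) M₀ / ∂θ_(i₁) ⋯ ∂θ_(i_k) ∂s_(j₁) ⋯ ∂s_(j_ℓ)` at `(s + i φ; θ)`, of all admissible orders,
exist, are bounded by `γ (1 + |φ|)^γ` and are jointly continuous in `(s, φ, θ)`. -/
def GrowthBound : Prop :=
  ∃ γ : Vec m × Param p₁ p₂ → ℝ,
    ContinuousOn γ (interior Y.convSet) ∧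
    (∀ z ∈ interior Y.convSet, 0 < γ z) ∧
    ∀ (is : List (Fin p₁ ⊕ Fin p₂)) (js : List (Fin m)),
      AdmissibleOrder is.length js.length →
        (∀ φ : Vec m,
          IterDiffOn (Y.complexMGF φ) (interior Y.convSet) (is.map dTheta ++ js.map dS)) ∧
        (∀ z ∈ interior Y.convSet, ∀ φ : Vec m,
          ‖iterDeriv (Y.complexMGF φ) (is.map dTheta ++ js.map dS) z‖
            ≤ γ z * (1 + ‖φ‖) ^ γ z) ∧
        ContinuousOn
          (fun w : Vec m × (Vec m × Param p₁ p₂) =>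
            iterDeriv (Y.complexMGF w.1) (is.map dTheta ++ js.map dS) w.2)
          {w | w.2 ∈ interior Y.convSet}

/-- The vector `K₀'(0; θ)`, the mean of `Y_θ`. -/
def K1 (θ : Param p₁ p₂) : Vec m :=
  WithLp.toLp 2 fun j => iterDeriv Y.cgf [dS j] (0, θ)

/-- The matrix `K₀''(0; θ)`, the covariance matrix of `Y_θ`. -/
def K2 (θ : Param p₁ p₂) : Matrix (Fin m) (Fin m) ℝ :=
  Matrix.of fun k l => iterDeriv Y.cgf [dS k, dS l] (0, θ)

/-- The matrix `∂K₀''/∂ν_j (0; θ)`. -/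
def dK2 (j : Fin p₂) (θ : Param p₁ p₂) : Matrix (Fin m) (Fin m) ℝ :=
  Matrix.of fun k l => iterDeriv Y.cgf [dNu j, dS k, dS l] (0, θ)

/-- The matrix `∂²K₀''/∂ν_i∂ν_j (0; θ)`. -/
def ddK2 (i j : Fin p₂) (θ : Param p₁ p₂) : Matrix (Fin m) (Fin m) ℝ :=
  Matrix.of fun k l => iterDeriv Y.cgf [dNu i, dNu j, dS k, dS l] (0, θ)

/-- The `m × p₁` matrix `B_ω` of mixed partial derivatives of `K₀` in `s_k` and `ω_j` at
`(0; θ)`, that is, the Jacobian matrix of `K₀'(0; θ)` with respect to `ω`. -/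
def Bomega (θ : Param p₁ p₂) : Matrix (Fin m) (Fin p₁) ℝ :=
  Matrix.of fun k j => iterDeriv Y.cgf [dOmega j, dS k] (0, θ)

/-- `J = A⁻¹ - A⁻¹ B (Bᵀ A⁻¹ B)⁻¹ Bᵀ A⁻¹` with `A = K₀''(0; θ)` and `B = B_ω`. -/
def J (θ : Param p₁ p₂) : Matrix (Fin m) (Fin m) ℝ :=
  (Y.K2 θ)⁻¹ -
    (Y.K2 θ)⁻¹ * Y.Bomega θ * ((Y.Bomega θ)ᵀ * (Y.K2 θ)⁻¹ * Y.Bomega θ)⁻¹ *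
      (Y.Bomega θ)ᵀ * (Y.K2 θ)⁻¹

/-- The quadratic form `ξᵀ S ξ`. -/
def quad (S : Matrix (Fin m) (Fin m) ℝ) (ξ : Vec m) : ℝ := ξ.ofLp ⬝ᵥ (S *ᵥ ξ.ofLp)

/-- The `p₂ × p₂` matrix `E`. -/
def E (θ : Param p₁ p₂) (ξ : Vec m) : Matrix (Fin p₂) (Fin p₂) ℝ :=
  Matrix.of fun i j =>
    quad (Y.J θ * ((1 / 2 : ℝ) • Y.ddK2 i j θ - Y.dK2 i θ * Y.J θ * Y.dK2 j θ) * Y.J θ) ξ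
      - 1 / 2 * Matrix.trace
          ((Y.K2 θ)⁻¹ * Y.ddK2 i j θ - (Y.K2 θ)⁻¹ ^ 2 * Y.dK2 i θ * Y.dK2 j θ)

/-- The distribution of `X_θ`, the sum of `n` i.i.d. copies of `Y_θ`. -/
def sumLaw (n : ℕ) (θ : Param p₁ p₂) : Measure (Vec m) :=
  Measure.map (fun y : Fin n → Vec m => ∑ i, y i) (Measure.pi fun _ => Y.law θ)

end Model

section Densities

variable {m : ℕ}

/-- `f` is a continuous probability density function for `μ` with respect to Lebesgue measure. -/
def IsContDensity (μ : Measure (Vec m)) (f : Vec m → ℝ) : Prop :=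
  Continuous f ∧ (∀ x, 0 ≤ f x) ∧ μ = volume.withDensity fun x => ENNReal.ofReal (f x)

/-- A continuous density is unique, so that `contDensity` below is well defined. -/
theorem IsContDensity.unique {μ : Measure (Vec m)} [IsFiniteMeasure μ] {f g : Vec m → ℝ}
    (hf : IsContDensity μ f) (hg : IsContDensity μ g) : f = g := by
  obtain ⟨hfc, hf0, hfμ⟩ := hf
  obtain ⟨hgc, hg0, hgμ⟩ := hg
  have hne : ∫⁻ x, ENNReal.ofReal (f x) ≠ ⊤ := by
    have h : μ univ = ∫⁻ x, ENNReal.ofReal (f x) := by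
      rw [hfμ, withDensity_apply _ MeasurableSet.univ, Measure.restrict_univ]
    rw [← h]
    exact measure_ne_top μ univ
  have hae := (withDensity_eq_iff (hfc.measurable.ennreal_ofReal.aemeasurable)
    (hgc.measurable.ennreal_ofReal.aemeasurable) hne).1 (hfμ.symm.trans hgμ)
  have hae' : f =ᵐ[volume] g := by
    filter_upwards [hae] with x hx
    exact (ENNReal.ofReal_eq_ofReal_iff (hf0 x) (hg0 x)).1 hx
  exact (hfc.ae_eq_iff_eq volume hgc).1 hae'

open Classical in
/-- The continuous probability density function of `μ`, if there is one (and `0` otherwise). -/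
def contDensity (μ : Measure (Vec m)) : Vec m → ℝ :=
  if h : ∃ f, IsContDensity μ f then Classical.choose h else 0

/-- The density of the normal distribution `N(a, S)` on `ℝ^m`. -/
def normalDensity (a : Vec m) (S : Matrix (Fin m) (Fin m) ℝ) (x : Vec m) : ℝ :=
  Real.exp (-(1 / 2) * Model.quad S⁻¹ (x - a)) / Real.sqrt (((2 * Real.pi) • S).det)

end Densities

namespace Model

variable {m p₁ p₂ : ℕ} (Y : Model m p₁ p₂)

/-- The true likelihood `L(θ; x)`: the continuous density of `X_θ` at `x`. -/
def likelihood (n : ℕ) (x : Vec m) (θ : Param p₁ p₂) : ℝ := contDensity (Y.sumLaw n θ) x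

/-- The likelihood of the normal approximation `N(K'(0; θ), K''(0; θ))`, where `K = n K₀`. -/
def normalLikelihood (n : ℕ) (x : Vec m) (θ : Param p₁ p₂) : ℝ :=
  normalDensity ((n : ℝ) • Y.K1 θ) ((n : ℝ) • Y.K2 θ) x

end Model

/-- `θ` is the unique local maximiser of `f` in the open set `U`, and `f` restricted to `U` attains
its maximum there. -/
def IsMaximiserIn {P : Type*} [TopologicalSpace P] (f : P → ℝ) (U : Set P) (θ : P) : Prop :=
  θ ∈ U ∧ IsLocalMax f θ ∧ (∀ θ' ∈ U, IsLocalMax f θ' → θ' = θ) ∧ IsMaxOn f U θ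

end MLE

end

noncomputable section

open Filter Metric

section
open scoped FourierTransform

namespace MLE

theorem continuous_charFun {m : ℕ} (μ : Measure (Vec m)) [IsFiniteMeasure μ] :
    Continuous (charFun μ) := by
  have : charFun μ = fun t => ∫ x, Complex.exp ((inner ℝ x t : ℝ) * Complex.I) ∂μ := by
    ext t; rfl
  rw [this]
  refine continuous_of_dominated (bound := fun _ => 1) ?_ ?_ (integrable_const _) ?_
  · intro t
    exact (by fun_prop : Continuous fun x : Vec m =>
      Complex.exp ((inner ℝ x t : ℝ) * Complex.I)).aestronglyMeasurable
  · intro t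
    filter_upwards with x
    rw [Complex.norm_exp_ofReal_mul_I]
  · filter_upwards with x
    fun_prop

/-- Parseval's identity between a measure and a Schwartz function. -/
theorem integral_schwartz_eq {m : ℕ} (μ : Measure (Vec m)) [IsFiniteMeasure μ]
    (h : Integrable fun w => charFun μ ((2 * Real.pi) • w)) (g : SchwartzMap (Vec m) ℂ) :
    ∫ x, g x ∂μ = ∫ x, g x * 𝓕 (fun w => charFun μ ((2 * Real.pi) • w)) x := by
  have hinv : ∀ x, g x = ∫ w, (𝐞 (inner ℝ w x) : ℂ) * 𝓕 g w := by
    intro x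
    have h1 := congrFun (g.continuous.fourierInv_fourier_eq g.integrable
      (by rw [← SchwartzMap.fourier_coe]; exact (𝓕 g).integrable)) x
    rw [← h1, Real.fourierInv_eq]
    rfl
  have hint : Integrable (fun w => 𝓕 g w) := (𝓕 g).integrable
  have hsw : ∫ x, g x ∂μ = ∫ w, charFun μ ((2 * Real.pi) • w) * 𝓕 g w := by
    calc ∫ x, g x ∂μ = ∫ x, (∫ w, (𝐞 (inner ℝ w x) : ℂ) * 𝓕 g w) ∂μ := by
          exact integral_congr_ae (Eventually.of_forall hinv)
      _ = ∫ w, (∫ x, (𝐞 (inner ℝ w x) : ℂ) * 𝓕 g w ∂μ) := by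
          apply integral_integral_swap
          have h2 : Integrable (fun p : Vec m × Vec m => 𝓕 g p.2) (μ.prod volume) :=
            hint.comp_snd μ
          refine h2.bdd_mul (c := 1) ?_ ?_
          · exact (by fun_prop : Continuous fun p : Vec m × Vec m =>
              (𝐞 (inner ℝ p.2 p.1) : ℂ)).aestronglyMeasurable
          · filter_upwards with p
            exact (Circle.norm_coe _).le
      _ = _ := by
          congr 1
          ext w
          rw [integral_mul_const]
          congr 1
          rw [charFun_apply]
          congr 1
          ext x
          rw [Real.fourierChar_apply, inner_smul_right, real_inner_comm]
  rw [hsw]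
  have hfl := VectorFourier.integral_fourierIntegral_smul_eq_flip (e := Real.fourierChar)
    (L := innerₗ (Vec m)) (μ := volume) (ν := volume) (f := g)
    (g := fun w => charFun μ ((2 * Real.pi) • w)) Real.continuous_fourierChar
    (continuous_inner (𝕜 := ℝ) (E := Vec m)) g.integrable h
  simp only [flip_innerₗ, smul_eq_mul] at hfl
  have e1 : ∀ x, 𝓕 (fun w => charFun μ ((2 * Real.pi) • w)) x =
    VectorFourier.fourierIntegral 𝐞 volume (innerₗ (Vec m))
      (fun w => charFun μ ((2 * Real.pi) • w)) x := fun x => rfl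
  simp_rw [e1]
  rw [← hfl]
  congr 1
  ext w
  rw [mul_comm]
  rfl

theorem integral_bump_eq {m : ℕ} (μ : Measure (Vec m)) [IsFiniteMeasure μ]
    (h : Integrable fun w => charFun μ ((2 * Real.pi) • w)) (g : Vec m → ℝ)
    (hg : ContDiff ℝ (↑(⊤ : ℕ∞)) g) (hgc : HasCompactSupport g) :
    ((∫ x, g x ∂μ : ℝ) : ℂ) =
      ∫ x, (g x : ℂ) * 𝓕 (fun w => charFun μ ((2 * Real.pi) • w)) x := by
  have hc : HasCompactSupport (fun x => (g x : ℂ)) := hgc.comp_left (g := fun r : ℝ => (r : ℂ)) rfl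
  have hs : ContDiff ℝ (↑(⊤ : ℕ∞)) (fun x => (g x : ℂ)) := Complex.ofRealCLM.contDiff.comp hg
  have := integral_schwartz_eq μ h (hc.toSchwartzMap hs)
  exact integral_complex_ofReal.symm.trans this

/-- A probability measure with integrable characteristic function has a continuous density, given
by the inverse Fourier transform. -/
theorem exists_isContDensity {m : ℕ} (μ : Measure (Vec m)) [IsProbabilityMeasure μ]
    (h : Integrable (charFun μ)) :
    ∃ f, IsContDensity μ f ∧ ∀ x, (f x : ℂ) =
      ((2 * Real.pi) ^ m)⁻¹ * ∫ φ, Complex.exp (-((inner ℝ φ x : ℝ) * Complex.I)) * charFun μ φ := by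
  set F : Vec m → ℂ := fun w => charFun μ ((2 * Real.pi) • w) with hF
  have hpi : (2 * Real.pi) ≠ 0 := by positivity
  have hFi : Integrable F := h.comp_smul hpi
  have hFc : Continuous F := (continuous_charFun μ).comp (by fun_prop)
  set f : Vec m → ℂ := 𝓕 F with hf
  have hfc : Continuous f :=
    VectorFourier.fourierIntegral_continuous Real.continuous_fourierChar
      (continuous_inner (𝕜 := ℝ) (E := Vec m)) hFi
  have hform : ∀ x, f x = ((2 * Real.pi) ^ m)⁻¹ *
      ∫ φ, Complex.exp (-((inner ℝ φ x : ℝ) * Complex.I)) * charFun μ φ := by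
    intro x
    have := Measure.integral_comp_smul (volume : Measure (Vec m))
      (fun φ => Complex.exp (-((inner ℝ φ x : ℝ) * Complex.I)) * charFun μ φ) (2 * Real.pi)
    rw [finrank_euclideanSpace_fin, abs_of_pos (by positivity)] at this
    rw [Complex.real_smul] at this
    rw [← this, hf, Real.fourier_eq']
    congr 1
    ext v
    rw [smul_eq_mul, inner_smul_left]
    congr 2
    push_cast
    simp
  have key := integral_bump_eq μ hFi
  have him : ∀ x, (f x).im = 0 := by
    have hci : Continuous fun x => (f x).im := Complex.continuous_im.comp hfc
    have : ∀ᵐ x, (f x).im = 0 := by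
      refine ae_eq_zero_of_integral_contDiff_smul_eq_zero hci.locallyIntegrable ?_
      intro g hg hgc
      have h1 := congrArg Complex.im (key g hg hgc)
      rw [Complex.ofReal_im] at h1
      have hi : Integrable fun x => (g x : ℂ) * f x := by
        refine Continuous.integrable_of_hasCompactSupport ?_ ?_
        · exact (Complex.continuous_ofReal.comp hg.continuous).mul hfc
        · exact (hgc.comp_left (g := fun r : ℝ => (r : ℂ)) rfl).mul_right
      have h2 := integral_im hi
      simp only [RCLike.im_to_complex, Complex.im_ofReal_mul] at h2
      simp only [smul_eq_mul]
      rw [h2]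
      exact h1.symm
    exact fun x => congrFun ((hci.ae_eq_iff_eq volume continuous_const).1 this) x
  have hreal : ∀ x, f x = ((f x).re : ℂ) := fun x => by
    apply Complex.ext <;> simp [him]
  have hcr : Continuous fun x => (f x).re := Complex.continuous_re.comp hfc
  have keyr : ∀ g : Vec m → ℝ, ContDiff ℝ (↑(⊤ : ℕ∞)) g → HasCompactSupport g →
      ∫ x, g x ∂μ = ∫ x, g x * (f x).re := by
    intro g hg hgc
    have h1 := key g hg hgc
    have : ∫ x, (g x : ℂ) * 𝓕 F x = ∫ x, ((g x * (f x).re : ℝ) : ℂ) := by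
      congr 1
      ext x
      rw [Complex.ofReal_mul, ← hreal]
    rw [this, integral_complex_ofReal] at h1
    exact_mod_cast h1
  have hpos : ∀ x, 0 ≤ (f x).re := by
    intro x0
    by_contra! hneg
    obtain ⟨r, hr, hball⟩ := isOpen_iff.1 (isOpen_lt hcr continuous_const) x0 hneg
    let b : ContDiffBump x0 := ⟨r / 2, r, by positivity, by linarith⟩
    have hb := keyr b b.contDiff b.hasCompactSupport
    have hlt : 0 < ∫ x, -(b x * (f x).re) := by
      refine Continuous.integral_pos_of_hasCompactSupport_nonneg_nonzero (x := x0) ?_ ?_ ?_ ?_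
      · exact (b.continuous.mul hcr).neg
      · exact (b.hasCompactSupport.mul_right).neg
      · intro x
        simp only [Pi.zero_apply]
        by_cases hx : x ∈ ball x0 r
        · have h1 : (f x).re < 0 := hball hx
          have h2 := b.nonneg (x := x)
          nlinarith
        · have : b x = 0 := by
            apply b.zero_of_le_dist
            simpa using hx
          simp [this]
      · have h1 : b x0 = 1 := b.one_of_mem_closedBall (by simp [b]; positivity)
        simp only [h1, one_mul, neg_ne_zero]
        exact hneg.ne
    rw [integral_neg, ← hb] at hlt
    have : 0 ≤ ∫ x, b x ∂μ := integral_nonneg fun x => b.nonneg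
    linarith
  have hint : Integrable fun x => (f x).re := by
    refine (aecover_closedBall (μ := volume) (x := (0 : Vec m)) (r := fun k : ℕ => (k : ℝ))
      (l := atTop) tendsto_natCast_atTop_atTop).integrable_of_integral_norm_bounded 1 ?_ ?_
    · intro k
      exact hcr.continuousOn.integrableOn_compact (isCompact_closedBall _ _)
    · filter_upwards with k
      let b : ContDiffBump (0 : Vec m) := ⟨k + 1, k + 2, by positivity, by linarith⟩
      have hb := keyr b b.contDiff b.hasCompactSupport
      have hbi : Integrable fun x => b x * (f x).re :=
        (b.continuous.mul hcr).integrable_of_hasCompactSupport b.hasCompactSupport.mul_right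
      calc ∫ x in closedBall 0 (k : ℝ), ‖(f x).re‖
          = ∫ x in closedBall 0 (k : ℝ), b x * (f x).re := by
            refine setIntegral_congr_fun measurableSet_closedBall fun x hx => ?_
            have : b x = 1 := b.one_of_mem_closedBall
              (closedBall_subset_closedBall (by simp [b]) hx)
            simp only [this, one_mul, Real.norm_of_nonneg (hpos x)]
        _ ≤ ∫ x, b x * (f x).re := by
            exact setIntegral_le_integral hbi
              (Eventually.of_forall fun x => mul_nonneg b.nonneg (hpos x))
        _ = ∫ x, b x ∂μ := hb.symm
        _ ≤ ∫ _, (1 : ℝ) ∂μ := by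
            refine integral_mono ?_ (integrable_const _) fun x => b.le_one
            exact b.continuous.integrable_of_hasCompactSupport b.hasCompactSupport
        _ = 1 := by simp
  have hfi : Integrable f := by
    have : f = fun x => ((f x).re : ℂ) := funext hreal
    rw [this]
    exact hint.ofReal
  have hinv := hFc.fourierInv_fourier_eq hFi hfi
  refine ⟨fun x => (f x).re, ⟨hcr, hpos, ?_⟩, fun x => by rw [← hreal, hform]⟩
  have hfin : IsFiniteMeasure ((volume : Measure (Vec m)).withDensity
      fun x => ENNReal.ofReal ((f x).re)) := isFiniteMeasure_withDensity_ofReal hint.2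
  apply Measure.ext_of_charFun
  ext t
  have h1 := congrFun hinv ((2 * Real.pi)⁻¹ • t)
  rw [hF] at h1
  simp only [smul_smul, mul_inv_cancel₀ hpi, one_smul] at h1
  rw [← h1, charFun_apply, Real.fourierInv_eq']
  have h3 : (fun x => ENNReal.ofReal ((f x).re)) = fun x => ((Real.toNNReal ((f x).re) : NNReal) : ENNReal) := rfl
  rw [h3, integral_withDensity_eq_integral_smul (by fun_prop)]
  congr 1
  ext x
  have h4 : 2 * Real.pi * inner ℝ x ((2 * Real.pi)⁻¹ • t) = inner ℝ x t := by
    rw [inner_smul_right, ← mul_assoc, mul_inv_cancel₀ hpi, one_mul]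
  rw [NNReal.smul_def, Real.coe_toNNReal _ (hpos x), h4, smul_eq_mul, Complex.real_smul, ← hreal]
  exact mul_comm _ _

end MLE
end


namespace MLE

theorem contDensity_spec {m : ℕ} {μ : Measure (Vec m)} [IsFiniteMeasure μ] {f : Vec m → ℝ}
    (hf : IsContDensity μ f) : contDensity μ = f := by
  have h : ∃ f, IsContDensity μ f := ⟨f, hf⟩
  have : IsContDensity μ (contDensity μ) := by
    unfold contDensity
    rw [dif_pos h]
    exact Classical.choose_spec h
  exact this.unique hf

section Sum

variable {m : ℕ} (μ : Measure (Vec m)) [IsProbabilityMeasure μ] (n : ℕ)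

/-- The law of the sum of `n` independent copies. -/
def sumMeasure : Measure (Vec m) :=
  Measure.map (fun y : Fin n → Vec m => ∑ i, y i) (Measure.pi fun _ => μ)

theorem measurable_sumMap : Measurable (fun y : Fin n → Vec m => ∑ i, y i) := by fun_prop

instance : IsProbabilityMeasure (sumMeasure μ n) :=
  Measure.isProbabilityMeasure_map (measurable_sumMap n).aemeasurable

/-- The moment generating function at a complex argument. -/
def cmgf (s φ : Vec m) : ℂ :=
  ∫ x, Complex.exp (((inner ℝ s x : ℝ) : ℂ) + ((inner ℝ φ x : ℝ) : ℂ) * Complex.I) ∂μ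

theorem integral_cexp_sumMeasure (s φ : Vec m) :
    cmgf (sumMeasure μ n) s φ = cmgf μ s φ ^ n := by
  unfold cmgf sumMeasure
  rw [integral_map (measurable_sumMap n).aemeasurable (by
    exact (by fun_prop : Continuous fun x : Vec m => Complex.exp (((inner ℝ s x : ℝ) : ℂ) +
      ((inner ℝ φ x : ℝ) : ℂ) * Complex.I)).aestronglyMeasurable)]
  have := integral_fintype_prod_eq_pow (ι := Fin n) (μ := μ) (fun x : Vec m =>
    Complex.exp (((inner ℝ s x : ℝ) : ℂ) + ((inner ℝ φ x : ℝ) : ℂ) * Complex.I))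
  rw [Fintype.card_fin] at this
  rw [← this]
  congr 1
  ext y
  rw [← Complex.exp_sum, Finset.sum_add_distrib, ← Finset.sum_mul, inner_sum, inner_sum]
  push_cast
  rfl

theorem integral_rexp_eq_cmgf (μ : Measure (Vec m)) (s : Vec m) :
    ((∫ x, Real.exp (inner ℝ s x) ∂μ : ℝ) : ℂ) = cmgf μ s 0 := by
  unfold cmgf
  rw [← integral_complex_ofReal]
  simp

theorem integrable_exp_sumMeasure {s : Vec m}
    (hs : Integrable (fun x => Real.exp (inner ℝ s x)) μ) :
    Integrable (fun x => Real.exp (inner ℝ s x)) (sumMeasure μ n) := by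
  unfold sumMeasure
  rw [integrable_map_measure (by
    exact (by fun_prop : Continuous fun x : Vec m => Real.exp (inner ℝ s x)).aestronglyMeasurable)
    (measurable_sumMap n).aemeasurable]
  have : Integrable (fun y : Fin n → Vec m => ∏ i, Real.exp (inner ℝ s (y i)))
      (Measure.pi fun _ => μ) := Integrable.fintype_prod fun _ => hs
  refine this.congr (Eventually.of_forall fun y => ?_)
  simp only [Function.comp_apply, inner_sum, Real.exp_sum]

theorem charFun_eq_cmgf (μ : Measure (Vec m)) (φ : Vec m) : charFun μ φ = cmgf μ 0 φ := by
  unfold cmgf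
  rw [charFun_apply]
  simp [real_inner_comm]

theorem charFun_tilted (μ : Measure (Vec m)) (s φ : Vec m) :
    charFun (μ.tilted (fun x => inner ℝ s x)) φ =
      cmgf μ s φ / (∫ x, Real.exp (inner ℝ s x) ∂μ : ℝ) := by
  rw [charFun_apply, integral_tilted]
  unfold cmgf
  rw [← integral_div]
  congr 1
  ext x
  rw [Complex.real_smul, Complex.exp_add, real_inner_comm φ x]
  push_cast
  ring

/-- The law of the sum has a continuous density, expressed by a Fourier integral along any
admissible vertical plane. -/
theorem density_sumMeasure (s : Vec m) (hs : Integrable (fun x => Real.exp (inner ℝ s x)) μ)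
    (h0 : Integrable fun φ => cmgf μ 0 φ ^ n) (hn : Integrable fun φ => cmgf μ s φ ^ n) :
    IsContDensity (sumMeasure μ n) (contDensity (sumMeasure μ n)) ∧
    ∀ x, (contDensity (sumMeasure μ n) x : ℂ) = ((2 * Real.pi) ^ m)⁻¹ * Complex.exp (-(inner ℝ s x : ℝ)) *
      ∫ φ, Complex.exp (-((inner ℝ φ x : ℝ) * Complex.I)) * cmgf μ s φ ^ n := by
  set σ := sumMeasure μ n with hσ
  have hsσ := integrable_exp_sumMeasure μ n hs
  set M := ∫ x, Real.exp (inner ℝ s x) ∂σ with hM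
  have hMpos : 0 < M := integral_exp_pos hsσ
  have hprob : IsProbabilityMeasure (σ.tilted (fun x => inner ℝ s x)) :=
    isProbabilityMeasure_tilted hsσ
  have hcf0 : Integrable (charFun σ) := by
    refine h0.congr (Eventually.of_forall fun φ => ?_)
    simp only [charFun_eq_cmgf, hσ, integral_cexp_sumMeasure]
  have hcf : ∀ φ, charFun (σ.tilted (fun x => inner ℝ s x)) φ = cmgf μ s φ ^ n / M := by
    intro φ
    rw [charFun_tilted, hσ, integral_cexp_sumMeasure]
  obtain ⟨f, hf, -⟩ := exists_isContDensity σ hcf0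
  have hint : Integrable (charFun (σ.tilted (fun x => inner ℝ s x))) := by
    refine (hn.div_const (M : ℂ)).congr (Eventually.of_forall fun φ => ?_)
    simp only [hcf]
  obtain ⟨g, hg, hgx⟩ := exists_isContDensity _ hint
  rw [contDensity_spec hf]
  refine ⟨hf, fun x => ?_⟩
  have hg' : IsContDensity (σ.tilted (fun x => inner ℝ s x))
      (fun x => Real.exp (inner ℝ s x) / M * f x) := by
    refine ⟨?_, fun x => mul_nonneg (by positivity) (hf.2.1 x), ?_⟩
    · have := hf.1
      fun_prop
    · unfold Measure.tilted
      conv_lhs => rw [hf.2.2]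
      rw [← withDensity_mul _ (hf.1.measurable.ennreal_ofReal) (by fun_prop)]
      congr 1
      ext x
      rw [← hf.2.2, ← hM, Pi.mul_apply, mul_comm, ENNReal.ofReal_mul (by positivity)]
  have hgf := congrFun (hg.unique hg') x
  have h1 := hgx x
  rw [hgf] at h1
  simp only [hcf] at h1
  have hMC : (M : ℂ) ≠ 0 := by exact_mod_cast hMpos.ne'
  have h2 : ∫ φ, Complex.exp (-((inner ℝ φ x : ℝ) * Complex.I)) * (cmgf μ s φ ^ n / M) =
      (∫ φ, Complex.exp (-((inner ℝ φ x : ℝ) * Complex.I)) * cmgf μ s φ ^ n) / M := by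
    rw [← integral_div]
    congr 1
    ext φ
    ring
  rw [h2] at h1
  have h3 : (f x : ℂ) = Complex.exp (-(inner ℝ s x : ℝ)) * M *
      ((Real.exp (inner ℝ s x) / M * f x : ℝ) : ℂ) := by
    push_cast
    rw [Complex.exp_neg]
    field_simp
  rw [h3, h1]
  generalize ∫ φ, Complex.exp (-((inner ℝ φ x : ℝ) * Complex.I)) * cmgf μ s φ ^ n = a
  push_cast
  field_simp

end Sum

namespace Model

variable {m p q : ℕ} (Y : Model m p q)

theorem likelihood_eq_integral {n : ℕ} {θ : Param p q} (hθ : θ ∈ Y.domain) {s : Vec m}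
    (hs : (s, θ) ∈ Y.convSet) (h0 : Integrable fun φ => Y.complexMGF φ (0, θ) ^ n)
    (hn : Integrable fun φ => Y.complexMGF φ (s, θ) ^ n) :
    IsContDensity (Y.sumLaw n θ) (fun x => Y.likelihood n x θ) ∧
    ∀ x, (Y.likelihood n x θ : ℂ) = ((2 * Real.pi) ^ m)⁻¹ * Complex.exp (-(inner ℝ s x : ℝ)) *
      ∫ φ, Complex.exp (-((inner ℝ φ x : ℝ) * Complex.I)) * Y.complexMGF φ (s, θ) ^ n := by
  have := Y.isProbabilityMeasure_law θ hθ
  exact density_sumMeasure (Y.law θ) n s hs.2 h0 hn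

end Model


open scoped MatrixOrder in
theorem exists_transpose_mul_self_of_posDef {m : ℕ} {S : Matrix (Fin m) (Fin m) ℝ} (hS : S.PosDef) :
    ∃ B : Matrix (Fin m) (Fin m) ℝ, B.det ≠ 0 ∧ S = Bᵀ * B := by
  obtain ⟨B, hB, hSB⟩ := CStarAlgebra.isStrictlyPositive_iff_eq_star_mul_self.1
    (Matrix.isStrictlyPositive_iff_posDef.2 hS)
  refine ⟨B, ((Matrix.isUnit_iff_isUnit_det _).1 hB).ne_zero, ?_⟩
  rw [hSB, Matrix.star_eq_conjTranspose, Matrix.conjTranspose_eq_transpose_of_trivial]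

theorem inner_eq_dotProduct {m : ℕ} (x y : Vec m) : inner ℝ x y = x.ofLp ⬝ᵥ y.ofLp := by
  rw [EuclideanSpace.inner_eq_star_dotProduct, star_trivial, dotProduct_comm]

theorem quad_transpose_mul_self {m : ℕ} (B : Matrix (Fin m) (Fin m) ℝ) (ξ : Vec m) :
    Model.quad (Bᵀ * B) ξ = ‖Matrix.toEuclideanLin B ξ‖ ^ 2 := by
  rw [← real_inner_self_eq_norm_sq, inner_eq_dotProduct, Model.quad, ← Matrix.mulVec_mulVec,
    Matrix.dotProduct_mulVec, Matrix.vecMul_transpose]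
  rfl

theorem integral_comp_toEuclideanLin {m : ℕ} (B : Matrix (Fin m) (Fin m) ℝ) (hB : B.det ≠ 0)
    (F : Vec m → ℂ) (hF : Continuous F) :
    ∫ φ, F (Matrix.toEuclideanLin B φ) = |B.det|⁻¹ * ∫ ψ, F ψ := by
  have hdet : LinearMap.det (Matrix.toEuclideanLin B) = B.det := by
    rw [Matrix.toEuclideanLin_eq_toLin_orthonormal, LinearMap.det_toLin]
  have h := Measure.map_linearMap_addHaar_eq_smul_addHaar (volume : Measure (Vec m))
    (f := Matrix.toEuclideanLin B) (by rwa [hdet])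
  have hc : Continuous (Matrix.toEuclideanLin B) := LinearMap.continuous_of_finiteDimensional _
  rw [← integral_map (φ := Matrix.toEuclideanLin B) hc.measurable.aemeasurable
    hF.aestronglyMeasurable, h, integral_smul_measure, hdet, abs_inv,
    ENNReal.toReal_ofReal (by positivity), Complex.real_smul]

theorem gaussian_fourier_integral {m : ℕ} {S : Matrix (Fin m) (Fin m) ℝ} (hS : S.PosDef)
    (w : Vec m) :
    ∫ φ, Complex.exp (-((inner ℝ φ w : ℝ) * Complex.I)) *
        Complex.exp (-(Model.quad S φ / 2 : ℝ)) =
      ((2 * Real.pi) ^ m / Real.sqrt (((2 * Real.pi) • S).det) *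
        Real.exp (-(1 / 2) * Model.quad S⁻¹ w) : ℝ) := by
  obtain ⟨B, hB, rfl⟩ := exists_transpose_mul_self_of_posDef hS
  have hBu : IsUnit B.det := hB.isUnit
  set v : Vec m := Matrix.toEuclideanLin (Bᵀ)⁻¹ w with hv
  set F : Vec m → ℂ := fun ψ => Complex.exp (-(1 / 2 : ℂ) * (‖ψ‖ : ℂ) ^ 2 +
    (-Complex.I) * (inner ℝ v ψ : ℝ)) with hF
  have hFc : Continuous F := by
    rw [hF]
    fun_prop
  have hin : ∀ φ, inner ℝ v (Matrix.toEuclideanLin B φ) = inner ℝ φ w := by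
    intro φ
    rw [inner_eq_dotProduct, inner_eq_dotProduct, hv]
    change ((Bᵀ)⁻¹ *ᵥ w.ofLp) ⬝ᵥ (B *ᵥ φ.ofLp) = _
    rw [Matrix.dotProduct_mulVec, ← Matrix.mulVec_transpose, Matrix.mulVec_mulVec,
      Matrix.mul_nonsing_inv _ (by rwa [Matrix.det_transpose]), Matrix.one_mulVec, dotProduct_comm]
  have h1 : (fun φ : Vec m => Complex.exp (-((inner ℝ φ w : ℝ) * Complex.I)) *
        Complex.exp (-(Model.quad (Bᵀ * B) φ / 2 : ℝ))) =
      fun φ => F (Matrix.toEuclideanLin B φ) := by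
    ext φ
    rw [hF, ← Complex.exp_add, quad_transpose_mul_self]
    simp only [hin]
    congr 1
    push_cast
    ring
  rw [h1, integral_comp_toEuclideanLin B hB F hFc, hF,
    GaussianFourier.integral_cexp_neg_mul_sq_norm_add (by norm_num)]
  have hq : Model.quad (Bᵀ * B)⁻¹ w = ‖v‖ ^ 2 := by
    rw [Matrix.mul_inv_rev, ← Matrix.transpose_nonsing_inv, hv, ← quad_transpose_mul_self,
      Matrix.transpose_nonsing_inv, Matrix.transpose_nonsing_inv, Matrix.transpose_transpose]
  have hdet : ((2 * Real.pi) • (Bᵀ * B)).det = (2 * Real.pi) ^ m * B.det ^ 2 := by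
    rw [Matrix.det_smul, Matrix.det_mul, Matrix.det_transpose, Fintype.card_fin]
    ring
  rw [hq, hdet, finrank_euclideanSpace_fin, Real.sqrt_mul (by positivity), Real.sqrt_sq_eq_abs]
  have hpow : ((Real.pi : ℂ) / (1 / 2)) ^ ((m : ℂ) / 2) =
      ((2 * Real.pi) ^ m / Real.sqrt ((2 * Real.pi) ^ m) : ℝ) := by
    rw [Real.div_sqrt]
    have : Real.sqrt ((2 * Real.pi) ^ m) = (2 * Real.pi) ^ ((m : ℝ) / 2) := by
      rw [Real.sqrt_eq_rpow, ← Real.rpow_natCast, ← Real.rpow_mul (by positivity)]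
      congr 1
      ring
    rw [this, Complex.ofReal_cpow (by positivity)]
    congr 1
    · push_cast
      ring
    · push_cast
      rfl
  rw [hpow]
  have hexp : (-Complex.I) ^ 2 * (‖v‖ : ℂ) ^ 2 / (4 * (1 / 2)) = ((-(1 / 2) * ‖v‖ ^ 2 : ℝ) : ℂ) := by
    rw [neg_sq, Complex.I_sq]
    push_cast
    ring
  rw [hexp, ← Complex.ofReal_exp]
  push_cast
  field_simp

theorem normalDensity_eq_integral {m : ℕ} {S : Matrix (Fin m) (Fin m) ℝ} (hS : S.PosDef)
    (a x : Vec m) :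
    (normalDensity a S x : ℂ) = ((2 * Real.pi) ^ m)⁻¹ *
      ∫ φ, Complex.exp (-((inner ℝ φ x : ℝ) * Complex.I)) *
        Complex.exp ((inner ℝ φ a : ℝ) * Complex.I - (Model.quad S φ / 2 : ℝ)) := by
  have h : (fun φ : Vec m => Complex.exp (-((inner ℝ φ x : ℝ) * Complex.I)) *
        Complex.exp ((inner ℝ φ a : ℝ) * Complex.I - (Model.quad S φ / 2 : ℝ))) =
      fun φ => Complex.exp (-((inner ℝ φ (x - a) : ℝ) * Complex.I)) *
        Complex.exp (-(Model.quad S φ / 2 : ℝ)) := by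
    ext φ
    rw [← Complex.exp_add, ← Complex.exp_add, inner_sub_right]
    congr 1
    push_cast
    ring
  rw [h, gaussian_fourier_integral hS, normalDensity]
  push_cast
  field_simp


section Moments

variable {m : ℕ}

/-- The monomial `∏ x_j`, `j` running through the list. -/
def mono (js : List (Fin m)) (x : Vec m) : ℝ := (js.map fun j => x j).prod

theorem continuous_mono (js : List (Fin m)) : Continuous (mono js) := by
  induction js with
  | nil =>
    have : mono ([] : List (Fin m)) = fun _ => 1 := by
      ext x
      simp [mono]
    rw [this]
    exact continuous_const
  | cons j js ih =>
    have : mono (j :: js) = fun x : Vec m => x j * mono js x := by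
      ext x
      simp [mono]
    rw [this]
    fun_prop

theorem abs_coord_le (x : Vec m) (j : Fin m) : |x j| ≤ ‖x‖ := by
  have := PiLp.norm_apply_le x j
  simpa using this

theorem abs_mono_le (js : List (Fin m)) (x : Vec m) : |mono js x| ≤ ‖x‖ ^ js.length := by
  induction js with
  | nil => simp [mono]
  | cons j js ih =>
    have : mono (j :: js) x = x j * mono js x := by simp [mono]
    rw [this, abs_mul, List.length_cons, pow_succ, mul_comm]
    exact mul_le_mul ih (abs_coord_le x j) (abs_nonneg _) (by positivity)

theorem norm_le_sum_abs (x : Vec m) : ‖x‖ ≤ ∑ j, |x j| := by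
  rw [EuclideanSpace.norm_eq]
  refine Real.sqrt_le_iff.2 ⟨Finset.sum_nonneg fun _ _ => abs_nonneg _, ?_⟩
  simpa using Finset.sum_sq_le_sq_sum_of_nonneg (s := Finset.univ) (f := fun j => |x j|)
    (fun _ _ => abs_nonneg _)

theorem exp_norm_le (ρ : ℝ) (hρ : 0 ≤ ρ) (x : Vec m) :
    Real.exp (ρ * ‖x‖) ≤ 1 + ∑ j, (Real.exp (ρ * m * x j) + Real.exp (-(ρ * m * x j))) := by
  have hsum : ∀ j, 0 ≤ Real.exp (ρ * m * x j) + Real.exp (-(ρ * m * x j)) := fun j => by positivity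
  rcases isEmpty_or_nonempty (Fin m) with h | h
  · have : ‖x‖ ≤ 0 := by
      refine (norm_le_sum_abs x).trans ?_
      simp
    have h0 : ‖x‖ = 0 := le_antisymm this (norm_nonneg _)
    simp [h0]
  · obtain ⟨j, hj⟩ := Finite.exists_max fun j => |x j|
    have h1 : ‖x‖ ≤ m * |x j| := by
      refine (norm_le_sum_abs x).trans ?_
      refine (Finset.sum_le_card_nsmul _ _ _ fun i _ => hj i).trans ?_
      simp
    have h2 : Real.exp (ρ * ‖x‖) ≤ Real.exp (ρ * m * x j) + Real.exp (-(ρ * m * x j)) := by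
      have h3 : Real.exp (ρ * ‖x‖) ≤ Real.exp |ρ * m * x j| := by
        rw [Real.exp_le_exp, abs_mul, abs_of_nonneg (by positivity : 0 ≤ ρ * m), mul_assoc]
        exact mul_le_mul_of_nonneg_left h1 hρ
      refine h3.trans ?_
      rcases abs_cases (ρ * m * x j) with ⟨h, -⟩ | ⟨h, -⟩ <;> rw [h]
      · linarith [Real.exp_pos (-(ρ * m * x j))]
      · linarith [Real.exp_pos (ρ * m * x j)]
    have h4 := Finset.single_le_sum (fun j _ => hsum j) (Finset.mem_univ j)
    linarith

variable {μ : Measure (Vec m)}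

/-- Exponential integrability at all points of a ball around `s`. -/
def ExpNear (μ : Measure (Vec m)) (s : Vec m) : Prop :=
  ∃ r > 0, ∀ s' ∈ ball s r, Integrable (fun x => Real.exp (inner ℝ s' x)) μ

theorem ExpNear.integrable_norm [IsFiniteMeasure μ] {s : Vec m} (h : ExpNear μ s) :
    ∃ ρ > 0, ∀ k : ℕ, Integrable (fun x => ‖x‖ ^ k * Real.exp (inner ℝ s x + ρ * ‖x‖)) μ := by
  obtain ⟨r, hr, h⟩ := h
  have hm : (0 : ℝ) < 2 * (m + 1) := by positivity
  set c : ℝ := r / (2 * (m + 1)) with hc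
  have hcpos : 0 < c := by positivity
  have hcm : c * m < r := by
    rw [hc, div_mul_eq_mul_div, div_lt_iff₀ hm]
    nlinarith
  have h0 : Integrable (fun x => Real.exp (inner ℝ s x)) μ := h s (mem_ball_self hr)
  have hcm0 : 0 ≤ c * m := by positivity
  have hj : ∀ j : Fin m, ∀ σ : ℝ, |σ| = 1 →
      Integrable (fun x : Vec m => Real.exp (inner ℝ s x) * Real.exp (σ * (c * m * x j))) μ := by
    intro j σ hσ
    have hmem : s + (σ * (c * m)) • EuclideanSpace.single j (1 : ℝ) ∈ ball s r := by
      rw [mem_ball, dist_self_add_left, norm_smul, Real.norm_eq_abs, abs_mul, hσ,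
        abs_of_nonneg hcm0]
      simpa using hcm
    refine (h _ hmem).congr (Eventually.of_forall fun x => ?_)
    simp only [inner_add_left, inner_smul_left, EuclideanSpace.inner_single_left, Real.exp_add]
    simp [mul_assoc]
  have hbig : Integrable (fun x => Real.exp (inner ℝ s x + c * ‖x‖)) μ := by
    have hsum : Integrable (fun x : Vec m => Real.exp (inner ℝ s x) + ∑ j,
        (Real.exp (inner ℝ s x) * Real.exp (1 * (c * m * x j)) +
          Real.exp (inner ℝ s x) * Real.exp ((-1) * (c * m * x j)))) μ := by
      refine h0.add (integrable_finsetSum _ fun j _ => ?_)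
      exact (hj j 1 (by simp)).add (hj j (-1) (by simp))
    refine hsum.mono' ?_ ?_
    · exact (by fun_prop : Continuous fun x : Vec m =>
        Real.exp (inner ℝ s x + c * ‖x‖)).aestronglyMeasurable
    · filter_upwards with x
      rw [Real.norm_eq_abs, abs_of_pos (Real.exp_pos _), Real.exp_add]
      refine (mul_le_mul_of_nonneg_left (exp_norm_le c hcpos.le x) (Real.exp_pos _).le).trans ?_
      rw [mul_add, mul_one, Finset.mul_sum]
      refine (add_le_add_iff_left _).2 (Finset.sum_le_sum fun j _ => ?_)
      rw [mul_add, one_mul, neg_one_mul]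
  refine ⟨c / 2, by positivity, fun k => ?_⟩
  refine (hbig.const_mul (k.factorial * (2 / c) ^ k)).mono' ?_ ?_
  · exact (by fun_prop : Continuous fun x : Vec m =>
        ‖x‖ ^ k * Real.exp (inner ℝ s x + c / 2 * ‖x‖)).aestronglyMeasurable
  · filter_upwards with x
    rw [Real.norm_of_nonneg (by positivity)]
    have h1 := Real.pow_div_factorial_le_exp (c / 2 * ‖x‖) (by positivity) k
    have h2 : ‖x‖ ^ k ≤ k.factorial * (2 / c) ^ k * Real.exp (c / 2 * ‖x‖) := by
      have h3 : ‖x‖ ^ k = k.factorial * (2 / c) ^ k * ((c / 2 * ‖x‖) ^ k / k.factorial) := by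
        have : (2 / c) ^ k * (c / 2 * ‖x‖) ^ k = ‖x‖ ^ k := by
          rw [← mul_pow]
          congr 1
          generalize c = c at *
          field_simp
        rw [mul_div_assoc', mul_assoc, this, mul_div_cancel_left₀]
        positivity
      rw [h3]
      exact mul_le_mul_of_nonneg_left h1 (by positivity)
    calc _ ≤ (k.factorial * (2 / c) ^ k * Real.exp (c / 2 * ‖x‖)) *
          Real.exp (inner ℝ s x + c / 2 * ‖x‖) :=
        mul_le_mul_of_nonneg_right h2 (Real.exp_pos _).le
      _ = _ := by
        rw [mul_assoc, ← Real.exp_add]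
        congr 2
        ring

/-- The integrand of the complex moments. -/
def momFun (js : List (Fin m)) (s φ x : Vec m) : ℂ :=
  (mono js x : ℂ) * Complex.exp (((inner ℝ s x : ℝ) : ℂ) + ((inner ℝ φ x : ℝ) : ℂ) * Complex.I)

/-- The moments `∫ x_{j₁} ⋯ x_{jₗ} exp((s + iφ) x)`. -/
def mom (μ : Measure (Vec m)) (js : List (Fin m)) (s φ : Vec m) : ℂ := ∫ x, momFun js s φ x ∂μ

theorem norm_cexp_add_mul_I (a b : ℝ) : ‖Complex.exp ((a : ℂ) + (b : ℂ) * Complex.I)‖ = Real.exp a := by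
  rw [Complex.norm_exp]
  simp

theorem norm_momFun_le (js : List (Fin m)) (s φ x : Vec m) :
    ‖momFun js s φ x‖ ≤ ‖x‖ ^ js.length * Real.exp (inner ℝ s x) := by
  rw [momFun, norm_mul, norm_cexp_add_mul_I, Complex.norm_real]
  exact mul_le_mul_of_nonneg_right (abs_mono_le js x) (Real.exp_pos _).le

theorem continuous_momFun (js : List (Fin m)) (s φ : Vec m) : Continuous (momFun js s φ) := by
  have := continuous_mono js
  unfold momFun
  fun_prop

theorem ExpNear.integrable_pow [IsFiniteMeasure μ] {s : Vec m} (h : ExpNear μ s) (k : ℕ) :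
    Integrable (fun x => ‖x‖ ^ k * Real.exp (inner ℝ s x)) μ := by
  obtain ⟨ρ, hρ, h⟩ := h.integrable_norm
  refine (h k).mono' ?_ ?_
  · exact (by fun_prop : Continuous fun x : Vec m =>
        ‖x‖ ^ k * Real.exp (inner ℝ s x)).aestronglyMeasurable
  · filter_upwards with x
    rw [Real.norm_of_nonneg (by positivity)]
    gcongr
    have : 0 ≤ ρ * ‖x‖ := by positivity
    linarith

theorem ExpNear.integrable_momFun [IsFiniteMeasure μ] {s : Vec m} (h : ExpNear μ s)
    (js : List (Fin m)) (φ : Vec m) : Integrable (momFun js s φ) μ :=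
  (h.integrable_pow js.length).mono' (continuous_momFun js s φ).aestronglyMeasurable
    (Eventually.of_forall fun x => norm_momFun_le js s φ x)

theorem momFun_cons (j : Fin m) (js : List (Fin m)) (s φ x : Vec m) :
    momFun (j :: js) s φ x = x j * momFun js s φ x := by
  simp [momFun, mono, mul_assoc]

/-- Differentiation of the moments along a complex direction. -/
theorem hasDerivAt_mom_zero [IsFiniteMeasure μ] {s : Vec m} (h : ExpNear μ s) (js : List (Fin m))
    (φ s' φ' : Vec m) :
    HasDerivAt (fun t : ℝ => mom μ js (s + t • s') (φ + t • φ'))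
      (∑ j, ((s' j : ℂ) + φ' j * Complex.I) * mom μ (j :: js) s φ) 0 := by
  obtain ⟨ρ, hρ, hint⟩ := h.integrable_norm
  set F' : ℝ → Vec m → ℂ := fun t x => ((inner ℝ s' x : ℝ) + (inner ℝ φ' x : ℝ) * Complex.I) *
    momFun js (s + t • s') (φ + t • φ') x with hF'
  set b : Vec m → ℝ := fun x => (‖s'‖ + ‖φ'‖) *
    (‖x‖ ^ (js.length + 1) * Real.exp (inner ℝ s x + ρ * ‖x‖)) with hb
  have hmain := (hasDerivAt_integral_of_dominated_loc_of_deriv_le (μ := μ) (𝕜 := ℝ)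
    (F := fun t x => momFun js (s + t • s') (φ + t • φ') x) (F' := F') (x₀ := 0) (bound := b)
    (s := ball 0 (ρ / (‖s'‖ + 1))) (ball_mem_nhds _ (by positivity)) ?_ ?_ ?_ ?_ ?_ ?_).2
  · have e : ∫ x, F' 0 x ∂μ = ∑ j, ((s' j : ℂ) + φ' j * Complex.I) * mom μ (j :: js) s φ := by
      have e1 : ∀ x, F' 0 x = ∑ j, ((s' j : ℂ) + φ' j * Complex.I) * momFun (j :: js) s φ x := by
        intro x
        simp only [hF', zero_smul, add_zero, momFun_cons]
        rw [inner_eq_dotProduct, inner_eq_dotProduct, dotProduct, dotProduct]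
        push_cast
        rw [Finset.sum_mul, ← Finset.sum_add_distrib, Finset.sum_mul]
        refine Finset.sum_congr rfl fun j _ => ?_
        ring
      simp_rw [e1]
      rw [integral_finsetSum _ fun j _ => (h.integrable_momFun (j :: js) φ).const_mul _]
      refine Finset.sum_congr rfl fun j _ => ?_
      rw [integral_const_mul]
      rfl
    rw [← e]
    exact hmain
  · exact Eventually.of_forall fun t => (continuous_momFun _ _ _).aestronglyMeasurable
  · simpa using h.integrable_momFun js φ
  · have := continuous_momFun js (s + (0 : ℝ) • s') (φ + (0 : ℝ) • φ')
    exact (by fun_prop : Continuous (F' 0)).aestronglyMeasurable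
  · filter_upwards with x t ht
    have ht' : |t| * ‖s'‖ ≤ ρ := by
      rw [mem_ball_zero_iff, Real.norm_eq_abs, lt_div_iff₀ (by positivity)] at ht
      nlinarith [abs_nonneg t, norm_nonneg s']
    have h1 : ‖((inner ℝ s' x : ℝ) : ℂ) + (inner ℝ φ' x : ℝ) * Complex.I‖ ≤ (‖s'‖ + ‖φ'‖) * ‖x‖ := by
      refine (norm_add_le _ _).trans ?_
      rw [norm_mul, Complex.norm_I, Complex.norm_real, Complex.norm_real, mul_one, add_mul]
      exact add_le_add (norm_inner_le_norm _ _) (norm_inner_le_norm _ _)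
    have h2 := norm_momFun_le js (s + t • s') (φ + t • φ') x
    have h3 : inner ℝ (s + t • s') x ≤ inner ℝ s x + ρ * ‖x‖ := by
      rw [inner_add_left, inner_smul_left]
      have := (abs_real_inner_le_norm s' x)
      have h4 : t * inner ℝ s' x ≤ |t| * (‖s'‖ * ‖x‖) := by
        calc t * inner ℝ s' x ≤ |t * inner ℝ s' x| := le_abs_self _
          _ = |t| * |inner ℝ s' x| := abs_mul _ _
          _ ≤ _ := mul_le_mul_of_nonneg_left this (abs_nonneg _)
      have h5 : |t| * (‖s'‖ * ‖x‖) ≤ ρ * ‖x‖ := by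
        rw [← mul_assoc]
        exact mul_le_mul_of_nonneg_right ht' (norm_nonneg _)
      simp only [conj_trivial]
      linarith
    calc ‖F' t x‖ = _ := norm_mul _ _
      _ ≤ ((‖s'‖ + ‖φ'‖) * ‖x‖) * (‖x‖ ^ js.length * Real.exp (inner ℝ s x + ρ * ‖x‖)) := by
        refine mul_le_mul h1 (h2.trans ?_) (norm_nonneg _) (by positivity)
        gcongr
      _ = b x := by
        simp only [hb]
        ring
  · exact (hint _).const_mul _
  · filter_upwards with x t _
    have hd : HasDerivAt (fun t : ℝ => ((inner ℝ (s + t • s') x : ℝ) : ℂ) +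
        ((inner ℝ (φ + t • φ') x : ℝ) : ℂ) * Complex.I)
        ((inner ℝ s' x : ℝ) + (inner ℝ φ' x : ℝ) * Complex.I) t := by
      have hl : ∀ a a' : Vec m, HasDerivAt (fun t : ℝ => ((inner ℝ (a + t • a') x : ℝ) : ℂ))
          (inner ℝ a' x : ℝ) t := by
        intro a a'
        simp only [inner_add_left, inner_smul_left, conj_trivial]
        have := ((hasDerivAt_id t).mul_const (inner ℝ a' x)).const_add (inner ℝ a x)
        simpa using this.ofReal_comp
      exact (hl s s').add ((hl φ φ').mul_const _)
    have := (hd.cexp).const_mul (mono js x : ℂ)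
    refine this.congr_deriv ?_
    simp only [hF', momFun]
    ring

theorem hasDerivAt_mom [IsFiniteMeasure μ] (js : List (Fin m)) (s φ s' φ' : Vec m) (t : ℝ)
    (h : ExpNear μ (s + t • s')) :
    HasDerivAt (fun t : ℝ => mom μ js (s + t • s') (φ + t • φ'))
      (∑ j, ((s' j : ℂ) + φ' j * Complex.I) * mom μ (j :: js) (s + t • s') (φ + t • φ')) t := by
  have h1 := hasDerivAt_mom_zero h js (φ + t • φ') s' φ'
  have h2 : HasDerivAt (fun u : ℝ => u - t) 1 t := (hasDerivAt_id t).sub_const t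
  rw [← sub_self t] at h1
  have h3 := HasDerivAt.scomp (h := fun u : ℝ => u - t) t h1 h2
  rw [one_smul] at h3
  refine h3.congr_of_eventuallyEq (Eventually.of_forall fun u => ?_)
  simp only [Function.comp_apply]
  congr 1 <;> module

end Moments

namespace Model

variable {m p q : ℕ} (Y : Model m p q)

theorem expNear_of_mem_interior {z : Vec m × Param p q} (hz : z ∈ interior Y.convSet) :
    ExpNear (Y.law z.2) z.1 := by
  obtain ⟨r, hr, h⟩ := Metric.mem_nhds_iff.1 (mem_interior_iff_mem_nhds.1 hz)
  refine ⟨r, hr, fun s' hs' => ?_⟩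
  have : (s', z.2) ∈ ball z r := by
    rw [mem_ball, Prod.dist_eq]
    simpa [hr] using hs'
  exact (h this).2

theorem iterDeriv_complexMGF_dS (js : List (Fin m)) (φ : Vec m) :
    ∀ z ∈ interior Y.convSet,
      iterDeriv (Y.complexMGF φ) (js.map dS) z = mom (Y.law z.2) js z.1 φ := by
  induction js with
  | nil =>
    intro z _
    simp [iterDeriv, complexMGF, mom, momFun, mono]
  | cons j js ih =>
    intro z hz
    have := Y.isProbabilityMeasure_law z.2 (interior_subset hz).1
    change lineDeriv ℝ (iterDeriv (Y.complexMGF φ) (js.map dS)) z (dS j) = _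
    have h1 := hasDerivAt_mom_zero (Y.expNear_of_mem_interior hz) js φ
      (EuclideanSpace.single j 1) 0
    have h2 : HasLineDerivAt ℝ (iterDeriv (Y.complexMGF φ) (js.map dS))
        (mom (Y.law z.2) (j :: js) z.1 φ) z (dS j) := by
      refine HasDerivAt.congr_of_eventuallyEq (h1.congr_deriv ?_) ?_
      · rw [Finset.sum_eq_single j]
        · simp
        · intro i _ hi
          simp [hi]
        · simp
      · have hc : Tendsto (fun t : ℝ => z + t • (dS j : Vec m × Param p q)) (nhds 0)
            (nhds z) := by
          have : Continuous fun t : ℝ => z + t • (dS j : Vec m × Param p q) := by fun_prop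
          simpa using this.tendsto 0
        filter_upwards [hc (isOpen_interior.mem_nhds hz)] with t ht
        rw [ih _ ht]
        simp [dS]
    exact h2.lineDeriv

end Model


section Calculus

variable {E F : Type*} [NormedAddCommGroup E] [NormedSpace ℝ E] [NormedAddCommGroup F]
  [NormedSpace ℝ F]

/-- Continuous partial derivatives along a basis give a Fréchet derivative. -/
theorem hasFDerivAt_of_partial {ι : Type*} [Fintype ι] [DecidableEq ι] {e : ι → E}
    {c : ι → E →L[ℝ] ℝ} (hc : ∀ h, ∑ i, c i h • e i = h) {f : E → F} {P : ι → E → F} {O : Set E}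
    (hO : IsOpen O) {x : E} (hx : x ∈ O)
    (hf : ∀ i, ∀ y ∈ O, HasLineDerivAt ℝ f (P i y) y (e i)) (hP : ∀ i, ContinuousAt (P i) x) :
    HasFDerivAt f (∑ i, (c i).smulRight (P i x)) x := by
  have key : ∀ T : Finset ι, ∀ ε > 0, ∃ δ > 0, ∀ h : E, ‖h‖ < δ →
      ‖f (x + ∑ i ∈ T, c i h • e i) - f x - ∑ i ∈ T, c i h • P i x‖ ≤ ε * ∑ i ∈ T, |c i h| := by
    intro T
    induction T using Finset.induction_on with
    | empty => exact fun ε _ => ⟨1, one_pos, fun h _ => by simp⟩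
    | insert a T ha ih =>
      intro ε hε
      obtain ⟨δ₁, hδ₁, h₁⟩ := ih ε hε
      have hev : ∀ᶠ y in nhds x, y ∈ O ∧ ‖P a y - P a x‖ < ε := by
        refine (hO.eventually_mem hx).and ?_
        have := (hP a).eventually (ball_mem_nhds (P a x) hε)
        filter_upwards [this] with y hy
        rwa [dist_eq_norm] at hy
      obtain ⟨r, hr, hball⟩ := eventually_nhds_iff_ball.1 hev
      have hg : Tendsto (fun h : E => (∑ i ∈ T, ‖c i h‖ * ‖e i‖) + ‖c a h‖ * ‖e a‖)
          (nhds 0) (nhds 0) := by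
        have : Continuous fun h : E => (∑ i ∈ T, ‖c i h‖ * ‖e i‖) + ‖c a h‖ * ‖e a‖ := by
          fun_prop
        simpa using this.tendsto 0
      obtain ⟨δ₂, hδ₂, h₂⟩ := eventually_nhds_iff_ball.1 (hg.eventually_lt_const hr)
      refine ⟨min δ₁ δ₂, lt_min hδ₁ hδ₂, fun h hh => ?_⟩
      have hA := h₁ h (hh.trans_le (min_le_left _ _))
      have hB := h₂ h (by simpa using hh.trans_le (min_le_right _ _))
      set y := x + ∑ i ∈ T, c i h • e i with hy
      have hmem : ∀ t ∈ Icc (0 : ℝ) 1, y + t • (c a h • e a) ∈ ball x r := by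
        intro t ht
        rw [mem_ball_iff_norm]
        calc ‖y + t • (c a h • e a) - x‖ = ‖∑ i ∈ T, c i h • e i + t • (c a h • e a)‖ := by
              rw [hy]
              congr 1
              abel
          _ ≤ ∑ i ∈ T, ‖c i h‖ * ‖e i‖ + ‖c a h‖ * ‖e a‖ := by
              refine (norm_add_le _ _).trans (add_le_add ?_ ?_)
              · refine (norm_sum_le _ _).trans (Finset.sum_le_sum fun i _ => (norm_smul _ _).le)
              · rw [norm_smul, norm_smul, Real.norm_eq_abs t, abs_of_nonneg ht.1]
                exact mul_le_of_le_one_left (by positivity) ht.2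
          _ < r := hB
      have hd : ∀ t ∈ Icc (0 : ℝ) 1, HasDerivWithinAt
          (fun t : ℝ => f (y + t • (c a h • e a)) - t • (c a h • P a x))
          (c a h • (P a (y + t • (c a h • e a)) - P a x)) (Icc 0 1) t := by
        intro t ht
        have h3 := hf a _ (hball _ (hmem t ht)).1
        have h4 : HasDerivAt (fun u : ℝ => (u - t) * c a h) (c a h) t := by
          simpa using ((hasDerivAt_id t).sub_const t).mul_const (c a h)
        have h5 : HasDerivAt (fun u : ℝ => f (y + t • (c a h • e a) + u • e a))
            (P a (y + t • (c a h • e a))) ((t - t) * c a h) := by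
          simpa [HasLineDerivAt] using h3
        have h6 := HasDerivAt.scomp (h := fun u : ℝ => (u - t) * c a h) t h5 h4
        have h7 : HasDerivAt (fun t : ℝ => f (y + t • (c a h • e a)))
            (c a h • P a (y + t • (c a h • e a))) t := by
          refine h6.congr_of_eventuallyEq (Eventually.of_forall fun u => ?_)
          simp only [Function.comp_apply]
          congr 1
          module
        have h8 : HasDerivAt (fun t : ℝ => t • (c a h • P a x)) (c a h • P a x) t := by
          simpa using (hasDerivAt_id t).smul_const (c a h • P a x)
        rw [smul_sub]
        exact (h7.sub h8).hasDerivWithinAt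
      have hC := norm_image_sub_le_of_norm_deriv_le_segment_01' (C := |c a h| * ε) hd (by
        intro t ht
        rw [norm_smul, Real.norm_eq_abs]
        exact mul_le_mul_of_nonneg_left (hball _ (hmem t ⟨ht.1, ht.2.le⟩)).2.le (abs_nonneg _))
      simp only [one_smul, zero_smul, add_zero, sub_zero] at hC
      rw [Finset.sum_insert ha, Finset.sum_insert ha, Finset.sum_insert ha]
      have e1 : f (x + (c a h • e a + ∑ i ∈ T, c i h • e i)) - f x -
          (c a h • P a x + ∑ i ∈ T, c i h • P i x) =
          (f (y + c a h • e a) - c a h • P a x - f y) +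
            (f y - f x - ∑ i ∈ T, c i h • P i x) := by
        have : x + (c a h • e a + ∑ i ∈ T, c i h • e i) = y + c a h • e a := by
          rw [hy]
          abel
        rw [this]
        abel
      rw [e1]
      refine (norm_add_le _ _).trans ?_
      rw [mul_add]
      refine add_le_add (hC.trans_eq (mul_comm _ _)) hA
  rw [hasFDerivAt_iff_isLittleO_nhds_zero, Asymptotics.isLittleO_iff]
  intro ε hε
  set K : ℝ := ∑ i, ‖c i‖ with hK
  obtain ⟨δ, hδ, h⟩ := key Finset.univ (ε / (K + 1)) (by positivity)
  filter_upwards [ball_mem_nhds (0 : E) hδ] with y hy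
  have h1 := h y (by simpa using hy)
  rw [hc] at h1
  have h2 : (∑ i, (c i).smulRight (P i x)) y = ∑ i, c i y • P i x := by
    simp
  rw [h2]
  refine h1.trans ?_
  have h3 : ∑ i, |c i y| ≤ K * ‖y‖ := by
    rw [hK, Finset.sum_mul]
    exact Finset.sum_le_sum fun i _ => (c i).le_opNorm y
  calc ε / (K + 1) * ∑ i, |c i y| ≤ ε / (K + 1) * (K * ‖y‖) := by gcongr
    _ = ε * (K / (K + 1)) * ‖y‖ := by ring
    _ ≤ ε * 1 * ‖y‖ := by
      gcongr
      exact (div_le_one (by positivity)).2 (by linarith)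
    _ = ε * ‖y‖ := by ring

/-- Interchange of a derivative in a real variable with a Fréchet derivative in a parameter. -/
theorem hasDerivAt_fderiv_swap [ProperSpace E] [CompleteSpace F] {f f1 : ℝ → E → F}
    {f' f1' : ℝ → E → E →L[ℝ] F} {a b : ℝ} {B : Set E} (hB : IsOpen B)
    (hf : ∀ t ∈ Ioo a b, ∀ x ∈ B, HasDerivAt (fun t => f t x) (f1 t x) t)
    (hf1 : ∀ x ∈ B, ContinuousOn (fun t => f1 t x) (Ioo a b))
    (hf' : ∀ t ∈ Ioo a b, ∀ x ∈ B, HasFDerivAt (f t) (f' t x) x)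
    (hf1' : ∀ t ∈ Ioo a b, ∀ x ∈ B, HasFDerivAt (f1 t) (f1' t x) x)
    (hcont : ContinuousOn (fun p : ℝ × E => f1' p.1 p.2) (Ioo a b ×ˢ B))
    {t : ℝ} (ht : t ∈ Ioo a b) {x : E} (hx : x ∈ B) :
    HasDerivAt (fun t => f' t x) (f1' t x) t := by
  have hcx : ContinuousOn (fun u => f1' u x) (Ioo a b) :=
    hcont.comp (f := fun u : ℝ => (u, x)) (by fun_prop) fun u hu => ⟨hu, hx⟩
  have key : ∀ u ∈ Ioo a b, f' u x = f' t x + ∫ τ in t..u, f1' τ x := by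
    intro u hu
    have hsub : uIcc t u ⊆ Ioo a b := (ordConnected_Ioo.uIcc_subset ht hu)
    obtain ⟨r, hr, hrB⟩ := nhds_basis_closedBall.mem_iff.1 (hB.mem_nhds hx)
    obtain ⟨K, hK⟩ := (isCompact_uIcc.prod (isCompact_closedBall x r)).exists_bound_of_continuousOn
      (hcont.mono (prod_mono hsub hrB))
    have hftc : ∀ y ∈ B, f u y = f t y + ∫ τ in t..u, f1 τ y := by
      intro y hy
      rw [intervalIntegral.integral_eq_sub_of_hasDerivAt (fun τ hτ => hf τ (hsub hτ) y hy)
        (((hf1 y hy).mono hsub).intervalIntegrable)]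
      abel
    have hd := intervalIntegral.hasFDerivAt_integral_of_dominated_of_fderiv_le (𝕜 := ℝ)
      (μ := volume) (F := fun y τ => f1 τ y) (F' := fun y τ => f1' τ y) (x₀ := x) (a := t) (b := u)
      (bound := fun _ => K) (s := closedBall x r) (closedBall_mem_nhds x hr)
      (by
        filter_upwards [hB.mem_nhds hx] with y hy
        exact (((hf1 y hy).mono hsub).mono uIoc_subset_uIcc).aestronglyMeasurable
          measurableSet_uIoc)
      (((hf1 x hx).mono hsub).intervalIntegrable)
      ((hcx.mono (uIoc_subset_uIcc.trans hsub)).aestronglyMeasurable measurableSet_uIoc)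
      (by
        filter_upwards with τ hτ y hy
        exact hK (τ, y) ⟨uIoc_subset_uIcc hτ, hy⟩)
      (by simp)
      (by
        filter_upwards with τ hτ y hy
        exact hf1' τ (hsub (uIoc_subset_uIcc hτ)) y (hrB hy))
    have h2 : HasFDerivAt (f u) (f' t x + ∫ τ in t..u, f1' τ x) x := by
      refine ((hf' t ht x hx).add hd).congr_of_eventuallyEq ?_
      filter_upwards [hB.mem_nhds hx] with y hy
      exact hftc y hy
    exact (hf' u hu x hx).unique h2
  have hat : ContinuousAt (fun u => f1' u x) t := hcx.continuousAt (isOpen_Ioo.mem_nhds ht)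
  have h3 := intervalIntegral.integral_hasDerivAt_right (a := t) (b := t)
    (f := fun u => f1' u x) (by simp)
    (hcx.stronglyMeasurableAtFilter isOpen_Ioo t ht) hat
  refine (h3.const_add (f' t x)).congr_of_eventuallyEq ?_
  filter_upwards [isOpen_Ioo.mem_nhds ht] with u hu
  exact key u hu

end Calculus


namespace Model

variable {m p q : ℕ} (Y : Model m p q)

/-- The coordinate directions of the parameter space. -/
def eTheta : Fin p ⊕ Fin q → Param p q
  | Sum.inl i => (EuclideanSpace.single i 1, 0)
  | Sum.inr i => (0, EuclideanSpace.single i 1)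

/-- The coordinate functionals of the parameter space. -/
def cTheta : Fin p ⊕ Fin q → Param p q →L[ℝ] ℝ
  | Sum.inl i => (EuclideanSpace.proj i).comp (ContinuousLinearMap.fst ℝ (Vec p) (Vec q))
  | Sum.inr i => (EuclideanSpace.proj i).comp (ContinuousLinearMap.snd ℝ (Vec p) (Vec q))

theorem sum_single_eq {d : ℕ} (x : Vec d) : ∑ i, x i • EuclideanSpace.single i (1 : ℝ) = x := by
  ext j
  simp [Finset.sum_apply, Pi.single_apply]

theorem sum_cTheta_smul_eTheta (h : Param p q) : ∑ i, cTheta i h • eTheta i = h := by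
  rw [Fintype.sum_sum_type]
  ext1
  · simpa [Prod.fst_sum, cTheta, eTheta] using sum_single_eq h.1
  · simpa [Prod.snd_sum, cTheta, eTheta] using sum_single_eq h.2

theorem dTheta_eq (i : Fin p ⊕ Fin q) : (dTheta i : Vec m × Param p q) = (0, eTheta i) := by
  rcases i with i | i <;> rfl

/-- The complex moments as functions of the parameter. -/
def G (js : List (Fin m)) (s φ : Vec m) (θ : Param p q) : ℂ := mom (Y.law θ) js s φ

/-- The derivative of the complex moments in the parameter. -/
def dG (js : List (Fin m)) (s φ : Vec m) (θ : Param p q) : Param p q →L[ℝ] ℂ :=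
  fderiv ℝ (Y.G js s φ) θ

/-- The second derivative of the complex moments in the parameter. -/
def ddG (js : List (Fin m)) (s φ : Vec m) (θ : Param p q) :
    Param p q →L[ℝ] Param p q →L[ℝ] ℂ :=
  fderiv ℝ (Y.dG js s φ) θ

theorem G_nil (s φ : Vec m) (θ : Param p q) : Y.G [] s φ θ = Y.complexMGF φ (s, θ) := by
  simp [G, mom, momFun, mono, complexMGF]

theorem iterDeriv_eq_G (js : List (Fin m)) (φ : Vec m) {z : Vec m × Param p q}
    (hz : z ∈ interior Y.convSet) :
    iterDeriv (Y.complexMGF φ) (js.map dS) z = Y.G js z.1 φ z.2 :=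
  Y.iterDeriv_complexMGF_dS js φ z hz

theorem hasLineDerivAt_slice {F : Type*} [NormedAddCommGroup F] [NormedSpace ℝ F]
    {O : Set (Vec m × Param p q)} (hO : IsOpen O) {f : Vec m × Param p q → F}
    {g : Param p q → F} {s : Vec m} (hfg : ∀ θ, (s, θ) ∈ O → g θ = f (s, θ)) {θ e : Param p q}
    {v : F} (h : (s, θ) ∈ O) (hf : HasLineDerivAt ℝ f v (s, θ) (0, e)) : HasLineDerivAt ℝ g v θ e := by
  refine HasDerivAt.congr_of_eventuallyEq hf ?_
  have hc : Tendsto (fun t : ℝ => (s, θ + t • e)) (nhds 0) (nhds (s, θ)) := by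
    have : Continuous fun t : ℝ => (s, θ + t • e) := by fun_prop
    simpa using this.tendsto 0
  filter_upwards [hc (hO.mem_nhds h)] with t ht
  rw [hfg _ ht]
  simp

/-- First partial derivatives in the parameter of the complex moments. -/
def pG (i : Fin p ⊕ Fin q) (js : List (Fin m)) (φ : Vec m) (z : Vec m × Param p q) : ℂ :=
  iterDeriv (Y.complexMGF φ) ([i].map dTheta ++ js.map dS) z

/-- Second partial derivatives in the parameter of the complex moments. -/
def ppG (i i' : Fin p ⊕ Fin q) (js : List (Fin m)) (φ : Vec m) (z : Vec m × Param p q) : ℂ :=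
  iterDeriv (Y.complexMGF φ) ([i, i'].map dTheta ++ js.map dS) z

variable {Y}

theorem continuous_slice {X : Type*} [TopologicalSpace X]
    {P : Vec m → Vec m × Param p q → X} {O : Set (Vec m × Param p q)} (hO : IsOpen O)
    (h : ContinuousOn (fun w : Vec m × (Vec m × Param p q) => P w.1 w.2) {w | w.2 ∈ O})
    (φ : Vec m) {s : Vec m} {θ : Param p q} (hz : (s, θ) ∈ O) :
    ContinuousAt (fun θ' => P φ (s, θ')) θ := by
  have h1 : ContinuousAt (fun w : Vec m × (Vec m × Param p q) => P w.1 w.2) (φ, (s, θ)) :=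
    h.continuousAt ((hO.preimage continuous_snd).mem_nhds hz)
  exact ContinuousAt.comp (f := fun θ' => (φ, (s, θ'))) (x := θ) h1 (by fun_prop)

theorem hasFDerivAt_G_aux (hg : Y.GrowthBound) {js : List (Fin m)} (hjs : js.length ≤ 5)
    {s φ : Vec m} {θ : Param p q} (hz : (s, θ) ∈ interior Y.convSet) :
    HasFDerivAt (Y.G js s φ) (∑ i, (cTheta i).smulRight (Y.pG i js φ (s, θ))) θ := by
  obtain ⟨γ, -, -, h⟩ := hg
  have hO : IsOpen {θ : Param p q | (s, θ) ∈ interior Y.convSet} :=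
    isOpen_interior.preimage (by fun_prop : Continuous fun θ : Param p q => (s, θ))
  refine hasFDerivAt_of_partial (P := fun i θ => Y.pG i js φ (s, θ))
    sum_cTheta_smul_eTheta hO hz ?_ ?_
  · intro i θ' hθ'
    have hi := (h [i] js (by left; simp; omega)).1 φ
    have h1 : HasLineDerivAt ℝ (iterDeriv (Y.complexMGF φ) (js.map dS)) (Y.pG i js φ (s, θ'))
      (s, θ') (dTheta i) := (hi.2 _ hθ').hasLineDerivAt
    rw [dTheta_eq] at h1
    refine hasLineDerivAt_slice isOpen_interior (fun θ hθ => ?_) hθ' h1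
    exact (Y.iterDeriv_eq_G js φ hθ).symm
  · intro i
    exact continuous_slice isOpen_interior (h [i] js (by left; simp; omega)).2.2 φ hz

theorem hasFDerivAt_G (hg : Y.GrowthBound) {js : List (Fin m)} (hjs : js.length ≤ 5)
    {s φ : Vec m} {θ : Param p q} (hz : (s, θ) ∈ interior Y.convSet) :
    HasFDerivAt (Y.G js s φ) (Y.dG js s φ θ) θ :=
  (hasFDerivAt_G_aux hg hjs hz).differentiableAt.hasFDerivAt

theorem dG_eq (hg : Y.GrowthBound) {js : List (Fin m)} (hjs : js.length ≤ 5)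
    {s φ : Vec m} {θ : Param p q} (hz : (s, θ) ∈ interior Y.convSet) :
    Y.dG js s φ θ = ∑ i, (cTheta i).smulRight (Y.pG i js φ (s, θ)) :=
  (hasFDerivAt_G_aux hg hjs hz).fderiv

theorem hasFDerivAt_dG_aux (hg : Y.GrowthBound) {js : List (Fin m)} (hjs : js.length ≤ 2)
    {s φ : Vec m} {θ : Param p q} (hz : (s, θ) ∈ interior Y.convSet) :
    HasFDerivAt (Y.dG js s φ) (∑ i, (cTheta i).smulRight
      (∑ i', (cTheta i').smulRight (Y.ppG i i' js φ (s, θ)))) θ := by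
  have hO : IsOpen {θ : Param p q | (s, θ) ∈ interior Y.convSet} :=
    isOpen_interior.preimage (by fun_prop : Continuous fun θ : Param p q => (s, θ))
  have hg' := hg
  obtain ⟨γ, -, -, h⟩ := hg
  refine hasFDerivAt_of_partial (P := fun i θ => ∑ i', (cTheta i').smulRight (Y.ppG i i' js φ (s, θ)))
    sum_cTheta_smul_eTheta hO hz ?_ ?_
  · intro i θ' hθ'
    have h2 : ∀ i', HasLineDerivAt ℝ (fun θ => Y.pG i' js φ (s, θ)) (Y.ppG i i' js φ (s, θ')) θ'
        (eTheta i) := by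
      intro i'
      have hi := (h [i, i'] js (by right; simpa using hjs)).1 φ
      have h1 : HasLineDerivAt ℝ (Y.pG i' js φ) (Y.ppG i i' js φ (s, θ'))
        (s, θ') (dTheta i) := (hi.2 _ hθ').hasLineDerivAt
      rw [dTheta_eq] at h1
      exact hasLineDerivAt_slice isOpen_interior (fun θ hθ => rfl) hθ' h1
    have h3 : HasLineDerivAt ℝ (fun θ => ∑ i', (cTheta i').smulRight (Y.pG i' js φ (s, θ)))
        (∑ i', (cTheta i').smulRight (Y.ppG i i' js φ (s, θ'))) θ' (eTheta i) := by
      refine HasDerivAt.fun_sum fun i' _ => ?_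
      exact (ContinuousLinearMap.smulRightL ℝ (Param p q) ℂ (cTheta i')).hasFDerivAt.comp_hasDerivAt
        (0 : ℝ) (h2 i')
    refine HasDerivAt.congr_of_eventuallyEq h3 ?_
    have hc : Tendsto (fun t : ℝ => θ' + t • (eTheta i : Param p q)) (nhds 0) (nhds θ') := by
      have : Continuous fun t : ℝ => θ' + t • (eTheta i : Param p q) := by fun_prop
      simpa using this.tendsto 0
    filter_upwards [hc (hO.mem_nhds hθ')] with t ht
    exact dG_eq hg' (by omega) ht
  · intro i
    have h2 : ∀ i', ContinuousAt (fun θ => Y.ppG i i' js φ (s, θ)) θ := fun i' =>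
      continuous_slice isOpen_interior (h [i, i'] js (by right; simpa using hjs)).2.2 φ hz
    refine tendsto_finsetSum _ fun i' _ => ?_
    exact ((ContinuousLinearMap.smulRightL ℝ (Param p q) ℂ (cTheta i')).continuous.tendsto _).comp
      (h2 i')

theorem hasFDerivAt_dG (hg : Y.GrowthBound) {js : List (Fin m)} (hjs : js.length ≤ 2)
    {s φ : Vec m} {θ : Param p q} (hz : (s, θ) ∈ interior Y.convSet) :
    HasFDerivAt (Y.dG js s φ) (Y.ddG js s φ θ) θ :=
  (hasFDerivAt_dG_aux hg hjs hz).differentiableAt.hasFDerivAt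

theorem ddG_eq (hg : Y.GrowthBound) {js : List (Fin m)} (hjs : js.length ≤ 2)
    {s φ : Vec m} {θ : Param p q} (hz : (s, θ) ∈ interior Y.convSet) :
    Y.ddG js s φ θ = ∑ i, (cTheta i).smulRight
      (∑ i', (cTheta i').smulRight (Y.ppG i i' js φ (s, θ))) :=
  (hasFDerivAt_dG_aux hg hjs hz).fderiv

theorem continuousOn_dG (hg : Y.GrowthBound) {js : List (Fin m)} (hjs : js.length ≤ 5) :
    ContinuousOn (fun w : Vec m × (Vec m × Param p q) => Y.dG js w.2.1 w.1 w.2.2)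
      {w | w.2 ∈ interior Y.convSet} := by
  have h1 : ContinuousOn (fun w : Vec m × (Vec m × Param p q) =>
      ∑ i, (cTheta i).smulRight (Y.pG i js w.1 w.2)) {w | w.2 ∈ interior Y.convSet} := by
    refine continuousOn_finsetSum _ fun i _ => ?_
    obtain ⟨γ, -, -, h⟩ := hg
    exact (ContinuousLinearMap.smulRightL ℝ (Param p q) ℂ (cTheta i)).continuous.comp_continuousOn
      (h [i] js (by left; simp; omega)).2.2
  exact h1.congr fun w hw => dG_eq hg hjs hw

set_option synthInstance.maxHeartbeats 200000 in
theorem continuousOn_ddG (hg : Y.GrowthBound) {js : List (Fin m)} (hjs : js.length ≤ 2) :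
    ContinuousOn (fun w : Vec m × (Vec m × Param p q) => Y.ddG js w.2.1 w.1 w.2.2)
      {w | w.2 ∈ interior Y.convSet} := by
  have : ContinuousAdd (Param p q →L[ℝ] Param p q →L[ℝ] ℂ) :=
    (inferInstance : IsTopologicalAddGroup (Param p q →L[ℝ] Param p q →L[ℝ] ℂ)).toContinuousAdd
  have h1 : ContinuousOn (fun w : Vec m × (Vec m × Param p q) =>
      ∑ i, (cTheta i).smulRight (∑ i', (cTheta i').smulRight (Y.ppG i i' js w.1 w.2)))
      {w | w.2 ∈ interior Y.convSet} := by
    refine continuousOn_finsetSum _ fun i _ => ?_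
    refine (ContinuousLinearMap.smulRightL ℝ (Param p q) _ (cTheta i)).continuous.comp_continuousOn
      (continuousOn_finsetSum _ fun i' _ => ?_)
    obtain ⟨γ, -, -, h⟩ := hg
    exact (ContinuousLinearMap.smulRightL ℝ (Param p q) ℂ (cTheta i')).continuous.comp_continuousOn
      (h [i, i'] js (by right; simpa using hjs)).2.2
  exact h1.congr fun w hw => ddG_eq hg hjs hw

variable (Y) in
/-- Uniform bounds near `(0, θ₀)`. -/
structure Reg (θ₀ : Param p q) (ρ C δ : ℝ) (Γ : ℕ) : Prop where
  ρ_pos : 0 < ρ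
  ρ_le : ρ ≤ 1
  one_le_C : 1 ≤ C
  δ_pos : 0 < δ
  mem : ∀ s θ, ‖s‖ ≤ ρ → ‖θ - θ₀‖ ≤ ρ → (s, θ) ∈ interior Y.convSet
  decay : ∀ s θ φ, ‖s‖ ≤ ρ → ‖θ - θ₀‖ ≤ ρ →
    ‖Y.G [] s φ θ‖ ≤ Y.mgf (s, θ) * (1 + δ * ‖φ‖ ^ 2) ^ (-δ)
  G_bound : ∀ js : List (Fin m), js.length ≤ 4 → ∀ s θ φ, ‖s‖ ≤ ρ → ‖θ - θ₀‖ ≤ ρ →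
    ‖Y.G js s φ θ‖ ≤ C * (1 + ‖φ‖) ^ Γ
  dG_bound : ∀ js : List (Fin m), js.length ≤ 4 → ∀ s θ φ, ‖s‖ ≤ ρ → ‖θ - θ₀‖ ≤ ρ →
    ‖Y.dG js s φ θ‖ ≤ C * (1 + ‖φ‖) ^ Γ
  ddG_bound : ∀ js : List (Fin m), js.length ≤ 2 → ∀ s θ φ, ‖s‖ ≤ ρ → ‖θ - θ₀‖ ≤ ρ →
    ‖Y.ddG js s φ θ‖ ≤ C * (1 + ‖φ‖) ^ Γ

theorem mgf_pos_of_mem {z : Vec m × Param p q} (hz : z ∈ Y.convSet) : 0 < Y.mgf z := by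
  have := Y.isProbabilityMeasure_law z.2 hz.1
  exact integral_exp_pos hz.2

theorem norm_G_nil_le (s φ : Vec m) (θ : Param p q) : ‖Y.G [] s φ θ‖ ≤ Y.mgf (s, θ) := by
  rw [G_nil]
  refine (norm_integral_le_integral_norm _).trans_eq ?_
  simp only [norm_cexp_add_mul_I]
  rfl

theorem mgf_eq_G (s : Vec m) (θ : Param p q) : (Y.mgf (s, θ) : ℂ) = Y.G [] s 0 θ := by
  rw [G_nil]
  exact integral_rexp_eq_cmgf _ _

theorem mgf_zero {θ : Param p q} (hθ : θ ∈ Y.domain) : Y.mgf (0, θ) = 1 := by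
  have := Y.isProbabilityMeasure_law θ hθ
  simp [mgf]

theorem exists_reg (hd : Y.DecayBound) (hg : Y.GrowthBound) {θ₀ : Param p q}
    (h0 : (0, θ₀) ∈ interior Y.convSet) : ∃ ρ C δ Γ, Y.Reg θ₀ ρ C δ Γ := by
  have hg0 := hg
  obtain ⟨δ, hδc, hδ, hdec⟩ := hd
  obtain ⟨γ, hγc, hγ, hgr⟩ := hg
  obtain ⟨r, hr, hball⟩ := nhds_basis_closedBall.mem_iff.1 (isOpen_interior.mem_nhds h0)
  set ρ := min r 1 with hρ
  have hρ0 : 0 < ρ := lt_min hr one_pos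
  have hmem0 : ∀ z ∈ closedBall ((0 : Vec m), θ₀) ρ, z ∈ interior Y.convSet := fun z hz =>
    hball (closedBall_subset_closedBall (min_le_left _ _) hz)
  have hcl : ∀ s θ, ‖s‖ ≤ ρ → ‖θ - θ₀‖ ≤ ρ → (s, θ) ∈ closedBall ((0 : Vec m), θ₀) ρ := by
    intro s θ hs hθ
    rw [mem_closedBall, Prod.dist_eq]
    refine max_le (by simpa using hs) (by simpa [dist_eq_norm] using hθ)
  have hmem : ∀ s θ, ‖s‖ ≤ ρ → ‖θ - θ₀‖ ≤ ρ → (s, θ) ∈ interior Y.convSet :=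
    fun s θ hs hθ => hmem0 _ (hcl s θ hs hθ)
  have hK : IsCompact (closedBall ((0 : Vec m), θ₀) ρ) := isCompact_closedBall _ _
  obtain ⟨zm, hzm, hmin⟩ := hK.exists_isMinOn ⟨_, mem_closedBall_self hρ0.le⟩
    (hδc.mono hmem0)
  obtain ⟨zM, hzM, hmax⟩ := hK.exists_isMaxOn ⟨_, mem_closedBall_self hρ0.le⟩
    (hγc.mono hmem0)
  set δ₀ := δ zm with hδ₀
  have hδ₀pos : 0 < δ₀ := hδ _ (hmem0 _ hzm)
  obtain ⟨Γ, hΓ⟩ := exists_nat_ge (γ zM)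
  have hΓ1 : ∀ φ : Vec m, ∀ s θ, ‖s‖ ≤ ρ → ‖θ - θ₀‖ ≤ ρ →
      γ (s, θ) * (1 + ‖φ‖) ^ γ (s, θ) ≤ Γ * (1 + ‖φ‖) ^ Γ := by
    intro φ s θ hs hθ
    have h1 : γ (s, θ) ≤ Γ := (hmax (hcl s θ hs hθ)).trans hΓ
    have h2 := hγ _ (hmem s θ hs hθ)
    rw [← Real.rpow_natCast]
    refine mul_le_mul h1 (Real.rpow_le_rpow_of_exponent_le ?_ h1) (by positivity) (by positivity)
    linarith [norm_nonneg φ]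
  set K : ℝ := ∑ i : Fin p ⊕ Fin q, ‖(cTheta i : Param p q →L[ℝ] ℝ)‖ with hKdef
  have hK0 : 0 ≤ K := Finset.sum_nonneg fun _ _ => norm_nonneg _
  have hsum : ∀ (W : Type) [NormedAddCommGroup W] [NormedSpace ℝ W] (P : Fin p ⊕ Fin q → W) (b : ℝ),
      (∀ i, ‖P i‖ ≤ b) → ‖∑ i, (cTheta i).smulRight (P i)‖ ≤ K * b := by
    intro W _ _ P b hb
    rw [hKdef, Finset.sum_mul]
    refine (norm_sum_le _ _).trans (Finset.sum_le_sum fun i _ => ?_)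
    rw [ContinuousLinearMap.norm_smulRight_apply]
    exact mul_le_mul_of_nonneg_left (hb i) (norm_nonneg _)
  set C : ℝ := 1 + m * Γ * 2 ^ Γ + Γ + K * Γ + K * (K * Γ) with hC
  have hG1 : ∀ js : List (Fin m), 1 ≤ js.length → js.length ≤ 6 → ∀ s θ φ, ‖s‖ ≤ ρ → ‖θ - θ₀‖ ≤ ρ →
      ‖Y.G js s φ θ‖ ≤ Γ * (1 + ‖φ‖) ^ Γ := by
    intro js h1 h4 s θ φ hs hθ
    have h2 := (hgr [] js (by left; simp; omega)).2.1 _ (hmem s θ hs hθ) φ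
    simp only [List.map_nil, List.nil_append] at h2
    rw [Y.iterDeriv_eq_G js φ (hmem s θ hs hθ)] at h2
    exact h2.trans (hΓ1 φ s θ hs hθ)
  refine ⟨ρ, C, δ₀, Γ, hρ0, min_le_right _ _, ?_, hδ₀pos, hmem, ?_, ?_, ?_, ?_⟩
  · rw [hC]
    have : 0 ≤ m * Γ * (2 : ℝ) ^ Γ + Γ + K * Γ + K * (K * Γ) := by positivity
    linarith
  · intro s θ φ hs hθ
    have hz := hmem s θ hs hθ
    have hM := mgf_pos_of_mem (interior_subset hz)
    have h1 := hdec _ hz φ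
    rw [norm_div, Complex.norm_real, Real.norm_eq_abs, abs_of_pos hM, div_le_iff₀ hM] at h1
    rw [G_nil, mul_comm]
    refine h1.trans (mul_le_mul_of_nonneg_right ?_ hM.le)
    have h2 : δ₀ ≤ δ (s, θ) := hmin (hcl s θ hs hθ)
    have hφ : 0 ≤ ‖φ‖ ^ 2 := by positivity
    have h3 : 1 ≤ 1 + δ₀ * ‖φ‖ ^ 2 := by nlinarith
    have h4 : 1 + δ₀ * ‖φ‖ ^ 2 ≤ 1 + δ (s, θ) * ‖φ‖ ^ 2 := by nlinarith
    calc (1 + δ (s, θ) * ‖φ‖ ^ 2) ^ (-δ (s, θ)) ≤ (1 + δ₀ * ‖φ‖ ^ 2) ^ (-δ (s, θ)) :=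
          Real.rpow_le_rpow_of_nonpos (by linarith) h4 (by linarith)
      _ ≤ (1 + δ₀ * ‖φ‖ ^ 2) ^ (-δ₀) := Real.rpow_le_rpow_of_exponent_le h3 (by linarith)
  · intro js hjs s θ φ hs hθ
    have hpow : 1 ≤ (1 + ‖φ‖) ^ Γ := one_le_pow₀ (by linarith [norm_nonneg φ])
    rcases js with _ | ⟨j, js⟩
    · have hdom := (interior_subset (hmem 0 θ (by simpa using hρ0.le) hθ)).1
      have := Y.isProbabilityMeasure_law θ hdom
      have hd1 : ∀ t ∈ Icc (0 : ℝ) 1, HasDerivWithinAt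
          (fun t : ℝ => Y.G [] (t • s) 0 θ) (∑ j, (s j : ℂ) * Y.G [j] (t • s) 0 θ) (Icc 0 1) t := by
        intro t ht
        have hts : ‖t • s‖ ≤ ρ := by
          rw [norm_smul, Real.norm_of_nonneg ht.1]
          exact (mul_le_of_le_one_left (norm_nonneg _) ht.2).trans hs
        have h1 := hasDerivAt_mom (μ := Y.law θ) [] 0 0 s 0 t
          (by simpa using Y.expNear_of_mem_interior (hmem _ θ hts hθ))
        simpa [G] using h1.hasDerivWithinAt
      have h2 := norm_image_sub_le_of_norm_deriv_le_segment_01' (C := m * Γ * 2 ^ Γ) hd1 (by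
        intro t ht
        have hts : ‖t • s‖ ≤ ρ := by
          rw [norm_smul, Real.norm_of_nonneg ht.1]
          exact (mul_le_of_le_one_left (norm_nonneg _) ht.2.le).trans hs
        have hb : ∀ j ∈ (Finset.univ : Finset (Fin m)), ‖(s j : ℂ) * Y.G [j] (t • s) 0 θ‖ ≤ Γ * 2 ^ Γ := by
          intro j _
          rw [norm_mul, Complex.norm_real]
          have h3 := hG1 [j] (by simp) (by simp) (t • s) θ 0 hts hθ
          simp only [norm_zero, add_zero, one_pow, mul_one] at h3
          have h4 : ‖s j‖ ≤ 1 := (abs_coord_le s j).trans (hs.trans (min_le_right _ _))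
          calc ‖s j‖ * ‖Y.G [j] (t • s) 0 θ‖ ≤ 1 * Γ := by gcongr
            _ ≤ Γ * 2 ^ Γ := by
              have : (1 : ℝ) ≤ 2 ^ Γ := one_le_pow₀ (by norm_num)
              have h5 : (0 : ℝ) ≤ Γ := by positivity
              nlinarith
        refine (norm_sum_le_of_le _ hb).trans ?_
        simp [mul_assoc])
      simp only [one_smul, zero_smul] at h2
      have h3 : ‖Y.G [] s φ θ‖ ≤ 1 + m * Γ * 2 ^ Γ := by
        refine (norm_G_nil_le s φ θ).trans ?_
        rw [← mgf_eq_G, ← mgf_eq_G, mgf_zero hdom, ← Complex.ofReal_sub, Complex.norm_real] at h2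
        have := (abs_le.1 h2).2
        linarith
      have h4 : 0 ≤ Γ + K * Γ + K * (K * Γ) := by positivity
      have h5 : 1 + m * Γ * 2 ^ Γ ≤ C := by rw [hC]; linarith
      calc _ ≤ C * 1 := by linarith
        _ ≤ _ := by
          refine mul_le_mul_of_nonneg_left hpow (le_trans (by positivity) h5)
    · refine (hG1 (j :: js) (by simp) (by omega) s θ φ hs hθ).trans ?_
      refine mul_le_mul_of_nonneg_right ?_ (by positivity)
      have h4 : 0 ≤ 1 + m * Γ * (2 : ℝ) ^ Γ + K * Γ + K * (K * Γ) := by positivity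
      rw [hC]
      linarith
  · intro js hjs s θ φ hs hθ
    rw [dG_eq hg0 (by omega) (hmem s θ hs hθ)]
    refine (hsum ℂ _ (Γ * (1 + ‖φ‖) ^ Γ) fun i => ?_).trans ?_
    · exact ((hgr [i] js (by left; simp; omega)).2.1 _ (hmem s θ hs hθ) φ).trans (hΓ1 φ s θ hs hθ)
    · rw [← mul_assoc]
      refine mul_le_mul_of_nonneg_right ?_ (by positivity)
      have h4 : 0 ≤ 1 + m * Γ * (2 : ℝ) ^ Γ + Γ + K * (K * Γ) := by positivity
      rw [hC]
      linarith
  · intro js hjs s θ φ hs hθ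
    rw [ddG_eq hg0 (by omega) (hmem s θ hs hθ)]
    refine (hsum _ _ (K * (Γ * (1 + ‖φ‖) ^ Γ)) fun i => hsum ℂ _ _ fun i' => ?_).trans ?_
    · exact ((hgr [i, i'] js (by right; simpa using hjs)).2.1 _ (hmem s θ hs hθ) φ).trans
        (hΓ1 φ s θ hs hθ)
    · rw [← mul_assoc, ← mul_assoc]
      refine mul_le_mul_of_nonneg_right ?_ (by positivity)
      have h4 : 0 ≤ 1 + m * Γ * (2 : ℝ) ^ Γ + Γ + K * Γ := by positivity
      rw [hC]
      linarith

end Model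


section Taylor

variable {W : Type*} [NormedAddCommGroup W] [NormedSpace ℝ W]

theorem norm_sub_le_of_hasDerivAt {h h' : ℝ → W} {b : ℝ}
    (hd : ∀ t ∈ Icc (0 : ℝ) 1, HasDerivAt h (h' t) t) (hb : ∀ t ∈ Icc (0 : ℝ) 1, ‖h' t‖ ≤ b) {u : ℝ}
    (hu : u ∈ Icc (0 : ℝ) 1) : ‖h u - h 0‖ ≤ b := by
  have hb0 : 0 ≤ b := (norm_nonneg _).trans (hb 0 (by simp))
  have := (convex_Icc (0 : ℝ) 1).norm_image_sub_le_of_norm_hasDerivWithin_le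
    (fun t ht => (hd t ht).hasDerivWithinAt) hb (left_mem_Icc.2 zero_le_one) hu
  refine this.trans ?_
  rw [sub_zero, Real.norm_of_nonneg hu.1]
  exact mul_le_of_le_one_right hb0 hu.2

theorem taylor_two {h h' h'' : ℝ → W} {b : ℝ}
    (hd : ∀ t ∈ Icc (0 : ℝ) 1, HasDerivAt h (h' t) t)
    (hd' : ∀ t ∈ Icc (0 : ℝ) 1, HasDerivAt h' (h'' t) t)
    (hb : ∀ t ∈ Icc (0 : ℝ) 1, ‖h'' t‖ ≤ b) : ‖h 1 - h 0 - h' 0‖ ≤ b := by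
  have h1 := norm_sub_le_of_hasDerivAt (h := fun t => h t - t • h' 0) (h' := fun t => h' t - h' 0)
    (b := b) (fun t ht => by
      have := (hasDerivAt_id t).smul_const (h' 0)
      rw [one_smul] at this
      exact (hd t ht).sub this) (fun t ht => norm_sub_le_of_hasDerivAt hd' hb ht)
    (right_mem_Icc.2 zero_le_one)
  simp only [one_smul, zero_smul, sub_zero] at h1
  rwa [sub_right_comm]

theorem taylor_two' {h h' h'' : ℝ → W} {b : ℝ}
    (hd : ∀ t ∈ Icc (0 : ℝ) 1, HasDerivAt h (h' t) t)
    (hd' : ∀ t ∈ Icc (0 : ℝ) 1, HasDerivAt h' (h'' t) t)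
    (hb : ∀ t ∈ Icc (0 : ℝ) 1, ‖h'' t - h'' 0‖ ≤ b) :
    ‖h 1 - h 0 - h' 0 - (1 / 2 : ℝ) • h'' 0‖ ≤ b := by
  have h1 := taylor_two (h := fun t => h t - (t ^ 2 / 2) • h'' 0) (h' := fun t => h' t - t • h'' 0)
    (h'' := fun t => h'' t - h'' 0) (b := b) (fun t ht => by
      have h2 : HasDerivAt (fun t : ℝ => t ^ 2 / 2) t t := by
        have := (hasDerivAt_pow 2 t).div_const 2
        simpa using this
      exact (hd t ht).sub (h2.smul_const (h'' 0))) (fun t ht => by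
      have := (hasDerivAt_id t).smul_const (h'' 0)
      rw [one_smul] at this
      exact (hd' t ht).sub this) hb
  simp only [zero_smul, sub_zero, one_pow, ne_eq, OfNat.ofNat_ne_zero, not_false_eq_true, zero_pow,
    zero_div] at h1
  convert h1 using 2
  module

theorem taylor_three {h h' h'' h''' : ℝ → W} {b : ℝ}
    (hd : ∀ t ∈ Icc (0 : ℝ) 1, HasDerivAt h (h' t) t)
    (hd' : ∀ t ∈ Icc (0 : ℝ) 1, HasDerivAt h' (h'' t) t)
    (hd'' : ∀ t ∈ Icc (0 : ℝ) 1, HasDerivAt h'' (h''' t) t)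
    (hb : ∀ t ∈ Icc (0 : ℝ) 1, ‖h''' t‖ ≤ b) :
    ‖h 1 - h 0 - h' 0 - (1 / 2 : ℝ) • h'' 0‖ ≤ b :=
  taylor_two' hd hd' fun _ ht => norm_sub_le_of_hasDerivAt hd'' hb ht

end Taylor

section RayFamily

variable {m : ℕ} {E W : Type*}
  [NormedAddCommGroup W] [NormedSpace ℝ W] [NormedSpace ℂ W]

/-- The coefficients of a complex direction. -/
def cdir (s φ : Vec m) (j : Fin m) : ℂ := (s j : ℂ) + φ j * Complex.I

theorem norm_cdir_le (s φ : Vec m) (j : Fin m) : ‖cdir s φ j‖ ≤ ‖s‖ + ‖φ‖ := by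
  refine (norm_add_le _ _).trans ?_
  rw [norm_mul, Complex.norm_I, mul_one, Complex.norm_real, Complex.norm_real]
  exact add_le_add (abs_coord_le s j) (abs_coord_le φ j)

/-- A family, indexed by lists of coordinates, in which prefixing a coordinate corresponds to
differentiation in that (complex) coordinate. -/
def IsRayFamily (O : Set (Vec m × E)) (H : List (Fin m) → Vec m → Vec m → E → W) (N : ℕ) : Prop :=
  ∀ js, js.length ≤ N → ∀ s s' φ φ' (t : ℝ) x, (s + t • s', x) ∈ O →
    HasDerivAt (fun t : ℝ => H js (s + t • s') (φ + t • φ') x)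
      (∑ j, cdir s' φ' j • H (j :: js) (s + t • s') (φ + t • φ') x) t

variable {O : Set (Vec m × E)} {H : List (Fin m) → Vec m → Vec m → E → W} {N : ℕ}

theorem norm_cdir_sum_le {W : Type*} [NormedAddCommGroup W] [NormedSpace ℂ W] (s φ : Vec m)
    {f : Fin m → W} {b : ℝ} (hb : ∀ j, ‖f j‖ ≤ b) :
    ‖∑ j, cdir s φ j • f j‖ ≤ m * (‖s‖ + ‖φ‖) * b := by
  have h : ∀ j ∈ (Finset.univ : Finset (Fin m)), ‖cdir s φ j • f j‖ ≤ (‖s‖ + ‖φ‖) * b := by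
    intro j _
    rw [norm_smul]
    exact mul_le_mul (norm_cdir_le s φ j) (hb j) (norm_nonneg _) (by positivity)
  refine (norm_sum_le_of_le _ h).trans_eq ?_
  rw [Finset.sum_const, Finset.card_univ, Fintype.card_fin, nsmul_eq_mul, mul_assoc]

section Expansion

variable {s s' φ' : Vec m} {x : E} {b : ℝ}

theorem IsRayFamily.expand_one (hH : IsRayFamily O H N)
    (hO : ∀ t ∈ Icc (0 : ℝ) 1, (s + t • s', x) ∈ O) {js : List (Fin m)} (hjs : js.length ≤ N)
    (hb : ∀ j, ∀ t ∈ Icc (0 : ℝ) 1, ‖H (j :: js) (s + t • s') (t • φ') x‖ ≤ b) :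
    ‖H js (s + s') φ' x - H js s 0 x‖ ≤ m * (‖s'‖ + ‖φ'‖) * b := by
  have := norm_sub_le_of_hasDerivAt (fun t ht => hH js hjs s s' 0 φ' t x (hO t ht))
    (fun t ht => norm_cdir_sum_le s' φ' fun j => by simpa using hb j t ht)
    (right_mem_Icc.2 zero_le_one)
  simpa using this

theorem IsRayFamily.hasDerivAt_two (hH : IsRayFamily O H N)
    (hO : ∀ t ∈ Icc (0 : ℝ) 1, (s + t • s', x) ∈ O) {js : List (Fin m)} (hjs : js.length + 1 ≤ N) :
    ∀ t ∈ Icc (0 : ℝ) 1, HasDerivAt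
      (fun t : ℝ => ∑ j, cdir s' φ' j • H (j :: js) (s + t • s') (0 + t • φ') x)
      (∑ j, cdir s' φ' j • ∑ k, cdir s' φ' k • H (k :: j :: js) (s + t • s') (0 + t • φ') x) t :=
  fun t ht => HasDerivAt.fun_sum fun j _ =>
    (hH (j :: js) (by simpa using hjs) s s' 0 φ' t x (hO t ht)).const_smul _

theorem IsRayFamily.expand_two (hH : IsRayFamily O H N)
    (hO : ∀ t ∈ Icc (0 : ℝ) 1, (s + t • s', x) ∈ O) {js : List (Fin m)} (hjs : js.length + 1 ≤ N)
    (hb : ∀ j k, ∀ t ∈ Icc (0 : ℝ) 1, ‖H (k :: j :: js) (s + t • s') (t • φ') x‖ ≤ b) :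
    ‖H js (s + s') φ' x - H js s 0 x - ∑ j, cdir s' φ' j • H (j :: js) s 0 x‖ ≤
      m * (‖s'‖ + ‖φ'‖) * (m * (‖s'‖ + ‖φ'‖) * b) := by
  have := taylor_two (fun t ht => hH js (by omega) s s' 0 φ' t x (hO t ht))
    (hH.hasDerivAt_two (φ' := φ') hO hjs)
    (fun t ht => norm_cdir_sum_le s' φ' fun j => norm_cdir_sum_le s' φ' fun k => by
      simpa using hb j k t ht)
  simpa using this

theorem IsRayFamily.expand_two' (hH : IsRayFamily O H N)
    (hO : ∀ t ∈ Icc (0 : ℝ) 1, (s + t • s', x) ∈ O) {js : List (Fin m)} (hjs : js.length + 1 ≤ N)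
    (hb : ∀ j k, ∀ t ∈ Icc (0 : ℝ) 1,
      ‖H (k :: j :: js) (s + t • s') (t • φ') x - H (k :: j :: js) s 0 x‖ ≤ b) :
    ‖H js (s + s') φ' x - H js s 0 x - ∑ j, cdir s' φ' j • H (j :: js) s 0 x -
      (1 / 2 : ℝ) • ∑ j, cdir s' φ' j • ∑ k, cdir s' φ' k • H (k :: j :: js) s 0 x‖ ≤
      m * (‖s'‖ + ‖φ'‖) * (m * (‖s'‖ + ‖φ'‖) * b) := by
  have := taylor_two' (fun t ht => hH js (by omega) s s' 0 φ' t x (hO t ht))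
    (hH.hasDerivAt_two (φ' := φ') hO hjs) (b := m * (‖s'‖ + ‖φ'‖) * (m * (‖s'‖ + ‖φ'‖) * b))
    (fun t ht => by
      simp only [zero_smul, add_zero, zero_add]
      rw [← Finset.sum_sub_distrib]
      simp_rw [← smul_sub, ← Finset.sum_sub_distrib, ← smul_sub]
      exact norm_cdir_sum_le s' φ' fun j => norm_cdir_sum_le s' φ' fun k => hb j k t ht)
  simpa using this

theorem IsRayFamily.expand_three (hH : IsRayFamily O H N)
    (hO : ∀ t ∈ Icc (0 : ℝ) 1, (s + t • s', x) ∈ O) {js : List (Fin m)} (hjs : js.length + 2 ≤ N)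
    (hb : ∀ j k l, ∀ t ∈ Icc (0 : ℝ) 1, ‖H (l :: k :: j :: js) (s + t • s') (t • φ') x‖ ≤ b) :
    ‖H js (s + s') φ' x - H js s 0 x - ∑ j, cdir s' φ' j • H (j :: js) s 0 x -
      (1 / 2 : ℝ) • ∑ j, cdir s' φ' j • ∑ k, cdir s' φ' k • H (k :: j :: js) s 0 x‖ ≤
      m * (‖s'‖ + ‖φ'‖) * (m * (‖s'‖ + ‖φ'‖) * (m * (‖s'‖ + ‖φ'‖) * b)) := by
  have := taylor_three (fun t ht => hH js (by omega) s s' 0 φ' t x (hO t ht))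
    (hH.hasDerivAt_two (φ' := φ') hO (by omega))
    (fun t ht => HasDerivAt.fun_sum fun j _ => HasDerivAt.const_smul _ <| HasDerivAt.fun_sum
      fun k _ => (hH (k :: j :: js) (by simp; omega) s s' 0 φ' t x (hO t ht)).const_smul _)
    (fun t ht => norm_cdir_sum_le s' φ' fun j => norm_cdir_sum_le s' φ' fun k =>
      norm_cdir_sum_le s' φ' fun l => by simpa using hb j k l t ht)
  simpa using this

end Expansion

end RayFamily


theorem IsRayFamily.fderiv {m : ℕ} {E W : Type*} [NormedAddCommGroup E] [NormedSpace ℝ E]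
    [ProperSpace E] [NormedAddCommGroup W] [NormedSpace ℝ W] [NormedSpace ℂ W] [CompleteSpace W]
    [SMulCommClass ℝ ℂ W]
    {O : Set (Vec m × E)} (hO : IsOpen O) {H : List (Fin m) → Vec m → Vec m → E → W} {N : ℕ}
    {H' : List (Fin m) → Vec m → Vec m → E → E →L[ℝ] W} (hH : IsRayFamily O H N)
    (hd : ∀ js, js.length ≤ N + 1 → ∀ s φ x, (s, x) ∈ O → HasFDerivAt (H js s φ) (H' js s φ x) x)
    (hc : ∀ js, js.length ≤ N + 1 →
      ContinuousOn (fun w : Vec m × (Vec m × E) => H' js w.2.1 w.1 w.2.2) {w | w.2 ∈ O})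
    (hray : ∀ js, js.length ≤ N + 1 → ∀ s s' φ φ' (t : ℝ) x, (s + t • s', x) ∈ O →
      ContinuousAt (fun t : ℝ => H js (s + t • s') (φ + t • φ') x) t) :
    IsRayFamily O H' N := by
  intro js hjs s s' φ φ' t x htx
  have hopen : IsOpen {p : ℝ × E | (s + p.1 • s', p.2) ∈ O} :=
    hO.preimage (by fun_prop : Continuous fun p : ℝ × E => (s + p.1 • s', p.2))
  obtain ⟨A, B, hA, hB, htA, hxB, hAB⟩ := (isOpen_prod_iff.1 hopen) t x htx
  obtain ⟨a, b, htab, habA⟩ := mem_nhds_iff_exists_Ioo_subset.1 (hA.mem_nhds htA)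
  have hmem : ∀ u ∈ Ioo a b, ∀ y ∈ B, (s + u • s', y) ∈ O := fun u hu y hy =>
    hAB (mk_mem_prod (habA hu) hy)
  refine hasDerivAt_fderiv_swap (a := a) (b := b) hB
    (f := fun t => H js (s + t • s') (φ + t • φ'))
    (f1 := fun t x => ∑ j, cdir s' φ' j • H (j :: js) (s + t • s') (φ + t • φ') x)
    (f' := fun t => H' js (s + t • s') (φ + t • φ'))
    (f1' := fun t x => ∑ j, cdir s' φ' j • H' (j :: js) (s + t • s') (φ + t • φ') x)
    ?_ ?_ ?_ ?_ ?_ htab hxB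
  · exact fun u hu y hy => hH js hjs s s' φ φ' u y (hmem u hu y hy)
  · intro y hy u hu
    refine ContinuousAt.continuousWithinAt (tendsto_finsetSum _ fun j _ => ?_)
    exact (hray (j :: js) (by simpa using hjs) s s' φ φ' u y (hmem u hu y hy)).const_smul _
  · exact fun u hu y hy => hd js (by omega) _ _ y (hmem u hu y hy)
  · intro u hu y hy
    exact HasFDerivAt.fun_sum fun j _ =>
      (hd (j :: js) (by simpa using hjs) _ _ y (hmem u hu y hy)).const_smul _
  · refine continuousOn_finsetSum _ fun j _ => ContinuousOn.fun_const_smul ?_ _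
    exact (hc (j :: js) (by simpa using hjs)).comp
      (f := fun p : ℝ × E => (φ + p.1 • φ', (s + p.1 • s', p.2))) (by fun_prop)
      fun p hp => hmem p.1 hp.1 p.2 hp.2

namespace Model

variable {m p q : ℕ} {Y : Model m p q}

theorem isRayFamily_G (N : ℕ) : IsRayFamily (interior Y.convSet) Y.G N := by
  intro js _ s s' φ φ' t θ h
  have := Y.isProbabilityMeasure_law θ (interior_subset h).1
  have h2 := Y.expNear_of_mem_interior h
  have h1 := hasDerivAt_mom js s φ s' φ' t h2
  simp only [smul_eq_mul]
  exact h1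

theorem isRayFamily_dG (hg : Y.GrowthBound) : IsRayFamily (interior Y.convSet) Y.dG 4 :=
  IsRayFamily.fderiv isOpen_interior (isRayFamily_G 4)
    (fun _ hjs _ _ _ hz => hasFDerivAt_G hg hjs hz) (fun _ hjs => continuousOn_dG hg hjs)
    (fun js hjs s s' φ φ' t x h =>
      (isRayFamily_G 5 js hjs s s' φ φ' t x h).continuousAt)

theorem continuousAt_ray {X : Type*} [TopologicalSpace X] {E : Type*} [TopologicalSpace E]
    {P : Vec m → Vec m → E → X} {O : Set (Vec m × E)} (hO : IsOpen O)
    (h : ContinuousOn (fun w : Vec m × (Vec m × E) => P w.2.1 w.1 w.2.2) {w | w.2 ∈ O})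
    (s s' φ φ' : Vec m) (t : ℝ) {x : E} (hz : (s + t • s', x) ∈ O) :
    ContinuousAt (fun t : ℝ => P (s + t • s') (φ + t • φ') x) t := by
  have h1 : ContinuousAt (fun w : Vec m × (Vec m × E) => P w.2.1 w.1 w.2.2)
      (φ + t • φ', (s + t • s', x)) := h.continuousAt ((hO.preimage continuous_snd).mem_nhds hz)
  exact ContinuousAt.comp (f := fun t : ℝ => (φ + t • φ', (s + t • s', x))) (x := t) h1 (by fun_prop)

theorem isRayFamily_ddG (hg : Y.GrowthBound) : IsRayFamily (interior Y.convSet) Y.ddG 1 := by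
  refine IsRayFamily.fderiv isOpen_interior (fun js hjs => isRayFamily_dG hg js (by omega))
    (fun _ hjs _ _ _ hz => hasFDerivAt_dG hg hjs hz) (fun _ hjs => continuousOn_ddG hg hjs)
    (fun js hjs s s' φ φ' t x h =>
      continuousAt_ray isOpen_interior (continuousOn_dG hg (by omega)) s s' φ φ' t h)

end Model


section MatrixNorm

attribute [local instance] Matrix.linftyOpNormedAddCommGroup Matrix.linftyOpNormedSpace

/-- Evaluation of a matrix entry as a continuous linear map. -/
def entryCLM {m : ℕ} (k l : Fin m) : Matrix (Fin m) (Fin m) ℝ →L[ℝ] ℝ :=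
  LinearMap.toContinuousLinearMap (Matrix.entryLinearMap ℝ ℝ k l)

theorem entryCLM_apply {m : ℕ} (k l : Fin m) (A : Matrix (Fin m) (Fin m) ℝ) :
    entryCLM k l A = A k l := rfl

theorem contDiffOn_matrix {m : ℕ} {E : Type*} [NormedAddCommGroup E] [NormedSpace ℝ E]
    {A : E → Matrix (Fin m) (Fin m) ℝ} {s : Set E} {n : WithTop ℕ∞}
    (h : ∀ k l, ContDiffOn ℝ n (fun x => A x k l) s) : ContDiffOn ℝ n A s := by
  have : A = fun x => ∑ k, ∑ l, A x k l • Matrix.single k l (1 : ℝ) := by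
    ext1 x
    conv_lhs => rw [Matrix.matrix_eq_sum_single (A x)]
    simp [Matrix.smul_single]
  rw [this]
  exact ContDiffOn.sum fun k _ => ContDiffOn.sum fun l _ => (h k l).smul contDiffOn_const

end MatrixNorm

theorem HasLineDerivAt.congr_on {E F : Type*} [NormedAddCommGroup E] [NormedSpace ℝ E]
    [NormedAddCommGroup F] [NormedSpace ℝ F] {f g : E → F} {O : Set E} (hO : IsOpen O)
    (hfg : ∀ y ∈ O, f y = g y) {x e : E} (hx : x ∈ O) {v : F} (h : HasLineDerivAt ℝ g v x e) :
    HasLineDerivAt ℝ f v x e := by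
  refine HasDerivAt.congr_of_eventuallyEq h ?_
  have hc : Tendsto (fun t : ℝ => x + t • e) (nhds 0) (nhds x) := by
    have : Continuous fun t : ℝ => x + t • e := by fun_prop
    simpa using this.tendsto 0
  filter_upwards [hc (hO.mem_nhds hx)] with t ht
  exact hfg _ ht

namespace Model

variable {m p q : ℕ} {Y : Model m p q}

/-- Real moments `∫ x_{j₁} ⋯ x_{jₗ} exp(s x)`. -/
def R (Y : Model m p q) (js : List (Fin m)) (z : Vec m × Param p q) : ℝ :=
  ∫ x, mono js x * Real.exp (inner ℝ z.1 x) ∂(Y.law z.2)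

theorem G_zero_eq_R (js : List (Fin m)) (s : Vec m) (θ : Param p q) :
    Y.G js s 0 θ = (Y.R js (s, θ) : ℂ) := by
  unfold G mom R
  rw [← integral_complex_ofReal]
  simp [momFun]

theorem R_nil (z : Vec m × Param p q) : Y.R [] z = Y.mgf z := by
  simp [R, mgf, mono]

theorem hasLineDerivAt_R (js : List (Fin m)) (j : Fin m) {z : Vec m × Param p q}
    (hz : z ∈ interior Y.convSet) : HasLineDerivAt ℝ (Y.R js) (Y.R (j :: js) z) z (dS j) := by
  have h := isRayFamily_G (Y := Y) js.length js le_rfl z.1 (EuclideanSpace.single j 1) 0 0 0 z.2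
    (by simpa using hz)
  have h1 : HasDerivAt (fun t : ℝ => (Y.R js (z + t • dS j) : ℂ)) (Y.R (j :: js) z : ℂ) 0 := by
    refine (h.congr_deriv ?_).congr_of_eventuallyEq (Eventually.of_forall fun t => ?_)
    · rw [Finset.sum_eq_single j]
      · simp [cdir, G_zero_eq_R]
      · intro i _ hi
        simp [cdir, hi]
      · simp
    · have : z + t • dS j = (z.1 + t • EuclideanSpace.single j (1 : ℝ), z.2) := by
        ext1 <;> simp [dS]
      simp only [smul_zero, add_zero, G_zero_eq_R, this]
  have h2 := Complex.reCLM.hasFDerivAt.comp_hasDerivAt 0 h1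
  have h3 : HasDerivAt (fun t : ℝ => Y.R js (z + t • dS j)) (Y.R (j :: js) z) 0 := by
    simpa [Function.comp_def] using h2
  exact h3

theorem hasLineDerivAt_cgf (j : Fin m) {z : Vec m × Param p q} (hz : z ∈ interior Y.convSet) :
    HasLineDerivAt ℝ Y.cgf (Y.R [j] z / Y.R [] z) z (dS j) := by
  have hpos : Y.R [] z ≠ 0 := by
    rw [R_nil]
    exact (mgf_pos_of_mem (interior_subset hz)).ne'
  have h1 := hasLineDerivAt_R [] j hz
  have h2 := HasDerivAt.log h1 (by simpa using hpos)
  simp only [zero_smul, add_zero, R_nil] at h2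
  rw [R_nil]
  exact h2

theorem hasLineDerivAt_cgf_two (k l : Fin m) {z : Vec m × Param p q}
    (hz : z ∈ interior Y.convSet) :
    HasLineDerivAt ℝ (iterDeriv Y.cgf [dS l])
      ((Y.R [k, l] z * Y.R [] z - Y.R [l] z * Y.R [k] z) / Y.R [] z ^ 2) z (dS k) := by
  have hpos : Y.R [] z ≠ 0 := by
    rw [R_nil]
    exact (mgf_pos_of_mem (interior_subset hz)).ne'
  refine HasLineDerivAt.congr_on isOpen_interior (g := fun z => Y.R [l] z / Y.R [] z)
    (fun y hy => (hasLineDerivAt_cgf l hy).lineDeriv) hz ?_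
  have h2 := HasDerivAt.fun_div (hasLineDerivAt_R [l] k hz) (hasLineDerivAt_R [] k hz) (by simpa using hpos)
  simp only [zero_smul, add_zero] at h2
  exact h2

variable (Y) in
/-- The parameters for which the moment generating function is finite near `0`. -/
def goodSet : Set (Param p q) := {θ | (0, θ) ∈ interior Y.convSet}

theorem isOpen_goodSet : IsOpen Y.goodSet :=
  isOpen_interior.preimage (by fun_prop : Continuous fun θ : Param p q => ((0 : Vec m), θ))

theorem mem_domain_of_goodSet {θ : Param p q} (hθ : θ ∈ Y.goodSet) : θ ∈ Y.domain :=
  (interior_subset hθ).1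

theorem R_nil_zero {θ : Param p q} (hθ : θ ∈ Y.goodSet) : Y.R [] (0, θ) = 1 := by
  rw [R_nil, mgf_zero (mem_domain_of_goodSet hθ)]

theorem K1_eq {θ : Param p q} (hθ : θ ∈ Y.goodSet) (j : Fin m) : Y.K1 θ j = Y.R [j] (0, θ) := by
  have := (hasLineDerivAt_cgf j hθ).lineDeriv
  rw [R_nil_zero hθ, div_one] at this
  exact this

theorem K2_eq {θ : Param p q} (hθ : θ ∈ Y.goodSet) (k l : Fin m) :
    Y.K2 θ k l = Y.R [k, l] (0, θ) - Y.K1 θ l * Y.K1 θ k := by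
  have := (hasLineDerivAt_cgf_two k l hθ).lineDeriv
  rw [R_nil_zero hθ, one_pow, div_one, mul_one] at this
  rw [K1_eq hθ, K1_eq hθ]
  exact this

theorem contDiffOn_G (hg : Y.GrowthBound) {js : List (Fin m)} (hjs : js.length ≤ 2) :
    ContDiffOn ℝ 2 (Y.G js 0 0) Y.goodSet := by
  rw [show (2 : WithTop ℕ∞) = 1 + 1 from rfl, contDiffOn_succ_iff_fderiv_of_isOpen isOpen_goodSet]
  refine ⟨fun θ hθ => (hasFDerivAt_G hg (by omega) hθ).differentiableAt.differentiableWithinAt,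
    by simp, ?_⟩
  have h1 : ContDiffOn ℝ 1 (Y.dG js 0 0) Y.goodSet := by
    rw [show (1 : WithTop ℕ∞) = 0 + 1 from rfl, contDiffOn_succ_iff_fderiv_of_isOpen isOpen_goodSet]
    refine ⟨fun θ hθ => (hasFDerivAt_dG hg (by omega) hθ).differentiableAt.differentiableWithinAt,
      by simp, ?_⟩
    rw [contDiffOn_zero]
    exact (continuousOn_ddG hg hjs).comp (f := fun θ : Param p q => ((0 : Vec m), ((0 : Vec m), θ)))
      (by fun_prop) fun θ hθ => hθ
  exact h1

theorem contDiffOn_R (hg : Y.GrowthBound) {js : List (Fin m)} (hjs : js.length ≤ 2) :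
    ContDiffOn ℝ 2 (fun θ => Y.R js (0, θ)) Y.goodSet := by
  refine (Complex.reCLM.contDiff.comp_contDiffOn (contDiffOn_G hg hjs)).congr fun θ _ => ?_
  simp [G_zero_eq_R]

theorem contDiffOn_K1 (hg : Y.GrowthBound) : ContDiffOn ℝ 2 Y.K1 Y.goodSet := by
  rw [contDiffOn_euclidean]
  exact fun j => (contDiffOn_R hg (js := [j]) (by simp)).congr fun θ hθ => K1_eq hθ j

theorem contDiffOn_K2_apply (hg : Y.GrowthBound) (k l : Fin m) :
    ContDiffOn ℝ 2 (fun θ => Y.K2 θ k l) Y.goodSet := by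
  have h1 := contDiffOn_euclidean.1 (contDiffOn_K1 hg)
  exact ((contDiffOn_R hg (js := [k, l]) (by simp)).sub ((h1 l).mul (h1 k))).congr
    fun θ hθ => K2_eq hθ k l

attribute [local instance] Matrix.linftyOpNormedAddCommGroup Matrix.linftyOpNormedSpace

theorem contDiffOn_K2 (hg : Y.GrowthBound) : ContDiffOn ℝ 2 Y.K2 Y.goodSet :=
  contDiffOn_matrix (contDiffOn_K2_apply hg)

theorem Bomega_apply (θ : Param p q) (k : Fin m) (j : Fin p) :
    Y.Bomega θ k j = lineDeriv ℝ (fun θ => Y.K1 θ k) θ (EuclideanSpace.single j 1, 0) := by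
  change lineDeriv ℝ (iterDeriv Y.cgf [dS k]) (0, θ) (dOmega j) = _
  unfold lineDeriv
  congr 1
  ext t
  have : ((0 : Vec m), θ) + t • dOmega j = (0, θ + t • (EuclideanSpace.single j (1 : ℝ), 0)) := by
    ext1 <;> simp [dOmega]
  rw [this]
  rfl

theorem dK2_apply (θ : Param p q) (j : Fin q) (k l : Fin m) :
    Y.dK2 j θ k l = lineDeriv ℝ (fun θ => Y.K2 θ k l) θ (0, EuclideanSpace.single j 1) := by
  change lineDeriv ℝ (iterDeriv Y.cgf [dS k, dS l]) (0, θ) (dNu j) = _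
  unfold lineDeriv
  congr 1
  ext t
  have : ((0 : Vec m), θ) + t • dNu j = (0, θ + t • (0, EuclideanSpace.single j (1 : ℝ))) := by
    ext1 <;> simp [dNu]
  rw [this]
  rfl

theorem ddK2_apply (θ : Param p q) (i j : Fin q) (k l : Fin m) :
    Y.ddK2 i j θ k l = lineDeriv ℝ (fun θ => Y.dK2 j θ k l) θ (0, EuclideanSpace.single i 1) := by
  change lineDeriv ℝ (iterDeriv Y.cgf [dNu j, dS k, dS l]) (0, θ) (dNu i) = _
  unfold lineDeriv
  congr 1
  ext t
  have : ((0 : Vec m), θ) + t • dNu i = (0, θ + t • (0, EuclideanSpace.single i (1 : ℝ))) := by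
    ext1 <;> simp [dNu]
  rw [this]
  rfl

theorem hasFDerivAt_K1 (hg : Y.GrowthBound) {θ : Param p q} (hθ : θ ∈ Y.goodSet) :
    HasFDerivAt Y.K1 (fderiv ℝ Y.K1 θ) θ :=
  (((contDiffOn_K1 hg).differentiableOn (by simp)).differentiableAt
    (isOpen_goodSet.mem_nhds hθ)).hasFDerivAt

theorem hasFDerivAt_K2 (hg : Y.GrowthBound) {θ : Param p q} (hθ : θ ∈ Y.goodSet) :
    HasFDerivAt Y.K2 (fderiv ℝ Y.K2 θ) θ :=
  (((contDiffOn_K2 hg).differentiableOn (by simp)).differentiableAt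
    (isOpen_goodSet.mem_nhds hθ)).hasFDerivAt

theorem hasFDerivAt_fderiv_K2 (hg : Y.GrowthBound) {θ : Param p q} (hθ : θ ∈ Y.goodSet) :
    HasFDerivAt (fderiv ℝ Y.K2) (fderiv ℝ (fderiv ℝ Y.K2) θ) θ :=
  ((((contDiffOn_K2 hg).fderiv_of_isOpen isOpen_goodSet (m := 1) (by norm_num)).differentiableOn
    (by simp)).differentiableAt (isOpen_goodSet.mem_nhds hθ)).hasFDerivAt

theorem fderiv_K1_apply (hg : Y.GrowthBound) {θ : Param p q} (hθ : θ ∈ Y.goodSet) (v : Vec p) :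
    (fderiv ℝ Y.K1 θ (v, 0)).ofLp = Y.Bomega θ *ᵥ v.ofLp := by
  have hv : ((v, 0) : Param p q) = ∑ j, v j • (EuclideanSpace.single j (1 : ℝ), 0) := by
    ext1
    · simpa [Prod.fst_sum] using (sum_single_eq v).symm
    · simp [Prod.snd_sum]
  ext k
  rw [hv, map_sum, Matrix.mulVec, dotProduct]
  simp only [map_smul]
  have h1 : ∀ j, (fderiv ℝ Y.K1 θ (EuclideanSpace.single j 1, 0)) k = Y.Bomega θ k j := by
    intro j
    rw [Bomega_apply]
    have h2 := ((EuclideanSpace.proj (𝕜 := ℝ) k : Vec m →L[ℝ] ℝ).hasFDerivAt.comp θ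
      (hasFDerivAt_K1 hg hθ)).hasLineDerivAt (EuclideanSpace.single j 1, 0)
    exact h2.lineDeriv.symm
  simp [h1, mul_comm]

theorem fderiv_K2_single (hg : Y.GrowthBound) {θ : Param p q} (hθ : θ ∈ Y.goodSet) (j : Fin q) :
    fderiv ℝ Y.K2 θ (0, EuclideanSpace.single j 1) = Y.dK2 j θ := by
  ext k l
  rw [dK2_apply]
  have h2 := ((entryCLM k l).hasFDerivAt.comp θ
    (hasFDerivAt_K2 hg hθ)).hasLineDerivAt (0, EuclideanSpace.single j 1)
  exact h2.lineDeriv.symm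

theorem fderiv_fderiv_K2_single (hg : Y.GrowthBound) {θ : Param p q} (hθ : θ ∈ Y.goodSet)
    (i j : Fin q) :
    fderiv ℝ (fderiv ℝ Y.K2) θ (0, EuclideanSpace.single i 1) (0, EuclideanSpace.single j 1) =
      Y.ddK2 i j θ := by
  ext k l
  rw [ddK2_apply]
  have h1 : HasLineDerivAt ℝ (fun θ => entryCLM k l (fderiv ℝ Y.K2 θ (0, EuclideanSpace.single j 1)))
      (entryCLM k l (fderiv ℝ (fderiv ℝ Y.K2) θ (0, EuclideanSpace.single i 1)
        (0, EuclideanSpace.single j 1))) θ (0, EuclideanSpace.single i 1) := by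
    exact (((entryCLM k l).comp (ContinuousLinearMap.apply ℝ (Matrix (Fin m) (Fin m) ℝ)
      ((0, EuclideanSpace.single j 1) : Param p q))).hasFDerivAt.comp θ
      (hasFDerivAt_fderiv_K2 hg hθ)).hasLineDerivAt (0, EuclideanSpace.single i 1)
  have h2 := HasLineDerivAt.congr_on (f := fun θ => Y.dK2 j θ k l) isOpen_goodSet (fun θ' hθ' => by
    rw [fderiv_K2_single hg hθ', entryCLM_apply]) hθ h1
  exact h2.lineDeriv.symm

theorem nu_eq_sum (η : Vec q) :
    ((0, η) : Param p q) = ∑ j, η j • (0, EuclideanSpace.single j (1 : ℝ)) := by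
  ext1
  · simp [Prod.fst_sum]
  · simpa [Prod.snd_sum] using (sum_single_eq η).symm

theorem fderiv_K2_nu (hg : Y.GrowthBound) {θ : Param p q} (hθ : θ ∈ Y.goodSet) (η : Vec q) :
    fderiv ℝ Y.K2 θ (0, η) = ∑ j, η j • Y.dK2 j θ := by
  rw [nu_eq_sum, map_sum]
  simp only [map_smul, fderiv_K2_single hg hθ]

theorem fderiv_fderiv_K2_nu (hg : Y.GrowthBound) {θ : Param p q} (hθ : θ ∈ Y.goodSet)
    (η : Vec q) :
    fderiv ℝ (fderiv ℝ Y.K2) θ (0, η) (0, η) = ∑ i, ∑ j, (η i * η j) • Y.ddK2 i j θ := by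
  rw [nu_eq_sum]
  simp only [map_sum, map_smul, sum_apply, smul_apply,
    fderiv_fderiv_K2_single hg hθ, Finset.smul_sum, smul_smul]
  exact Finset.sum_comm.trans (by simp [mul_comm])

end Model

theorem hasDerivAt_line {E F : Type*} [NormedAddCommGroup E] [NormedSpace ℝ E]
    [NormedAddCommGroup F] [NormedSpace ℝ F] {f : E → F} {f' : E →L[ℝ] F} {x e : E} {t : ℝ}
    (h : HasFDerivAt f f' (x + t • e)) : HasDerivAt (fun t : ℝ => f (x + t • e)) (f' e) t := by
  have h1 : HasDerivAt (fun t : ℝ => x + t • e) e t := by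
    simpa using ((hasDerivAt_id t).smul_const e).const_add x
  exact h.comp_hasDerivAt t h1

theorem fderiv_apply_eq_zero_of_line {E F : Type*} [NormedAddCommGroup E] [NormedSpace ℝ E]
    [NormedAddCommGroup F] [NormedSpace ℝ F] {f : E → F} {f' : E →L[ℝ] F} {x e : E}
    (h : HasFDerivAt f f' x) (hc : ∀ᶠ t : ℝ in nhds 0, f (x + t • e) = f x) : f' e = 0 := by
  have h1 : HasDerivAt (fun t : ℝ => f (x + t • e)) (f' e) 0 := hasDerivAt_line (by simpa using h)
  exact h1.unique ((hasDerivAt_const (0 : ℝ) (f x)).congr_of_eventuallyEq hc)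

namespace Model

variable {m p q : ℕ} {Y : Model m p q}

theorem eventually_line_mem {E : Type*} [NormedAddCommGroup E] [NormedSpace ℝ E] {O : Set E}
    (hO : IsOpen O) {x : E} (hx : x ∈ O) (e : E) : ∀ᶠ t : ℝ in nhds 0, x + t • e ∈ O := by
  have hc : Tendsto (fun t : ℝ => x + t • e) (nhds 0) (nhds x) := by
    have : Continuous fun t : ℝ => x + t • e := by fun_prop
    simpa using this.tendsto 0
  exact hc (hO.mem_nhds hx)

theorem G_nil_zero {θ : Param p q} (hθ : θ ∈ Y.goodSet) : Y.G [] 0 0 θ = 1 := by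
  rw [G_zero_eq_R, R_nil_zero hθ, Complex.ofReal_one]

theorem dG_nil_zero (hg : Y.GrowthBound) {θ : Param p q} (hθ : θ ∈ Y.goodSet) :
    Y.dG [] 0 0 θ = 0 := by
  refine ContinuousLinearMap.ext fun e => ?_
  refine fderiv_apply_eq_zero_of_line (hasFDerivAt_G hg (Nat.zero_le _) hθ) ?_
  filter_upwards [eventually_line_mem isOpen_goodSet hθ e] with t ht
  rw [G_nil_zero ht, G_nil_zero hθ]

theorem ddG_nil_zero (hg : Y.GrowthBound) {θ : Param p q} (hθ : θ ∈ Y.goodSet) :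
    Y.ddG [] 0 0 θ = 0 := by
  refine ContinuousLinearMap.ext fun e => ?_
  refine fderiv_apply_eq_zero_of_line (hasFDerivAt_dG hg (Nat.zero_le _) hθ) ?_
  filter_upwards [eventually_line_mem isOpen_goodSet hθ e] with t ht
  rw [dG_nil_zero hg ht, dG_nil_zero hg hθ]

variable (Y) in
/-- The mean depends on the first block of parameters only. -/
def MeanCond : Prop := ∀ (ω : Vec p) (ν ν' : Vec q),
  (0, (ω, ν)) ∈ interior Y.convSet → (0, (ω, ν')) ∈ interior Y.convSet →
    Y.K1 (ω, ν) = Y.K1 (ω, ν')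

theorem G_single_line (hmean : Y.MeanCond) (j : Fin m) {θ : Param p q} (hθ : θ ∈ Y.goodSet)
    (η : Vec q) (hη : θ + (0, η) ∈ Y.goodSet) : Y.G [j] 0 0 (θ + (0, η)) = Y.G [j] 0 0 θ := by
  rw [G_zero_eq_R, G_zero_eq_R, ← K1_eq hη, ← K1_eq hθ]
  have : θ + (0, η) = (θ.1, θ.2 + η) := by ext1 <;> simp
  rw [this] at hη ⊢
  rw [hmean θ.1 _ θ.2 hη hθ]

theorem dG_single_nu (hg : Y.GrowthBound) (hmean : Y.MeanCond) (j : Fin m) {θ : Param p q}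
    (hθ : θ ∈ Y.goodSet) (η : Vec q) : Y.dG [j] 0 0 θ (0, η) = 0 := by
  refine fderiv_apply_eq_zero_of_line (hasFDerivAt_G hg (by simp) hθ) ?_
  filter_upwards [eventually_line_mem isOpen_goodSet hθ (0, η)] with t ht
  have h1 : t • ((0, η) : Param p q) = (0, t • η) := by simp
  rw [h1] at ht ⊢
  exact G_single_line hmean j hθ _ ht

theorem param_split (e : Param p q) : e = (e.1, 0) + (0, e.2) := by simp

theorem dG_single (hg : Y.GrowthBound) (hmean : Y.MeanCond) (j : Fin m) {θ : Param p q}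
    (hθ : θ ∈ Y.goodSet) (e : Param p q) : Y.dG [j] 0 0 θ e = Y.dG [j] 0 0 θ (e.1, 0) := by
  conv_lhs => rw [param_split e]
  rw [map_add, dG_single_nu hg hmean j hθ, add_zero]

theorem ddG_single_nu (hg : Y.GrowthBound) (hmean : Y.MeanCond) (j : Fin m) {θ : Param p q}
    (hθ : θ ∈ Y.goodSet) (e : Param p q) (η : Vec q) : Y.ddG [j] 0 0 θ e (0, η) = 0 := by
  have h1 := (hasFDerivAt_dG hg (js := [j]) (s := 0) (φ := 0) (by simp) hθ).clm_apply
    (hasFDerivAt_const ((0, η) : Param p q) θ)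
  have h2 := fderiv_apply_eq_zero_of_line (e := e) h1 (by
    filter_upwards [eventually_line_mem isOpen_goodSet hθ e] with t ht
    rw [dG_single_nu hg hmean j ht, dG_single_nu hg hmean j hθ])
  simpa using h2

theorem ddG_symm (hg : Y.GrowthBound) {js : List (Fin m)} (hjs : js.length ≤ 2) {θ : Param p q}
    (hθ : θ ∈ Y.goodSet) (e e' : Param p q) : Y.ddG js 0 0 θ e e' = Y.ddG js 0 0 θ e' e :=
  second_derivative_symmetric_of_eventually (f := Y.G js 0 0) (f' := Y.dG js 0 0)
    (by filter_upwards [isOpen_goodSet.mem_nhds hθ] with y hy using hasFDerivAt_G hg (by omega) hy)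
    (hasFDerivAt_dG hg hjs hθ) e e'

theorem ddG_single (hg : Y.GrowthBound) (hmean : Y.MeanCond) (j : Fin m) {θ : Param p q}
    (hθ : θ ∈ Y.goodSet) (e : Param p q) :
    Y.ddG [j] 0 0 θ e e = Y.ddG [j] 0 0 θ (e.1, 0) (e.1, 0) := by
  conv_lhs => rw [param_split e]
  rw [map_add, ddG_single_nu hg hmean j hθ, add_zero, ddG_symm hg (by simp) hθ, map_add,
    ddG_single_nu hg hmean j hθ, add_zero]

end Model

section Jet

variable {P P1 P2 Q Q1 Q2 : ℂ} {B x f : ℝ}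

/-- The exponent of a Gaussian characteristic function with first and second moments `P`, `Q`. -/
def jexp (P Q : ℂ) : ℂ := Complex.I * P - (Q - P ^ 2) / 2

/-- The first derivative of `jexp`. -/
def jexp1 (P P1 Q1 : ℂ) : ℂ := Complex.I * P1 - (Q1 - 2 * P * P1) / 2

/-- The second derivative of `jexp`. -/
def jexp2 (P P1 P2 Q2 : ℂ) : ℂ := Complex.I * P2 - (Q2 - 2 * P * P2 - 2 * P1 ^ 2) / 2

theorem norm_exp_sub_le {z : ℂ} {b c : ℝ} (hz : ‖z‖ ≤ b) (hc : b ≤ c) (k : ℕ) :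
    ‖Complex.exp z - ∑ i ∈ Finset.range k, z ^ i / i.factorial‖ ≤ b ^ k * Real.exp c :=
  (Complex.norm_exp_sub_sum_le_norm_mul_exp z k).trans (by
    have := (norm_nonneg z).trans hz
    have := hz.trans hc
    gcongr)

theorem norm_half_le {a : ℂ} {b : ℝ} (h : ‖a‖ ≤ 2 * b) : ‖a / 2‖ ≤ b := by
  rw [norm_div, Complex.norm_ofNat]
  linarith

theorem norm_I_mul_le {a : ℂ} {b : ℝ} (h : ‖a‖ ≤ b) : ‖Complex.I * a‖ ≤ b := by
  rwa [norm_mul, Complex.norm_I, one_mul]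

theorem norm_pow_two_le {a : ℂ} {b : ℝ} (h : ‖a‖ ≤ b) : ‖a ^ 2‖ ≤ b ^ 2 := by
  rw [norm_pow]
  gcongr

theorem norm_two_mul_mul_le {a c : ℂ} {b d : ℝ} (h : ‖a‖ ≤ b) (h' : ‖c‖ ≤ d) :
    ‖2 * a * c‖ ≤ 2 * (b * d) := by
  have := norm_mul_le_of_le h h'
  rw [norm_mul] at this
  rw [norm_mul, norm_mul, Complex.norm_ofNat, mul_assoc]
  linarith

theorem norm_jexp_rem (hB : 1 ≤ B) (hP : ‖P‖ ≤ B * x) (hQ : ‖Q‖ ≤ B * x ^ 2) :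
    ‖(Q - P ^ 2) / 2‖ ≤ B ^ 2 * x ^ 2 := by
  refine norm_half_le (((norm_sub_le_of_le hQ (norm_pow_two_le hP))).trans ?_)
  have : B * x ^ 2 ≤ B ^ 2 * x ^ 2 := by
    gcongr
    nlinarith
  nlinarith

theorem norm_jexp1_rem (hB : 1 ≤ B) (hf : 0 ≤ f) (hP : ‖P‖ ≤ B * x)
    (hP1 : ‖P1‖ ≤ B * x * f) (hQ1 : ‖Q1‖ ≤ B * x ^ 2 * f) :
    ‖(Q1 - 2 * P * P1) / 2‖ ≤ 2 * B ^ 2 * x ^ 2 * f := by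
  refine norm_half_le (((norm_sub_le_of_le hQ1 (norm_two_mul_mul_le hP hP1))).trans ?_)
  have : B * x ^ 2 * f ≤ B ^ 2 * x ^ 2 * f := by
    gcongr
    nlinarith
  nlinarith [(by positivity : 0 ≤ B ^ 2 * x ^ 2 * f)]

theorem norm_jexp2_rem (hB : 1 ≤ B) (hP : ‖P‖ ≤ B * x)
    (hP1 : ‖P1‖ ≤ B * x * f) (hP2 : ‖P2‖ ≤ B * x * f ^ 2) (hQ2 : ‖Q2‖ ≤ B * x ^ 2 * f ^ 2) :
    ‖(Q2 - 2 * P * P2 - 2 * P1 ^ 2) / 2‖ ≤ 3 * B ^ 2 * x ^ 2 * f ^ 2 := by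
  have h3 := norm_two_mul_mul_le hP1 hP1
  rw [show 2 * P1 * P1 = 2 * P1 ^ 2 by ring] at h3
  refine norm_half_le ((norm_sub_le_of_le (norm_sub_le_of_le hQ2 (norm_two_mul_mul_le hP hP2)) h3).trans ?_)
  have : B * x ^ 2 * f ^ 2 ≤ B ^ 2 * x ^ 2 * f ^ 2 := by
    gcongr
    nlinarith
  nlinarith

theorem norm_jexp_le (hB : 1 ≤ B) (hx : 0 ≤ x) (hx1 : x ≤ 1) (hP : ‖P‖ ≤ B * x)
    (hQ : ‖Q‖ ≤ B * x ^ 2) : ‖jexp P Q‖ ≤ 2 * B ^ 2 * x := by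
  refine (norm_sub_le_of_le (norm_I_mul_le hP) (norm_jexp_rem hB hP hQ)).trans ?_
  have h1 : B * x ≤ B ^ 2 * x := by gcongr; nlinarith
  have h2 : B ^ 2 * x ^ 2 ≤ B ^ 2 * x := by gcongr; nlinarith
  linarith

theorem jet_pow_le (hB : 1 ≤ B) (hx : 0 ≤ x) (hx1 : x ≤ 1) :
    B ^ 3 * x ^ 3 ≤ B ^ 6 * Real.exp (2 * B ^ 2) * x ^ 3 ∧ B ^ 4 * x ^ 4 ≤ B ^ 6 * Real.exp (2 * B ^ 2) * x ^ 3 := by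
  have h : ∀ {i : ℕ}, i ≤ 6 → B ^ i ≤ B ^ 6 * Real.exp (2 * B ^ 2) := fun hi =>
    (pow_le_pow_right₀ hB hi).trans
      (le_mul_of_one_le_right (by positivity) (Real.one_le_exp (by positivity)))
  exact ⟨by gcongr; exact h (by norm_num), mul_le_mul (h (by norm_num))
    (pow_le_pow_of_le_one hx hx1 (by norm_num)) (by positivity) (by positivity)⟩

theorem exp_sub_jet (hB : 1 ≤ B) (hx : 0 ≤ x) (hx1 : x ≤ 1) (hP : ‖P‖ ≤ B * x)
    (hQ : ‖Q‖ ≤ B * x ^ 2) :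
    ‖Complex.exp (jexp P Q) - (1 + Complex.I * P - Q / 2)‖ ≤
      64 * (B ^ 6 * Real.exp (2 * B ^ 2)) * x ^ 3 := by
  have h1 := norm_jexp_rem hB hP hQ
  have h2 := norm_exp_sub_le (norm_jexp_le hB hx hx1 hP hQ)
    (mul_le_of_le_one_right (by positivity) hx1 : 2 * B ^ 2 * x ≤ 2 * B ^ 2) 3
  have h3 := norm_two_mul_mul_le (norm_I_mul_le hP) h1
  have h4 := norm_pow_two_le h1
  have h5 := norm_add_le_of_le h2 (norm_half_le (b := B ^ 3 * x ^ 3 + B ^ 4 * x ^ 4)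
    ((norm_sub_le_of_le h4 h3).trans (by nlinarith [(by positivity : 0 ≤ B ^ 4 * x ^ 4)])))
  have h6 : Complex.exp (jexp P Q) - (1 + Complex.I * P - Q / 2) =
      (Complex.exp (jexp P Q) - ∑ i ∈ Finset.range 3, jexp P Q ^ i / i.factorial) +
      (((Q - P ^ 2) / 2) ^ 2 - 2 * (Complex.I * P) * ((Q - P ^ 2) / 2)) / 2 := by
    simp only [Finset.sum_range_succ, Finset.sum_range_zero, Nat.factorial, jexp]
    push_cast
    linear_combination (P ^ 2 / 2 : ℂ) * Complex.I_sq
  rw [h6]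
  refine h5.trans ?_
  obtain ⟨h7, h8⟩ := jet_pow_le hB hx hx1
  nlinarith

theorem norm_jexp1_le (hB : 1 ≤ B) (hx : 0 ≤ x) (hx1 : x ≤ 1) (hf : 0 ≤ f) (hP : ‖P‖ ≤ B * x)
    (hP1 : ‖P1‖ ≤ B * x * f) (hQ1 : ‖Q1‖ ≤ B * x ^ 2 * f) :
    ‖jexp1 P P1 Q1‖ ≤ 3 * B ^ 2 * x * f := by
  refine (norm_sub_le_of_le (norm_I_mul_le hP1) (norm_jexp1_rem hB hf hP hP1 hQ1)).trans ?_
  have h1 : B * x * f ≤ B ^ 2 * x * f := by gcongr; nlinarith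
  have h2 : B ^ 2 * x ^ 2 * f ≤ B ^ 2 * x * f := by gcongr; nlinarith
  linarith

theorem exp_sub_jet1 (hB : 1 ≤ B) (hx : 0 ≤ x) (hx1 : x ≤ 1) (hf : 0 ≤ f) (hP : ‖P‖ ≤ B * x)
    (hQ : ‖Q‖ ≤ B * x ^ 2) (hP1 : ‖P1‖ ≤ B * x * f) (hQ1 : ‖Q1‖ ≤ B * x ^ 2 * f) :
    ‖jexp1 P P1 Q1 * Complex.exp (jexp P Q) - (Complex.I * P1 - Q1 / 2)‖ ≤
      64 * (B ^ 6 * Real.exp (2 * B ^ 2)) * x ^ 3 * f := by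
  have h1 := norm_jexp_rem hB hP hQ
  have h1' := norm_jexp1_rem hB hf hP hP1 hQ1
  have h2 := norm_exp_sub_le (norm_jexp_le hB hx hx1 hP hQ)
    (mul_le_of_le_one_right (by positivity) hx1 : 2 * B ^ 2 * x ≤ 2 * B ^ 2) 2
  have h3 := norm_mul_le_of_le (norm_I_mul_le hP1) h1
  have h4 := norm_mul_le_of_le (norm_I_mul_le hP) h1'
  have h5 := norm_mul_le_of_le h1 h1'
  have h7 := norm_mul_le_of_le (norm_jexp1_le hB hx hx1 hf hP hP1 hQ1) h2
  have h8 := norm_add_le_of_le (norm_sub_le_of_le (norm_sub_le_of_le h7 h3) h4) h5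
  have h6 : jexp1 P P1 Q1 * Complex.exp (jexp P Q) - (Complex.I * P1 - Q1 / 2) =
      jexp1 P P1 Q1 * (Complex.exp (jexp P Q) - ∑ i ∈ Finset.range 2, jexp P Q ^ i / i.factorial)
      - Complex.I * P1 * ((Q - P ^ 2) / 2) - Complex.I * P * ((Q1 - 2 * P * P1) / 2)
      + (Q - P ^ 2) / 2 * ((Q1 - 2 * P * P1) / 2) := by
    simp only [Finset.sum_range_succ, Finset.sum_range_zero, Nat.factorial, jexp, jexp1]
    push_cast
    linear_combination (P * P1 : ℂ) * Complex.I_sq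
  rw [h6]
  refine h8.trans ?_
  obtain ⟨h7, h8⟩ := jet_pow_le hB hx hx1
  have h7 := mul_le_mul_of_nonneg_right h7 hf
  have h8 := mul_le_mul_of_nonneg_right h8 hf
  have h9 : (0 : ℝ) ≤ B ^ 6 * Real.exp (2 * B ^ 2) * x ^ 3 * f := by positivity
  nlinarith

theorem norm_jexp2_le (hB : 1 ≤ B) (hx : 0 ≤ x) (hx1 : x ≤ 1) (hP : ‖P‖ ≤ B * x)
    (hP1 : ‖P1‖ ≤ B * x * f) (hP2 : ‖P2‖ ≤ B * x * f ^ 2) (hQ2 : ‖Q2‖ ≤ B * x ^ 2 * f ^ 2) :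
    ‖jexp2 P P1 P2 Q2‖ ≤ 4 * B ^ 2 * x * f ^ 2 := by
  refine (norm_sub_le_of_le (norm_I_mul_le hP2) (norm_jexp2_rem hB hP hP1 hP2 hQ2)).trans ?_
  have h1 : B * x * f ^ 2 ≤ B ^ 2 * x * f ^ 2 := by gcongr; nlinarith
  have h2 : B ^ 2 * x ^ 2 * f ^ 2 ≤ B ^ 2 * x * f ^ 2 := by gcongr; nlinarith
  linarith

theorem exp_sub_jet2 (hB : 1 ≤ B) (hx : 0 ≤ x) (hx1 : x ≤ 1) (hf : 0 ≤ f) (hP : ‖P‖ ≤ B * x)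
    (hQ : ‖Q‖ ≤ B * x ^ 2) (hP1 : ‖P1‖ ≤ B * x * f) (hQ1 : ‖Q1‖ ≤ B * x ^ 2 * f)
    (hP2 : ‖P2‖ ≤ B * x * f ^ 2) (hQ2 : ‖Q2‖ ≤ B * x ^ 2 * f ^ 2) :
    ‖(jexp2 P P1 P2 Q2 + jexp1 P P1 Q1 ^ 2) * Complex.exp (jexp P Q) -
        (Complex.I * P2 - Q2 / 2)‖ ≤
      64 * (B ^ 6 * Real.exp (2 * B ^ 2)) * x ^ 3 * f ^ 2 := by
  have h1 := norm_jexp_rem hB hP hQ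
  have h1' := norm_jexp1_rem hB hf hP hP1 hQ1
  have h1'' := norm_jexp2_rem hB hP hP1 hP2 hQ2
  have hc : 2 * B ^ 2 * x ≤ 2 * B ^ 2 := mul_le_of_le_one_right (by positivity) hx1
  have e1 := norm_exp_sub_le (norm_jexp_le hB hx hx1 hP hQ) hc 1
  have e2 := norm_exp_sub_le (norm_jexp_le hB hx hx1 hP hQ) hc 2
  have t1 := norm_mul_le_of_le (norm_jexp2_le hB hx hx1 hP hP1 hP2 hQ2) e2
  have t2 := norm_mul_le_of_le (norm_pow_two_le (norm_jexp1_le hB hx hx1 hf hP hP1 hQ1)) e1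
  have t3 := norm_mul_le_of_le (norm_I_mul_le hP2) h1
  have t4 := norm_mul_le_of_le (norm_I_mul_le hP) h1''
  have t5 := norm_mul_le_of_le h1 h1''
  have t6 := norm_two_mul_mul_le (norm_I_mul_le hP1) h1'
  have t7 := norm_pow_two_le h1'
  have h8 := norm_add_le_of_le (norm_sub_le_of_le (norm_add_le_of_le (norm_sub_le_of_le
    (norm_sub_le_of_le (norm_add_le_of_le t1 t2) t3) t4) t5) t6) t7
  have h6 : (jexp2 P P1 P2 Q2 + jexp1 P P1 Q1 ^ 2) * Complex.exp (jexp P Q) -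
        (Complex.I * P2 - Q2 / 2) =
      jexp2 P P1 P2 Q2 * (Complex.exp (jexp P Q) -
        ∑ i ∈ Finset.range 2, jexp P Q ^ i / i.factorial)
      + jexp1 P P1 Q1 ^ 2 * (Complex.exp (jexp P Q) -
        ∑ i ∈ Finset.range 1, jexp P Q ^ i / i.factorial)
      - Complex.I * P2 * ((Q - P ^ 2) / 2)
      - Complex.I * P * ((Q2 - 2 * P * P2 - 2 * P1 ^ 2) / 2)
      + (Q - P ^ 2) / 2 * ((Q2 - 2 * P * P2 - 2 * P1 ^ 2) / 2)
      - 2 * (Complex.I * P1) * ((Q1 - 2 * P * P1) / 2) + ((Q1 - 2 * P * P1) / 2) ^ 2 := by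
    simp only [Finset.sum_range_succ, Finset.sum_range_zero, Nat.factorial, jexp, jexp1, jexp2]
    push_cast
    linear_combination (P * P2 + P1 ^ 2 : ℂ) * Complex.I_sq
  rw [h6]
  refine h8.trans ?_
  obtain ⟨h7, h8⟩ := jet_pow_le hB hx hx1
  have h7 := mul_le_mul_of_nonneg_right h7 (sq_nonneg f)
  have h8 := mul_le_mul_of_nonneg_right h8 (sq_nonneg f)
  nlinarith

end Jet


theorem norm_lin_le {m : ℕ} (φ : Vec m) {a : Fin m → ℂ} {b : ℝ} (h : ∀ j, ‖a j‖ ≤ b) :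
    ‖∑ j, (φ j : ℂ) * a j‖ ≤ m * ‖φ‖ * b := by
  have h1 := norm_cdir_sum_le φ 0 h
  simpa [cdir] using h1

theorem sum_cdir_zero {m : ℕ} (φ : Vec m) (a : Fin m → ℂ) :
    ∑ j, cdir 0 φ j • a j = Complex.I * ∑ j, (φ j : ℂ) * a j := by
  rw [Finset.mul_sum]
  refine Finset.sum_congr rfl fun j _ => ?_
  simp [cdir]
  ring

theorem half_sum_cdir_zero {m : ℕ} (φ : Vec m) (a : Fin m → Fin m → ℂ) :
    (1 / 2 : ℝ) • ∑ j, cdir 0 φ j • ∑ k, cdir 0 φ k • a k j =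
      -(∑ j, (φ j : ℂ) * ∑ k, (φ k : ℂ) * a k j) / 2 := by
  simp_rw [sum_cdir_zero]
  rw [Complex.real_smul]
  simp_rw [← mul_assoc, mul_comm _ Complex.I, mul_assoc]
  rw [← Finset.mul_sum]
  push_cast
  linear_combination (1 / 2 * ∑ j, (φ j : ℂ) * ∑ k, (φ k : ℂ) * a k j) * Complex.I_sq

namespace Model

variable {m p q : ℕ} {Y : Model m p q}

variable (Y) in
/-- The first moment of `φ Y_θ`. -/
def mP (φ : Vec m) (θ : Param p q) : ℂ := ∑ j, (φ j : ℂ) * Y.G [j] 0 0 θ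

variable (Y) in
/-- The derivative of the first moment of `φ Y_θ` in the direction `e`. -/
def mP1 (φ : Vec m) (θ e : Param p q) : ℂ := ∑ j, (φ j : ℂ) * Y.dG [j] 0 0 θ e

variable (Y) in
/-- The second derivative of the first moment of `φ Y_θ` in the direction `e`. -/
def mP2 (φ : Vec m) (θ e : Param p q) : ℂ := ∑ j, (φ j : ℂ) * Y.ddG [j] 0 0 θ e e

variable (Y) in
/-- The second moment of `φ Y_θ`. -/
def mQ (φ : Vec m) (θ : Param p q) : ℂ := ∑ j, (φ j : ℂ) * ∑ k, (φ k : ℂ) * Y.G [k, j] 0 0 θ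

variable (Y) in
/-- The derivative of the second moment of `φ Y_θ` in the direction `e`. -/
def mQ1 (φ : Vec m) (θ e : Param p q) : ℂ :=
  ∑ j, (φ j : ℂ) * ∑ k, (φ k : ℂ) * Y.dG [k, j] 0 0 θ e

variable (Y) in
/-- The second derivative of the second moment of `φ Y_θ` in the direction `e`. -/
def mQ2 (φ : Vec m) (θ e : Param p q) : ℂ :=
  ∑ j, (φ j : ℂ) * ∑ k, (φ k : ℂ) * Y.ddG [k, j] 0 0 θ e e

variable (Y) in
/-- The Gaussian characteristic function with the same mean and covariance as `Y_θ`. -/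
def gN (φ : Vec m) (θ : Param p q) : ℂ := Complex.exp (jexp (Y.mP φ θ) (Y.mQ φ θ))

variable (Y) in
/-- The derivative of `gN` in the direction `e`. -/
def gN1 (φ : Vec m) (θ e : Param p q) : ℂ :=
  jexp1 (Y.mP φ θ) (Y.mP1 φ θ e) (Y.mQ1 φ θ e) * Y.gN φ θ

variable (Y) in
/-- The second derivative of `gN` in the direction `e`. -/
def gN2 (φ : Vec m) (θ e : Param p q) : ℂ :=
  (jexp2 (Y.mP φ θ) (Y.mP1 φ θ e) (Y.mP2 φ θ e) (Y.mQ2 φ θ e) +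
    jexp1 (Y.mP φ θ) (Y.mP1 φ θ e) (Y.mQ1 φ θ e) ^ 2) * Y.gN φ θ

section LineDerivatives

variable {φ : Vec m} {θ e : Param p q} {t : ℝ}

theorem hasDerivAt_G_line (hg : Y.GrowthBound) {js : List (Fin m)} (hjs : js.length ≤ 2)
    (φ : Vec m) (h : θ + t • e ∈ Y.goodSet) :
    HasDerivAt (fun t : ℝ => Y.G js 0 φ (θ + t • e)) (Y.dG js 0 φ (θ + t • e) e) t :=
  hasDerivAt_line (hasFDerivAt_G hg (by omega) h)

theorem hasDerivAt_dG_line (hg : Y.GrowthBound) {js : List (Fin m)} (hjs : js.length ≤ 2)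
    (φ : Vec m) (h : θ + t • e ∈ Y.goodSet) :
    HasDerivAt (fun t : ℝ => Y.dG js 0 φ (θ + t • e) e) (Y.ddG js 0 φ (θ + t • e) e e) t :=
  (ContinuousLinearMap.apply ℝ ℂ e).hasFDerivAt.comp_hasDerivAt t
    (hasDerivAt_line (hasFDerivAt_dG hg hjs h))

theorem hasDerivAt_mP (hg : Y.GrowthBound) (h : θ + t • e ∈ Y.goodSet) :
    HasDerivAt (fun t : ℝ => Y.mP φ (θ + t • e)) (Y.mP1 φ (θ + t • e) e) t :=
  HasDerivAt.fun_sum fun _ _ => (hasDerivAt_G_line hg (by simp) 0 h).const_mul _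

theorem hasDerivAt_mP1 (hg : Y.GrowthBound) (h : θ + t • e ∈ Y.goodSet) :
    HasDerivAt (fun t : ℝ => Y.mP1 φ (θ + t • e) e) (Y.mP2 φ (θ + t • e) e) t :=
  HasDerivAt.fun_sum fun _ _ => (hasDerivAt_dG_line hg (by simp) 0 h).const_mul _

theorem hasDerivAt_mQ (hg : Y.GrowthBound) (h : θ + t • e ∈ Y.goodSet) :
    HasDerivAt (fun t : ℝ => Y.mQ φ (θ + t • e)) (Y.mQ1 φ (θ + t • e) e) t :=
  HasDerivAt.fun_sum fun _ _ => HasDerivAt.const_mul _ <| HasDerivAt.fun_sum fun _ _ =>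
    (hasDerivAt_G_line hg (by simp) 0 h).const_mul _

theorem hasDerivAt_mQ1 (hg : Y.GrowthBound) (h : θ + t • e ∈ Y.goodSet) :
    HasDerivAt (fun t : ℝ => Y.mQ1 φ (θ + t • e) e) (Y.mQ2 φ (θ + t • e) e) t :=
  HasDerivAt.fun_sum fun _ _ => HasDerivAt.const_mul _ <| HasDerivAt.fun_sum fun _ _ =>
    (hasDerivAt_dG_line hg (by simp) 0 h).const_mul _

theorem hasDerivAt_gN (hg : Y.GrowthBound) (h : θ + t • e ∈ Y.goodSet) :
    HasDerivAt (fun t : ℝ => Y.gN φ (θ + t • e)) (Y.gN1 φ (θ + t • e) e) t := by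
  have h1 := hasDerivAt_mP (φ := φ) hg h
  have h2 := (((h1.const_mul Complex.I).sub
    (((hasDerivAt_mQ (φ := φ) hg h).sub (h1.fun_pow 2)).div_const 2)).cexp)
  refine h2.congr_deriv ?_
  simp only [gN1, gN, jexp1, jexp, Pi.sub_apply]
  push_cast
  ring

theorem hasDerivAt_gN1 (hg : Y.GrowthBound) (h : θ + t • e ∈ Y.goodSet) :
    HasDerivAt (fun t : ℝ => Y.gN1 φ (θ + t • e) e) (Y.gN2 φ (θ + t • e) e) t := by
  have h1 := hasDerivAt_mP (φ := φ) hg h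
  have h1' := hasDerivAt_mP1 (φ := φ) hg h
  have h2 := (((h1'.const_mul Complex.I).sub
    (((hasDerivAt_mQ1 (φ := φ) hg h).sub ((h1.const_mul 2).fun_mul h1')).div_const 2)).fun_mul
    (hasDerivAt_gN (φ := φ) hg h))
  refine h2.congr_deriv ?_
  simp only [gN2, gN1, jexp2, jexp1, Pi.sub_apply]
  ring

end LineDerivatives

section Real

theorem mP_eq (φ : Vec m) {θ : Param p q} (hθ : θ ∈ Y.goodSet) :
    Y.mP φ θ = (inner ℝ φ (Y.K1 θ) : ℝ) := by
  rw [inner_eq_dotProduct, dotProduct]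
  push_cast
  exact Finset.sum_congr rfl fun j _ => by rw [G_zero_eq_R, K1_eq hθ]

theorem mQ_sub_eq (φ : Vec m) {θ : Param p q} (hθ : θ ∈ Y.goodSet) :
    Y.mQ φ θ - Y.mP φ θ ^ 2 = (quad (Y.K2 θ) φ : ℝ) := by
  have h1 : Y.mP φ θ ^ 2 = ∑ j, (φ j : ℂ) * ∑ k, (φ k : ℂ) * (Y.K1 θ j * Y.K1 θ k : ℝ) := by
    rw [mP_eq φ hθ, inner_eq_dotProduct, dotProduct, sq]
    push_cast
    rw [Finset.sum_mul]
    refine Finset.sum_congr rfl fun j _ => ?_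
    rw [Finset.mul_sum, Finset.mul_sum]
    exact Finset.sum_congr rfl fun k _ => by ring
  rw [h1, mQ, ← Finset.sum_sub_distrib, quad, dotProduct]
  push_cast
  rw [show (∑ j, (φ j : ℂ) * ((Y.K2 θ *ᵥ φ.ofLp) j : ℝ)) =
    ∑ j, ∑ k, (φ j : ℂ) * ((Y.K2 θ j k : ℝ) * (φ k : ℂ)) by
      simp only [Matrix.mulVec, dotProduct]; push_cast; simp only [Finset.mul_sum]]
  simp only [Finset.mul_sum, ← Finset.sum_sub_distrib]
  refine (Finset.sum_congr rfl fun j _ => Finset.sum_congr rfl fun k _ => ?_).trans Finset.sum_comm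
  rw [K2_eq hθ, G_zero_eq_R]
  push_cast
  ring

theorem jexp_eq (φ : Vec m) {θ : Param p q} (hθ : θ ∈ Y.goodSet) :
    jexp (Y.mP φ θ) (Y.mQ φ θ) =
      (inner ℝ φ (Y.K1 θ) : ℝ) * Complex.I - (quad (Y.K2 θ) φ / 2 : ℝ) := by
  rw [jexp, mQ_sub_eq φ hθ, mP_eq φ hθ]
  push_cast
  ring

theorem norm_gN (φ : Vec m) {θ : Param p q} (hθ : θ ∈ Y.goodSet) :
    ‖Y.gN φ θ‖ = Real.exp (-(quad (Y.K2 θ) φ / 2)) := by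
  rw [gN, jexp_eq φ hθ, Complex.norm_exp]
  simp

theorem quad_smul (S : Matrix (Fin m) (Fin m) ℝ) (t : ℝ) (φ : Vec m) :
    quad S (t • φ) = t ^ 2 * quad S φ := by
  simp [quad, Matrix.mulVec_smul]
  ring

end Real

section Jets

variable {θ₀ : Param p q} {ρ C δ : ℝ} {Γ : ℕ}

theorem Reg.mem_goodSet (h : Y.Reg θ₀ ρ C δ Γ) {θ : Param p q} (hθ : ‖θ - θ₀‖ ≤ ρ) :
    θ ∈ Y.goodSet := h.mem 0 θ (by simpa using h.ρ_pos.le) hθ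

theorem Reg.ray_mem (h : Y.Reg θ₀ ρ C δ Γ) {θ : Param p q} (hθ : ‖θ - θ₀‖ ≤ ρ) :
    ∀ t ∈ Icc (0 : ℝ) 1, ((0 : Vec m) + t • (0 : Vec m), θ) ∈ interior Y.convSet := fun t _ => by
  rw [smul_zero, add_zero]
  exact h.mem_goodSet hθ

/-- The constant in bounds for first and second moments. -/
def momConst (m : ℕ) (C : ℝ) : ℝ := (m + 1) ^ 2 * C

theorem one_le_momConst (m : ℕ) {C : ℝ} (hC : 1 ≤ C) : 1 ≤ momConst m C := by
  unfold momConst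
  have : (1 : ℝ) ≤ (m + 1) ^ 2 := one_le_pow₀ (by linarith [(Nat.cast_nonneg m : (0 : ℝ) ≤ m)])
  nlinarith

theorem norm_lin_le_momConst (φ : Vec m) {a : Fin m → ℂ} {b f : ℝ} (hb : 0 ≤ b) (hf : 0 ≤ f)
    (h : ∀ j, ‖a j‖ ≤ b * f) : ‖∑ j, (φ j : ℂ) * a j‖ ≤ momConst m b * ‖φ‖ * f := by
  refine (norm_lin_le φ h).trans ?_
  have h1 : (m : ℝ) ≤ (m + 1) ^ 2 := by nlinarith [(Nat.cast_nonneg m : (0 : ℝ) ≤ m)]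
  have h2 : (0 : ℝ) ≤ ‖φ‖ * (b * f) := by positivity
  unfold momConst
  nlinarith

theorem norm_bil_le_momConst (φ : Vec m) {a : Fin m → Fin m → ℂ} {b f : ℝ} (hb : 0 ≤ b)
    (hf : 0 ≤ f) (h : ∀ j k, ‖a j k‖ ≤ b * f) :
    ‖∑ j, (φ j : ℂ) * ∑ k, (φ k : ℂ) * a j k‖ ≤ momConst m b * ‖φ‖ ^ 2 * f := by
  refine (norm_lin_le φ fun j => norm_lin_le φ (h j)).trans ?_
  have h2 : (0 : ℝ) ≤ ‖φ‖ ^ 2 * (b * f) := by positivity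
  unfold momConst
  nlinarith

theorem Reg.C_nonneg (h : Y.Reg θ₀ ρ C δ Γ) : 0 ≤ C := zero_le_one.trans h.one_le_C

theorem norm_fst_zero_le (e : Param p q) : ‖((e.1, 0) : Param p q)‖ = ‖e.1‖ := by
  simp [Prod.norm_def]

section Bounds

variable {φ : Vec m} {θ e : Param p q}

theorem Reg.norm_mP_le (h : Y.Reg θ₀ ρ C δ Γ) (hθ : ‖θ - θ₀‖ ≤ ρ) :
    ‖Y.mP φ θ‖ ≤ momConst m C * ‖φ‖ := by
  have := norm_lin_le_momConst φ h.C_nonneg zero_le_one (a := fun j => Y.G [j] 0 0 θ) fun j => by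
    simpa using h.G_bound [j] (by simp) 0 θ 0 (by simpa using h.ρ_pos.le) hθ
  simpa [mP] using this

theorem Reg.norm_mQ_le (h : Y.Reg θ₀ ρ C δ Γ) (hθ : ‖θ - θ₀‖ ≤ ρ) :
    ‖Y.mQ φ θ‖ ≤ momConst m C * ‖φ‖ ^ 2 := by
  have := norm_bil_le_momConst φ h.C_nonneg zero_le_one (a := fun j k => Y.G [k, j] 0 0 θ)
    fun j k => by simpa using h.G_bound [k, j] (by simp) 0 θ 0 (by simpa using h.ρ_pos.le) hθ
  simpa [mQ] using this

theorem Reg.norm_dG_zero_le (h : Y.Reg θ₀ ρ C δ Γ) (hθ : ‖θ - θ₀‖ ≤ ρ) {js : List (Fin m)}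
    (hjs : js.length ≤ 2) (e : Param p q) : ‖Y.dG js 0 0 θ e‖ ≤ C * ‖e‖ := by
  have := h.dG_bound js (by omega) 0 θ 0 (by simpa using h.ρ_pos.le) hθ
  exact (Y.dG js 0 0 θ).le_of_opNorm_le (by simpa using this) e

theorem norm_apply_two_le {E F : Type*} [NormedAddCommGroup E] [NormedSpace ℝ E]
    [NormedAddCommGroup F] [NormedSpace ℝ F] {L : E →L[ℝ] E →L[ℝ] F} {b : ℝ} (hL : ‖L‖ ≤ b) (e : E) :
    ‖L e e‖ ≤ b * ‖e‖ ^ 2 := by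
  refine (L.le_opNorm₂ e e).trans ?_
  rw [mul_assoc, ← sq]
  gcongr

theorem Reg.norm_ddG_zero_le (h : Y.Reg θ₀ ρ C δ Γ) (hθ : ‖θ - θ₀‖ ≤ ρ) {js : List (Fin m)}
    (hjs : js.length ≤ 2) (e : Param p q) : ‖Y.ddG js 0 0 θ e e‖ ≤ C * ‖e‖ ^ 2 := by
  have := h.ddG_bound js (by omega) 0 θ 0 (by simpa using h.ρ_pos.le) hθ
  exact norm_apply_two_le (by simpa using this) e

theorem Reg.norm_mP1_le (h : Y.Reg θ₀ ρ C δ Γ) (hg : Y.GrowthBound) (hmean : Y.MeanCond)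
    (hθ : ‖θ - θ₀‖ ≤ ρ) : ‖Y.mP1 φ θ e‖ ≤ momConst m C * ‖φ‖ * ‖e.1‖ :=
  norm_lin_le_momConst φ h.C_nonneg (norm_nonneg _) fun j => by
    rw [dG_single hg hmean j (h.mem_goodSet hθ), ← norm_fst_zero_le]
    exact h.norm_dG_zero_le hθ (by simp) _

theorem Reg.norm_mP2_le (h : Y.Reg θ₀ ρ C δ Γ) (hg : Y.GrowthBound) (hmean : Y.MeanCond)
    (hθ : ‖θ - θ₀‖ ≤ ρ) : ‖Y.mP2 φ θ e‖ ≤ momConst m C * ‖φ‖ * ‖e.1‖ ^ 2 :=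
  norm_lin_le_momConst φ h.C_nonneg (by positivity) fun j => by
    rw [ddG_single hg hmean j (h.mem_goodSet hθ), ← norm_fst_zero_le]
    exact h.norm_ddG_zero_le hθ (by simp) _

theorem Reg.norm_mQ1_le (h : Y.Reg θ₀ ρ C δ Γ) (hθ : ‖θ - θ₀‖ ≤ ρ) :
    ‖Y.mQ1 φ θ e‖ ≤ momConst m C * ‖φ‖ ^ 2 * ‖e‖ :=
  norm_bil_le_momConst φ h.C_nonneg (norm_nonneg _) fun _ _ => h.norm_dG_zero_le hθ (by simp) _

theorem Reg.norm_mQ2_le (h : Y.Reg θ₀ ρ C δ Γ) (hθ : ‖θ - θ₀‖ ≤ ρ) :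
    ‖Y.mQ2 φ θ e‖ ≤ momConst m C * ‖φ‖ ^ 2 * ‖e‖ ^ 2 :=
  norm_bil_le_momConst φ h.C_nonneg (by positivity) fun _ _ => h.norm_ddG_zero_le hθ (by simp) _

theorem Reg.G_sub_jet (h : Y.Reg θ₀ ρ C δ Γ) (hθ : ‖θ - θ₀‖ ≤ ρ) (hφ : ‖φ‖ ≤ 1) :
    ‖Y.G [] 0 φ θ - (1 + Complex.I * Y.mP φ θ - Y.mQ φ θ / 2)‖ ≤
      m ^ 3 * (C * 2 ^ Γ) * ‖φ‖ ^ 3 := by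
  have h1 := (isRayFamily_G (Y := Y) 2).expand_three (φ' := φ) (b := C * 2 ^ Γ) (h.ray_mem hθ)
    (js := []) (by simp) (fun j k l t ht => by
      refine (h.G_bound _ (by simp) _ θ _ (by simpa using h.ρ_pos.le) hθ).trans ?_
      have := h.C_nonneg
      have h2 : ‖t • φ‖ ≤ 1 := by
        rw [norm_smul, Real.norm_of_nonneg ht.1]
        exact mul_le_one₀ ht.2 (norm_nonneg _) hφ
      gcongr
      linarith)
  rw [sum_cdir_zero, half_sum_cdir_zero φ (fun k j => Y.G [k, j] 0 0 θ), add_zero,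
    G_nil_zero (h.mem_goodSet hθ), norm_zero, zero_add] at h1
  refine (le_of_eq ?_).trans (h1.trans_eq (by ring))
  congr 1
  unfold mP mQ
  ring

theorem norm_smul_le_one {φ : Vec m} {t : ℝ} (ht : t ∈ Icc (0 : ℝ) 1) : ‖t • φ‖ ≤ ‖φ‖ := by
  rw [norm_smul, Real.norm_of_nonneg ht.1]
  exact mul_le_of_le_one_left (norm_nonneg _) ht.2

theorem Reg.dG_sub_jet (h : Y.Reg θ₀ ρ C δ Γ) (hg : Y.GrowthBound) (hθ : ‖θ - θ₀‖ ≤ ρ)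
    (hφ : ‖φ‖ ≤ 1) :
    ‖Y.dG [] 0 φ θ e - (Complex.I * Y.mP1 φ θ e - Y.mQ1 φ θ e / 2)‖ ≤
      m ^ 3 * (C * 2 ^ Γ) * ‖φ‖ ^ 3 * ‖e‖ := by
  have h1 := (isRayFamily_dG hg).expand_three (φ' := φ) (b := C * 2 ^ Γ) (h.ray_mem hθ)
    (js := []) (by simp) (fun j k l t ht => by
      refine (h.dG_bound _ (by simp) _ θ _ (by simpa using h.ρ_pos.le) hθ).trans ?_
      have := h.C_nonneg
      have h2 := (norm_smul_le_one (φ := φ) ht).trans hφ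
      gcongr
      linarith)
  have h2 := (ContinuousLinearMap.le_of_opNorm_le _ h1 e)
  simp only [sub_apply, sum_apply, smul_apply, add_zero,
    dG_nil_zero hg (h.mem_goodSet hθ), zero_apply, norm_zero, zero_add] at h2
  rw [sum_cdir_zero, half_sum_cdir_zero φ (fun k j => Y.dG [k, j] 0 0 θ e)] at h2
  refine (le_of_eq ?_).trans (h2.trans_eq (by ring))
  congr 1
  unfold mP1 mQ1
  ring

theorem Reg.ddG_sub_jet (h : Y.Reg θ₀ ρ C δ Γ) (hg : Y.GrowthBound) (hθ : ‖θ - θ₀‖ ≤ ρ)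
    {κ : ℝ} (hκ : ∀ js : List (Fin m), js.length = 2 → ∀ φ' : Vec m, ‖φ'‖ ≤ ‖φ‖ →
      ‖Y.ddG js 0 φ' θ - Y.ddG js 0 0 θ‖ ≤ κ) :
    ‖Y.ddG [] 0 φ θ e e - (Complex.I * Y.mP2 φ θ e - Y.mQ2 φ θ e / 2)‖ ≤
      m ^ 2 * κ * ‖φ‖ ^ 2 * ‖e‖ ^ 2 := by
  have h1 := (isRayFamily_ddG hg).expand_two' (φ' := φ) (b := κ) (h.ray_mem hθ)
    (js := []) (by simp) (fun j k t ht => by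
      simpa using hκ [k, j] rfl (t • φ) (norm_smul_le_one ht))
  have h2 := norm_apply_two_le h1 e
  simp only [sub_apply, sum_apply, smul_apply, add_zero,
    ddG_nil_zero hg (h.mem_goodSet hθ), zero_apply, norm_zero, zero_add] at h2
  rw [sum_cdir_zero, half_sum_cdir_zero φ (fun k j => Y.ddG [k, j] 0 0 θ e e)] at h2
  refine (le_of_eq ?_).trans (h2.trans_eq (by ring))
  congr 1
  unfold mP2 mQ2
  ring

end Bounds

end Jets

end Model

theorem nonneg_of_hasDerivAt_of_nonneg {F : ℝ → ℝ} {F' r : ℝ} (h : HasDerivAt F F' 0) (h0 : F 0 = 0)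
    (hr : 0 < r) (hF : ∀ u, 0 < u → u < r → 0 ≤ F u) : 0 ≤ F' := by
  have h1 := (hasDerivWithinAt_iff_tendsto_slope' (s := Ioi (0 : ℝ)) (by simp)).1
    h.hasDerivWithinAt
  refine ge_of_tendsto h1 ?_
  filter_upwards [Ioo_mem_nhdsGT hr] with u hu
  rw [slope_def_field, h0, sub_zero, sub_zero]
  exact div_nonneg (hF u hu.1 hu.2) hu.1.le

theorem exp_neg_le_rpow {δ y : ℝ} (hδ : 0 ≤ δ) (hy : 0 ≤ y) :
    Real.exp (-(δ * y)) ≤ (1 + y) ^ (-δ) := by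
  rw [Real.rpow_def_of_pos (by positivity)]
  refine Real.exp_le_exp.2 ?_
  have := Real.log_le_sub_one_of_pos (by positivity : 0 < 1 + y)
  nlinarith

theorem rpow_le_one_of_decay {δ y : ℝ} (hδ : 0 ≤ δ) (hy : 0 ≤ y) : (1 + y) ^ (-δ) ≤ 1 :=
  Real.rpow_le_one_of_one_le_of_nonpos (by linarith) (by linarith)

namespace Model

variable {m p q : ℕ} {Y : Model m p q} {θ₀ : Param p q} {ρ C δ : ℝ} {Γ : ℕ}

/-- The constant in the jet comparison bounds. -/
def jetConst (m : ℕ) (C : ℝ) (Γ : ℕ) : ℝ :=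
  m ^ 3 * (C * 2 ^ Γ) + 64 * (momConst m C ^ 6 * Real.exp (2 * momConst m C ^ 2))

section

variable {φ : Vec m} {θ e : Param p q}

theorem Reg.decay_zero (h : Y.Reg θ₀ ρ C δ Γ) (hθ : ‖θ - θ₀‖ ≤ ρ) :
    ‖Y.G [] 0 φ θ‖ ≤ (1 + δ * ‖φ‖ ^ 2) ^ (-δ) := by
  have h1 := h.decay 0 θ φ (by simpa using h.ρ_pos.le) hθ
  rwa [mgf_zero (mem_domain_of_goodSet (h.mem_goodSet hθ)), one_mul] at h1

theorem Reg.G_sub_gN (h : Y.Reg θ₀ ρ C δ Γ) (hθ : ‖θ - θ₀‖ ≤ ρ) (hφ : ‖φ‖ ≤ 1) :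
    ‖Y.G [] 0 φ θ - Y.gN φ θ‖ ≤ jetConst m C Γ * ‖φ‖ ^ 3 := by
  have h1 := h.G_sub_jet hθ hφ
  have h2 := exp_sub_jet (one_le_momConst m h.one_le_C) (norm_nonneg φ) hφ (h.norm_mP_le hθ)
    (h.norm_mQ_le hθ)
  have h3 := norm_sub_le_of_le h1 h2
  rw [sub_sub_sub_cancel_right] at h3
  exact h3.trans_eq (by unfold jetConst; ring)

theorem Reg.quad_lower (h : Y.Reg θ₀ ρ C δ Γ) (hθ : ‖θ - θ₀‖ ≤ ρ) (φ : Vec m) :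
    δ ^ 2 * ‖φ‖ ^ 2 ≤ quad (Y.K2 θ) φ / 2 := by
  set a := quad (Y.K2 θ) φ / 2 with ha
  have h1 : HasDerivAt (fun u : ℝ => (1 + δ * ‖φ‖ ^ 2 * u) ^ (-δ) - Real.exp (-(a * u)) +
      jetConst m C Γ * ‖φ‖ ^ 3 * u ^ (3 / 2 : ℝ)) (a - δ ^ 2 * ‖φ‖ ^ 2) 0 := by
    have d1 : HasDerivAt (fun u : ℝ => (1 + δ * ‖φ‖ ^ 2 * u) ^ (-δ))
        (δ * ‖φ‖ ^ 2 * -δ * (1 + δ * ‖φ‖ ^ 2 * 0) ^ (-δ - 1)) 0 := by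
      have := ((hasDerivAt_id (0 : ℝ)).const_mul (δ * ‖φ‖ ^ 2)).const_add 1
      simp only [mul_one] at this
      exact this.rpow_const (p := -δ) (Or.inl (by simp))
    have d2 : HasDerivAt (fun u : ℝ => Real.exp (-(a * u))) (Real.exp (-(a * 0)) * -a) 0 := by
      have := ((hasDerivAt_id (0 : ℝ)).const_mul a).neg
      simp only [mul_one] at this
      exact this.exp
    have d3 := (Real.hasDerivAt_rpow_const (x := 0) (p := (3 / 2 : ℝ)) (Or.inr (by norm_num))).const_mul
      (jetConst m C Γ * ‖φ‖ ^ 3)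
    refine ((d1.sub d2).add d3).congr_deriv ?_
    rw [Real.zero_rpow (by norm_num)]
    simp
    ring
  have hr : 0 < (1 / (1 + ‖φ‖)) ^ 2 := by positivity
  have h2 := nonneg_of_hasDerivAt_of_nonneg h1 (by simp [Real.zero_rpow (by norm_num : (3 / 2 : ℝ) ≠ 0)])
    hr (fun u hu hur => by
      have hsq : Real.sqrt u ^ 2 = u := Real.sq_sqrt hu.le
      have hu1 : Real.sqrt u ≤ 1 / (1 + ‖φ‖) := (Real.sqrt_le_left (by positivity)).2 hur.le
      have hφ : ‖Real.sqrt u • φ‖ = Real.sqrt u * ‖φ‖ := by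
        rw [norm_smul, Real.norm_of_nonneg (Real.sqrt_nonneg u)]
      have hφ1 : ‖Real.sqrt u • φ‖ ≤ 1 := by
        rw [hφ]
        calc Real.sqrt u * ‖φ‖ ≤ 1 / (1 + ‖φ‖) * ‖φ‖ := by gcongr
          _ ≤ 1 := by
            rw [one_div_mul_eq_div, div_le_one (by positivity)]
            linarith
      have h3 := h.G_sub_gN hθ hφ1
      have h4 := h.decay_zero (φ := Real.sqrt u • φ) hθ
      have h5 := norm_gN (Real.sqrt u • φ) (h.mem_goodSet hθ)
      rw [hφ] at h3 h4
      rw [mul_pow, hsq] at h4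
      rw [quad_smul, hsq] at h5
      have h6 := norm_sub_norm_le (Y.gN (Real.sqrt u • φ) θ) (Y.G [] 0 (Real.sqrt u • φ) θ)
      rw [norm_sub_rev] at h6
      have h7 : u ^ (3 / 2 : ℝ) = Real.sqrt u ^ 3 := by
        rw [Real.sqrt_eq_rpow, ← Real.rpow_natCast, ← Real.rpow_mul hu.le]
        norm_num
      rw [h7, show a * u = u * quad (Y.K2 θ) φ / 2 by rw [ha]; ring, ← h5]
      rw [show δ * (u * ‖φ‖ ^ 2) = δ * ‖φ‖ ^ 2 * u by ring] at h4
      nlinarith)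
  linarith

theorem Reg.norm_gN_le (h : Y.Reg θ₀ ρ C δ Γ) (hθ : ‖θ - θ₀‖ ≤ ρ) :
    ‖Y.gN φ θ‖ ≤ (1 + δ * ‖φ‖ ^ 2) ^ (-δ) := by
  rw [norm_gN φ (h.mem_goodSet hθ)]
  refine (Real.exp_le_exp.2 (neg_le_neg (h.quad_lower hθ φ))).trans ?_
  rw [sq δ, mul_assoc]
  exact exp_neg_le_rpow h.δ_pos.le (mul_nonneg h.δ_pos.le (sq_nonneg _))

theorem Reg.norm_gN_le_one (h : Y.Reg θ₀ ρ C δ Γ) (hθ : ‖θ - θ₀‖ ≤ ρ) : ‖Y.gN φ θ‖ ≤ 1 :=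
  (h.norm_gN_le hθ).trans (rpow_le_one_of_decay h.δ_pos.le (mul_nonneg h.δ_pos.le (sq_nonneg _)))

theorem Reg.norm_G_le_one (h : Y.Reg θ₀ ρ C δ Γ) (hθ : ‖θ - θ₀‖ ≤ ρ) : ‖Y.G [] 0 φ θ‖ ≤ 1 :=
  (h.decay_zero hθ).trans (rpow_le_one_of_decay h.δ_pos.le (mul_nonneg h.δ_pos.le (sq_nonneg _)))

theorem Reg.jexp1_le (h : Y.Reg θ₀ ρ C δ Γ) (hg : Y.GrowthBound) (hmean : Y.MeanCond)
    (hθ : ‖θ - θ₀‖ ≤ ρ) : ‖jexp1 (Y.mP φ θ) (Y.mP1 φ θ e) (Y.mQ1 φ θ e)‖ ≤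
      momConst m C * ‖φ‖ * ‖e.1‖ + 2 * momConst m C ^ 2 * ‖φ‖ ^ 2 * ‖e‖ := by
  have hB := one_le_momConst m h.one_le_C
  have h1 := h.norm_mP1_le (φ := φ) (e := e) hg hmean hθ
  refine norm_sub_le_of_le (norm_I_mul_le h1) (norm_jexp1_rem hB (norm_nonneg e)
    (h.norm_mP_le hθ) (h1.trans ?_) (h.norm_mQ1_le hθ))
  gcongr
  exact norm_fst_le e

theorem Reg.jexp2_le (h : Y.Reg θ₀ ρ C δ Γ) (hg : Y.GrowthBound) (hmean : Y.MeanCond)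
    (hθ : ‖θ - θ₀‖ ≤ ρ) :
    ‖jexp2 (Y.mP φ θ) (Y.mP1 φ θ e) (Y.mP2 φ θ e) (Y.mQ2 φ θ e)‖ ≤
      momConst m C * ‖φ‖ * ‖e.1‖ ^ 2 + 3 * momConst m C ^ 2 * ‖φ‖ ^ 2 * ‖e‖ ^ 2 := by
  have hB := one_le_momConst m h.one_le_C
  have hf := norm_fst_le e
  have h1 := h.norm_mP1_le (φ := φ) (e := e) hg hmean hθ
  have h2 := h.norm_mP2_le (φ := φ) (e := e) hg hmean hθ
  refine norm_sub_le_of_le (norm_I_mul_le h2) (norm_jexp2_rem hB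
    (h.norm_mP_le hθ) (h1.trans ?_) (h2.trans ?_) (h.norm_mQ2_le hθ))
  all_goals gcongr

end

end Model

/-- The scaling `(v, η) ↦ (ε v, η)` of parameter increments. -/
def scl {p q : ℕ} (ε : ℝ) (e : Param p q) : Param p q := (ε • e.1, e.2)

section Scale

variable {p q : ℕ} {ε : ℝ}

theorem norm_scl_le (h0 : 0 ≤ ε) (h1 : ε ≤ 1) (e : Param p q) : ‖scl ε e‖ ≤ ‖e‖ := by
  refine (max_le_max ?_ le_rfl : _ ≤ max ‖e.1‖ ‖e.2‖)
  change ‖ε • e.1‖ ≤ ‖e.1‖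
  rw [norm_smul, Real.norm_of_nonneg h0]
  exact mul_le_of_le_one_left (norm_nonneg _) h1

theorem norm_scl_fst_le (h0 : 0 ≤ ε) (e : Param p q) : ‖(scl ε e).1‖ ≤ ε * ‖e‖ := by
  change ‖ε • e.1‖ ≤ _
  rw [norm_smul, Real.norm_of_nonneg h0]
  gcongr
  exact norm_fst_le e

theorem norm_scl_phi {m : ℕ} (h0 : 0 ≤ ε) (φ : Vec m) : ‖ε • φ‖ = ε * ‖φ‖ := by
  rw [norm_smul, Real.norm_of_nonneg h0]

end Scale

namespace Model

variable {m p q : ℕ} {Y : Model m p q} {θ₀ : Param p q} {ρ C δ : ℝ} {Γ : ℕ}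

section Crude

variable {φ : Vec m} {θ e : Param p q}

theorem Reg.norm_gN1_le (h : Y.Reg θ₀ ρ C δ Γ) (hg : Y.GrowthBound) (hmean : Y.MeanCond)
    (hθ : ‖θ - θ₀‖ ≤ ρ) : ‖Y.gN1 φ θ e‖ ≤
      momConst m C * ‖φ‖ * ‖e.1‖ + 2 * momConst m C ^ 2 * ‖φ‖ ^ 2 * ‖e‖ := by
  rw [gN1, norm_mul]
  exact (mul_le_of_le_one_right (norm_nonneg _) (h.norm_gN_le_one hθ)).trans
    (h.jexp1_le hg hmean hθ)

theorem Reg.norm_gN2_le (h : Y.Reg θ₀ ρ C δ Γ) (hg : Y.GrowthBound) (hmean : Y.MeanCond)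
    (hθ : ‖θ - θ₀‖ ≤ ρ) : ‖Y.gN2 φ θ e‖ ≤
      momConst m C * ‖φ‖ * ‖e.1‖ ^ 2 + 3 * momConst m C ^ 2 * ‖φ‖ ^ 2 * ‖e‖ ^ 2 +
      (momConst m C * ‖φ‖ * ‖e.1‖ + 2 * momConst m C ^ 2 * ‖φ‖ ^ 2 * ‖e‖) ^ 2 := by
  rw [gN2, norm_mul]
  exact (mul_le_of_le_one_right (norm_nonneg _) (h.norm_gN_le_one hθ)).trans
    (norm_add_le_of_le (h.jexp2_le hg hmean hθ) (norm_pow_two_le (h.jexp1_le hg hmean hθ)))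

theorem Reg.norm_dG_le (h : Y.Reg θ₀ ρ C δ Γ) (hθ : ‖θ - θ₀‖ ≤ ρ) :
    ‖Y.dG [] 0 φ θ e‖ ≤ C * (1 + ‖φ‖) ^ Γ * ‖e‖ :=
  ContinuousLinearMap.le_of_opNorm_le _
    (h.dG_bound [] (by simp) 0 θ φ (by simpa using h.ρ_pos.le) hθ) e

theorem Reg.norm_ddG_le (h : Y.Reg θ₀ ρ C δ Γ) (hθ : ‖θ - θ₀‖ ≤ ρ) :
    ‖Y.ddG [] 0 φ θ e e‖ ≤ C * (1 + ‖φ‖) ^ Γ * ‖e‖ ^ 2 :=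
  norm_apply_two_le (h.ddG_bound [] (by simp) 0 θ φ (by simpa using h.ρ_pos.le) hθ) e

theorem Reg.dG_sub_gN1 (h : Y.Reg θ₀ ρ C δ Γ) (hg : Y.GrowthBound) (hmean : Y.MeanCond)
    (hθ : ‖θ - θ₀‖ ≤ ρ) (hφ : ‖φ‖ ≤ 1) :
    ‖Y.dG [] 0 φ θ e - Y.gN1 φ θ e‖ ≤ jetConst m C Γ * ‖φ‖ ^ 3 * ‖e‖ := by
  have hB := one_le_momConst m h.one_le_C
  have hf := norm_fst_le e
  have h2 := exp_sub_jet1 hB (norm_nonneg φ) hφ (norm_nonneg e) (h.norm_mP_le hθ)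
    (h.norm_mQ_le hθ) ((h.norm_mP1_le hg hmean hθ).trans (by gcongr)) (h.norm_mQ1_le (e := e) hθ)
  have h3 := norm_sub_le_of_le (h.dG_sub_jet hg hθ hφ (e := e)) h2
  rw [sub_sub_sub_cancel_right] at h3
  exact h3.trans_eq (by unfold jetConst; ring)

theorem Reg.ddG_sub_gN2 (h : Y.Reg θ₀ ρ C δ Γ) (hg : Y.GrowthBound) (hmean : Y.MeanCond)
    (hθ : ‖θ - θ₀‖ ≤ ρ) (hφ : ‖φ‖ ≤ 1) {κ : ℝ}
    (hκ : ∀ js : List (Fin m), js.length = 2 → ∀ φ' : Vec m, ‖φ'‖ ≤ ‖φ‖ →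
      ‖Y.ddG js 0 φ' θ - Y.ddG js 0 0 θ‖ ≤ κ) :
    ‖Y.ddG [] 0 φ θ e e - Y.gN2 φ θ e‖ ≤
      (m ^ 2 * κ + jetConst m C Γ * ‖φ‖) * ‖φ‖ ^ 2 * ‖e‖ ^ 2 := by
  have hB := one_le_momConst m h.one_le_C
  have hf := norm_fst_le e
  have h2 := exp_sub_jet2 hB (norm_nonneg φ) hφ (norm_nonneg e) (h.norm_mP_le hθ)
    (h.norm_mQ_le hθ) ((h.norm_mP1_le hg hmean hθ).trans (by gcongr)) (h.norm_mQ1_le (e := e) hθ)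
    ((h.norm_mP2_le hg hmean hθ).trans (by gcongr)) (h.norm_mQ2_le (e := e) hθ)
  have h3 := norm_sub_le_of_le (h.ddG_sub_jet hg hθ hκ (e := e)) h2
  rw [sub_sub_sub_cancel_right] at h3
  refine h3.trans ?_
  have h4 : (0 : ℝ) ≤ m ^ 3 * (C * 2 ^ Γ) * ‖φ‖ ^ 3 * ‖e‖ ^ 2 := by
    have := h.C_nonneg
    positivity
  unfold jetConst
  linarith

end Crude

theorem Reg.exists_modulus (h : Y.Reg θ₀ ρ C δ Γ) (hg : Y.GrowthBound) {κ : ℝ} (hκ : 0 < κ) :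
    ∃ d, 0 < d ∧ d ≤ 1 ∧ ∀ js : List (Fin m), js.length = 2 → ∀ φ : Vec m, ‖φ‖ ≤ d →
      ∀ θ : Param p q, ‖θ - θ₀‖ ≤ ρ → ‖Y.ddG js 0 φ θ - Y.ddG js 0 0 θ‖ ≤ κ := by
  have h1 : ∀ k j : Fin m, ∀ᶠ d in nhdsWithin (0 : ℝ) (Ioi 0), ∀ φ : Vec m, ‖φ‖ ≤ d →
      ∀ θ : Param p q, ‖θ - θ₀‖ ≤ ρ → ‖Y.ddG [k, j] 0 φ θ - Y.ddG [k, j] 0 0 θ‖ ≤ κ := by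
    intro k j
    have hc : ContinuousOn (fun w : Vec m × Param p q => Y.ddG [k, j] 0 w.1 w.2)
        (closedBall 0 1 ×ˢ closedBall θ₀ ρ) :=
      (continuousOn_ddG hg (js := [k, j]) (by simp)).comp
        (f := fun w : Vec m × Param p q => (w.1, ((0 : Vec m), w.2))) (by fun_prop)
        fun w hw => h.mem_goodSet (by simpa [dist_eq_norm] using hw.2)
    have hK : IsCompact (closedBall (0 : Vec m) 1 ×ˢ closedBall θ₀ ρ) :=
      (isCompact_closedBall _ _).prod (isCompact_closedBall _ _)
    obtain ⟨d, hd, hu⟩ := (uniformContinuousOn_iff (α := Vec m × Param p q)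
      (β := Param p q →L[ℝ] Param p q →L[ℝ] ℂ)).1 (hK.uniformContinuousOn_of_continuous hc) κ hκ
    filter_upwards [Ioo_mem_nhdsGT (lt_min hd one_pos)] with r hr φ hφ θ hθ
    have hr1 := hr.2.trans_le (min_le_left d 1)
    have hr2 := hr.2.trans_le (min_le_right d 1)
    have := hu (φ, θ) ⟨by simpa using (hφ.trans hr2.le), by simpa [dist_eq_norm] using hθ⟩ (0, θ)
      ⟨by simp, by simpa [dist_eq_norm] using hθ⟩ (by
        rw [Prod.dist_eq, dist_self, max_lt_iff]
        exact ⟨by simpa using hφ.trans_lt hr1, hd⟩)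
    exact ((dist_eq_norm (Y.ddG [k, j] 0 φ θ) (Y.ddG [k, j] 0 0 θ)).symm.trans_lt this).le
  have h2 := eventually_all.2 fun k => eventually_all.2 (h1 k)
  obtain ⟨d, hd, hd1⟩ := (h2.and (Ioo_mem_nhdsGT (one_pos : (0 : ℝ) < 1))).exists
  refine ⟨d, hd1.1, hd1.2.le, fun js hjs => ?_⟩
  obtain ⟨k, j, rfl⟩ := List.length_eq_two.1 hjs
  exact hd k j

variable (Y) in
/-- Bounds for the rescaled characteristic function, its Gaussian counterpart, and their
derivatives in the parameter. -/
structure JetBounds (θ₀ : Param p q) (ρ K : ℝ) (Λ : ℕ) : Prop where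
  one_le_K : 1 ≤ K
  G_sub : ∀ ε, 0 < ε → ε ≤ 1 → ∀ θ, ‖θ - θ₀‖ ≤ ρ → ∀ φ : Vec m,
    ‖Y.G [] 0 (ε • φ) θ - Y.gN (ε • φ) θ‖ ≤ K * ε ^ 3 * (1 + ‖φ‖) ^ Λ
  dG_le : ∀ ε, 0 < ε → ε ≤ 1 → ∀ θ, ‖θ - θ₀‖ ≤ ρ → ∀ (φ : Vec m) (e : Param p q),
    ‖Y.dG [] 0 (ε • φ) θ (scl ε e)‖ ≤ K * ε ^ 2 * (1 + ‖φ‖) ^ Λ * ‖e‖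
  gN1_le : ∀ ε, 0 < ε → ε ≤ 1 → ∀ θ, ‖θ - θ₀‖ ≤ ρ → ∀ (φ : Vec m) (e : Param p q),
    ‖Y.gN1 (ε • φ) θ (scl ε e)‖ ≤ K * ε ^ 2 * (1 + ‖φ‖) ^ Λ * ‖e‖
  dG_sub : ∀ ε, 0 < ε → ε ≤ 1 → ∀ θ, ‖θ - θ₀‖ ≤ ρ → ∀ (φ : Vec m) (e : Param p q),
    ‖Y.dG [] 0 (ε • φ) θ (scl ε e) - Y.gN1 (ε • φ) θ (scl ε e)‖ ≤
      K * ε ^ 3 * (1 + ‖φ‖) ^ Λ * ‖e‖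
  ddG_le : ∀ ε, 0 < ε → ε ≤ 1 → ∀ θ, ‖θ - θ₀‖ ≤ ρ → ∀ (φ : Vec m) (e : Param p q),
    ‖Y.ddG [] 0 (ε • φ) θ (scl ε e) (scl ε e)‖ ≤ K * ε ^ 2 * (1 + ‖φ‖) ^ Λ * ‖e‖ ^ 2
  gN2_le : ∀ ε, 0 < ε → ε ≤ 1 → ∀ θ, ‖θ - θ₀‖ ≤ ρ → ∀ (φ : Vec m) (e : Param p q),
    ‖Y.gN2 (ε • φ) θ (scl ε e)‖ ≤ K * ε ^ 2 * (1 + ‖φ‖) ^ Λ * ‖e‖ ^ 2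
  ddG_sub : ∀ κ, 0 < κ → ∃ K', 0 ≤ K' ∧ ∀ ε, 0 < ε → ε ≤ 1 → ∀ θ, ‖θ - θ₀‖ ≤ ρ →
    ∀ (φ : Vec m) (e : Param p q),
    ‖Y.ddG [] 0 (ε • φ) θ (scl ε e) (scl ε e) - Y.gN2 (ε • φ) θ (scl ε e)‖ ≤
      (κ + K' * ε) * ε ^ 2 * (1 + ‖φ‖) ^ Λ * ‖e‖ ^ 2

section Scaled

variable {ε : ℝ} {θ : Param p q}

theorem Reg.scaled_gN1_le (h : Y.Reg θ₀ ρ C δ Γ)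
    (hε : 0 < ε) (hε1 : ε ≤ 1) (φ : Vec m) (e : Param p q) :
    momConst m C * ‖ε • φ‖ * ‖(scl ε e).1‖ + 2 * momConst m C ^ 2 * ‖ε • φ‖ ^ 2 * ‖scl ε e‖ ≤
      3 * momConst m C ^ 2 * ε ^ 2 * (1 + ‖φ‖) ^ 2 * ‖e‖ := by
  have hB := one_le_momConst m h.one_le_C
  rw [norm_scl_phi hε.le]
  set B := momConst m C
  set x := ‖φ‖
  have hx : 0 ≤ x := norm_nonneg φ
  have h1 := norm_scl_fst_le hε.le e
  have h2 := norm_scl_le hε.le hε1 e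
  have hy : 1 + x ≤ (1 + x) ^ 2 := by nlinarith
  have hBB : B ≤ B ^ 2 := by nlinarith
  calc B * (ε * x) * ‖(scl ε e).1‖ + 2 * B ^ 2 * (ε * x) ^ 2 * ‖scl ε e‖
      ≤ B ^ 2 * (ε * (1 + x) ^ 2) * (ε * ‖e‖) + 2 * B ^ 2 * (ε * (1 + x)) ^ 2 * ‖e‖ := by
        have : x ≤ (1 + x) ^ 2 := by nlinarith
        gcongr
        linarith
    _ = _ := by ring

theorem Reg.scaled_gN2_le (h : Y.Reg θ₀ ρ C δ Γ) (hg : Y.GrowthBound) (hmean : Y.MeanCond)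
    (hε : 0 < ε) (hε1 : ε ≤ 1) (hθ : ‖θ - θ₀‖ ≤ ρ) (φ : Vec m) (e : Param p q) :
    ‖Y.gN2 (ε • φ) θ (scl ε e)‖ ≤ 13 * momConst m C ^ 4 * ε ^ 2 * (1 + ‖φ‖) ^ 4 * ‖e‖ ^ 2 := by
  have hB := one_le_momConst m h.one_le_C
  have h3 := h.scaled_gN1_le hε hε1 φ e
  refine (h.norm_gN2_le hg hmean hθ).trans ?_
  have h4 := pow_le_pow_left₀ (by positivity) h3 2
  rw [norm_scl_phi hε.le] at h4 ⊢
  set B := momConst m C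
  set x := ‖φ‖
  have hx : 0 ≤ x := norm_nonneg φ
  have h1 := norm_scl_fst_le hε.le e
  have h2 := norm_scl_le hε.le hε1 e
  have hy : 1 ≤ 1 + x := by linarith
  have hBB : B ≤ B ^ 4 := le_self_pow₀ hB (by norm_num)
  have hBB' : B ^ 2 ≤ B ^ 4 := pow_le_pow_right₀ hB (by norm_num)
  have h5 : B * (ε * x) * ‖(scl ε e).1‖ ^ 2 ≤ B ^ 4 * ε ^ 2 * (1 + x) ^ 4 * ‖e‖ ^ 2 := by
    calc B * (ε * x) * ‖(scl ε e).1‖ ^ 2 ≤ B ^ 4 * (1 * (1 + x) ^ 4) * (ε * ‖e‖) ^ 2 := by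
          have : x ≤ (1 + x) ^ 4 := by
            have := le_self_pow₀ hy (n := 4) (by norm_num)
            linarith
          gcongr
      _ = _ := by ring
  have h6 : 3 * B ^ 2 * (ε * x) ^ 2 * ‖scl ε e‖ ^ 2 ≤ 3 * (B ^ 4 * ε ^ 2 * (1 + x) ^ 4 * ‖e‖ ^ 2) := by
    calc 3 * B ^ 2 * (ε * x) ^ 2 * ‖scl ε e‖ ^ 2 ≤ 3 * B ^ 4 * (ε ^ 2 * (1 + x) ^ 4) * ‖e‖ ^ 2 := by
          have : x ^ 2 ≤ (1 + x) ^ 4 := by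
            have := pow_le_pow_right₀ hy (show 2 ≤ 4 by norm_num)
            nlinarith
          rw [mul_pow]
          gcongr
      _ = _ := by ring
  have h7 : (3 * B ^ 2 * ε ^ 2 * (1 + x) ^ 2 * ‖e‖) ^ 2 ≤
      9 * (B ^ 4 * ε ^ 2 * (1 + x) ^ 4 * ‖e‖ ^ 2) := by
    calc (3 * B ^ 2 * ε ^ 2 * (1 + x) ^ 2 * ‖e‖) ^ 2
        = 9 * B ^ 4 * ε ^ 4 * (1 + x) ^ 4 * ‖e‖ ^ 2 := by ring
      _ ≤ 9 * B ^ 4 * ε ^ 2 * (1 + x) ^ 4 * ‖e‖ ^ 2 := by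
          have : ε ^ 4 ≤ ε ^ 2 := pow_le_pow_of_le_one hε.le hε1 (by norm_num)
          gcongr
      _ = _ := by ring
  linarith

theorem scaled_poly_le {a x : ℝ} {k n : ℕ} (hε : 0 < ε) (hε1 : ε ≤ 1) (hx : 0 ≤ x) (ha : 0 ≤ a)
    (hn : n ≤ k) : a * (ε * x) ^ 3 * (1 + ε * x) ^ n ≤ a * ε ^ 3 * (1 + x) ^ (k + 3) := by
  have h1 : ε * x ≤ x := mul_le_of_le_one_left hx hε1
  calc a * (ε * x) ^ 3 * (1 + ε * x) ^ n ≤ a * (ε * (1 + x)) ^ 3 * (1 + x) ^ n := by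
        gcongr
        linarith
    _ = a * ε ^ 3 * (1 + x) ^ (n + 3) := by ring
    _ ≤ _ := by
      gcongr
      linarith

theorem Reg.jetConst_nonneg (h : Y.Reg θ₀ ρ C δ Γ) : 0 ≤ jetConst m C Γ := by
  have := h.C_nonneg
  unfold jetConst momConst
  positivity

theorem Reg.scaled_G_sub (h : Y.Reg θ₀ ρ C δ Γ)
    (hε : 0 < ε) (hε1 : ε ≤ 1) (hθ : ‖θ - θ₀‖ ≤ ρ) (φ : Vec m) :
    ‖Y.G [] 0 (ε • φ) θ - Y.gN (ε • φ) θ‖ ≤ (jetConst m C Γ + 2) * ε ^ 3 * (1 + ‖φ‖) ^ (0 + 3) := by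
  have hj := h.jetConst_nonneg
  have h0 : ‖Y.G [] 0 (ε • φ) θ - Y.gN (ε • φ) θ‖ ≤ (jetConst m C Γ + 2) * ‖ε • φ‖ ^ 3 := by
    rcases le_total ‖ε • φ‖ 1 with h1 | h1
    · refine (h.G_sub_gN hθ h1).trans ?_
      gcongr
      linarith
    · have h2 := norm_sub_le_of_le (h.norm_G_le_one (φ := ε • φ) hθ) (h.norm_gN_le_one (φ := ε • φ) hθ)
      have h3 := one_le_pow₀ h1 (n := 3)
      nlinarith
  refine h0.trans ?_
  have := scaled_poly_le (a := jetConst m C Γ + 2) (k := 0) (n := 0) hε hε1 (norm_nonneg φ)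
    (by positivity) le_rfl
  rw [norm_scl_phi hε.le]
  simpa using this

theorem Reg.scaled_dG_sub (h : Y.Reg θ₀ ρ C δ Γ) (hg : Y.GrowthBound) (hmean : Y.MeanCond)
    (hε : 0 < ε) (hε1 : ε ≤ 1) (hθ : ‖θ - θ₀‖ ≤ ρ) (φ : Vec m) (e : Param p q) :
    ‖Y.dG [] 0 (ε • φ) θ (scl ε e) - Y.gN1 (ε • φ) θ (scl ε e)‖ ≤
      (jetConst m C Γ + C + 3 * momConst m C ^ 2) * ε ^ 3 * (1 + ‖φ‖) ^ (Γ + 3) * ‖e‖ := by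
  have hC := h.C_nonneg
  have hB := one_le_momConst m h.one_le_C
  have hj := h.jetConst_nonneg
  have h0 : ∀ e : Param p q, ‖Y.dG [] 0 (ε • φ) θ e - Y.gN1 (ε • φ) θ e‖ ≤
      (jetConst m C Γ + C + 3 * momConst m C ^ 2) * ‖ε • φ‖ ^ 3 * (1 + ‖ε • φ‖) ^ Γ * ‖e‖ := by
    intro e
    set x := ‖ε • φ‖ with hx
    have hx0 : 0 ≤ x := norm_nonneg _
    have hy : 1 ≤ (1 + x) ^ Γ := one_le_pow₀ (by linarith)
    rcases le_total x 1 with h1 | h1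
    · refine (h.dG_sub_gN1 hg hmean hθ h1).trans ?_
      gcongr ?_ * ‖e‖
      refine le_mul_of_le_mul_of_nonneg_left ?_ hy (by positivity)
      rw [mul_one]
      gcongr
      nlinarith
    · have h2 := norm_sub_le_of_le (h.norm_dG_le (φ := ε • φ) (e := e) hθ)
        (h.norm_gN1_le (φ := ε • φ) (e := e) hg hmean hθ)
      refine h2.trans ?_
      rw [← hx]
      have h3 : x ≤ x ^ 3 := le_self_pow₀ h1 (by norm_num)
      have h4 : x ^ 2 ≤ x ^ 3 := pow_le_pow_right₀ h1 (by norm_num)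
      have h5 : 1 ≤ x ^ 3 := one_le_pow₀ h1
      have hBB : momConst m C ≤ momConst m C ^ 2 := le_self_pow₀ hB (by norm_num)
      have hf := norm_fst_le e
      calc C * (1 + x) ^ Γ * ‖e‖ + (momConst m C * x * ‖e.1‖ + 2 * momConst m C ^ 2 * x ^ 2 * ‖e‖)
          ≤ C * (1 + x) ^ Γ * ‖e‖ * x ^ 3 + (momConst m C ^ 2 * x ^ 3 * ‖e‖ +
              2 * momConst m C ^ 2 * x ^ 3 * ‖e‖) * (1 + x) ^ Γ := by
            refine add_le_add (le_mul_of_one_le_right (by positivity) h5) ?_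
            refine le_mul_of_le_mul_of_nonneg_left ?_ hy (by positivity)
            rw [mul_one]
            gcongr
        _ = (0 + C + 3 * momConst m C ^ 2) * x ^ 3 * (1 + x) ^ Γ * ‖e‖ := by ring
        _ ≤ _ := by gcongr
  refine (h0 _).trans ?_
  rw [norm_scl_phi hε.le]
  exact mul_le_mul (scaled_poly_le hε hε1 (norm_nonneg φ) (by positivity) le_rfl)
    (norm_scl_le hε.le hε1 e) (norm_nonneg _) (by positivity)

theorem Reg.scaled_ddG_sub (h : Y.Reg θ₀ ρ C δ Γ) (hg : Y.GrowthBound) (hmean : Y.MeanCond)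
    {κ : ℝ} (hκ : 0 < κ) : ∃ K', 0 ≤ K' ∧ ∀ ε, 0 < ε → ε ≤ 1 → ∀ θ, ‖θ - θ₀‖ ≤ ρ →
    ∀ (φ : Vec m) (e : Param p q),
    ‖Y.ddG [] 0 (ε • φ) θ (scl ε e) (scl ε e) - Y.gN2 (ε • φ) θ (scl ε e)‖ ≤
      (κ + K' * ε) * ε ^ 2 * (1 + ‖φ‖) ^ (Γ + 4 + 3) * ‖e‖ ^ 2 := by
  have hC := h.C_nonneg
  have hB := one_le_momConst m h.one_le_C
  have hj := h.jetConst_nonneg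
  obtain ⟨d, hd0, hd1, hd⟩ := h.exists_modulus hg (div_pos hκ (by positivity : (0 : ℝ) < m ^ 2 + 1))
  refine ⟨jetConst m C Γ + (C + 13 * momConst m C ^ 4) / d ^ 3, by positivity, ?_⟩
  intro ε hε hε1 θ hθ φ e
  have hs := norm_scl_le hε.le hε1 e
  have hxe := norm_scl_phi hε.le φ
  have hx0 : 0 ≤ ‖φ‖ := norm_nonneg _
  rcases le_total ‖ε • φ‖ d with h1 | h1
  · have h2 := h.ddG_sub_gN2 hg hmean hθ (h1.trans hd1) (e := scl ε e)
      (κ := κ / (m ^ 2 + 1)) fun js hjs φ' hφ' => hd js hjs φ' (hφ'.trans h1) θ hθ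
    refine h2.trans ?_
    rw [hxe]
    have h3 : (m : ℝ) ^ 2 * (κ / (m ^ 2 + 1)) ≤ κ := by
      rw [mul_div_assoc', div_le_iff₀ (by positivity)]
      nlinarith
    set a := (m : ℝ) ^ 2 * (κ / (m ^ 2 + 1))
    have h4 : 0 ≤ (C + 13 * momConst m C ^ 4) / d ^ 3 := by positivity
    have h5 : (1 : ℝ) ≤ 1 + ‖φ‖ := by linarith
    calc (a + jetConst m C Γ * (ε * ‖φ‖)) * (ε * ‖φ‖) ^ 2 *
          ‖scl ε e‖ ^ 2
        ≤ (κ * (1 + ‖φ‖) + (jetConst m C Γ + (C + 13 * momConst m C ^ 4) / d ^ 3) *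
            (ε * (1 + ‖φ‖))) * (ε * (1 + ‖φ‖)) ^ 2 * ‖e‖ ^ 2 := by
          gcongr
          · exact h3.trans (le_mul_of_one_le_right hκ.le h5)
          all_goals linarith
      _ = (κ + (jetConst m C Γ + (C + 13 * momConst m C ^ 4) / d ^ 3) * ε) * ε ^ 2 *
            (1 + ‖φ‖) ^ 3 * ‖e‖ ^ 2 := by ring
      _ ≤ _ := by
          gcongr
          omega
  · have h2 := norm_sub_le_of_le (h.norm_ddG_le (φ := ε • φ) (e := scl ε e) hθ)
      (h.norm_gN2_le (φ := ε • φ) (e := scl ε e) hg hmean hθ)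
    refine h2.trans ?_
    set x := ‖ε • φ‖
    have hBB : momConst m C ≤ momConst m C ^ 2 := le_self_pow₀ hB (by norm_num)
    have hBB' : momConst m C ^ 2 ≤ momConst m C ^ 4 := pow_le_pow_right₀ hB (by norm_num)
    have hf := (norm_fst_le (scl ε e)).trans hs
    have hy : (1 : ℝ) ≤ 1 + x := by linarith
    have hyG : (1 : ℝ) ≤ (1 + x) ^ Γ := one_le_pow₀ hy
    have h3 : momConst m C * x * ‖(scl ε e).1‖ ^ 2 +
        3 * momConst m C ^ 2 * x ^ 2 * ‖scl ε e‖ ^ 2 +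
        (momConst m C * x * ‖(scl ε e).1‖ + 2 * momConst m C ^ 2 * x ^ 2 * ‖scl ε e‖) ^ 2 ≤
        13 * momConst m C ^ 4 * (1 + x) ^ 4 * ‖e‖ ^ 2 := by
      have e1 : x ≤ (1 + x) ^ 2 := by nlinarith
      have e2 : x ^ 2 ≤ (1 + x) ^ 2 := by nlinarith
      have e3 : (1 + x) ^ 2 ≤ (1 + x) ^ 4 := pow_le_pow_right₀ hy (by norm_num)
      calc _ ≤ momConst m C ^ 4 * (1 + x) ^ 4 * ‖e‖ ^ 2 +
            3 * momConst m C ^ 4 * (1 + x) ^ 4 * ‖e‖ ^ 2 +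
            (momConst m C ^ 2 * (1 + x) ^ 2 * ‖e‖ + 2 * momConst m C ^ 2 * (1 + x) ^ 2 * ‖e‖) ^ 2 := by
            gcongr
            · exact hBB.trans hBB'
            · exact e1.trans e3
            · exact e2.trans e3
        _ = _ := by ring
    have h5 : C * (1 + x) ^ Γ * ‖scl ε e‖ ^ 2 ≤ C * (1 + x) ^ Γ * (1 + x) ^ 4 * ‖e‖ ^ 2 := by
      refine mul_le_mul (le_mul_of_one_le_right (by positivity) (one_le_pow₀ hy))
        (pow_le_pow_left₀ (norm_nonneg _) hs 2) (by positivity) (by positivity)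
    have h6 : 1 ≤ x ^ 3 / d ^ 3 := by
      rw [one_le_div (by positivity)]
      gcongr
    have h7 : C * (1 + x) ^ Γ * (1 + x) ^ 4 * ‖e‖ ^ 2 +
        13 * momConst m C ^ 4 * (1 + x) ^ 4 * ‖e‖ ^ 2 ≤
        ((C + 13 * momConst m C ^ 4) * (1 + x) ^ (Γ + 4) * ‖e‖ ^ 2) * (x ^ 3 / d ^ 3) := by
      refine le_mul_of_le_mul_of_nonneg_left ?_ h6 (by positivity)
      have : 13 * momConst m C ^ 4 * (1 + x) ^ 4 * ‖e‖ ^ 2 ≤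
        13 * momConst m C ^ 4 * ((1 + x) ^ Γ * (1 + x) ^ 4) * ‖e‖ ^ 2 := by
        gcongr
        exact le_mul_of_one_le_left (by positivity) hyG
      rw [pow_add]
      linarith
    have h8 := scaled_poly_le (a := (C + 13 * momConst m C ^ 4) / d ^ 3) (k := Γ + 4) (n := Γ + 4)
      hε hε1 hx0 (by positivity) le_rfl
    rw [← hxe] at h8
    calc _ ≤ ((C + 13 * momConst m C ^ 4) * (1 + x) ^ (Γ + 4) * ‖e‖ ^ 2) * (x ^ 3 / d ^ 3) := by
          linarith
      _ = (C + 13 * momConst m C ^ 4) / d ^ 3 * x ^ 3 * (1 + x) ^ (Γ + 4) * ‖e‖ ^ 2 := by ring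
      _ ≤ (C + 13 * momConst m C ^ 4) / d ^ 3 * ε ^ 3 * (1 + ‖φ‖) ^ (Γ + 4 + 3) * ‖e‖ ^ 2 := by
          gcongr
      _ = (0 + (0 + (C + 13 * momConst m C ^ 4) / d ^ 3) * ε) * ε ^ 2 *
            (1 + ‖φ‖) ^ (Γ + 4 + 3) * ‖e‖ ^ 2 := by ring
      _ ≤ _ := by gcongr

theorem Reg.exists_jetBounds (h : Y.Reg θ₀ ρ C δ Γ) (hg : Y.GrowthBound) (hmean : Y.MeanCond) :
    ∃ K Λ, Y.JetBounds θ₀ ρ K Λ := by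
  have hC := h.C_nonneg
  have hB := one_le_momConst m h.one_le_C
  have hj := h.jetConst_nonneg
  obtain ⟨K', hK', hdd⟩ := h.scaled_ddG_sub hg hmean one_pos
  set B := momConst m C
  set K := jetConst m C Γ + 2 + C + 6 * B ^ 2 + 13 * B ^ 4 + K'
  have hy : ∀ (φ : Vec m) {k : ℕ}, k ≤ Γ + 4 + 3 → (1 + ‖φ‖) ^ k ≤ (1 + ‖φ‖) ^ (Γ + 4 + 3) :=
    fun φ k hk => pow_le_pow_right₀ (by linarith [norm_nonneg φ]) hk
  have hB2 : 0 ≤ B ^ 2 := by positivity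
  have hB4 : 0 ≤ B ^ 4 := by positivity
  have hn1 : ∀ ε, 0 < ε → ε ≤ 1 → ∀ θ, ‖θ - θ₀‖ ≤ ρ → ∀ (φ : Vec m) (e : Param p q),
      ‖Y.gN1 (ε • φ) θ (scl ε e)‖ ≤ 3 * B ^ 2 * ε ^ 2 * (1 + ‖φ‖) ^ (Γ + 4 + 3) * ‖e‖ := by
    intro ε hε hε1 θ hθ φ e
    refine (h.norm_gN1_le hg hmean hθ).trans ((h.scaled_gN1_le hε hε1 φ e).trans ?_)
    gcongr 3 * B ^ 2 * ε ^ 2 * ?_ * ‖e‖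
    exact hy φ (by omega)
  have hn2 : ∀ ε, 0 < ε → ε ≤ 1 → ∀ θ, ‖θ - θ₀‖ ≤ ρ → ∀ (φ : Vec m) (e : Param p q),
      ‖Y.gN2 (ε • φ) θ (scl ε e)‖ ≤ 13 * B ^ 4 * ε ^ 2 * (1 + ‖φ‖) ^ (Γ + 4 + 3) * ‖e‖ ^ 2 := by
    intro ε hε hε1 θ hθ φ e
    refine (h.scaled_gN2_le hg hmean hε hε1 hθ φ e).trans ?_
    gcongr 13 * B ^ 4 * ε ^ 2 * ?_ * ‖e‖ ^ 2
    exact hy φ (by omega)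
  have hs1 : ∀ ε, 0 < ε → ε ≤ 1 → ∀ θ, ‖θ - θ₀‖ ≤ ρ → ∀ (φ : Vec m) (e : Param p q),
      ‖Y.dG [] 0 (ε • φ) θ (scl ε e) - Y.gN1 (ε • φ) θ (scl ε e)‖ ≤
      (jetConst m C Γ + C + 3 * B ^ 2) * ε ^ 3 * (1 + ‖φ‖) ^ (Γ + 4 + 3) * ‖e‖ := by
    intro ε hε hε1 θ hθ φ e
    refine (h.scaled_dG_sub hg hmean hε hε1 hθ φ e).trans ?_
    gcongr (jetConst m C Γ + C + 3 * B ^ 2) * ε ^ 3 * ?_ * ‖e‖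
    exact hy φ (by omega)
  have hmono : ∀ {a c x y : ℝ}, a ≤ c → 0 ≤ x → 0 ≤ y → ∀ φ : Vec m,
      a * x * (1 + ‖φ‖) ^ (Γ + 4 + 3) * y ≤ c * x * (1 + ‖φ‖) ^ (Γ + 4 + 3) * y := by
    intro a c x y hac hx hy' φ
    gcongr
  have hpow : ∀ {ε : ℝ}, 0 < ε → ε ≤ 1 → ε ^ 3 ≤ ε ^ 2 := fun h1 h2 =>
    pow_le_pow_of_le_one h1.le h2 (by norm_num)
  refine ⟨K, Γ + 4 + 3, ⟨by linarith, ?_, ?_, ?_, ?_, ?_, ?_, fun κ hκ => h.scaled_ddG_sub hg hmean hκ⟩⟩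
  · intro ε hε hε1 θ hθ φ
    refine (h.scaled_G_sub hε hε1 hθ φ).trans ?_
    have := hy φ (k := 0 + 3) (by omega)
    gcongr
    linarith
  · intro ε hε hε1 θ hθ φ e
    have h1 := norm_add_le_of_le (hs1 ε hε hε1 θ hθ φ e) (hn1 ε hε hε1 θ hθ φ e)
    rw [sub_add_cancel] at h1
    refine h1.trans ?_
    have h2 : (jetConst m C Γ + C + 3 * B ^ 2) * ε ^ 3 * (1 + ‖φ‖) ^ (Γ + 4 + 3) * ‖e‖ ≤
        (jetConst m C Γ + C + 3 * B ^ 2) * ε ^ 2 * (1 + ‖φ‖) ^ (Γ + 4 + 3) * ‖e‖ := by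
      have := hpow hε hε1
      gcongr
    have h3 := hmono (a := jetConst m C Γ + C + 6 * B ^ 2) (c := K) (by linarith) (sq_nonneg ε)
      (norm_nonneg e) φ
    linarith
  · exact fun ε hε hε1 θ hθ φ e => (hn1 ε hε hε1 θ hθ φ e).trans
      (hmono (by linarith) (sq_nonneg ε) (norm_nonneg e) φ)
  · exact fun ε hε hε1 θ hθ φ e => (hs1 ε hε hε1 θ hθ φ e).trans
      (hmono (by linarith) (by positivity) (norm_nonneg e) φ)
  · intro ε hε hε1 θ hθ φ e
    have h1 := norm_add_le_of_le (hdd ε hε hε1 θ hθ φ e) (hn2 ε hε hε1 θ hθ φ e)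
    rw [sub_add_cancel] at h1
    refine h1.trans ?_
    have h2 : (1 + K' * ε) * ε ^ 2 * (1 + ‖φ‖) ^ (Γ + 4 + 3) * ‖e‖ ^ 2 ≤
        (1 + K') * ε ^ 2 * (1 + ‖φ‖) ^ (Γ + 4 + 3) * ‖e‖ ^ 2 := by
      gcongr
      exact mul_le_of_le_one_right hK' hε1
    have h3 := hmono (a := 1 + K' + 13 * B ^ 4) (c := K) (by linarith) (sq_nonneg ε)
      (sq_nonneg ‖e‖) φ
    linarith
  · exact fun ε hε hε1 θ hθ φ e => (hn2 ε hε hε1 θ hθ φ e).trans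
      (hmono (by linarith) (sq_nonneg ε) (sq_nonneg _) φ)

end Scaled

end Model

theorem norm_pow_sub_pow_le {a b : ℂ} {g : ℝ} (ha : ‖a‖ ≤ g) (hb : ‖b‖ ≤ g) (k : ℕ) :
    ‖a ^ (k + 1) - b ^ (k + 1)‖ ≤ (k + 1) * ‖a - b‖ * g ^ k := by
  induction k with
  | zero => simp
  | succ k ih =>
    have h1 : a ^ (k + 1 + 1) - b ^ (k + 1 + 1) =
        a * (a ^ (k + 1) - b ^ (k + 1)) + (a - b) * b ^ (k + 1) := by ring
    have h2 : ‖b ^ (k + 1)‖ ≤ g ^ (k + 1) := by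
      rw [norm_pow]
      gcongr
    rw [h1]
    refine (norm_add_le_of_le (norm_mul_le_of_le ha ih) (norm_mul_le_of_le le_rfl h2)).trans_eq ?_
    push_cast
    ring

/-- A polynomial weight is dominated by the decay of a large power of a characteristic function. -/
theorem exists_decay_weight (m Λ : ℕ) {δ : ℝ} (hδ : 0 < δ) :
    ∃ D : ℝ, 1 ≤ D ∧ ∃ N : ℕ, ∀ n k : ℕ, N ≤ n → n ≤ 2 * k → ∀ ε : ℝ, n * ε ^ 2 = 1 →
      ∀ x : ℝ, 0 ≤ x → (1 + x) ^ Λ * ((1 + δ * (ε * x) ^ 2) ^ (-δ)) ^ k ≤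
        D * (1 + x) ^ (-((m : ℝ) + 1)) := by
  set T : ℕ := Λ + m + 1 with hT
  have hT1 : (1 : ℝ) ≤ T := by rw [hT]; push_cast; linarith [(Nat.cast_nonneg Λ : (0:ℝ) ≤ Λ), (Nat.cast_nonneg m : (0:ℝ) ≤ m)]
  set c : ℝ := min 1 (δ ^ 2 / (2 * T))
  have hc0 : 0 < c := lt_min one_pos (by positivity)
  have hc1 : c ≤ 1 := min_le_left _ _
  obtain ⟨N, hN⟩ := exists_nat_ge (2 * T / δ)
  refine ⟨(2 / c) ^ T, one_le_pow₀ (by rw [le_div_iff₀ hc0]; linarith), N + 1,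
    fun n k hn hk ε hε x hx => ?_⟩
  have hn0 : (0 : ℝ) < n := by
    have : 0 < n := by omega
    exact_mod_cast this
  have hε2 : ε ^ 2 = 1 / n := by rw [eq_div_iff hn0.ne']; linarith
  have hk' : (n : ℝ) ≤ 2 * k := by exact_mod_cast hk
  have hnN : 2 * T / δ ≤ n := hN.trans (by exact_mod_cast (by omega : N ≤ n))
  rw [div_le_iff₀ hδ] at hnN
  have hq : 1 ≤ δ * k / T := by
    rw [le_div_iff₀ (by linarith)]
    nlinarith
  set s := δ * (ε * x) ^ 2 with hs
  have hs0 : 0 ≤ s := by positivity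
  have h1 : 1 + c * x ^ 2 ≤ (1 + s) ^ (δ * k / T) := by
    refine le_trans ?_ (one_add_mul_self_le_rpow_one_add (by linarith) hq)
    have h2 : δ ^ 2 / (2 * T) * x ^ 2 ≤ δ * k / T * s := by
      rw [hs, mul_pow, hε2]
      have : δ * k / T * (δ * (1 / n * x ^ 2)) = (δ ^ 2 / (2 * T) * x ^ 2) * (2 * k / n) := by
        field_simp
      rw [this]
      exact le_mul_of_one_le_right (by positivity) ((one_le_div hn0).2 hk')
    have h3 : c * x ^ 2 ≤ δ ^ 2 / (2 * T) * x ^ 2 := by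
      gcongr
      exact min_le_right _ _
    linarith
  have h4 : (1 + x) ^ 2 * (c / 2) ≤ 1 + c * x ^ 2 := by nlinarith [sq_nonneg (x - 1)]
  have h5 : ((1 + x) ^ 2 * (c / 2)) ^ T ≤ (1 + s) ^ (δ * k) := by
    have h6 : (1 + s) ^ (δ * k) = ((1 + s) ^ (δ * k / T)) ^ T := by
      rw [← Real.rpow_natCast, ← Real.rpow_mul (by positivity)]
      congr 1
      field_simp
    rw [h6]
    exact pow_le_pow_left₀ (by positivity) (h4.trans h1) T
  have h7 : ((1 + s) ^ (-δ)) ^ k = ((1 + s) ^ (δ * k))⁻¹ := by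
    rw [← Real.rpow_natCast, ← Real.rpow_mul (by positivity), ← Real.rpow_neg (by positivity)]
    congr 1
    ring
  have h8 : (1 + x) ^ (-((m : ℝ) + 1)) = ((1 + x) ^ (m + 1))⁻¹ := by
    rw [Real.rpow_neg (by positivity), ← Real.rpow_natCast]
    push_cast
    rfl
  rw [h7, h8, ← div_eq_mul_inv, ← div_eq_mul_inv, div_le_div_iff₀ (by positivity) (by positivity)]
  have h9 : (1 + x) ^ Λ * (1 + x) ^ (m + 1) ≤ (1 + x) ^ (2 * T) := by
    rw [← pow_add]
    exact pow_le_pow_right₀ (by linarith) (by omega)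
  refine h9.trans ?_
  have h10 : (1 + x) ^ (2 * T) = (2 / c) ^ T * ((1 + x) ^ 2 * (c / 2)) ^ T := by
    rw [← mul_pow, pow_mul]
    congr 1
    field_simp
  rw [h10]
  gcongr

section Pointwise

variable {X X1 X2 Z Z1 Z2 : ℂ} {g K ε y f κ : ℝ} {k : ℕ}

theorem pow_kernel_le (hy : 1 ≤ y) (hg0 : 0 ≤ g) (hg1 : g ≤ 1) (hX : ‖X‖ ≤ g) :
    ‖X ^ (k + 3)‖ ≤ 1 * (y ^ 3 * g ^ k) := by
  rw [norm_pow, one_mul]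
  exact ((pow_le_pow_left₀ (norm_nonneg _) hX _).trans (pow_le_pow_of_le_one hg0 hg1 (by omega))).trans
    (le_mul_of_one_le_left (pow_nonneg hg0 _) (one_le_pow₀ hy))

theorem pow_kernel_sub (hK : 1 ≤ K) (hy : 1 ≤ y) (hg0 : 0 ≤ g) (hg1 : g ≤ 1) (hε : 0 < ε)
    (hn : ((k + 3 : ℕ) : ℝ) * ε ^ 2 = 1) (hX : ‖X‖ ≤ g) (hZ : ‖Z‖ ≤ g)
    (hXZ : ‖X - Z‖ ≤ K * ε ^ 3 * y) :
    ‖X ^ (k + 3) - Z ^ (k + 3)‖ ≤ K * ε * (y ^ 3 * g ^ k) := by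
  refine (norm_pow_sub_pow_le hX hZ (k + 2)).trans ?_
  have hgk : g ^ (k + 2) ≤ g ^ k := pow_le_pow_of_le_one hg0 hg1 (by omega)
  have hy3 : y ≤ y ^ 3 := le_self_pow₀ hy (by norm_num)
  have h1 : ((k + 2 : ℕ) : ℝ) + 1 = ((k + 3 : ℕ) : ℝ) := by push_cast; ring
  rw [h1]
  calc ((k + 3 : ℕ) : ℝ) * ‖X - Z‖ * g ^ (k + 2)
      ≤ ((k + 3 : ℕ) : ℝ) * (K * ε ^ 3 * y ^ 3) * g ^ k := by
        gcongr
        exact hXZ.trans (by gcongr)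
    _ = (((k + 3 : ℕ) : ℝ) * ε ^ 2) * (K * ε * (y ^ 3 * g ^ k)) := by ring
    _ = _ := by rw [hn, one_mul]

theorem pow_kernel1_le (hK : 1 ≤ K) (hy : 1 ≤ y) (hg0 : 0 ≤ g) (hg1 : g ≤ 1) (hf : 0 ≤ f)
    (hn : ((k + 3 : ℕ) : ℝ) * ε ^ 2 = 1) (hX : ‖X‖ ≤ g) (hX1 : ‖X1‖ ≤ K * ε ^ 2 * y * f) :
    ‖((k + 3 : ℕ) : ℂ) * X ^ (k + 2) * X1‖ ≤ K * f * (y ^ 3 * g ^ k) := by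
  have hgk : g ^ (k + 2) ≤ g ^ k := pow_le_pow_of_le_one hg0 hg1 (by omega)
  have hy3 : y ≤ y ^ 3 := le_self_pow₀ hy (by norm_num)
  rw [norm_mul, norm_mul, norm_pow, Complex.norm_natCast]
  calc ((k + 3 : ℕ) : ℝ) * ‖X‖ ^ (k + 2) * ‖X1‖
      ≤ ((k + 3 : ℕ) : ℝ) * g ^ k * (K * ε ^ 2 * y ^ 3 * f) := by
        gcongr
        · exact (pow_le_pow_left₀ (norm_nonneg _) hX _).trans hgk
        · exact hX1.trans (by gcongr)
    _ = (((k + 3 : ℕ) : ℝ) * ε ^ 2) * (K * f * (y ^ 3 * g ^ k)) := by ring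
    _ = _ := by rw [hn, one_mul]

theorem pow_kernel1_sub (hK : 1 ≤ K) (hy : 1 ≤ y) (hg0 : 0 ≤ g) (hg1 : g ≤ 1) (hε : 0 < ε)
    (hf : 0 ≤ f)
    (hn : ((k + 3 : ℕ) : ℝ) * ε ^ 2 = 1) (hX : ‖X‖ ≤ g) (hZ : ‖Z‖ ≤ g)
    (hXZ : ‖X - Z‖ ≤ K * ε ^ 3 * y) (hX1 : ‖X1‖ ≤ K * ε ^ 2 * y * f)
    (hXZ1 : ‖X1 - Z1‖ ≤ K * ε ^ 3 * y * f) :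
    ‖((k + 3 : ℕ) : ℂ) * X ^ (k + 2) * X1 - ((k + 3 : ℕ) : ℂ) * Z ^ (k + 2) * Z1‖ ≤
      2 * K ^ 2 * ε * f * (y ^ 3 * g ^ k) := by
  have hgk : g ^ (k + 2) ≤ g ^ k := pow_le_pow_of_le_one hg0 hg1 (by omega)
  have hgk1 : g ^ (k + 1) ≤ g ^ k := pow_le_pow_of_le_one hg0 hg1 (by omega)
  have hy3 : y ≤ y ^ 3 := le_self_pow₀ hy (by norm_num)
  have hy23 : y ^ 2 ≤ y ^ 3 := pow_le_pow_right₀ hy (by norm_num)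
  have hKK : K ≤ K ^ 2 := le_self_pow₀ hK (by norm_num)
  have hsplit : ((k + 3 : ℕ) : ℂ) * X ^ (k + 2) * X1 - ((k + 3 : ℕ) : ℂ) * Z ^ (k + 2) * Z1 =
      ((k + 3 : ℕ) : ℂ) * ((X ^ (k + 2) - Z ^ (k + 2)) * X1) +
      ((k + 3 : ℕ) : ℂ) * (Z ^ (k + 2) * (X1 - Z1)) := by ring
  have hp : ‖X ^ (k + 2) - Z ^ (k + 2)‖ ≤ ((k + 3 : ℕ) : ℝ) * (K * ε ^ 3 * y) * g ^ k := by
    refine (norm_pow_sub_pow_le hX hZ (k + 1)).trans ?_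
    have : ((k + 1 : ℕ) : ℝ) + 1 ≤ ((k + 3 : ℕ) : ℝ) := by push_cast; linarith
    gcongr
  have hz : ‖Z ^ (k + 2)‖ ≤ g ^ k := by
    rw [norm_pow]
    exact (pow_le_pow_left₀ (norm_nonneg _) hZ _).trans hgk
  have hnn : ‖((k + 3 : ℕ) : ℂ)‖ ≤ ((k + 3 : ℕ) : ℝ) := (Complex.norm_natCast _).le
  rw [hsplit]
  refine (norm_add_le_of_le (norm_mul_le_of_le hnn (norm_mul_le_of_le hp hX1))
    (norm_mul_le_of_le hnn (norm_mul_le_of_le hz hXZ1))).trans ?_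
  calc ((k + 3 : ℕ) : ℝ) * (((k + 3 : ℕ) : ℝ) * (K * ε ^ 3 * y) * g ^ k * (K * ε ^ 2 * y * f)) +
        ((k + 3 : ℕ) : ℝ) * (g ^ k * (K * ε ^ 3 * y * f))
      = (((k + 3 : ℕ) : ℝ) * ε ^ 2) ^ 2 * (K ^ 2 * ε * f * (y ^ 2 * g ^ k)) +
        (((k + 3 : ℕ) : ℝ) * ε ^ 2) * (K * ε * f * (y * g ^ k)) := by ring
    _ = K ^ 2 * ε * f * (y ^ 2 * g ^ k) + K * ε * f * (y * g ^ k) := by rw [hn]; ring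
    _ ≤ K ^ 2 * ε * f * (y ^ 3 * g ^ k) + K ^ 2 * ε * f * (y ^ 3 * g ^ k) := by gcongr
    _ = _ := by ring

/-- The second derivative of an `n`-th power. -/
def powKernel2 (k : ℕ) (X X1 X2 : ℂ) : ℂ :=
  ((k + 3 : ℕ) : ℂ) * X ^ (k + 2) * X2 +
    ((k + 3 : ℕ) : ℂ) * ((k + 2 : ℕ) : ℂ) * X ^ (k + 1) * X1 ^ 2

theorem pow_kernel2_le (hK : 1 ≤ K) (hy : 1 ≤ y) (hg0 : 0 ≤ g) (hg1 : g ≤ 1)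
    (hn : ((k + 3 : ℕ) : ℝ) * ε ^ 2 = 1) (hX : ‖X‖ ≤ g) (hX1 : ‖X1‖ ≤ K * ε ^ 2 * y * f)
    (hX2 : ‖X2‖ ≤ K * ε ^ 2 * y * f ^ 2) :
    ‖powKernel2 k X X1 X2‖ ≤ 2 * K ^ 2 * f ^ 2 * (y ^ 3 * g ^ k) := by
  have hgk1 : g ^ (k + 1) ≤ g ^ k := pow_le_pow_of_le_one hg0 hg1 (by omega)
  have hy23 : y ^ 2 ≤ y ^ 3 := pow_le_pow_right₀ hy (by norm_num)
  have hKK : K ≤ K ^ 2 := le_self_pow₀ hK (by norm_num)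
  have hn0 : (((k + 3 : ℕ) : ℝ) * ε ^ 2) ^ 2 = 1 := by rw [hn, one_pow]
  refine (norm_add_le _ _).trans ?_
  have h1 := pow_kernel1_le hK hy hg0 hg1 (sq_nonneg f) hn hX hX2
  have h2 : ‖((k + 3 : ℕ) : ℂ) * ((k + 2 : ℕ) : ℂ) * X ^ (k + 1) * X1 ^ 2‖ ≤
      K ^ 2 * f ^ 2 * (y ^ 3 * g ^ k) := by
    rw [norm_mul, norm_mul, norm_mul, norm_pow, norm_pow, Complex.norm_natCast,
      Complex.norm_natCast]
    calc ((k + 3 : ℕ) : ℝ) * ((k + 2 : ℕ) : ℝ) * ‖X‖ ^ (k + 1) * ‖X1‖ ^ 2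
        ≤ ((k + 3 : ℕ) : ℝ) * ((k + 3 : ℕ) : ℝ) * g ^ k * (K * ε ^ 2 * y * f) ^ 2 := by
          gcongr
          · norm_num
          · exact (pow_le_pow_left₀ (norm_nonneg _) hX _).trans hgk1
      _ = (((k + 3 : ℕ) : ℝ) * ε ^ 2) ^ 2 * (K ^ 2 * f ^ 2 * (y ^ 2 * g ^ k)) := by ring
      _ ≤ _ := by
        rw [hn0, one_mul]
        gcongr
  have h3 : K * f ^ 2 * (y ^ 3 * g ^ k) ≤ K ^ 2 * f ^ 2 * (y ^ 3 * g ^ k) := by gcongr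
  linarith

theorem pow_kernel2_sub (hK : 1 ≤ K) (hy : 1 ≤ y) (hg0 : 0 ≤ g) (hg1 : g ≤ 1) (hε : 0 < ε)
    (hκ : 0 ≤ κ)
    (hn : ((k + 3 : ℕ) : ℝ) * ε ^ 2 = 1) (hX : ‖X‖ ≤ g) (hZ : ‖Z‖ ≤ g)
    (hXZ : ‖X - Z‖ ≤ K * ε ^ 3 * y) (hX1 : ‖X1‖ ≤ K * ε ^ 2 * y * f)
    (hZ1 : ‖Z1‖ ≤ K * ε ^ 2 * y * f)
    (hXZ1 : ‖X1 - Z1‖ ≤ K * ε ^ 3 * y * f) (hX2 : ‖X2‖ ≤ K * ε ^ 2 * y * f ^ 2)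
    (hXZ2 : ‖X2 - Z2‖ ≤ κ * ε ^ 2 * y * f ^ 2) :
    ‖powKernel2 k X X1 X2 - powKernel2 k Z Z1 Z2‖ ≤
      (κ + 4 * K ^ 3 * ε) * f ^ 2 * (y ^ 3 * g ^ k) := by
  have hgk : g ^ (k + 2) ≤ g ^ k := pow_le_pow_of_le_one hg0 hg1 (by omega)
  have hgk1 : g ^ (k + 1) ≤ g ^ k := pow_le_pow_of_le_one hg0 hg1 (by omega)
  have hy3 : y ≤ y ^ 3 := le_self_pow₀ hy (by norm_num)
  have hy23 : y ^ 2 ≤ y ^ 3 := pow_le_pow_right₀ hy (by norm_num)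
  have hKK : K ^ 2 ≤ K ^ 3 := pow_le_pow_right₀ hK (by norm_num)
  set n : ℝ := ((k + 3 : ℕ) : ℝ) with hnn
  have hsplit : powKernel2 k X X1 X2 - powKernel2 k Z Z1 Z2 =
      ((k + 3 : ℕ) : ℂ) * ((X ^ (k + 2) - Z ^ (k + 2)) * X2) +
      ((k + 3 : ℕ) : ℂ) * (Z ^ (k + 2) * (X2 - Z2)) +
      ((k + 3 : ℕ) : ℂ) * (((k + 2 : ℕ) : ℂ) * ((X ^ (k + 1) - Z ^ (k + 1)) * X1 ^ 2)) +
      ((k + 3 : ℕ) : ℂ) * (((k + 2 : ℕ) : ℂ) * (Z ^ (k + 1) * ((X1 - Z1) * (X1 + Z1)))) := by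
    unfold powKernel2
    ring
  have hp : ‖X ^ (k + 2) - Z ^ (k + 2)‖ ≤ n * (K * ε ^ 3 * y) * g ^ k := by
    refine (norm_pow_sub_pow_le hX hZ (k + 1)).trans ?_
    have : ((k + 1 : ℕ) : ℝ) + 1 ≤ n := by rw [hnn]; push_cast; linarith
    gcongr
  have hp1 : ‖X ^ (k + 1) - Z ^ (k + 1)‖ ≤ n * (K * ε ^ 3 * y) * g ^ k := by
    refine (norm_pow_sub_pow_le hX hZ k).trans ?_
    have : (k : ℝ) + 1 ≤ n := by rw [hnn]; push_cast; linarith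
    gcongr
  have hz : ‖Z ^ (k + 2)‖ ≤ g ^ k := by
    rw [norm_pow]
    exact (pow_le_pow_left₀ (norm_nonneg _) hZ _).trans hgk
  have hz1 : ‖Z ^ (k + 1)‖ ≤ g ^ k := by
    rw [norm_pow]
    exact (pow_le_pow_left₀ (norm_nonneg _) hZ _).trans hgk1
  have h3 : ‖((k + 3 : ℕ) : ℂ)‖ ≤ n := (Complex.norm_natCast _).le
  have h2 : ‖((k + 2 : ℕ) : ℂ)‖ ≤ n := by
    rw [Complex.norm_natCast, hnn]
    push_cast
    linarith
  rw [hsplit]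
  refine (norm_add_le_of_le (norm_add_le_of_le (norm_add_le_of_le
    (norm_mul_le_of_le h3 (norm_mul_le_of_le hp hX2))
    (norm_mul_le_of_le h3 (norm_mul_le_of_le hz hXZ2)))
    (norm_mul_le_of_le h3 (norm_mul_le_of_le h2 (norm_mul_le_of_le hp1 (norm_pow_two_le hX1)))))
    (norm_mul_le_of_le h3 (norm_mul_le_of_le h2 (norm_mul_le_of_le hz1
      (norm_mul_le_of_le hXZ1 (norm_add_le_of_le hX1 hZ1)))))).trans ?_
  calc _ = (n * ε ^ 2) ^ 2 * (K ^ 2 * ε * f ^ 2 * (y ^ 2 * g ^ k)) +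
        (n * ε ^ 2) * (κ * f ^ 2 * (y * g ^ k)) +
        (n * ε ^ 2) ^ 3 * (K ^ 3 * ε * f ^ 2 * (y ^ 3 * g ^ k)) +
        (n * ε ^ 2) ^ 2 * (2 * K ^ 2 * ε * f ^ 2 * (y ^ 2 * g ^ k)) := by ring
    _ = K ^ 2 * ε * f ^ 2 * (y ^ 2 * g ^ k) + κ * f ^ 2 * (y * g ^ k) +
        K ^ 3 * ε * f ^ 2 * (y ^ 3 * g ^ k) + 2 * K ^ 2 * ε * f ^ 2 * (y ^ 2 * g ^ k) := by
      rw [hn]; ring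
    _ ≤ K ^ 3 * ε * f ^ 2 * (y ^ 3 * g ^ k) + κ * f ^ 2 * (y ^ 3 * g ^ k) +
        K ^ 3 * ε * f ^ 2 * (y ^ 3 * g ^ k) + 2 * K ^ 3 * ε * f ^ 2 * (y ^ 3 * g ^ k) := by gcongr
    _ = _ := by ring

end Pointwise


section Osc

variable {m : ℕ}

/-- An integrable weight on `ℝ^m`. -/
def wt (φ : Vec m) : ℝ := (1 + ‖φ‖) ^ (-((m : ℝ) + 1))

theorem integrable_wt : Integrable (wt : Vec m → ℝ) :=
  integrable_one_add_norm (by simp)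

theorem wt_nonneg (φ : Vec m) : 0 ≤ wt φ := by unfold wt; positivity

/-- The oscillating factor of Fourier integrals. -/
def osf (a φ : Vec m) : ℂ := Complex.exp (-((inner ℝ φ a : ℝ) * Complex.I))

theorem norm_osf (a φ : Vec m) : ‖osf a φ‖ = 1 := by
  unfold osf
  rw [← neg_mul, ← Complex.ofReal_neg, Complex.norm_exp_ofReal_mul_I]

theorem continuous_osf (a : Vec m) : Continuous (osf a) := by unfold osf; fun_prop

/-- The Fourier integral of a power of `X`. -/
def osc (k : ℕ) (a : Vec m) (X : Vec m → ℂ) : ℂ := ∫ φ, osf a φ * X φ ^ (k + 3)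

/-- The derivative of `osc` when `X` has derivative `X1`. -/
def osc1 (k : ℕ) (a : Vec m) (X X1 : Vec m → ℂ) : ℂ :=
  ∫ φ, osf a φ * (((k + 3 : ℕ) : ℂ) * X φ ^ (k + 2) * X1 φ)

/-- The second derivative of `osc` when `X` has derivatives `X1` and `X2`. -/
def osc2 (k : ℕ) (a : Vec m) (X X1 X2 : Vec m → ℂ) : ℂ :=
  ∫ φ, osf a φ * powKernel2 k (X φ) (X1 φ) (X2 φ)

theorem norm_osf_mul_le {a φ : Vec m} {u : ℂ} {b : ℝ} (h : ‖u‖ ≤ b) : ‖osf a φ * u‖ ≤ b := by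
  rwa [norm_mul, norm_osf, one_mul]

theorem integrable_osf_mul {a : Vec m} {u : Vec m → ℂ} (hu : Continuous u) {b : ℝ}
    (h : ∀ φ, ‖u φ‖ ≤ b * wt φ) : Integrable fun φ => osf a φ * u φ :=
  (integrable_wt.const_mul b).mono' ((continuous_osf a).mul hu).aestronglyMeasurable
    (Eventually.of_forall fun φ => norm_osf_mul_le (h φ))

theorem norm_integral_osf_le {a : Vec m} {u : Vec m → ℂ} {b : ℝ}
    (h : ∀ φ, ‖u φ‖ ≤ b * wt φ) : ‖∫ φ, osf a φ * u φ‖ ≤ b * ∫ φ : Vec m, wt φ := by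
  rw [← integral_const_mul]
  exact norm_integral_le_of_norm_le (integrable_wt.const_mul b)
    (Eventually.of_forall fun φ => norm_osf_mul_le (h φ))

theorem norm_integral_osf_sub_le {a : Vec m} {u v : Vec m → ℂ} (hu : Continuous u)
    (hv : Continuous v) {b b' b'' : ℝ} (h : ∀ φ, ‖u φ‖ ≤ b * wt φ) (h' : ∀ φ, ‖v φ‖ ≤ b' * wt φ)
    (h'' : ∀ φ, ‖u φ - v φ‖ ≤ b'' * wt φ) :
    ‖(∫ φ, osf a φ * u φ) - ∫ φ, osf a φ * v φ‖ ≤ b'' * ∫ φ : Vec m, wt φ := by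
  rw [← integral_sub (integrable_osf_mul hu h) (integrable_osf_mul hv h')]
  simp_rw [← mul_sub]
  exact norm_integral_osf_le h''

theorem hasDerivAt_integral_osf {a : Vec m} {u u' : ℝ → Vec m → ℂ} {s : Set ℝ} {t : ℝ}
    (hs : s ∈ nhds t) (hu : ∀ r ∈ s, Continuous (u r)) (hu' : ∀ r ∈ s, Continuous (u' r))
    {b b' : ℝ} (h : ∀ r ∈ s, ∀ φ, ‖u r φ‖ ≤ b * wt φ) (h' : ∀ r ∈ s, ∀ φ, ‖u' r φ‖ ≤ b' * wt φ)
    (hd : ∀ r ∈ s, ∀ φ, HasDerivAt (fun r => u r φ) (u' r φ) r) :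
    HasDerivAt (fun r => ∫ φ, osf a φ * u r φ) (∫ φ, osf a φ * u' t φ) t := by
  have ht : t ∈ s := mem_of_mem_nhds hs
  refine (hasDerivAt_integral_of_dominated_loc_of_deriv_le (bound := fun φ => b' * wt φ)
    (F := fun r φ => osf a φ * u r φ) (F' := fun r φ => osf a φ * u' r φ) hs
    ?_ (integrable_osf_mul (hu t ht) (h t ht)) ?_ ?_ (integrable_wt.const_mul b') ?_).2
  · filter_upwards [hs] with r hr
    exact ((continuous_osf a).mul (hu r hr)).aestronglyMeasurable
  · exact ((continuous_osf a).mul (hu' t ht)).aestronglyMeasurable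
  · exact Eventually.of_forall fun φ r hr => norm_osf_mul_le (h' r hr φ)
  · exact Eventually.of_forall fun φ r hr => (hd r hr φ).const_mul _

end Osc

/-- The scale `1/√n` with `n = k + 3`. -/
def eps (k : ℕ) : ℝ := (Real.sqrt ((k + 3 : ℕ) : ℝ))⁻¹

theorem eps_pos (k : ℕ) : 0 < eps k := by
  unfold eps
  positivity

theorem mul_eps_sq (k : ℕ) : ((k + 3 : ℕ) : ℝ) * eps k ^ 2 = 1 := by
  unfold eps
  have : (0 : ℝ) < ((k + 3 : ℕ) : ℝ) := by positivity
  rw [inv_pow, Real.sq_sqrt this.le, mul_inv_cancel₀ this.ne']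

theorem eps_le_one (k : ℕ) : eps k ≤ 1 := by
  have h1 := mul_eps_sq k
  have h2 : (1 : ℝ) ≤ ((k + 3 : ℕ) : ℝ) := by exact_mod_cast (by omega : 1 ≤ k + 3)
  have h3 := eps_pos k
  by_contra h
  push Not at h
  nlinarith

theorem decay_mem {m : ℕ} {δ : ℝ} (hδ : 0 < δ) (x : Vec m) :
    0 ≤ (1 + δ * ‖x‖ ^ 2) ^ (-δ) ∧ (1 + δ * ‖x‖ ^ 2) ^ (-δ) ≤ 1 :=
  ⟨by positivity, rpow_le_one_of_decay hδ.le (by positivity)⟩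

theorem exists_decay_dom (m Λ : ℕ) {δ : ℝ} (hδ : 0 < δ) : ∃ D, 1 ≤ D ∧ ∃ N, ∀ {k}, N + 3 ≤ k →
    ∀ {u : Vec m → ℂ} {b : ℝ}, 0 ≤ b →
      (∀ φ, ‖u φ‖ ≤ b * (((1 + ‖φ‖) ^ Λ) ^ 3 * ((1 + δ * ‖eps k • φ‖ ^ 2) ^ (-δ)) ^ k)) →
      ∀ φ, ‖u φ‖ ≤ b * D * wt φ := by
  obtain ⟨D, hD1, N, hD⟩ := exists_decay_weight m (Λ * 3) hδ
  refine ⟨D, hD1, N, fun {k} hk u b hb hu φ => (hu φ).trans ?_⟩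
  rw [mul_assoc]
  refine mul_le_mul_of_nonneg_left ?_ hb
  have := hD (k + 3) k (by omega) (by omega) (eps k) (mul_eps_sq k) ‖φ‖ (norm_nonneg φ)
  rw [pow_mul] at this
  simpa only [norm_scl_phi (eps_pos k).le, wt] using this

theorem tendsto_eps : Tendsto eps atTop (nhds 0) := by
  unfold eps
  refine tendsto_inv_atTop_zero.comp (Real.tendsto_sqrt_atTop.comp ?_)
  exact tendsto_natCast_atTop_atTop.comp (tendsto_add_atTop_nat 3)

namespace Model

variable {m p q : ℕ} {Y : Model m p q} {θ₀ : Param p q} {ρ C δ K : ℝ} {Γ Λ : ℕ}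

variable (Y) in
/-- The rescaled Fourier integral of the characteristic function of the sum. -/
def tI (k : ℕ) (a : Vec m) (θ : Param p q) : ℝ :=
  (osc k a fun φ => Y.G [] 0 (eps k • φ) θ).re

variable (Y) in
/-- The derivative of `tI` in the direction `scl (eps k) e`. -/
def tI1 (k : ℕ) (a : Vec m) (θ e : Param p q) : ℝ :=
  (osc1 k a (fun φ => Y.G [] 0 (eps k • φ) θ)
    fun φ => Y.dG [] 0 (eps k • φ) θ (scl (eps k) e)).re

variable (Y) in
/-- The second derivative of `tI` in the direction `scl (eps k) e`. -/
def tI2 (k : ℕ) (a : Vec m) (θ e : Param p q) : ℝ :=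
  (osc2 k a (fun φ => Y.G [] 0 (eps k • φ) θ)
    (fun φ => Y.dG [] 0 (eps k • φ) θ (scl (eps k) e))
    fun φ => Y.ddG [] 0 (eps k • φ) θ (scl (eps k) e) (scl (eps k) e)).re

variable (Y) in
/-- The rescaled Fourier integral of the Gaussian characteristic function. -/
def nI (k : ℕ) (a : Vec m) (θ : Param p q) : ℝ :=
  (osc k a fun φ => Y.gN (eps k • φ) θ).re

variable (Y) in
/-- The derivative of `nI` in the direction `scl (eps k) e`. -/
def nI1 (k : ℕ) (a : Vec m) (θ e : Param p q) : ℝ :=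
  (osc1 k a (fun φ => Y.gN (eps k • φ) θ) fun φ => Y.gN1 (eps k • φ) θ (scl (eps k) e)).re

variable (Y) in
/-- The second derivative of `nI` in the direction `scl (eps k) e`. -/
def nI2 (k : ℕ) (a : Vec m) (θ e : Param p q) : ℝ :=
  (osc2 k a (fun φ => Y.gN (eps k • φ) θ) (fun φ => Y.gN1 (eps k • φ) θ (scl (eps k) e))
    fun φ => Y.gN2 (eps k • φ) θ (scl (eps k) e)).re

theorem continuous_G {θ : Param p q} (hθ : θ ∈ Y.goodSet) :
    Continuous fun φ => Y.G [] 0 φ θ := by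
  have hp := Y.isProbabilityMeasure_law θ (mem_domain_of_goodSet hθ)
  have : (fun φ => Y.G [] 0 φ θ) = charFun (Y.law θ) := by
    ext φ
    rw [G_nil, charFun_apply]
    unfold complexMGF
    refine integral_congr_ae (Eventually.of_forall fun x => ?_)
    simp [real_inner_comm]
  rw [this]
  exact continuous_charFun _

theorem continuous_dG (hg : Y.GrowthBound) {θ : Param p q} (hθ : θ ∈ Y.goodSet)
    (e : Param p q) : Continuous fun φ => Y.dG [] 0 φ θ e := by
  have h1 : Continuous fun φ => Y.dG [] 0 φ θ := by
    rw [← continuousOn_univ]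
    exact (continuousOn_dG hg (js := []) (by simp)).comp
      (f := fun φ : Vec m => (φ, ((0 : Vec m), θ))) (by fun_prop) fun φ _ => hθ
  exact (ContinuousLinearMap.apply ℝ ℂ e).continuous.comp h1

theorem continuous_ddG (hg : Y.GrowthBound) {θ : Param p q} (hθ : θ ∈ Y.goodSet)
    (e : Param p q) : Continuous fun φ => Y.ddG [] 0 φ θ e e := by
  have h1 : Continuous fun φ => Y.ddG [] 0 φ θ := by
    rw [← continuousOn_univ]
    exact (continuousOn_ddG hg (js := []) (by simp)).comp
      (f := fun φ : Vec m => (φ, ((0 : Vec m), θ))) (by fun_prop) fun φ _ => hθ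
  exact (ContinuousLinearMap.apply ℝ ℂ e).continuous.comp
    ((ContinuousLinearMap.apply ℝ (Param p q →L[ℝ] ℂ) e).continuous.comp h1)

theorem continuous_gN (θ : Param p q) : Continuous fun φ => Y.gN φ θ := by
  unfold gN jexp mP mQ
  fun_prop

theorem continuous_gN1 (θ e : Param p q) : Continuous fun φ => Y.gN1 φ θ e := by
  have := continuous_gN (Y := Y) θ
  unfold gN1 jexp1 mP mP1 mQ1
  fun_prop

theorem continuous_gN2 (θ e : Param p q) : Continuous fun φ => Y.gN2 φ θ e := by
  have := continuous_gN (Y := Y) θ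
  unfold gN2 jexp1 jexp2 mP mP1 mP2 mQ1 mQ2
  fun_prop

variable (Y) in
/-- The comparison of the rescaled Fourier integrals of the true and the Gaussian
characteristic function, for all `k ≥ N`. -/
structure OscBounds (θ₀ : Param p q) (ρ K : ℝ) (N : ℕ) : Prop where
  tI_deriv : ∀ k, N ≤ k → ∀ a θ e, ‖θ - θ₀‖ < ρ →
    HasDerivAt (fun t : ℝ => Y.tI k a (θ + t • scl (eps k) e)) (Y.tI1 k a θ e) 0
  tI1_deriv : ∀ k, N ≤ k → ∀ a θ e, ‖θ - θ₀‖ < ρ →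
    HasDerivAt (fun t : ℝ => Y.tI1 k a (θ + t • scl (eps k) e) e) (Y.tI2 k a θ e) 0
  nI_deriv : ∀ k, N ≤ k → ∀ a θ e, ‖θ - θ₀‖ < ρ →
    HasDerivAt (fun t : ℝ => Y.nI k a (θ + t • scl (eps k) e)) (Y.nI1 k a θ e) 0
  nI1_deriv : ∀ k, N ≤ k → ∀ a θ e, ‖θ - θ₀‖ < ρ →
    HasDerivAt (fun t : ℝ => Y.nI1 k a (θ + t • scl (eps k) e) e) (Y.nI2 k a θ e) 0
  one_le_K : 1 ≤ K
  sub_le : ∀ k, N ≤ k → ∀ a θ, ‖θ - θ₀‖ < ρ → |Y.tI k a θ - Y.nI k a θ| ≤ K * eps k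
  tI1_le : ∀ k, N ≤ k → ∀ a θ e, ‖θ - θ₀‖ < ρ → |Y.tI1 k a θ e| ≤ K * ‖e‖
  nI1_le : ∀ k, N ≤ k → ∀ a θ e, ‖θ - θ₀‖ < ρ → |Y.nI1 k a θ e| ≤ K * ‖e‖
  sub1_le : ∀ k, N ≤ k → ∀ a θ e, ‖θ - θ₀‖ < ρ →
    |Y.tI1 k a θ e - Y.nI1 k a θ e| ≤ K * eps k * ‖e‖
  nI2_le : ∀ k, N ≤ k → ∀ a θ e, ‖θ - θ₀‖ < ρ → |Y.nI2 k a θ e| ≤ K * ‖e‖ ^ 2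
  sub2_le : ∀ κ, 0 < κ → ∃ K', 0 ≤ K' ∧ ∀ k, N ≤ k → ∀ a θ e, ‖θ - θ₀‖ < ρ →
    |Y.tI2 k a θ e - Y.nI2 k a θ e| ≤ (κ + K' * eps k) * ‖e‖ ^ 2

theorem line_mem_ball {E : Type*} [NormedAddCommGroup E] [NormedSpace ℝ E] {x₀ x e : E} {ρ : ℝ}
    (h : ‖x - x₀‖ < ρ) : {t : ℝ | ‖x + t • e - x₀‖ < ρ} ∈ nhds (0 : ℝ) := by
  have hc : Continuous fun t : ℝ => ‖x + t • e - x₀‖ := by fun_prop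
  exact (isOpen_lt hc continuous_const).mem_nhds (by simpa using h)

theorem Reg.exists_oscBounds (h : Y.Reg θ₀ ρ C δ Γ) (hg : Y.GrowthBound) (hmean : Y.MeanCond) :
    ∃ K N, Y.OscBounds θ₀ ρ K N := by
  obtain ⟨K, Λ, hJ⟩ := h.exists_jetBounds hg hmean
  obtain ⟨D, hD1, N, hw⟩ := exists_decay_dom m Λ h.δ_pos
  have hK := hJ.one_le_K
  set S := ∫ φ : Vec m, wt φ
  have hS0 : 0 ≤ S := integral_nonneg wt_nonneg
  set g : ℕ → Vec m → ℝ := fun k φ => (1 + δ * ‖eps k • φ‖ ^ 2) ^ (-δ)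
  have hg0 : ∀ k φ, 0 ≤ g k φ := fun k φ => (decay_mem h.δ_pos _).1
  have hg1 : ∀ k φ, g k φ ≤ 1 := fun k φ => (decay_mem h.δ_pos _).2
  have hy : ∀ φ : Vec m, 1 ≤ (1 + ‖φ‖) ^ Λ := fun φ => one_le_pow₀ (by linarith [norm_nonneg φ])
  have hG : ∀ k θ, ‖θ - θ₀‖ ≤ ρ → ∀ φ : Vec m, ‖Y.G [] 0 (eps k • φ) θ‖ ≤ g k φ :=
    fun k θ hθ φ => h.decay_zero hθ
  have hN : ∀ k θ, ‖θ - θ₀‖ ≤ ρ → ∀ φ : Vec m, ‖Y.gN (eps k • φ) θ‖ ≤ g k φ :=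
    fun k θ hθ φ => h.norm_gN_le hθ
  have cG : ∀ k θ, ‖θ - θ₀‖ ≤ ρ → Continuous fun φ => Y.G [] 0 (eps k • φ) θ := fun k θ hθ =>
    (continuous_G (h.mem_goodSet hθ)).comp (continuous_const_smul (eps k))
  have cdG : ∀ k θ e, ‖θ - θ₀‖ ≤ ρ → Continuous fun φ => Y.dG [] 0 (eps k • φ) θ e :=
    fun k θ e hθ => (continuous_dG hg (h.mem_goodSet hθ) e).comp (continuous_const_smul (eps k))
  have cddG : ∀ k θ e, ‖θ - θ₀‖ ≤ ρ → Continuous fun φ => Y.ddG [] 0 (eps k • φ) θ e e :=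
    fun k θ e hθ => (continuous_ddG hg (h.mem_goodSet hθ) e).comp (continuous_const_smul (eps k))
  have cN : ∀ k θ, Continuous fun φ => Y.gN (eps k • φ) θ := fun k θ =>
    (continuous_gN θ).comp (continuous_const_smul (eps k))
  have cN1 : ∀ k θ e, Continuous fun φ => Y.gN1 (eps k • φ) θ e := fun k θ e =>
    (continuous_gN1 θ e).comp (continuous_const_smul (eps k))
  have cN2 : ∀ k θ e, Continuous fun φ => Y.gN2 (eps k • φ) θ e := fun k θ e =>
    (continuous_gN2 θ e).comp (continuous_const_smul (eps k))
  have ck : ∀ k {X X1 X2 : Vec m → ℂ}, Continuous X → Continuous X1 → Continuous X2 →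
      Continuous fun φ => powKernel2 k (X φ) (X1 φ) (X2 φ) := by
    intro k X X1 X2 h1 h2 h3
    unfold powKernel2
    fun_prop
  have b0 : ∀ k {X : Vec m → ℂ}, (∀ φ, ‖X φ‖ ≤ g k φ) → ∀ φ,
      ‖X φ ^ (k + 3)‖ ≤ 1 * (((1 + ‖φ‖) ^ Λ) ^ 3 * g k φ ^ k) := fun k _ hX φ =>
    pow_kernel_le (hy φ) (hg0 k φ) (hg1 k φ) (hX φ)
  have g1 : ∀ {k θ}, N + 3 ≤ k → ‖θ - θ₀‖ ≤ ρ → ∀ e φ, ‖((k + 3 : ℕ) : ℂ) *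
      Y.G [] 0 (eps k • φ) θ ^ (k + 2) * Y.dG [] 0 (eps k • φ) θ (scl (eps k) e)‖ ≤
      K * ‖e‖ * D * wt φ := fun {k θ} hk hθ e => hw hk (by positivity) fun φ =>
    pow_kernel1_le hK (hy φ) (hg0 k φ) (hg1 k φ) (norm_nonneg e) (mul_eps_sq k)
      (hG k θ hθ φ) (hJ.dG_le _ (eps_pos k) (eps_le_one k) _ hθ φ e)
  have n1 : ∀ {k θ}, N + 3 ≤ k → ‖θ - θ₀‖ ≤ ρ → ∀ e φ, ‖((k + 3 : ℕ) : ℂ) *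
      Y.gN (eps k • φ) θ ^ (k + 2) * Y.gN1 (eps k • φ) θ (scl (eps k) e)‖ ≤
      K * ‖e‖ * D * wt φ := fun {k θ} hk hθ e => hw hk (by positivity) fun φ =>
    pow_kernel1_le hK (hy φ) (hg0 k φ) (hg1 k φ) (norm_nonneg e) (mul_eps_sq k)
      (hN k θ hθ φ) (hJ.gN1_le _ (eps_pos k) (eps_le_one k) _ hθ φ e)
  have g2 : ∀ {k θ}, N + 3 ≤ k → ‖θ - θ₀‖ ≤ ρ → ∀ e φ, ‖powKernel2 k (Y.G [] 0 (eps k • φ) θ)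
      (Y.dG [] 0 (eps k • φ) θ (scl (eps k) e))
      (Y.ddG [] 0 (eps k • φ) θ (scl (eps k) e) (scl (eps k) e))‖ ≤
      2 * K ^ 2 * ‖e‖ ^ 2 * D * wt φ := fun {k θ} hk hθ e => hw hk (by positivity) fun φ =>
    pow_kernel2_le hK (hy φ) (hg0 k φ) (hg1 k φ) (mul_eps_sq k) (hG k θ hθ φ)
      (hJ.dG_le _ (eps_pos k) (eps_le_one k) _ hθ φ e)
      (hJ.ddG_le _ (eps_pos k) (eps_le_one k) _ hθ φ e)
  have n2 : ∀ {k θ}, N + 3 ≤ k → ‖θ - θ₀‖ ≤ ρ → ∀ e φ, ‖powKernel2 k (Y.gN (eps k • φ) θ)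
      (Y.gN1 (eps k • φ) θ (scl (eps k) e)) (Y.gN2 (eps k • φ) θ (scl (eps k) e))‖ ≤
      2 * K ^ 2 * ‖e‖ ^ 2 * D * wt φ := fun {k θ} hk hθ e => hw hk (by positivity) fun φ =>
    pow_kernel2_le hK (hy φ) (hg0 k φ) (hg1 k φ) (mul_eps_sq k) (hN k θ hθ φ)
      (hJ.gN1_le _ (eps_pos k) (eps_le_one k) _ hθ φ e)
      (hJ.gN2_le _ (eps_pos k) (eps_le_one k) _ hθ φ e)
  have hfin : ∀ {b u : ℝ}, 0 ≤ u → b ≤ 4 * K ^ 2 * u → b * D * S ≤ max 1 (4 * K ^ 2 * D * S) * u :=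
    fun {b u} hu hb => calc
      b * D * S ≤ 4 * K ^ 2 * u * D * S := by gcongr
      _ = 4 * K ^ 2 * D * S * u := by ring
      _ ≤ _ := mul_le_mul_of_nonneg_right (le_max_right _ _) hu
  have hre : ∀ {z w : ℂ} {b : ℝ}, ‖z - w‖ ≤ b → |z.re - w.re| ≤ b := fun {z w b} hzw =>
    (by rw [← Complex.sub_re]; exact (Complex.abs_re_le_norm _).trans hzw)
  have dpow : ∀ (k : ℕ) {X : ℝ → ℂ} {X' : ℂ} {t : ℝ}, HasDerivAt X X' t →
      HasDerivAt (fun t => X t ^ (k + 3)) (((k + 3 : ℕ) : ℂ) * X t ^ (k + 2) * X') t :=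
    fun k X X' t hX => hX.fun_pow (k + 3)
  have dpow2 : ∀ (k : ℕ) {X X1 : ℝ → ℂ} {X2 : ℂ} {t : ℝ}, HasDerivAt X (X1 t) t →
      HasDerivAt X1 X2 t → HasDerivAt (fun t => ((k + 3 : ℕ) : ℂ) * X t ^ (k + 2) * X1 t)
        (powKernel2 k (X t) (X1 t) X2) t := by
    intro k X X1 X2 t h1 h2
    refine (((h1.fun_pow (k + 2)).const_mul ((k + 3 : ℕ) : ℂ)).fun_mul h2).congr_deriv ?_
    unfold powKernel2
    simp only [show k + 2 - 1 = k + 1 from rfl]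
    ring
  have hmemt : ∀ {θ e : Param p q} {t : ℝ}, ‖θ + t • e - θ₀‖ < ρ → θ + t • e ∈ Y.goodSet :=
    fun ht => h.mem_goodSet ht.le
  refine ⟨max 1 (4 * K ^ 2 * D * S), N + 3, ⟨?_, ?_, ?_, ?_, le_max_left _ _, ?_, ?_, ?_, ?_, ?_, ?_⟩⟩
  · intro k hk a θ e hθ
    refine Complex.reCLM.hasFDerivAt.comp_hasDerivAt 0 ((hasDerivAt_integral_osf (a := a)
      (line_mem_ball (e := scl (eps k) e) hθ) (u := fun t φ => Y.G [] 0 (eps k • φ) (θ + t • scl (eps k) e) ^ (k + 3))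
      (u' := fun t φ => ((k + 3 : ℕ) : ℂ) * Y.G [] 0 (eps k • φ) (θ + t • scl (eps k) e) ^ (k + 2) *
        Y.dG [] 0 (eps k • φ) (θ + t • scl (eps k) e) (scl (eps k) e))
      (fun t ht => (cG k _ (le_of_lt ht)).pow _)
      (fun t ht => (((cG k _ (le_of_lt ht)).pow _).const_mul _).mul (cdG k _ _ (le_of_lt ht)))
      (fun t ht => hw hk zero_le_one (b0 k (hG k _ (le_of_lt ht))))
      (fun t ht => g1 hk (le_of_lt ht) e)
      (fun t ht φ => dpow k (hasDerivAt_G_line hg (by simp) _ (hmemt ht)))).congr_deriv ?_)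
    simp only [zero_smul, add_zero]
    rfl
  · intro k hk a θ e hθ
    refine Complex.reCLM.hasFDerivAt.comp_hasDerivAt 0 ((hasDerivAt_integral_osf (a := a)
      (line_mem_ball (e := scl (eps k) e) hθ)
      (u := fun t φ => ((k + 3 : ℕ) : ℂ) * Y.G [] 0 (eps k • φ) (θ + t • scl (eps k) e) ^ (k + 2) *
        Y.dG [] 0 (eps k • φ) (θ + t • scl (eps k) e) (scl (eps k) e))
      (u' := fun t φ => powKernel2 k (Y.G [] 0 (eps k • φ) (θ + t • scl (eps k) e))
        (Y.dG [] 0 (eps k • φ) (θ + t • scl (eps k) e) (scl (eps k) e))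
        (Y.ddG [] 0 (eps k • φ) (θ + t • scl (eps k) e) (scl (eps k) e) (scl (eps k) e)))
      (fun t ht => (((cG k _ (le_of_lt ht)).pow _).const_mul _).mul (cdG k _ _ (le_of_lt ht)))
      (fun t ht => ck k (cG k _ (le_of_lt ht)) (cdG k _ _ (le_of_lt ht)) (cddG k _ _ (le_of_lt ht)))
      (fun t ht => g1 hk (le_of_lt ht) e)
      (fun t ht => g2 hk (le_of_lt ht) e)
      (fun t ht φ => dpow2 k (hasDerivAt_G_line hg (by simp) _ (hmemt ht))
        (hasDerivAt_dG_line hg (by simp) _ (hmemt ht)))).congr_deriv ?_)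
    simp only [zero_smul, add_zero]
    rfl
  · intro k hk a θ e hθ
    refine Complex.reCLM.hasFDerivAt.comp_hasDerivAt 0 ((hasDerivAt_integral_osf (a := a)
      (line_mem_ball (e := scl (eps k) e) hθ) (u := fun t φ => Y.gN (eps k • φ) (θ + t • scl (eps k) e) ^ (k + 3))
      (u' := fun t φ => ((k + 3 : ℕ) : ℂ) * Y.gN (eps k • φ) (θ + t • scl (eps k) e) ^ (k + 2) *
        Y.gN1 (eps k • φ) (θ + t • scl (eps k) e) (scl (eps k) e))
      (fun t ht => (cN k _).pow _)
      (fun t ht => (((cN k _).pow _).const_mul _).mul (cN1 k _ _))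
      (fun t ht => hw hk zero_le_one (b0 k (hN k _ (le_of_lt ht))))
      (fun t ht => n1 hk (le_of_lt ht) e)
      (fun t ht φ => dpow k (hasDerivAt_gN hg (hmemt ht)))).congr_deriv ?_)
    simp only [zero_smul, add_zero]
    rfl
  · intro k hk a θ e hθ
    refine Complex.reCLM.hasFDerivAt.comp_hasDerivAt 0 ((hasDerivAt_integral_osf (a := a)
      (line_mem_ball (e := scl (eps k) e) hθ)
      (u := fun t φ => ((k + 3 : ℕ) : ℂ) * Y.gN (eps k • φ) (θ + t • scl (eps k) e) ^ (k + 2) *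
        Y.gN1 (eps k • φ) (θ + t • scl (eps k) e) (scl (eps k) e))
      (u' := fun t φ => powKernel2 k (Y.gN (eps k • φ) (θ + t • scl (eps k) e))
        (Y.gN1 (eps k • φ) (θ + t • scl (eps k) e) (scl (eps k) e))
        (Y.gN2 (eps k • φ) (θ + t • scl (eps k) e) (scl (eps k) e)))
      (fun t ht => (((cN k _).pow _).const_mul _).mul (cN1 k _ _))
      (fun t ht => ck k (cN k _) (cN1 k _ _) (cN2 k _ _))
      (fun t ht => n1 hk (le_of_lt ht) e)
      (fun t ht => n2 hk (le_of_lt ht) e)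
      (fun t ht φ => dpow2 k (hasDerivAt_gN hg (hmemt ht))
        (hasDerivAt_gN1 hg (hmemt ht)))).congr_deriv ?_)
    simp only [zero_smul, add_zero]
    rfl
  all_goals have hKK : K ≤ K ^ 2 := le_self_pow₀ hK (by norm_num)
  · intro k hk a θ hθ
    have he := eps_pos k
    refine (hre (norm_integral_osf_sub_le (a := a) ((cG k θ hθ.le).pow _) ((cN k θ).pow _)
      (hw hk zero_le_one (b0 k (hG k θ hθ.le))) (hw hk zero_le_one (b0 k (hN k θ hθ.le)))
      (hw hk (b := K * eps k) (by positivity) fun φ => pow_kernel_sub hK (hy φ) (hg0 k φ) (hg1 k φ)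
        he (mul_eps_sq k) (hG k θ hθ.le φ) (hN k θ hθ.le φ)
        (hJ.G_sub _ he (eps_le_one k) θ hθ.le φ)))).trans ?_
    exact hfin he.le (by gcongr; linarith)
  · intro k hk a θ e hθ
    refine (Complex.abs_re_le_norm _).trans ((norm_integral_osf_le (a := a)
      (g1 hk hθ.le e)).trans ?_)
    exact hfin (norm_nonneg e) (by gcongr; linarith)
  · intro k hk a θ e hθ
    refine (Complex.abs_re_le_norm _).trans ((norm_integral_osf_le (a := a)
      (n1 hk hθ.le e)).trans ?_)
    exact hfin (norm_nonneg e) (by gcongr; linarith)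
  · intro k hk a θ e hθ
    have he := eps_pos k
    refine (hre (norm_integral_osf_sub_le (a := a)
      ((((cG k _ hθ.le).pow _).const_mul _).mul (cdG k _ _ hθ.le))
      ((((cN k _).pow _).const_mul _).mul (cN1 k _ _))
      (g1 hk hθ.le e)
      (n1 hk hθ.le e)
      (hw hk (b := 2 * K ^ 2 * eps k * ‖e‖) (by positivity) fun φ => pow_kernel1_sub hK (hy φ)
        (hg0 k φ) (hg1 k φ) he (norm_nonneg e) (mul_eps_sq k) (hG k θ hθ.le φ) (hN k θ hθ.le φ)
        (hJ.G_sub _ he (eps_le_one k) θ hθ.le φ) (hJ.dG_le _ he (eps_le_one k) _ hθ.le φ e)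
        (hJ.dG_sub _ he (eps_le_one k) _ hθ.le φ e)))).trans ?_
    refine (hfin (u := eps k * ‖e‖) (by positivity) ?_).trans_eq (by ring)
    rw [← mul_assoc]
    gcongr
    norm_num
  · intro k hk a θ e hθ
    refine (Complex.abs_re_le_norm _).trans ((norm_integral_osf_le (a := a)
      (n2 hk hθ.le e)).trans ?_)
    exact hfin (sq_nonneg _) (by gcongr; norm_num)
  · intro κ hκ
    have hDS : 0 < D * S + 1 := by positivity
    obtain ⟨K', hK', hdd⟩ := hJ.ddG_sub (κ / (D * S + 1)) (div_pos hκ hDS)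
    refine ⟨(K' + 4 * K ^ 3) * D * S, by positivity, fun k hk a θ e hθ => ?_⟩
    have he := eps_pos k
    have hκ' : 0 ≤ κ / (D * S + 1) + K' * eps k := by positivity
    refine (hre (norm_integral_osf_sub_le (a := a)
      (ck k (cG k _ hθ.le) (cdG k _ _ hθ.le) (cddG k _ _ hθ.le))
      (ck k (cN k _) (cN1 k _ _) (cN2 k _ _))
      (g2 hk hθ.le e)
      (n2 hk hθ.le e)
      (hw hk (b := (κ / (D * S + 1) + K' * eps k + 4 * K ^ 3 * eps k) * ‖e‖ ^ 2) (by positivity)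
        fun φ => pow_kernel2_sub hK (hy φ)
        (hg0 k φ) (hg1 k φ) he hκ' (mul_eps_sq k) (hG k θ hθ.le φ) (hN k θ hθ.le φ)
        (hJ.G_sub _ he (eps_le_one k) θ hθ.le φ) (hJ.dG_le _ he (eps_le_one k) _ hθ.le φ e)
        (hJ.gN1_le _ (eps_pos k) (eps_le_one k) _ hθ.le φ e)
        (hJ.dG_sub _ he (eps_le_one k) _ hθ.le φ e)
        (hJ.ddG_le _ (eps_pos k) (eps_le_one k) _ hθ.le φ e)
        (hdd _ he (eps_le_one k) _ hθ.le φ e)))).trans ?_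
    have h1 : κ / (D * S + 1) * (D * S) ≤ κ := by
      rw [div_mul_eq_mul_div, div_le_iff₀ hDS]
      nlinarith
    have h2 : κ / (D * S + 1) * (D * S) * ‖e‖ ^ 2 ≤ κ * ‖e‖ ^ 2 := by gcongr
    calc _ = κ / (D * S + 1) * (D * S) * ‖e‖ ^ 2 +
          ((K' + 4 * K ^ 3) * D * S) * eps k * ‖e‖ ^ 2 := by ring
      _ ≤ κ * ‖e‖ ^ 2 + ((K' + 4 * K ^ 3) * D * S) * eps k * ‖e‖ ^ 2 := by gcongr
      _ = _ := by ring


theorem R_swap (k l : Fin m) (z : Vec m × Param p q) : Y.R [k, l] z = Y.R [l, k] z := by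
  unfold R mono
  simp [mul_comm]

theorem K2_transpose {θ : Param p q} (hθ : θ ∈ Y.goodSet) : (Y.K2 θ)ᵀ = Y.K2 θ := by
  ext k l
  rw [Matrix.transpose_apply, K2_eq hθ, K2_eq hθ, R_swap, mul_comm]

theorem Reg.quad_pos (h : Y.Reg θ₀ ρ C δ Γ) {θ : Param p q} (hθ : ‖θ - θ₀‖ ≤ ρ) {φ : Vec m}
    (hφ : φ ≠ 0) : 0 < quad (Y.K2 θ) φ := by
  have h1 := h.quad_lower hθ φ
  have h2 : 0 < δ ^ 2 * ‖φ‖ ^ 2 := by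
    have := h.δ_pos
    positivity
  linarith

theorem Reg.K2_posDef (h : Y.Reg θ₀ ρ C δ Γ) {θ : Param p q} (hθ : ‖θ - θ₀‖ ≤ ρ) :
    (Y.K2 θ).PosDef := by
  refine Matrix.PosDef.of_dotProduct_mulVec_pos ?_ fun x hx => ?_
  · rw [Matrix.IsHermitian, Matrix.conjTranspose_eq_transpose_of_trivial]
    exact K2_transpose (h.mem_goodSet hθ)
  · have := h.quad_pos hθ (φ := WithLp.toLp 2 x) (by simpa using hx)
    simpa [quad] using this

theorem continuous_complexMGF {s : Vec m} {θ : Param p q} (hs : (s, θ) ∈ Y.convSet) :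
    Continuous fun φ => Y.complexMGF φ (s, θ) := by
  unfold complexMGF
  refine continuous_of_dominated (bound := fun x => Real.exp (inner ℝ s x)) ?_ ?_ hs.2 ?_
  · intro φ
    exact Continuous.aestronglyMeasurable (by fun_prop)
  · exact fun φ => Eventually.of_forall fun x => (norm_cexp_add_mul_I _ _).le
  · exact Eventually.of_forall fun x => by fun_prop

theorem Reg.exists_integrable_pow (h : Y.Reg θ₀ ρ C δ Γ) :
    ∃ N : ℕ, ∀ n : ℕ, N ≤ n → ∀ (s : Vec m) (θ : Param p q), ‖s‖ ≤ ρ → ‖θ - θ₀‖ ≤ ρ →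
      Integrable fun φ => Y.complexMGF φ (s, θ) ^ n := by
  obtain ⟨D, hD1, N, hD⟩ := exists_decay_weight m 0 h.δ_pos
  refine ⟨N + 1, fun n hn s θ hs hθ => ?_⟩
  have hmem := interior_subset (h.mem s θ hs hθ)
  have hn0 : (1 : ℝ) ≤ n := by exact_mod_cast (by omega : 1 ≤ n)
  have hM := (mgf_pos_of_mem hmem).le
  have h1s : 1 ≤ Real.sqrt n := Real.one_le_sqrt.2 hn0
  refine (integrable_wt.const_mul (Y.mgf (s, θ) ^ n * D)).mono'
    ((continuous_complexMGF hmem).pow n).aestronglyMeasurable (Eventually.of_forall fun φ => ?_)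
  have h1 := h.decay s θ φ hs hθ
  rw [G_nil] at h1
  have h2 := hD n n (by omega) (by omega) (Real.sqrt n)⁻¹
    (by rw [inv_pow, Real.sq_sqrt (by positivity), mul_inv_cancel₀ (by positivity)])
    (Real.sqrt n * ‖φ‖) (by positivity)
  rw [pow_zero, one_mul, inv_mul_cancel_left₀ (by positivity)] at h2
  have h3 : (1 + Real.sqrt n * ‖φ‖) ^ (-((m : ℝ) + 1)) ≤ wt φ :=
    Real.rpow_le_rpow_of_nonpos (by positivity) (by nlinarith [norm_nonneg φ]) (by linarith [(Nat.cast_nonneg m : (0:ℝ) ≤ m)])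
  rw [norm_pow]
  calc ‖Y.complexMGF φ (s, θ)‖ ^ n ≤ (Y.mgf (s, θ) * (1 + δ * ‖φ‖ ^ 2) ^ (-δ)) ^ n := by gcongr
    _ = Y.mgf (s, θ) ^ n * ((1 + δ * ‖φ‖ ^ 2) ^ (-δ)) ^ n := mul_pow _ _ _
    _ ≤ Y.mgf (s, θ) ^ n * (D * wt φ) := by
      gcongr
      exact h2.trans (by gcongr)
    _ = _ := by ring

/-- Rescaling of Fourier integrals. -/
theorem integral_rescale {ε : ℝ} (hε : 0 < ε) (f : Vec m → ℂ) :
    ∫ φ, f φ = (ε : ℂ) ^ m * ∫ φ, f (ε • φ) := by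
  rw [Measure.integral_comp_smul, finrank_euclideanSpace_fin, abs_of_pos (by positivity),
    Complex.real_smul]
  push_cast
  rw [mul_inv_cancel_left₀ (pow_ne_zero _ (by exact_mod_cast hε.ne'))]

/-- The normalising factor between densities and rescaled Fourier integrals. -/
def nrm (m k : ℕ) : ℝ := (eps k / (2 * Real.pi)) ^ m

theorem nrm_pos (m k : ℕ) : 0 < nrm m k := by
  have := eps_pos k
  unfold nrm
  positivity

theorem osf_rescale (ε : ℝ) (x φ : Vec m) :
    Complex.exp (-((inner ℝ (ε • φ) x : ℝ) * Complex.I)) = osf (ε • x) φ := by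
  unfold osf
  rw [real_inner_smul_left, real_inner_smul_right]

theorem likelihood_eq_tI {k : ℕ} {θ : Param p q} (hθ : θ ∈ Y.goodSet)
    (h0 : Integrable fun φ => Y.complexMGF φ (0, θ) ^ (k + 3)) (x : Vec m) :
    Y.likelihood (k + 3) x θ = nrm m k * Y.tI k (eps k • x) θ := by
  have h1 := (Y.likelihood_eq_integral (mem_domain_of_goodSet hθ) (interior_subset hθ) h0 h0).2 x
  rw [inner_zero_left, integral_rescale (eps_pos k)] at h1
  simp only [osf_rescale, ← G_nil] at h1
  have h2 : (Y.likelihood (k + 3) x θ : ℂ) = (nrm m k : ℝ) *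
      osc k (eps k • x) fun φ => Y.G [] 0 (eps k • φ) θ := by
    rw [h1, osc, nrm]
    push_cast
    rw [div_pow]
    simp
    ring
  have h3 := congrArg Complex.re h2
  rwa [Complex.ofReal_re, Complex.re_ofReal_mul] at h3

theorem normalLikelihood_eq_nI {k : ℕ} {θ : Param p q} (hθ : θ ∈ Y.goodSet)
    (hpd : (Y.K2 θ).PosDef) (x : Vec m) :
    Y.normalLikelihood (k + 3) x θ = nrm m k * Y.nI k (eps k • x) θ := by
  have hn : (0 : ℝ) < ((k + 3 : ℕ) : ℝ) := by positivity
  have h1 := normalDensity_eq_integral (hpd.smul hn) (((k + 3 : ℕ) : ℝ) • Y.K1 θ) x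
  rw [integral_rescale (eps_pos k)] at h1
  simp only [osf_rescale] at h1
  have h4 : ∀ φ : Vec m, Complex.exp ((inner ℝ φ (((k + 3 : ℕ) : ℝ) • Y.K1 θ) : ℝ) * Complex.I -
      (quad (((k + 3 : ℕ) : ℝ) • Y.K2 θ) φ / 2 : ℝ)) = Y.gN φ θ ^ (k + 3) := by
    intro φ
    rw [gN, jexp_eq φ hθ, ← Complex.exp_nat_mul, real_inner_smul_right]
    congr 1
    have : quad (((k + 3 : ℕ) : ℝ) • Y.K2 θ) φ = ((k + 3 : ℕ) : ℝ) * quad (Y.K2 θ) φ := by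
      simp [quad, Matrix.smul_mulVec]
    rw [this]
    push_cast
    ring
  simp only [h4] at h1
  have h2 : (Y.normalLikelihood (k + 3) x θ : ℂ) = (nrm m k : ℝ) *
      osc k (eps k • x) fun φ => Y.gN (eps k • φ) θ := by
    rw [normalLikelihood, h1, osc, nrm]
    push_cast
    rw [div_pow]
    ring
  have h3 := congrArg Complex.re h2
  rwa [Complex.ofReal_re, Complex.re_ofReal_mul] at h3

end Model

section MatrixCalculus

attribute [local instance] Matrix.linftyOpNormedRing Matrix.linftyOpNormedAlgebra

variable {m : ℕ} {A : ℝ → Matrix (Fin m) (Fin m) ℝ} {A1 : Matrix (Fin m) (Fin m) ℝ} {t : ℝ}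

theorem hasDerivAt_entry (h : HasDerivAt A A1 t) (k l : Fin m) :
    HasDerivAt (fun t => A t k l) (A1 k l) t :=
  (LinearMap.toContinuousLinearMap (Matrix.entryLinearMap ℝ ℝ k l)).hasFDerivAt.comp_hasDerivAt t h

theorem hasDerivAt_matrix_inv (h : HasDerivAt A A1 t) (hA : IsUnit (A t)) :
    HasDerivAt (fun t => (A t)⁻¹) (-((A t)⁻¹ * A1 * (A t)⁻¹)) t := by
  obtain ⟨u, hu⟩ := hA
  have h1 := hasFDerivAt_ringInverse (𝕜 := ℝ) u
  rw [hu] at h1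
  have h2 := h1.comp_hasDerivAt t h
  simp only [Matrix.nonsing_inv_eq_ringInverse]
  refine h2.congr_deriv ?_
  rw [← hu, Ring.inverse_unit]
  simp

theorem hasDerivAt_mulVec {v : ℝ → Fin m → ℝ} {v1 : Fin m → ℝ} (h : HasDerivAt A A1 t)
    (hv : HasDerivAt v v1 t) : HasDerivAt (fun t => A t *ᵥ v t) (A1 *ᵥ v t + A t *ᵥ v1) t := by
  rw [hasDerivAt_pi]
  intro k
  change HasDerivAt (fun x => ∑ l, A x k l * v x l) _ t
  refine (HasDerivAt.fun_sum fun l _ => (hasDerivAt_entry h k l).fun_mul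
    (hasDerivAt_pi.1 hv l)).congr_deriv ?_
  simp [Matrix.mulVec, dotProduct, Finset.sum_add_distrib]

theorem hasDerivAt_dotProduct {v w : ℝ → Fin m → ℝ} {v1 w1 : Fin m → ℝ} (hv : HasDerivAt v v1 t)
    (hw : HasDerivAt w w1 t) : HasDerivAt (fun t => v t ⬝ᵥ w t) (v1 ⬝ᵥ w t + v t ⬝ᵥ w1) t := by
  refine (HasDerivAt.fun_sum fun l _ => (hasDerivAt_pi.1 hv l).fun_mul
    (hasDerivAt_pi.1 hw l)).congr_deriv ?_
  simp [dotProduct, Finset.sum_add_distrib]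

theorem hasDerivAt_trace (h : HasDerivAt A A1 t) :
    HasDerivAt (fun t => (A t).trace) A1.trace t :=
  HasDerivAt.fun_sum fun l _ => hasDerivAt_entry h l l

theorem hasDerivAt_det_one_add_smul (M : Matrix (Fin m) (Fin m) ℝ) :
    HasDerivAt (fun r : ℝ => (1 + r • M).det) M.trace 0 := by
  have h : (fun r : ℝ => (1 + r • M).det) =
      fun r => 1 + M.trace * r +
        (Matrix.det (1 + (Polynomial.X : Polynomial ℝ) • M.map Polynomial.C)).divX.divX.eval r * r ^ 2 := by
    ext r
    exact Matrix.det_one_add_smul r M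
  rw [h]
  have h2 := ((((hasDerivAt_id (0 : ℝ)).const_mul M.trace).const_add 1).add
    ((Polynomial.hasDerivAt (Matrix.det (1 + (Polynomial.X : Polynomial ℝ) • M.map Polynomial.C)).divX.divX
      0).fun_mul (hasDerivAt_pow 2 (0 : ℝ))))
  refine h2.congr_deriv ?_
  simp

theorem hasDerivAt_det (h : HasDerivAt A A1 t) (hA : IsUnit (A t)) :
    HasDerivAt (fun t => (A t).det) ((A t).det * ((A t)⁻¹ * A1).trace) t := by
  have hdiff : DifferentiableAt ℝ (fun M : Matrix (Fin m) (Fin m) ℝ => M.det) (A t) := by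
    simp only [Matrix.det_apply]
    refine DifferentiableAt.fun_sum fun σ _ => DifferentiableAt.const_smul ?_ _
    have hc : ContDiff ℝ 1 fun M : Matrix (Fin m) (Fin m) ℝ => ∏ i, M (σ i) i :=
      contDiff_prod fun i _ =>
        (LinearMap.toContinuousLinearMap (Matrix.entryLinearMap ℝ ℝ (σ i) i)).contDiff
    exact (hc.differentiable (by simp)).differentiableAt
  have h1 := hdiff.hasFDerivAt.comp_hasDerivAt t h
  refine h1.congr_deriv ?_
  have h2 : HasDerivAt (fun r : ℝ => A t + r • A1) A1 0 :=
    (((hasDerivAt_id (0 : ℝ)).smul_const A1).const_add (A t)).congr_deriv (one_smul ℝ A1)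
  have h3 : HasDerivAt (fun r : ℝ => (A t + r • A1).det)
      (fderiv ℝ (fun M : Matrix (Fin m) (Fin m) ℝ => M.det) (A t) A1) 0 := by
    refine HasFDerivAt.comp_hasDerivAt (l := fun M : Matrix (Fin m) (Fin m) ℝ => M.det) 0 ?_ h2
    rw [zero_smul, add_zero]
    exact hdiff.hasFDerivAt
  have h4 := (hasDerivAt_det_one_add_smul ((A t)⁻¹ * A1)).const_mul (A t).det
  refine h3.unique (h4.congr_of_eventuallyEq (Eventually.of_forall fun r => ?_))
  have h5 : A t + r • A1 = A t * (1 + r • ((A t)⁻¹ * A1)) := by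
    rw [Matrix.mul_add, Matrix.mul_one, Matrix.mul_smul, ← Matrix.mul_assoc,
      Matrix.mul_nonsing_inv _ ((Matrix.isUnit_iff_isUnit_det _).1 hA), Matrix.one_mul]
  simp only [h5, Matrix.det_mul]

end MatrixCalculus

section GaussianLog

attribute [local instance] Matrix.linftyOpNormedRing Matrix.linftyOpNormedAlgebra

variable {m : ℕ}

/-- The logarithm of a Gaussian density, up to constants. -/
def gLog (A : Matrix (Fin m) (Fin m) ℝ) (w : Fin m → ℝ) : ℝ :=
  -(1 / 2) * (w ⬝ᵥ (A⁻¹ *ᵥ w)) - 1 / 2 * Real.log A.det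

/-- The derivative of `gLog`. -/
def gLog1 (A A1 : Matrix (Fin m) (Fin m) ℝ) (w w1 : Fin m → ℝ) : ℝ :=
  -(w1 ⬝ᵥ (A⁻¹ *ᵥ w)) + 1 / 2 * ((A⁻¹ *ᵥ w) ⬝ᵥ (A1 *ᵥ (A⁻¹ *ᵥ w))) - 1 / 2 * (A⁻¹ * A1).trace

/-- The second derivative of `gLog`. -/
def gLog2 (A A1 A2 : Matrix (Fin m) (Fin m) ℝ) (w w1 w2 : Fin m → ℝ) : ℝ :=
  -(w2 ⬝ᵥ (A⁻¹ *ᵥ w)) -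
    (w1 - A1 *ᵥ (A⁻¹ *ᵥ w)) ⬝ᵥ (A⁻¹ *ᵥ (w1 - A1 *ᵥ (A⁻¹ *ᵥ w))) +
    1 / 2 * ((A⁻¹ *ᵥ w) ⬝ᵥ (A2 *ᵥ (A⁻¹ *ᵥ w))) - 1 / 2 * (A⁻¹ * A2).trace +
    1 / 2 * (A⁻¹ * A1 * (A⁻¹ * A1)).trace

theorem dotProduct_mulVec_symm {S : Matrix (Fin m) (Fin m) ℝ} (hS : Sᵀ = S) (v w : Fin m → ℝ) :
    v ⬝ᵥ (S *ᵥ w) = w ⬝ᵥ (S *ᵥ v) := by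
  rw [Matrix.dotProduct_mulVec, ← Matrix.mulVec_transpose, hS, dotProduct_comm]

variable {A A1 : ℝ → Matrix (Fin m) (Fin m) ℝ} {A2 : Matrix (Fin m) (Fin m) ℝ}
  {w w1 : ℝ → Fin m → ℝ} {w2 : Fin m → ℝ} {t : ℝ}

theorem hasDerivAt_solve (hA : HasDerivAt A (A1 t) t) (hpd : (A t).PosDef)
    (hw : HasDerivAt w (w1 t) t) :
    HasDerivAt (fun t => (A t)⁻¹ *ᵥ w t) ((A t)⁻¹ *ᵥ (w1 t - A1 t *ᵥ ((A t)⁻¹ *ᵥ w t))) t := by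
  refine (hasDerivAt_mulVec (hasDerivAt_matrix_inv hA hpd.isUnit) hw).congr_deriv ?_
  rw [Matrix.mulVec_sub, Matrix.neg_mulVec, Matrix.mulVec_mulVec, Matrix.mulVec_mulVec]
  abel

theorem inv_transpose_of_symm {A : Matrix (Fin m) (Fin m) ℝ} (h : Aᵀ = A) : (A⁻¹)ᵀ = A⁻¹ := by
  rw [Matrix.transpose_nonsing_inv, h]

theorem posDef_transpose {A : Matrix (Fin m) (Fin m) ℝ} (h : A.PosDef) : Aᵀ = A := by
  have := h.isHermitian
  rwa [Matrix.IsHermitian, Matrix.conjTranspose_eq_transpose_of_trivial] at this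

theorem hasDerivAt_gLog (hA : HasDerivAt A (A1 t) t) (hpd : (A t).PosDef)
    (hw : HasDerivAt w (w1 t) t) :
    HasDerivAt (fun t => gLog (A t) (w t)) (gLog1 (A t) (A1 t) (w t) (w1 t)) t := by
  have h1 := hasDerivAt_dotProduct hw (hasDerivAt_solve hA hpd hw)
  have h2 := (hasDerivAt_det hA hpd.isUnit).log hpd.det_pos.ne'
  refine ((h1.const_mul (-(1 / 2))).sub (h2.const_mul (1 / 2))).congr_deriv ?_
  have hS := inv_transpose_of_symm (posDef_transpose hpd)
  rw [mul_div_cancel_left₀ _ hpd.det_pos.ne', dotProduct_mulVec_symm hS (w t), sub_dotProduct,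
    dotProduct_comm (A1 t *ᵥ _)]
  unfold gLog1
  ring

theorem hasDerivAt_gLog1 (hA : HasDerivAt A (A1 t) t) (hA1 : HasDerivAt A1 A2 t)
    (hpd : (A t).PosDef) (hs : (A1 t)ᵀ = A1 t) (hw : HasDerivAt w (w1 t) t)
    (hw1 : HasDerivAt w1 w2 t) :
    HasDerivAt (fun t => gLog1 (A t) (A1 t) (w t) (w1 t))
      (gLog2 (A t) (A1 t) A2 (w t) (w1 t) w2) t := by
  have hP := hasDerivAt_solve hA hpd hw
  have h1 := hasDerivAt_dotProduct hw1 hP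
  have h2 := hasDerivAt_dotProduct hP (hasDerivAt_mulVec hA1 hP)
  have h3 := hasDerivAt_trace ((hasDerivAt_matrix_inv hA hpd.isUnit).mul hA1)
  refine ((h1.neg.add (h2.const_mul (1 / 2))).sub (h3.const_mul (1 / 2))).congr_deriv ?_
  set P := (A t)⁻¹ *ᵥ w t
  set Q := (A t)⁻¹ *ᵥ (w1 t - A1 t *ᵥ P)
  have h4 : P ⬝ᵥ (A1 t *ᵥ Q) = Q ⬝ᵥ (A1 t *ᵥ P) := dotProduct_mulVec_symm hs P Q
  have h5 : (w1 t - A1 t *ᵥ P) ⬝ᵥ Q = w1 t ⬝ᵥ Q - Q ⬝ᵥ (A1 t *ᵥ P) := by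
    rw [sub_dotProduct, dotProduct_comm (A1 t *ᵥ P)]
  unfold gLog2
  rw [h5, dotProduct_add, h4, Matrix.trace_add, Matrix.neg_mul, Matrix.trace_neg,
    Matrix.mul_assoc ((A t)⁻¹ * A1 t)]
  ring

end GaussianLog


namespace Model

variable {m p q : ℕ} {Y : Model m p q} {θ₀ : Param p q} {ρ C δ K : ℝ} {Γ Λ : ℕ}

section MeanStructure

variable {θ : Param p q}

theorem hasFDerivAt_fderiv_K1 (hg : Y.GrowthBound) (hθ : θ ∈ Y.goodSet) :
    HasFDerivAt (fderiv ℝ Y.K1) (fderiv ℝ (fderiv ℝ Y.K1) θ) θ :=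
  ((((contDiffOn_K1 hg).fderiv_of_isOpen isOpen_goodSet (m := 1) (by norm_num)).differentiableOn
    (by simp)).differentiableAt (isOpen_goodSet.mem_nhds hθ)).hasFDerivAt

theorem K1_add_nu (hmean : Y.MeanCond) (hθ : θ ∈ Y.goodSet)
    (η : Vec q) (hη : θ + (0, η) ∈ Y.goodSet) : Y.K1 (θ + (0, η)) = Y.K1 θ := by
  have : θ + (0, η) = (θ.1, θ.2 + η) := by ext1 <;> simp
  rw [this] at hη ⊢
  rw [hmean θ.1 _ θ.2 hη hθ]

theorem fderiv_K1_nu (hg : Y.GrowthBound) (hmean : Y.MeanCond) (hθ : θ ∈ Y.goodSet) (η : Vec q) :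
    fderiv ℝ Y.K1 θ (0, η) = 0 := by
  refine fderiv_apply_eq_zero_of_line (hasFDerivAt_K1 hg hθ) ?_
  filter_upwards [eventually_line_mem isOpen_goodSet hθ (0, η)] with t ht
  have h1 : t • ((0, η) : Param p q) = (0, t • η) := by simp
  rw [h1] at ht ⊢
  exact K1_add_nu hmean hθ _ ht

theorem fderiv_fderiv_K1_nu (hg : Y.GrowthBound) (hmean : Y.MeanCond) (hθ : θ ∈ Y.goodSet)
    (e : Param p q) (η : Vec q) : fderiv ℝ (fderiv ℝ Y.K1) θ (0, η) e = 0 := by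
  have hsymm := second_derivative_symmetric_of_eventually (f := Y.K1) (f' := fderiv ℝ Y.K1)
    (by filter_upwards [isOpen_goodSet.mem_nhds hθ] with y hy using hasFDerivAt_K1 hg hy)
    (hasFDerivAt_fderiv_K1 hg hθ) (0, η) e
  rw [hsymm]
  have h1 := (ContinuousLinearMap.apply ℝ (Vec m) ((0, η) : Param p q)).hasFDerivAt.comp θ
    (hasFDerivAt_fderiv_K1 hg hθ)
  exact fderiv_apply_eq_zero_of_line (e := e) h1 (by
    filter_upwards [eventually_line_mem isOpen_goodSet hθ e] with t ht
    exact (fderiv_K1_nu hg hmean ht η).trans (fderiv_K1_nu hg hmean hθ η).symm)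

theorem scl_eq (ε : ℝ) (e : Param p q) : scl ε e = ε • (e.1, (0 : Vec q)) + (0, e.2) := by
  ext1 <;> simp [scl]

theorem fderiv_K1_scl (hg : Y.GrowthBound) (hmean : Y.MeanCond) (hθ : θ ∈ Y.goodSet) (ε : ℝ)
    (e : Param p q) : fderiv ℝ Y.K1 θ (scl ε e) = ε • fderiv ℝ Y.K1 θ (e.1, 0) := by
  rw [scl_eq, map_add, map_smul, fderiv_K1_nu hg hmean hθ, add_zero]

theorem fderiv_fderiv_K1_scl (hg : Y.GrowthBound) (hmean : Y.MeanCond) (hθ : θ ∈ Y.goodSet)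
    (ε : ℝ) (e : Param p q) : fderiv ℝ (fderiv ℝ Y.K1) θ (scl ε e) (e.1, 0) =
      ε • fderiv ℝ (fderiv ℝ Y.K1) θ (e.1, 0) (e.1, 0) := by
  rw [scl_eq, map_add, map_smul]
  exact (congrArg₂ (· + ·) rfl (fderiv_fderiv_K1_nu hg hmean hθ _ _)).trans (add_zero _)

end MeanStructure

section ClosedForm

attribute [local instance] Matrix.linftyOpNormedAddCommGroup Matrix.linftyOpNormedSpace

variable {θ : Param p q}

theorem fderiv_K2_transpose (hg : Y.GrowthBound) (hθ : θ ∈ Y.goodSet) (e : Param p q) :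
    (fderiv ℝ Y.K2 θ e)ᵀ = fderiv ℝ Y.K2 θ e := by
  have h1 : ∀ k l, HasDerivAt (fun t : ℝ => Y.K2 (θ + t • e) k l) (fderiv ℝ Y.K2 θ e k l) 0 :=
    fun k l => (entryCLM k l).hasFDerivAt.comp_hasDerivAt 0
      (hasDerivAt_line (x := θ) (e := e) (t := 0) (by rw [zero_smul, add_zero]; exact hasFDerivAt_K2 hg hθ))
  ext k l
  refine (h1 l k).unique ((h1 k l).congr_of_eventuallyEq ?_)
  filter_upwards [eventually_line_mem isOpen_goodSet hθ e] with t ht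
  exact congrFun (congrFun (K2_transpose ht) k) l

variable (Y) in
/-- The derivative of the logarithm of the Gaussian approximation in a rescaled direction, for a
given value `w` of the standardised observation. -/
def lD (ε : ℝ) (θ : Param p q) (w : Vec m) (e : Param p q) : ℝ :=
  gLog1 (Y.K2 θ) (fderiv ℝ Y.K2 θ (scl ε e)) w.ofLp (-(fderiv ℝ Y.K1 θ (e.1, 0)).ofLp)

variable (Y) in
/-- The second derivative of the logarithm of the Gaussian approximation in a rescaled direction. -/
def lH (ε : ℝ) (θ : Param p q) (w : Vec m) (e : Param p q) : ℝ :=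
  gLog2 (Y.K2 θ) (fderiv ℝ Y.K2 θ (scl ε e)) (fderiv ℝ (fderiv ℝ Y.K2) θ (scl ε e) (scl ε e))
    w.ofLp (-(fderiv ℝ Y.K1 θ (e.1, 0)).ofLp)
    (-(ε • fderiv ℝ (fderiv ℝ Y.K1) θ (e.1, 0) (e.1, 0)).ofLp)

variable (Y) in
/-- The standardised observation. -/
def wv (k : ℕ) (a : Vec m) (θ : Param p q) : Vec m := a - (eps k)⁻¹ • Y.K1 θ

/-- The constant in the closed form of Gaussian Fourier integrals. -/
def gc (m : ℕ) : ℝ := Real.sqrt ((2 * Real.pi) ^ m)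

theorem gc_pos (m : ℕ) : 0 < gc m := by unfold gc; positivity

theorem nI_eq (hθ : θ ∈ Y.goodSet) (hpd : (Y.K2 θ).PosDef) (k : ℕ) (a : Vec m) :
    Y.nI k a θ = gc m * Real.exp (gLog (Y.K2 θ) (Y.wv k a θ).ofLp) := by
  have he := eps_pos k
  have hn : (0 : ℝ) < ((k + 3 : ℕ) : ℝ) := by positivity
  have hne := mul_eps_sq k
  set n : ℝ := ((k + 3 : ℕ) : ℝ)
  have h1 := normalLikelihood_eq_nI (k := k) hθ hpd ((eps k)⁻¹ • a)
  rw [smul_smul, mul_inv_cancel₀ he.ne', one_smul] at h1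
  have h2 : (eps k)⁻¹ • a - n • Y.K1 θ = (eps k)⁻¹ • Y.wv k a θ := by
    rw [wv, smul_sub, smul_smul]
    congr 2
    field_simp
    linarith
  have hdet := hpd.det_pos
  have h3 : quad (n • Y.K2 θ)⁻¹ ((eps k)⁻¹ • a - n • Y.K1 θ) =
      (Y.wv k a θ).ofLp ⬝ᵥ ((Y.K2 θ)⁻¹ *ᵥ (Y.wv k a θ).ofLp) := by
    have h4 : (n • Y.K2 θ)⁻¹ = n⁻¹ • (Y.K2 θ)⁻¹ := by
      refine Matrix.inv_eq_left_inv ?_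
      rw [Matrix.smul_mul, Matrix.mul_smul, smul_smul, inv_mul_cancel₀ hn.ne', one_smul,
        Matrix.nonsing_inv_mul _ (isUnit_iff_ne_zero.2 hdet.ne')]
    rw [h2, h4, quad_smul, quad, Matrix.smul_mulVec, dotProduct_smul, smul_eq_mul, ← mul_assoc]
    have : (eps k)⁻¹ ^ 2 * n⁻¹ = 1 := by
      rw [inv_pow, ← mul_inv, mul_comm, hne, inv_one]
    rw [this, one_mul]
  have h5 : Real.sqrt (((2 * Real.pi) • (n • Y.K2 θ)).det) =
      Real.sqrt ((2 * Real.pi) ^ m) * Real.sqrt (n ^ m) * Real.sqrt (Y.K2 θ).det := by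
    rw [Matrix.det_smul, Matrix.det_smul, Fintype.card_fin, Real.sqrt_mul (by positivity),
      Real.sqrt_mul (by positivity), mul_assoc]
  have h6 : Real.exp (gLog (Y.K2 θ) (Y.wv k a θ).ofLp) =
      Real.exp (-(1 / 2) * ((Y.wv k a θ).ofLp ⬝ᵥ ((Y.K2 θ)⁻¹ *ᵥ (Y.wv k a θ).ofLp))) /
        Real.sqrt (Y.K2 θ).det := by
    rw [gLog, Real.exp_sub]
    congr 1
    rw [Real.sqrt_eq_rpow, Real.rpow_def_of_pos hdet, mul_comm]
  rw [normalLikelihood, normalDensity, h3, h5] at h1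
  rw [h6]
  have h7 : nrm m k * gc m * (Real.sqrt ((2 * Real.pi) ^ m) * Real.sqrt (n ^ m)) = 1 := by
    unfold nrm gc
    have h8 : Real.sqrt ((2 * Real.pi) ^ m) * Real.sqrt ((2 * Real.pi) ^ m) = (2 * Real.pi) ^ m :=
      Real.mul_self_sqrt (by positivity)
    have h9 : Real.sqrt (n ^ m) = ((eps k) ^ m)⁻¹ := by
      rw [Real.sqrt_eq_iff_mul_self_eq (by positivity) (by positivity), ← mul_inv, ← mul_pow,
        ← inv_pow]
      congr 1
      rw [← sq]
      field_simp
      linarith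
    rw [h9, div_pow]
    field_simp
    rw [sq, h8]
  have hnr := nrm_pos m k
  refine mul_left_cancel₀ hnr.ne' (h1.symm.trans ?_)
  have hs := Real.sqrt_pos.2 hdet
  have hd : 0 < Real.sqrt ((2 * Real.pi) ^ m) * Real.sqrt (n ^ m) := by positivity
  rw [← div_div, div_eq_iff hs.ne', div_eq_iff hd.ne']
  field_simp
  linear_combination -h7

variable {k : ℕ} {a : Vec m} {e : Param p q} {t : ℝ}

theorem hasDerivAt_ofLp {v : ℝ → Vec m} {v' : Vec m} {t : ℝ} (h : HasDerivAt v v' t) :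
    HasDerivAt (fun t => (v t).ofLp) v'.ofLp t := by
  rw [hasDerivAt_pi]
  exact fun i => (EuclideanSpace.proj (𝕜 := ℝ) i : Vec m →L[ℝ] ℝ).hasFDerivAt.comp_hasDerivAt t h

theorem hasDerivAt_wv (hg : Y.GrowthBound) (hmean : Y.MeanCond)
    (ht : θ + t • scl (eps k) e ∈ Y.goodSet) :
    HasDerivAt (fun t : ℝ => (Y.wv k a (θ + t • scl (eps k) e)).ofLp)
      (-(fderiv ℝ Y.K1 (θ + t • scl (eps k) e) (e.1, 0)).ofLp) t := by
  have h1 := (hasDerivAt_line (hasFDerivAt_K1 hg ht))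
  rw [fderiv_K1_scl hg hmean ht] at h1
  have h2 := (h1.const_smul (eps k)⁻¹).const_sub a
  rw [smul_smul, inv_mul_cancel₀ (eps_pos k).ne', one_smul] at h2
  exact hasDerivAt_ofLp h2

theorem hasDerivAt_wv1 (hg : Y.GrowthBound) (hmean : Y.MeanCond)
    (ht : θ + t • scl (eps k) e ∈ Y.goodSet) :
    HasDerivAt (fun t : ℝ => -(fderiv ℝ Y.K1 (θ + t • scl (eps k) e) (e.1, 0)).ofLp)
      (-((eps k) • fderiv ℝ (fderiv ℝ Y.K1) (θ + t • scl (eps k) e) (e.1, 0) (e.1, 0)).ofLp) t := by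
  have h1 := (ContinuousLinearMap.apply ℝ (Vec m) ((e.1, 0) : Param p q)).hasFDerivAt.comp_hasDerivAt t
    (hasDerivAt_line (hasFDerivAt_fderiv_K1 hg ht))
  have h2 := h1.congr_deriv (fderiv_fderiv_K1_scl hg hmean ht (eps k) e)
  exact (hasDerivAt_ofLp h2).neg

theorem hasDerivAt_K2_line (hg : Y.GrowthBound) (ht : θ + t • e ∈ Y.goodSet) :
    HasDerivAt (fun t : ℝ => Y.K2 (θ + t • e)) (fderiv ℝ Y.K2 (θ + t • e) e) t :=
  hasDerivAt_line (hasFDerivAt_K2 hg ht)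

theorem hasDerivAt_dK2_line (hg : Y.GrowthBound) (ht : θ + t • e ∈ Y.goodSet) :
    HasDerivAt (fun t : ℝ => fderiv ℝ Y.K2 (θ + t • e) e)
      (fderiv ℝ (fderiv ℝ Y.K2) (θ + t • e) e e) t :=
  (ContinuousLinearMap.apply ℝ (Matrix (Fin m) (Fin m) ℝ) e).hasFDerivAt.comp_hasDerivAt t
    (hasDerivAt_line (hasFDerivAt_fderiv_K2 hg ht))

theorem hasDerivAt_gLog_line (hg : Y.GrowthBound) (hmean : Y.MeanCond)
    (ht : θ + t • scl (eps k) e ∈ Y.goodSet) (hpd : (Y.K2 (θ + t • scl (eps k) e)).PosDef) :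
    HasDerivAt (fun t : ℝ => gLog (Y.K2 (θ + t • scl (eps k) e))
        (Y.wv k a (θ + t • scl (eps k) e)).ofLp)
      (Y.lD (eps k) (θ + t • scl (eps k) e) (Y.wv k a (θ + t • scl (eps k) e)) e) t :=
  hasDerivAt_gLog (A1 := fun t => fderiv ℝ Y.K2 (θ + t • scl (eps k) e) (scl (eps k) e))
    (w1 := fun t => -(fderiv ℝ Y.K1 (θ + t • scl (eps k) e) (e.1, 0)).ofLp)
    (hasDerivAt_K2_line hg ht) hpd (hasDerivAt_wv hg hmean ht)

theorem hasDerivAt_lD_line (hg : Y.GrowthBound) (hmean : Y.MeanCond)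
    (ht : θ + t • scl (eps k) e ∈ Y.goodSet) (hpd : (Y.K2 (θ + t • scl (eps k) e)).PosDef) :
    HasDerivAt (fun t : ℝ => Y.lD (eps k) (θ + t • scl (eps k) e)
        (Y.wv k a (θ + t • scl (eps k) e)) e)
      (Y.lH (eps k) (θ + t • scl (eps k) e) (Y.wv k a (θ + t • scl (eps k) e)) e) t :=
  hasDerivAt_gLog1 (A1 := fun t => fderiv ℝ Y.K2 (θ + t • scl (eps k) e) (scl (eps k) e))
    (w1 := fun t => -(fderiv ℝ Y.K1 (θ + t • scl (eps k) e) (e.1, 0)).ofLp)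
    (hasDerivAt_K2_line hg ht) (hasDerivAt_dK2_line hg ht) hpd (fderiv_K2_transpose hg ht _)
    (hasDerivAt_wv hg hmean ht) (hasDerivAt_wv1 hg hmean ht)

end ClosedForm

end Model

theorem le_of_second_deriv_le {h h1 h2 : ℝ → ℝ} {c : ℝ}
    (hd : ∀ t ∈ Icc (0 : ℝ) 1, HasDerivAt h (h1 t) t)
    (hd' : ∀ t ∈ Icc (0 : ℝ) 1, HasDerivAt h1 (h2 t) t)
    (hb : ∀ t ∈ Icc (0 : ℝ) 1, h2 t ≤ -c) :
    h 1 ≤ h 0 + h1 0 - c / 2 ∧ h1 1 ≤ h1 0 - c := by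
  have key : ∀ {g g1 : ℝ → ℝ}, (∀ t ∈ Icc (0 : ℝ) 1, HasDerivAt g (g1 t) t) →
      (∀ t ∈ Icc (0 : ℝ) 1, g1 t ≤ 0) → AntitoneOn g (Icc 0 1) := fun hg hg1 =>
    antitoneOn_of_hasDerivWithinAt_nonpos (convex_Icc 0 1)
      (fun t ht => (hg t ht).continuousAt.continuousWithinAt)
      (fun t ht => (hg t (interior_subset ht)).hasDerivWithinAt)
      (fun t ht => hg1 t (interior_subset ht))
  have h01 : (0 : ℝ) ∈ Icc (0 : ℝ) 1 := by simp
  have h11 : (1 : ℝ) ∈ Icc (0 : ℝ) 1 := by simp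
  have a1 := key (g := fun t => h1 t + c * t) (g1 := fun t => h2 t + c)
    (fun t ht => by
      have := (hd' t ht).add ((hasDerivAt_id t).const_mul c)
      rw [mul_one] at this
      exact this) (fun t ht => by linarith [hb t ht])
  have a2 := key (g := fun t => h t + (c / 2 * t ^ 2 - h1 0 * t)) (g1 := fun t => h1 t + (c * t - h1 0))
    (fun t ht => by
      have h2 := (((hasDerivAt_pow 2 t).const_mul (c / 2)).sub ((hasDerivAt_id t).const_mul (h1 0)))
      refine ((hd t ht).add h2).congr_deriv ?_
      simp
      ring) (fun t ht => by
      have := a1 h01 ht ht.1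
      simp only [mul_zero, add_zero] at this
      linarith)
  constructor
  · have := a2 h01 h11 zero_le_one
    simp at this
    linarith
  · have := a1 h01 h11 zero_le_one
    simp at this
    linarith

theorem hasDerivAt_line_shift {E F : Type*} [AddCommGroup E] [Module ℝ E] [NormedAddCommGroup F]
    [NormedSpace ℝ F] {f : E → F} {x d : E} {t : ℝ} {f' : F}
    (h : HasDerivAt (fun s : ℝ => f (x + t • d + s • d)) f' 0) :
    HasDerivAt (fun s : ℝ => f (x + s • d)) f' t := by
  have h1 : HasDerivAt (fun s : ℝ => f (x + t • d + s • d)) f' (t - t) := by rwa [sub_self]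
  have h2 := h1.comp_sub_const t t
  refine h2.congr_of_eventuallyEq (Eventually.of_forall fun s => ?_)
  simp only
  rw [add_assoc, ← add_smul, add_sub_cancel]

section Peak

variable {p q : ℕ}

/-- A function `f` of the parameter with derivatives `f1` and `f2` along scaled directions whose
logarithm is strongly concave on `Q`. -/
structure Peak (U Q : Set (Param p q)) (ε c : ℝ) (f : Param p q → ℝ)
    (f1 f2 : Param p q → Param p q → ℝ) : Prop where
  convex : Convex ℝ Q
  subset : Q ⊆ U
  deriv : ∀ θ ∈ U, ∀ e, HasDerivAt (fun t : ℝ => f (θ + t • scl ε e)) (f1 θ e) 0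
  deriv1 : ∀ θ ∈ Q, ∀ e, HasDerivAt (fun t : ℝ => f1 (θ + t • scl ε e) e) (f2 θ e) 0
  pos : ∀ θ ∈ Q, 0 < f θ
  conc : ∀ θ ∈ Q, ∀ e, f2 θ e / f θ - (f1 θ e / f θ) ^ 2 ≤ -(c * ‖e‖ ^ 2)

variable {U Q : Set (Param p q)} {ε c : ℝ} {f : Param p q → ℝ}
  {f1 f2 : Param p q → Param p q → ℝ} {θ θ' e : Param p q}

theorem Peak.segment (h : Peak U Q ε c f f1 f2) (hθ : θ ∈ Q) (hθ' : θ + scl ε e ∈ Q) :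
    Real.log (f (θ + scl ε e)) ≤ Real.log (f θ) + f1 θ e / f θ - c * ‖e‖ ^ 2 / 2 ∧
      f1 (θ + scl ε e) e / f (θ + scl ε e) ≤ f1 θ e / f θ - c * ‖e‖ ^ 2 := by
  have hmem : ∀ t ∈ Icc (0 : ℝ) 1, θ + t • scl ε e ∈ Q := fun t ht => by
    have := h.convex.add_smul_sub_mem hθ hθ' ht
    rwa [add_sub_cancel_left] at this
  have hd : ∀ t ∈ Icc (0 : ℝ) 1, HasDerivAt (fun t : ℝ => f (θ + t • scl ε e))
      (f1 (θ + t • scl ε e) e) t := fun t ht =>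
    hasDerivAt_line_shift (h.deriv _ (h.subset (hmem t ht)) e)
  have hd1 : ∀ t ∈ Icc (0 : ℝ) 1, HasDerivAt (fun t : ℝ => f1 (θ + t • scl ε e) e)
      (f2 (θ + t • scl ε e) e) t := fun t ht =>
    hasDerivAt_line_shift (f := fun θ => f1 θ e) (h.deriv1 _ (hmem t ht) e)
  have := le_of_second_deriv_le (h := fun t => Real.log (f (θ + t • scl ε e)))
    (h1 := fun t => f1 (θ + t • scl ε e) e / f (θ + t • scl ε e))
    (h2 := fun t => f2 (θ + t • scl ε e) e / f (θ + t • scl ε e) -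
      (f1 (θ + t • scl ε e) e / f (θ + t • scl ε e)) ^ 2) (c := c * ‖e‖ ^ 2)
    (fun t ht => (hd t ht).log (h.pos _ (hmem t ht)).ne')
    (fun t ht => by
      have hp := (h.pos _ (hmem t ht)).ne'
      refine ((hd1 t ht).div (hd t ht) hp).congr_deriv ?_
      field_simp)
    (fun t ht => h.conc _ (hmem t ht) e)
  simpa using this

theorem Peak.deriv_eq_zero_of_isLocalMax (h : Peak U Q ε c f f1 f2) (hθ : θ ∈ U)
    (hm : IsLocalMax f θ) (e : Param p q) : f1 θ e = 0 := by
  have hc : Tendsto (fun t : ℝ => θ + t • scl ε e) (nhds 0) (nhds θ) := by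
    have : Continuous fun t : ℝ => θ + t • scl ε e := by fun_prop
    simpa using this.tendsto 0
  have h1 : IsLocalMax (fun t : ℝ => f (θ + t • scl ε e)) 0 := by
    unfold IsLocalMax IsMaxFilter
    simp only [zero_smul, add_zero]
    exact hc.eventually hm
  exact h1.hasDerivAt_eq_zero (h.deriv θ hθ e)

theorem scl_zero (ε : ℝ) : scl ε (0 : Param p q) = 0 := by ext1 <;> simp [scl]

theorem exists_scl_eq (hε : ε ≠ 0) (d : Param p q) : ∃ e, scl ε e = d :=
  ⟨(ε⁻¹ • d.1, d.2), by ext1 <;> simp [scl, smul_smul, hε]⟩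

theorem Peak.exists_isMaximiserIn (h : Peak U Q ε c f f1 f2) (hU : IsOpen U) (hε : 0 < ε) (hc : 0 < c)
    (hf : ContinuousOn f U) {z : Param p q} {a τ : ℝ} (ha : 0 < a)
    (hbox : ∀ q, ‖q‖ ≤ a → z + scl ε q ∈ Q)
    (hcent : ∀ e, f1 z e ≤ τ * ‖e‖ * f z) (hτ : τ < c * a / 2)
    (hrad : ∀ θ ∈ U, θ ∉ Q → ∃ e : Param p q, ∃ b ∈ Ioo (0 : ℝ) 1,
      θ + b • scl ε e ∈ Q ∧ ∀ t ∈ Icc 0 b, θ + t • scl ε e ∈ U ∧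
        0 < f1 (θ + t • scl ε e) e) :
    ∃ θ ∈ Q, IsMaximiserIn f U θ := by
  have hz : z ∈ Q := by
    have h0 := hbox 0 (by simpa using ha.le)
    rwa [scl_zero, add_zero] at h0
  have hcomp : IsCompact ((fun q => z + scl ε q) '' closedBall (0 : Param p q) a) := by
    refine (isCompact_closedBall _ _).image ?_
    unfold scl
    fun_prop
  have hsub : (fun q => z + scl ε q) '' closedBall (0 : Param p q) a ⊆ Q := by
    rintro _ ⟨q, hq, rfl⟩
    exact hbox q (by simpa using hq)
  obtain ⟨_, ⟨q, hq, rfl⟩, hmax⟩ := hcomp.exists_isMaxOn ⟨z, 0, by simpa using ha.le, by simp only [scl_zero, add_zero]⟩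
    (hf.mono (hsub.trans h.subset))
  have hqa : ‖q‖ ≤ a := by simpa using hq
  have hQq := hbox q hqa
  have hzle : f z ≤ f (z + scl ε q) := hmax ⟨0, by simpa using ha.le, by simp only [scl_zero, add_zero]⟩
  have hlt : ‖q‖ < a := by
    refine lt_of_le_of_ne hqa fun heq => ?_
    have h1 := (h.segment hz hQq).1
    have h2 := Real.log_le_log (h.pos z hz) hzle
    have h3 := hcent q
    have h4 : f1 z q / f z ≤ τ * ‖q‖ := by
      rw [div_le_iff₀ (h.pos z hz)]
      exact h3
    rw [heq] at h1 h4
    nlinarith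
  have hcrit : ∀ e, f1 (z + scl ε q) e = 0 := by
    intro e
    have h0 : IsLocalMax (fun t : ℝ => f (z + scl ε q + t • scl ε e)) 0 := by
      have hcq : Continuous fun t : ℝ => ‖q + t • e‖ := by fun_prop
      have := (isOpen_lt hcq continuous_const).mem_nhds (x := (0 : ℝ)) (by simpa using hlt)
      filter_upwards [this] with t ht
      have h1 : z + scl ε q + t • scl ε e = z + scl ε (q + t • e) := by
        ext1
        · simp [scl, smul_smul, mul_comm t, add_assoc]
        · simp [scl, add_assoc]
      simp only [zero_smul, add_zero]
      rw [h1]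
      exact hmax ⟨q + t • e, by simpa using (le_of_lt ht), rfl⟩
    exact h0.hasDerivAt_eq_zero (h.deriv _ (h.subset hQq) e)
  set θ := z + scl ε q
  have hQmax : ∀ θ' ∈ Q, f θ' ≤ f θ := by
    intro θ' hθ'
    obtain ⟨e, he⟩ := exists_scl_eq hε.ne' (θ' - θ)
    have h1 := (h.segment hQq (e := e) (by rwa [he, add_sub_cancel])).1
    rw [he, add_sub_cancel, hcrit, zero_div, add_zero] at h1
    refine (Real.log_le_log_iff (h.pos _ hθ') (h.pos _ hQq)).1 (h1.trans ?_)
    have : 0 ≤ c * ‖e‖ ^ 2 / 2 := by positivity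
    linarith
  have hUmax : ∀ θ' ∈ U, f θ' ≤ f θ := by
    intro θ' hθ'
    by_cases hQ : θ' ∈ Q
    · exact hQmax _ hQ
    obtain ⟨e, b, hb, hbQ, hline⟩ := hrad θ' hθ' hQ
    have hmono : MonotoneOn (fun t : ℝ => f (θ' + t • scl ε e)) (Icc 0 b) := by
      have hd : ∀ t ∈ Icc 0 b, HasDerivAt (fun t : ℝ => f (θ' + t • scl ε e))
        (f1 (θ' + t • scl ε e) e) t := fun t ht =>
        hasDerivAt_line_shift (h.deriv _ (hline t ht).1 e)
      exact monotoneOn_of_hasDerivWithinAt_nonneg (convex_Icc 0 b)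
        (fun t ht => (hd t ht).continuousAt.continuousWithinAt)
        (fun t ht => (hd t (interior_subset ht)).hasDerivWithinAt)
        (fun t ht => (hline t (interior_subset ht)).2.le)
    have := hmono (left_mem_Icc.2 hb.1.le) (right_mem_Icc.2 hb.1.le) hb.1.le
    simp only [zero_smul, add_zero] at this
    exact this.trans (hQmax _ hbQ)
  refine ⟨θ, hQq, h.subset hQq, ?_, ?_, hUmax⟩
  · filter_upwards [hU.mem_nhds (h.subset hQq)] with θ' hθ' using hUmax θ' hθ'
  · intro θ' hθ' hm
    by_cases hQ : θ' ∈ Q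
    · obtain ⟨e, he⟩ := exists_scl_eq hε.ne' (θ - θ')
      have h1 := (h.segment hQ (e := e) (by rwa [he, add_sub_cancel])).2
      rw [h.deriv_eq_zero_of_isLocalMax hθ' hm, he, add_sub_cancel, hcrit, zero_div, zero_div] at h1
      have h2 : ‖e‖ ^ 2 ≤ 0 := by
        by_contra h3
        push Not at h3
        nlinarith
      have h3 : e = 0 := by
        rw [← norm_eq_zero]
        exact pow_eq_zero_iff two_ne_zero |>.1 (le_antisymm h2 (sq_nonneg _))
      have h4 : θ - θ' = 0 := by rw [← he, h3]; exact scl_zero ε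
      exact (sub_eq_zero.1 h4).symm
    · obtain ⟨e, b, hb, -, hline⟩ := hrad θ' hθ' hQ
      have h1 := (hline 0 (left_mem_Icc.2 hb.1.le)).2
      simp only [zero_smul, add_zero] at h1
      rw [h.deriv_eq_zero_of_isLocalMax hθ' hm] at h1
      exact absurd h1 (lt_irrefl _)

theorem Peak.dist_le {g : Param p q → ℝ} {g1 g2 : Param p q → Param p q → ℝ} {K : ℝ}
    (h : Peak U Q ε c f f1 f2) (h' : Peak U Q ε c g g1 g2) (hε : 0 < ε) (hc : 0 < c) (hK : 0 ≤ K)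
    (hfg : ∀ θ ∈ Q, ∀ e, |g1 θ e / g θ - f1 θ e / f θ| ≤ K * ε * ‖e‖) (hθ : θ ∈ Q) (hθ' : θ' ∈ Q)
    (hm : IsMaximiserIn f U θ) (hm' : IsMaximiserIn g U θ') :
    ‖θ.1 - θ'.1‖ ≤ K / c * ε ^ 2 ∧ ‖θ.2 - θ'.2‖ ≤ K / c * ε := by
  obtain ⟨e, he⟩ := exists_scl_eq hε.ne' (θ' - θ)
  have h1 := (h.segment hθ (e := e) (by rwa [he, add_sub_cancel])).2
  have h2 := hfg θ' hθ' e
  rw [h'.deriv_eq_zero_of_isLocalMax hm'.1 hm'.2.1, zero_div, zero_sub, abs_neg] at h2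
  rw [h.deriv_eq_zero_of_isLocalMax hm.1 hm.2.1, he, add_sub_cancel, zero_div, zero_sub] at h1
  have h3 := (abs_le.1 h2).1
  have h4 : ‖e‖ ≤ K / c * ε := by
    rcases (norm_nonneg e).eq_or_lt with h0 | h0
    · rw [← h0]
      positivity
    · rw [div_mul_eq_mul_div, le_div_iff₀ hc]
      nlinarith
  have h5 : ‖ε • e.1‖ ≤ ε * ‖e‖ := by
    rw [norm_smul, Real.norm_eq_abs, abs_of_pos hε]
    gcongr
    exact norm_fst_le e
  have h6 := congrArg Prod.fst he
  have h7 := congrArg Prod.snd he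
  simp only [scl, Prod.fst_sub, Prod.snd_sub] at h6 h7
  rw [norm_sub_rev, norm_sub_rev θ.2, ← h6, ← h7]
  exact ⟨h5.trans (by nlinarith), (norm_snd_le e).trans h4⟩

end Peak


section Schur

variable {m p : ℕ} {A A1 A2 : Matrix (Fin m) (Fin m) ℝ} {B : Matrix (Fin m) (Fin p) ℝ}
  {v : Fin p → ℝ} {w x ξ : Fin m → ℝ}

/-- The matrix `A⁻¹ - A⁻¹ B (Bᵀ A⁻¹ B)⁻¹ Bᵀ A⁻¹`. -/
def Jmat (A : Matrix (Fin m) (Fin m) ℝ) (B : Matrix (Fin m) (Fin p) ℝ) :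
    Matrix (Fin m) (Fin m) ℝ :=
  A⁻¹ - A⁻¹ * B * (Bᵀ * A⁻¹ * B)⁻¹ * Bᵀ * A⁻¹

theorem posDef_gram (hA : A.PosDef) (hB : Function.Injective B.mulVec) :
    (Bᵀ * A⁻¹ * B).PosDef := by
  simpa using hA.inv.conjTranspose_mul_mul_same hB

theorem gram_transpose (hA : A.PosDef) : (Bᵀ * A⁻¹ * B)ᵀ = Bᵀ * A⁻¹ * B := by
  have := inv_transpose_of_symm (posDef_transpose hA)
  simp [Matrix.transpose_mul, this, Matrix.mul_assoc]

theorem Jmat_transpose (hA : A.PosDef) : (Jmat A B)ᵀ = Jmat A B := by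
  have h1 := inv_transpose_of_symm (posDef_transpose hA)
  have h2 := inv_transpose_of_symm (gram_transpose (B := B) hA)
  simp only [Jmat, Matrix.transpose_sub, Matrix.transpose_mul, Matrix.transpose_transpose, h1, h2]
  simp only [Matrix.mul_assoc]

theorem Jmat_mul (hA : A.PosDef) (hB : Function.Injective B.mulVec) : Jmat A B * B = 0 := by
  have h := Matrix.nonsing_inv_mul _ (isUnit_iff_ne_zero.2 (posDef_gram hA hB).det_pos.ne')
  rw [Jmat, Matrix.sub_mul, sub_eq_zero]
  have : A⁻¹ * B * (Bᵀ * A⁻¹ * B)⁻¹ * Bᵀ * A⁻¹ * B =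
      A⁻¹ * B * ((Bᵀ * A⁻¹ * B)⁻¹ * (Bᵀ * A⁻¹ * B)) := by
    simp only [Matrix.mul_assoc]
  rw [this, h, Matrix.mul_one]

theorem dotProduct_Jmat_le (hA : A.PosDef) (hB : Function.Injective B.mulVec) :
    x ⬝ᵥ (Jmat A B *ᵥ x) ≤ x ⬝ᵥ (A⁻¹ *ᵥ x) := by
  have hS := inv_transpose_of_symm (posDef_transpose hA)
  have h1 := (posDef_gram hA hB).inv.posSemidef.dotProduct_mulVec_nonneg (Bᵀ *ᵥ (A⁻¹ *ᵥ x))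
  have h2 : x ⬝ᵥ ((A⁻¹ * B * (Bᵀ * A⁻¹ * B)⁻¹ * Bᵀ * A⁻¹) *ᵥ x) =
      (Bᵀ *ᵥ (A⁻¹ *ᵥ x)) ⬝ᵥ ((Bᵀ * A⁻¹ * B)⁻¹ *ᵥ (Bᵀ *ᵥ (A⁻¹ *ᵥ x))) := by
    simp only [← Matrix.mulVec_mulVec]
    rw [Matrix.dotProduct_mulVec, ← Matrix.mulVec_transpose, hS, Matrix.dotProduct_mulVec,
      ← Matrix.mulVec_transpose]
  rw [Jmat, Matrix.sub_mulVec, dotProduct_sub, h2]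
  simp only [star_trivial] at h1
  linarith

theorem trace_comm_le {S T : Matrix (Fin m) (Fin m) ℝ} (hS : Sᵀ = S) (hT : Tᵀ = T) :
    (S * T * (S * T)).trace ≤ (S ^ 2 * T * T).trace := by
  have h1 := (Matrix.posSemidef_conjTranspose_mul_self (S * T - T * S)).trace_nonneg
  rw [Matrix.conjTranspose_eq_transpose_of_trivial, Matrix.transpose_sub, Matrix.transpose_mul,
    Matrix.transpose_mul, hS, hT, Matrix.sub_mul, Matrix.mul_sub, Matrix.mul_sub] at h1
  simp only [Matrix.trace_sub] at h1
  have e1 : (T * S * (S * T)).trace = (S ^ 2 * T * T).trace := by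
    rw [Matrix.mul_assoc, Matrix.trace_mul_comm, sq]
    simp only [Matrix.mul_assoc]
  have e2 : (T * S * (T * S)).trace = (S * T * (S * T)).trace := by
    rw [Matrix.mul_assoc, Matrix.trace_mul_comm]
    simp only [Matrix.mul_assoc]
  have e3 : (S * T * (T * S)).trace = (S ^ 2 * T * T).trace := by
    rw [Matrix.trace_mul_comm (S * T), Matrix.mul_assoc, Matrix.trace_mul_comm, sq]
    simp only [Matrix.mul_assoc]
  rw [e1, e2, e3] at h1
  linarith

theorem gLog2_le (hA : A.PosDef) (hB : Function.Injective B.mulVec) (hA1 : A1ᵀ = A1) :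
    gLog2 A A1 A2 w (-(B *ᵥ v)) 0 ≤
      (A⁻¹ *ᵥ w) ⬝ᵥ (((1 / 2 : ℝ) • A2 - A1 * Jmat A B * A1) *ᵥ (A⁻¹ *ᵥ w)) -
        1 / 2 * (A⁻¹ * A2 - A⁻¹ ^ 2 * A1 * A1).trace := by
  have hS := inv_transpose_of_symm (posDef_transpose hA)
  have h1 := trace_comm_le hS hA1
  set P := A⁻¹ *ᵥ w with hP
  have h2 := dotProduct_Jmat_le (x := B *ᵥ v + A1 *ᵥ P) hA hB
  have hJB : Jmat A B *ᵥ (B *ᵥ v) = 0 := by rw [Matrix.mulVec_mulVec, Jmat_mul hA hB, Matrix.zero_mulVec]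
  have h3 : (B *ᵥ v) ⬝ᵥ (Jmat A B *ᵥ (A1 *ᵥ P)) = 0 := by
    rw [Matrix.dotProduct_mulVec, ← Matrix.mulVec_transpose, Jmat_transpose hA, hJB,
      zero_dotProduct]
  rw [Matrix.mulVec_add, hJB, zero_add, add_dotProduct, h3, zero_add] at h2
  have h4 : P ⬝ᵥ ((A1 * Jmat A B * A1) *ᵥ P) = (A1 *ᵥ P) ⬝ᵥ (Jmat A B *ᵥ (A1 *ᵥ P)) := by
    rw [Matrix.mul_assoc, ← Matrix.mulVec_mulVec, Matrix.dotProduct_mulVec,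
      ← Matrix.mulVec_transpose, hA1, ← Matrix.mulVec_mulVec]
  have h5 : -(B *ᵥ v) - A1 *ᵥ P = -(B *ᵥ v + A1 *ᵥ P) := by abel
  rw [Matrix.sub_mulVec, dotProduct_sub, h4, Matrix.smul_mulVec, dotProduct_smul, Matrix.trace_sub,
    smul_eq_mul]
  unfold gLog2
  rw [← hP, h5, Matrix.mulVec_neg, neg_dotProduct_neg, zero_dotProduct, Matrix.mulVec_add] at *
  linarith

theorem gLog2_zero_neg (hA : A.PosDef) (hB : Function.Injective B.mulVec) (hv : v ≠ 0) :
    gLog2 A 0 0 w (-(B *ᵥ v)) 0 < 0 := by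
  have h1 : B *ᵥ v ≠ 0 := fun h => hv (hB (h.trans (Matrix.mulVec_zero B).symm))
  have h2 := hA.inv.dotProduct_mulVec_pos h1
  simp only [star_trivial] at h2
  unfold gLog2
  simp only [Matrix.zero_mulVec, sub_zero, zero_dotProduct, dotProduct_zero, Matrix.trace_zero, mul_zero, Matrix.mulVec_neg, neg_dotProduct_neg]
  linarith

/-- The vector `ξ - B (Bᵀ A⁻¹ B)⁻¹ Bᵀ A⁻¹ ξ`. -/
def resid (A : Matrix (Fin m) (Fin m) ℝ) (B : Matrix (Fin m) (Fin p) ℝ) (ξ : Fin m → ℝ) :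
    Fin m → ℝ :=
  ξ - B *ᵥ (((Bᵀ * A⁻¹ * B)⁻¹ * Bᵀ * A⁻¹) *ᵥ ξ)

theorem inv_mulVec_resid : A⁻¹ *ᵥ resid A B ξ = Jmat A B *ᵥ ξ := by
  simp [resid, Jmat, Matrix.mulVec_sub, Matrix.sub_mulVec, Matrix.mulVec_mulVec, Matrix.mul_assoc]

theorem dotProduct_inv_resid (hA : A.PosDef) (hB : Function.Injective B.mulVec) :
    (B *ᵥ v) ⬝ᵥ (A⁻¹ *ᵥ resid A B ξ) = 0 := by
  rw [inv_mulVec_resid, Matrix.dotProduct_mulVec, ← Matrix.mulVec_transpose, Jmat_transpose hA,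
    Matrix.mulVec_mulVec, Jmat_mul hA hB, Matrix.zero_mulVec, zero_dotProduct]

theorem mulVec_injective_of_rank (hB : B.rank = p) : Function.Injective B.mulVec := by
  have h1 := B.mulVecLin.finrank_range_add_finrank_ker
  have h2 : Module.finrank ℝ B.mulVecLin.ker = 0 := by
    have : Module.finrank ℝ B.mulVecLin.range = p := hB
    simp at h1
    omega
  exact LinearMap.ker_eq_bot.1 (Submodule.finrank_eq_zero.1 h2)

end Schur


section GLogContinuity

variable {m : ℕ} {X : Type*} [TopologicalSpace X] {A A1 A2 : X → Matrix (Fin m) (Fin m) ℝ}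
  {w w1 w2 : X → Fin m → ℝ} {x : X}

theorem continuousAt_of_entry (hA : ∀ k l, ContinuousAt (fun z => A z k l) x) : ContinuousAt A x :=
  continuousAt_pi.2 fun k => continuousAt_pi.2 fun l => hA k l

theorem continuousAt_det (hA : ContinuousAt A x) : ContinuousAt (fun z => (A z).det) x :=
  ContinuousAt.comp (g := Matrix.det) (continuous_id.matrix_det.continuousAt) hA

theorem continuousAt_matrix_inv (hA : ContinuousAt A x) (h : (A x).det ≠ 0) :
    ContinuousAt (fun z => (A z)⁻¹) x := by
  simp only [Matrix.inv_def, Ring.inverse_eq_inv']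
  exact ((continuousAt_det hA).inv₀ h).smul
    (ContinuousAt.comp (g := Matrix.adjugate) (continuous_id.matrix_adjugate.continuousAt) hA)

theorem continuousAt_mulVec (hA : ContinuousAt A x) (hw : ContinuousAt w x) :
    ContinuousAt (fun z => A z *ᵥ w z) x :=
  ContinuousAt.comp (g := fun p : Matrix (Fin m) (Fin m) ℝ × (Fin m → ℝ) => p.1 *ᵥ p.2)
    (continuous_fst.matrix_mulVec continuous_snd).continuousAt (hA.prodMk hw)

theorem continuousAt_dotProduct (hw : ContinuousAt w x) (hw1 : ContinuousAt w1 x) :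
    ContinuousAt (fun z => w z ⬝ᵥ w1 z) x :=
  ContinuousAt.comp (g := fun p : (Fin m → ℝ) × (Fin m → ℝ) => p.1 ⬝ᵥ p.2)
    (continuous_fst.dotProduct continuous_snd).continuousAt (hw.prodMk hw1)

theorem continuousAt_trace (hA : ContinuousAt A x) : ContinuousAt (fun z => (A z).trace) x :=
  ContinuousAt.comp (g := Matrix.trace) (continuous_id.matrix_trace.continuousAt) hA

theorem continuousAt_gLog (hA : ContinuousAt A x) (h : (A x).det ≠ 0) (hw : ContinuousAt w x) :
    ContinuousAt (fun z => gLog (A z) (w z)) x :=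
  ((continuousAt_dotProduct hw (continuousAt_mulVec (continuousAt_matrix_inv hA h) hw)).const_mul
    _).sub (((continuousAt_det hA).log h).const_mul _)

theorem continuousAt_gLog1 (hA : ContinuousAt A x) (h : (A x).det ≠ 0) (hA1 : ContinuousAt A1 x)
    (hw : ContinuousAt w x) (hw1 : ContinuousAt w1 x) :
    ContinuousAt (fun z => gLog1 (A z) (A1 z) (w z) (w1 z)) x := by
  have hS := continuousAt_matrix_inv hA h
  have hP := continuousAt_mulVec hS hw
  exact ((continuousAt_dotProduct hw1 hP).neg.add
    ((continuousAt_dotProduct hP (continuousAt_mulVec hA1 hP)).const_mul _)).sub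
    ((continuousAt_trace (hS.mul hA1)).const_mul _)

theorem continuousAt_gLog2 (hA : ContinuousAt A x) (h : (A x).det ≠ 0) (hA1 : ContinuousAt A1 x)
    (hA2 : ContinuousAt A2 x) (hw : ContinuousAt w x) (hw1 : ContinuousAt w1 x)
    (hw2 : ContinuousAt w2 x) :
    ContinuousAt (fun z => gLog2 (A z) (A1 z) (A2 z) (w z) (w1 z) (w2 z)) x := by
  have hS := continuousAt_matrix_inv hA h
  have hP := continuousAt_mulVec hS hw
  have hR := hw1.sub (continuousAt_mulVec hA1 hP)
  exact ((((continuousAt_dotProduct hw2 hP).neg.sub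
    (continuousAt_dotProduct hR (continuousAt_mulVec hS hR))).add
    ((continuousAt_dotProduct hP (continuousAt_mulVec hA2 hP)).const_mul _)).sub
    ((continuousAt_trace (hS.mul hA2)).const_mul _)).add
    ((continuousAt_trace ((hS.mul hA1).mul (hS.mul hA1))).const_mul _)

theorem gLog1_smul (A A1 : Matrix (Fin m) (Fin m) ℝ) (w w1 : Fin m → ℝ) (t : ℝ) :
    gLog1 A (t • A1) w (t • w1) = t * gLog1 A A1 w w1 := by
  simp only [gLog1, smul_dotProduct, Matrix.smul_mulVec, dotProduct_smul, Matrix.mul_smul,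
    Matrix.trace_smul, smul_eq_mul]
  ring

theorem gLog2_smul (A A1 A2 : Matrix (Fin m) (Fin m) ℝ) (w w1 w2 : Fin m → ℝ) (t : ℝ) :
    gLog2 A (t • A1) (t • t • A2) w (t • w1) (t • t • w2) = t ^ 2 * gLog2 A A1 A2 w w1 w2 := by
  simp only [gLog2, smul_dotProduct, Matrix.smul_mulVec, dotProduct_smul, Matrix.mul_smul,
    Matrix.smul_mul, Matrix.mulVec_smul, ← smul_sub, Matrix.trace_smul, smul_eq_mul]
  ring

end GLogContinuity

namespace Model

variable {m p q : ℕ} {Y : Model m p q} {θ₀ θ : Param p q} {ρ C δ K : ℝ} {Γ N : ℕ}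

section Continuity

theorem continuousAt_fderiv_K1 (hg : Y.GrowthBound) (hθ : θ ∈ Y.goodSet) :
    ContinuousAt (fderiv ℝ Y.K1) θ :=
  (hasFDerivAt_fderiv_K1 hg hθ).continuousAt

theorem continuousAt_fderiv2_K1 (hg : Y.GrowthBound) (hθ : θ ∈ Y.goodSet) :
    ContinuousAt (fderiv ℝ (fderiv ℝ Y.K1)) θ :=
  (((((contDiffOn_K1 hg).fderiv_of_isOpen isOpen_goodSet (m := 1) (by norm_num)).fderiv_of_isOpen
    isOpen_goodSet (m := 0) (by norm_num))).continuousOn).continuousAt (isOpen_goodSet.mem_nhds hθ)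

attribute [local instance] Matrix.linftyOpNormedAddCommGroup Matrix.linftyOpNormedSpace

theorem continuousAt_K2_entry (hg : Y.GrowthBound) (hθ : θ ∈ Y.goodSet) (k l : Fin m) :
    ContinuousAt (fun θ => Y.K2 θ k l) θ :=
  (entryCLM k l).continuous.continuousAt.comp (hasFDerivAt_K2 hg hθ).continuousAt

theorem continuousAt_fderiv2_K2 (hg : Y.GrowthBound) (hθ : θ ∈ Y.goodSet) :
    ContinuousAt (fderiv ℝ (fderiv ℝ Y.K2)) θ :=
  (((((contDiffOn_K2 hg).fderiv_of_isOpen isOpen_goodSet (m := 1) (by norm_num)).fderiv_of_isOpen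
    isOpen_goodSet (m := 0) (by norm_num))).continuousOn).continuousAt (isOpen_goodSet.mem_nhds hθ)

variable {X : Type*} [TopologicalSpace X] {x : X} {T E E' : X → Param p q}

theorem continuousAt_dK2_entry (hg : Y.GrowthBound) (hT : ContinuousAt T x) (hE : ContinuousAt E x)
    (hθ : T x ∈ Y.goodSet) (k l : Fin m) :
    ContinuousAt (fun z => fderiv ℝ Y.K2 (T z) (E z) k l) x :=
  (entryCLM k l).continuous.continuousAt.comp
    ((ContinuousAt.comp (g := fderiv ℝ Y.K2) (hasFDerivAt_fderiv_K2 hg hθ).continuousAt hT).clm_apply hE)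

theorem continuousAt_ddK2_entry (hg : Y.GrowthBound) (hT : ContinuousAt T x) (hE : ContinuousAt E x)
    (hθ : T x ∈ Y.goodSet) (k l : Fin m) :
    ContinuousAt (fun z => fderiv ℝ (fderiv ℝ Y.K2) (T z) (E z) (E z) k l) x :=
  (entryCLM k l).continuous.continuousAt.comp
    (((ContinuousAt.comp (g := fderiv ℝ (fderiv ℝ Y.K2)) (continuousAt_fderiv2_K2 hg hθ) hT).clm_apply
      hE).clm_apply hE)

end Continuity

section Continuity

variable {X : Type*} [TopologicalSpace X] {x : X} {T E : X → Param p q} {W : X → Vec m}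
  {ε : X → ℝ}

theorem continuousAt_ofLp {d : ℕ} {V : X → Vec d} (hV : ContinuousAt V x) :
    ContinuousAt (fun z => (V z).ofLp) x :=
  (PiLp.continuous_ofLp 2 _).continuousAt.comp hV

theorem continuousAt_scl (hε : ContinuousAt ε x) (hE : ContinuousAt E x) :
    ContinuousAt (fun z => scl (ε z) (E z)) x := by
  unfold scl
  exact (hε.smul hE.fst).prodMk hE.snd

theorem continuousAt_lD (hg : Y.GrowthBound) (hε : ContinuousAt ε x) (hT : ContinuousAt T x)
    (hW : ContinuousAt W x) (hE : ContinuousAt E x) (hθ : T x ∈ Y.goodSet)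
    (hdet : (Y.K2 (T x)).det ≠ 0) :
    ContinuousAt (fun z => Y.lD (ε z) (T z) (W z) (E z)) x :=
  continuousAt_gLog1
    (continuousAt_of_entry fun k l => ContinuousAt.comp (g := fun θ => Y.K2 θ k l)
      (continuousAt_K2_entry hg hθ k l) hT) hdet
    (continuousAt_of_entry (continuousAt_dK2_entry hg hT (continuousAt_scl hε hE) hθ))
    (continuousAt_ofLp hW)
    (continuousAt_ofLp ((ContinuousAt.comp (g := fderiv ℝ Y.K1) (continuousAt_fderiv_K1 hg hθ)
      hT).clm_apply (hE.fst.prodMk continuousAt_const))).neg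

theorem continuousAt_lH (hg : Y.GrowthBound) (hε : ContinuousAt ε x) (hT : ContinuousAt T x)
    (hW : ContinuousAt W x) (hE : ContinuousAt E x) (hθ : T x ∈ Y.goodSet)
    (hdet : (Y.K2 (T x)).det ≠ 0) :
    ContinuousAt (fun z => Y.lH (ε z) (T z) (W z) (E z)) x := by
  have hE0 : ContinuousAt (fun z => (((E z).1, 0) : Param p q)) x :=
    hE.fst.prodMk continuousAt_const
  exact continuousAt_gLog2
    (continuousAt_of_entry fun k l => ContinuousAt.comp (g := fun θ => Y.K2 θ k l)
      (continuousAt_K2_entry hg hθ k l) hT) hdet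
    (continuousAt_of_entry (continuousAt_dK2_entry hg hT (continuousAt_scl hε hE) hθ))
    (continuousAt_of_entry (continuousAt_ddK2_entry hg hT (continuousAt_scl hε hE) hθ))
    (continuousAt_ofLp hW)
    (continuousAt_ofLp ((ContinuousAt.comp (g := fderiv ℝ Y.K1) (continuousAt_fderiv_K1 hg hθ)
      hT).clm_apply hE0)).neg
    (continuousAt_ofLp (hε.smul (((ContinuousAt.comp (g := fderiv ℝ (fderiv ℝ Y.K1))
      (continuousAt_fderiv2_K1 hg hθ) hT).clm_apply hE0).clm_apply hE0))).neg

theorem scl_smul (ε t : ℝ) (e : Param p q) : scl ε (t • e) = t • scl ε e := by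
  ext1 <;> simp [scl, smul_comm t ε]

theorem smul_fst_zero (t : ℝ) (e : Param p q) :
    (((t • e).1, 0) : Param p q) = t • (e.1, 0) := by ext1 <;> simp

theorem lD_smul (ε : ℝ) (θ : Param p q) (w : Vec m) (t : ℝ) (e : Param p q) :
    Y.lD ε θ w (t • e) = t * Y.lD ε θ w e := by
  unfold lD
  rw [scl_smul, smul_fst_zero, map_smul, map_smul, ← gLog1_smul, smul_neg]
  rfl

theorem lH_smul (ε : ℝ) (θ : Param p q) (w : Vec m) (t : ℝ) (e : Param p q) :
    Y.lH ε θ w (t • e) = t ^ 2 * Y.lH ε θ w e := by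
  unfold lH
  rw [scl_smul, smul_fst_zero, map_smul, map_smul, map_smul, map_smul, ← gLog2_smul, smul_neg]
  simp only [smul_apply, map_smul, smul_neg, smul_comm ε]
  rfl

end Continuity

theorem eventually_forall_of_sphere {X : Type*} [TopologicalSpace X] {E : Type*}
    [NormedAddCommGroup E] [NormedSpace ℝ E] [FiniteDimensional ℝ E] {x : X} {P : X → E → Prop}
    (h : ∀ e : E, ‖e‖ = 1 → ∀ᶠ z : X × E in nhds (x, e), P z.1 z.2) :
    ∀ᶠ z in nhds x, ∀ e, ‖e‖ = 1 → P z e := by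
  have : ProperSpace E := FiniteDimensional.proper ℝ E
  have := (isCompact_sphere (0 : E) 1).eventually_forall_of_forall_eventually (x₀ := x) (P := P)
    fun e he => h e (by simpa using he)
  filter_upwards [this] with z hz e he using hz e (by simpa using he)

theorem exists_unit_smul {E : Type*} [NormedAddCommGroup E] [NormedSpace ℝ E] {e : E} (he : e ≠ 0) :
    ∃ u : E, ‖u‖ = 1 ∧ e = ‖e‖ • u := by
  refine ⟨‖e‖⁻¹ • e, ?_, ?_⟩
  · rw [norm_smul, norm_inv, norm_norm, inv_mul_cancel₀ (norm_ne_zero_iff.2 he)]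
  · rw [smul_smul, mul_inv_cancel₀ (norm_ne_zero_iff.2 he), one_smul]

section Local

variable {w₀ : Vec m}

theorem eventually_lH_le (hg : Y.GrowthBound) (hθ : θ₀ ∈ Y.goodSet) (hdet : (Y.K2 θ₀).det ≠ 0)
    (hneg : ∀ e, e ≠ 0 → Y.lH 0 θ₀ w₀ e < 0) :
    ∃ c > 0, ∀ᶠ z : ℝ × Param p q × Vec m in nhds (0, θ₀, w₀),
      ∀ e, Y.lH z.1 z.2.1 z.2.2 e ≤ -(c * ‖e‖ ^ 2) := by
  have hcont : ∀ z : (ℝ × Param p q × Vec m) × Param p q, z.1 = (0, θ₀, w₀) →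
      ContinuousAt (fun z : (ℝ × Param p q × Vec m) × Param p q =>
        Y.lH z.1.1 z.1.2.1 z.1.2.2 z.2) z := fun z hz =>
    continuousAt_lH hg (by fun_prop) (by fun_prop) (by fun_prop) (by fun_prop) (by rwa [hz])
      (by rwa [hz])
  obtain ⟨c, hc, hcle⟩ : ∃ c > 0, ∀ e : Param p q, ‖e‖ = 1 → Y.lH 0 θ₀ w₀ e < -c := by
    rcases (sphere (0 : Param p q) 1).eq_empty_or_nonempty with h0 | h0
    · refine ⟨1, one_pos, fun e he => ?_⟩
      have : e ∈ sphere (0 : Param p q) 1 := by simpa using he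
      rw [h0] at this
      exact this.elim
    · obtain ⟨u, hu, hmax⟩ := (isCompact_sphere (0 : Param p q) 1).exists_isMaxOn h0
        (f := fun e => Y.lH 0 θ₀ w₀ e) fun e _ =>
          (ContinuousAt.comp (f := fun e : Param p q => (((0 : ℝ), θ₀, w₀), e))
            (hcont ((0, θ₀, w₀), e) rfl) (by fun_prop)).continuousWithinAt
      have hu1 : ‖u‖ = 1 := by simpa using hu
      have hu0 := hneg u (by rintro rfl; simp at hu1)
      refine ⟨-Y.lH 0 θ₀ w₀ u / 2, by linarith, fun e he => ?_⟩
      have : Y.lH 0 θ₀ w₀ e ≤ Y.lH 0 θ₀ w₀ u := hmax (by simpa using he : e ∈ _)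
      linarith
  refine ⟨c, hc, ?_⟩
  have := eventually_forall_of_sphere (x := ((0 : ℝ), θ₀, w₀))
    (P := fun z e => Y.lH z.1 z.2.1 z.2.2 e < -c)
    fun e he => (hcont ((0, θ₀, w₀), e) rfl).eventually (gt_mem_nhds (hcle e he))
  filter_upwards [this] with z hz e
  rcases eq_or_ne e 0 with rfl | he
  · have := lH_smul (Y := Y) z.1 z.2.1 z.2.2 0 0
    simp at this
    simp [this]
  · obtain ⟨u, hu, hue⟩ := exists_unit_smul he
    rw [hue, lH_smul, norm_smul, hu, norm_norm, mul_one]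
    nlinarith [hz u hu, sq_nonneg ‖e‖]

theorem eventually_lD_le (hg : Y.GrowthBound) (hθ : θ₀ ∈ Y.goodSet) (hdet : (Y.K2 θ₀).det ≠ 0)
    (hzero : ∀ e, Y.lD 0 θ₀ w₀ e = 0) {τ : ℝ} (hτ : 0 < τ) :
    ∀ᶠ z : ℝ × Param p q × Vec m in nhds (0, θ₀, w₀),
      ∀ e, Y.lD z.1 z.2.1 z.2.2 e ≤ τ * ‖e‖ := by
  have := eventually_forall_of_sphere (x := ((0 : ℝ), θ₀, w₀))
    (P := fun z e => Y.lD z.1 z.2.1 z.2.2 e < τ)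
    fun e he => (continuousAt_lD (Y := Y) (x := (((0 : ℝ), θ₀, w₀), e))
      (ε := fun z : (ℝ × Param p q × Vec m) × Param p q => z.1.1) (T := fun z => z.1.2.1)
      (W := fun z => z.1.2.2) (E := fun z => z.2) hg (by fun_prop) (by fun_prop) (by fun_prop)
      (by fun_prop) hθ hdet).eventually (gt_mem_nhds ((hzero e).trans_lt hτ))
  filter_upwards [this] with z hz e
  rcases eq_or_ne e 0 with rfl | he
  · have := lD_smul (Y := Y) z.1 z.2.1 z.2.2 0 0
    simp at this
    simp [this]
  · obtain ⟨u, hu, hue⟩ := exists_unit_smul he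
    rw [hue, lD_smul, norm_smul, hu, norm_norm, mul_one]
    nlinarith [hz u hu, norm_nonneg e]

end Local

end Model


namespace Model

variable {m p q : ℕ} {Y : Model m p q} {θ₀ θ : Param p q} {ρ C δ K : ℝ} {Γ N k : ℕ}

section Centre

variable {ξ₀ w₀ : Vec m} {e : Param p q}

theorem scl_zero_left (e : Param p q) : scl 0 e = (0, e.2) := by ext1 <;> simp [scl]

theorem quad_conj {J : Matrix (Fin m) (Fin m) ℝ} (hJ : Jᵀ = J) (M : Matrix (Fin m) (Fin m) ℝ)
    (ξ : Vec m) : quad (J * M * J) ξ = (J *ᵥ ξ.ofLp) ⬝ᵥ (M *ᵥ (J *ᵥ ξ.ofLp)) := by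
  rw [quad, Matrix.mul_assoc, ← Matrix.mulVec_mulVec, Matrix.dotProduct_mulVec,
    ← Matrix.mulVec_transpose, hJ, Matrix.mulVec_mulVec]

theorem lD_centre_eq_zero (hg : Y.GrowthBound) (hθ : θ₀ ∈ Y.goodSet) (hpd : (Y.K2 θ₀).PosDef)
    (hB : Function.Injective (Y.Bomega θ₀).mulVec)
    (hξ₀ : ∀ j : Fin q, quad (Y.J θ₀ * Y.dK2 j θ₀ * Y.J θ₀) ξ₀ =
      Matrix.trace ((Y.K2 θ₀)⁻¹ * Y.dK2 j θ₀))
    (hw₀ : w₀.ofLp = resid (Y.K2 θ₀) (Y.Bomega θ₀) ξ₀.ofLp) (e : Param p q) :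
    Y.lD 0 θ₀ w₀ e = 0 := by
  have hJ : Y.J θ₀ = Jmat (Y.K2 θ₀) (Y.Bomega θ₀) := rfl
  have hJt := Jmat_transpose (B := Y.Bomega θ₀) hpd
  unfold lD gLog1
  rw [scl_zero_left, fderiv_K2_nu hg hθ, fderiv_K1_apply hg hθ, neg_dotProduct, hw₀,
    dotProduct_inv_resid hpd hB, inv_mulVec_resid]
  simp only [hJ, quad_conj hJt] at hξ₀
  simp only [Matrix.sum_mulVec, dotProduct_sum, Matrix.smul_mulVec, dotProduct_smul, Matrix.mul_sum,
    Matrix.mul_smul, Matrix.trace_sum, Matrix.trace_smul, hξ₀]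
  ring

theorem quadratic_eq (J : Matrix (Fin m) (Fin m) ℝ) (S : Matrix (Fin m) (Fin m) ℝ)
    (D : Fin q → Matrix (Fin m) (Fin m) ℝ) (DD : Fin q → Fin q → Matrix (Fin m) (Fin m) ℝ)
    (P : Fin m → ℝ) (η : Fin q → ℝ) :
    P ⬝ᵥ (((1 / 2 : ℝ) • (∑ i, ∑ j, (η i * η j) • DD i j) -
        (∑ i, η i • D i) * J * (∑ i, η i • D i)) *ᵥ P) -
      1 / 2 * (S * (∑ i, ∑ j, (η i * η j) • DD i j) -
        S ^ 2 * (∑ i, η i • D i) * (∑ i, η i • D i)).trace =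
    η ⬝ᵥ ((Matrix.of fun i j => P ⬝ᵥ (((1 / 2 : ℝ) • DD i j - D i * J * D j) *ᵥ P) -
      1 / 2 * (S * DD i j - S ^ 2 * D i * D j).trace) *ᵥ η) := by
  have h1 : (1 / 2 : ℝ) • (∑ i, ∑ j, (η i * η j) • DD i j) -
      (∑ i, η i • D i) * J * (∑ i, η i • D i) =
      ∑ i, ∑ j, (η i * η j) • ((1 / 2 : ℝ) • DD i j - D i * J * D j) := by
    simp only [Finset.smul_sum, Finset.sum_mul, Finset.mul_sum, smul_sub, Finset.sum_sub_distrib,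
      Matrix.smul_mul, Matrix.mul_smul, smul_smul]
    congr 1
    · simp only [mul_comm (1 / 2 : ℝ)]
    · rw [Finset.sum_comm]
      simp only [mul_comm]
  have h2 : S * (∑ i, ∑ j, (η i * η j) • DD i j) - S ^ 2 * (∑ i, η i • D i) * (∑ i, η i • D i) =
      ∑ i, ∑ j, (η i * η j) • (S * DD i j - S ^ 2 * D i * D j) := by
    simp only [Finset.sum_mul, Finset.mul_sum, smul_sub, Finset.sum_sub_distrib,
      Matrix.smul_mul, Matrix.mul_smul, smul_smul]
    congr 1
    rw [Finset.sum_comm]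
    simp only [mul_comm]
  have h3 : ∀ M : Matrix (Fin q) (Fin q) ℝ, η ⬝ᵥ (M *ᵥ η) = ∑ i, ∑ j, η i * η j * M i j := by
    intro M
    simp only [dotProduct, Matrix.mulVec, Finset.mul_sum]
    refine Finset.sum_congr rfl fun i _ => Finset.sum_congr rfl fun j _ => ?_
    ring
  rw [h1, h2, h3]
  simp only [Matrix.sum_mulVec, dotProduct_sum, Matrix.smul_mulVec, dotProduct_smul,
    Matrix.trace_sum, Matrix.trace_smul, smul_eq_mul, Matrix.of_apply]
  simp only [Finset.mul_sum, ← Finset.sum_sub_distrib]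
  refine Finset.sum_congr rfl fun i _ => Finset.sum_congr rfl fun j _ => ?_
  ring

theorem lH_centre_neg (hg : Y.GrowthBound) (hθ : θ₀ ∈ Y.goodSet) (hpd : (Y.K2 θ₀).PosDef)
    (hB : Function.Injective (Y.Bomega θ₀).mulVec) (hE : (-(Y.E θ₀ ξ₀)).PosDef)
    (hw₀ : w₀.ofLp = resid (Y.K2 θ₀) (Y.Bomega θ₀) ξ₀.ofLp) (he : e ≠ 0) :
    Y.lH 0 θ₀ w₀ e < 0 := by
  have hJt := Jmat_transpose (B := Y.Bomega θ₀) hpd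
  have hA1 := fderiv_K2_transpose hg hθ (scl 0 e)
  unfold lH
  rw [fderiv_K1_apply hg hθ, zero_smul]
  have h0 : -WithLp.ofLp (0 : Vec m) = 0 := by simp
  rw [h0]
  by_cases hη : e.2 = 0
  · have hv : e.1.ofLp ≠ 0 := fun h => he (Prod.ext (by
      ext i
      exact congrFun h i) hη)
    rw [scl_zero_left, hη]
    have : ((0, 0) : Param p q) = 0 := rfl
    rw [this, map_zero, map_zero]
    exact gLog2_zero_neg hpd hB hv
  · refine (gLog2_le hpd hB hA1).trans_lt ?_
    rw [scl_zero_left, fderiv_K2_nu hg hθ, fderiv_fderiv_K2_nu hg hθ, hw₀, inv_mulVec_resid,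
      quadratic_eq]
    have h1 := hE.dotProduct_mulVec_pos (x := e.2.ofLp) (fun h => hη (by ext i; exact congrFun h i))
    rw [Matrix.neg_mulVec, dotProduct_neg, star_trivial] at h1
    have h2 : Y.E θ₀ ξ₀ = Matrix.of fun i j => (Jmat (Y.K2 θ₀) (Y.Bomega θ₀) *ᵥ ξ₀.ofLp) ⬝ᵥ
        (((1 / 2 : ℝ) • Y.ddK2 i j θ₀ - Y.dK2 i θ₀ * Jmat (Y.K2 θ₀) (Y.Bomega θ₀) * Y.dK2 j θ₀) *ᵥ
          (Jmat (Y.K2 θ₀) (Y.Bomega θ₀) *ᵥ ξ₀.ofLp)) -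
        1 / 2 * ((Y.K2 θ₀)⁻¹ * Y.ddK2 i j θ₀ -
          (Y.K2 θ₀)⁻¹ ^ 2 * Y.dK2 i θ₀ * Y.dK2 j θ₀).trace := by
      ext i j
      simp only [E, Matrix.of_apply, ← quad_conj hJt]
      rfl
    rw [← h2]
    linarith

end Centre

section Identify

variable {a : Vec m} {e : Param p q}

theorem OscBounds.nI_eventually (h : Y.Reg θ₀ ρ C δ Γ) (hθ : ‖θ - θ₀‖ < ρ) (d : Param p q) :
    ∀ᶠ t : ℝ in nhds 0, ‖θ + t • d - θ₀‖ < ρ ∧ Y.nI k a (θ + t • d) =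
      gc m * Real.exp (gLog (Y.K2 (θ + t • d)) (Y.wv k a (θ + t • d)).ofLp) := by
  filter_upwards [line_mem_ball hθ (e := d)] with t ht
  have ht' : ‖θ + t • d - θ₀‖ < ρ := ht
  exact ⟨ht', nI_eq (h.mem_goodSet ht'.le) (h.K2_posDef ht'.le) k a⟩

theorem OscBounds.nI1_eq (ho : Y.OscBounds θ₀ ρ K N) (h : Y.Reg θ₀ ρ C δ Γ) (hg : Y.GrowthBound)
    (hmean : Y.MeanCond) (hk : N ≤ k) (hθ : ‖θ - θ₀‖ < ρ) :
    Y.nI1 k a θ e = Y.nI k a θ * Y.lD (eps k) θ (Y.wv k a θ) e := by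
  have hm := h.mem_goodSet hθ.le
  have h1 := (hasDerivAt_gLog_line (k := k) (a := a) (e := e) (t := 0) hg hmean
    (by simpa using hm) (by simpa using h.K2_posDef hθ.le)).exp.const_mul (gc m)
  have h2 := (ho.nI_deriv k hk a θ e hθ).congr_of_eventuallyEq
    (show (fun t : ℝ => gc m * Real.exp (gLog (Y.K2 (θ + t • scl (eps k) e))
        (Y.wv k a (θ + t • scl (eps k) e)).ofLp)) =ᶠ[nhds 0] _ by
      filter_upwards [OscBounds.nI_eventually (k := k) (a := a) h hθ (scl (eps k) e)] with t ht
        using ht.2.symm)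
  have h3 := h2.unique h1
  simp only [zero_smul, add_zero] at h3
  rw [h3, nI_eq hm (h.K2_posDef hθ.le), mul_assoc]

theorem OscBounds.nI2_eq (ho : Y.OscBounds θ₀ ρ K N) (h : Y.Reg θ₀ ρ C δ Γ) (hg : Y.GrowthBound)
    (hmean : Y.MeanCond) (hk : N ≤ k) (hθ : ‖θ - θ₀‖ < ρ) :
    Y.nI2 k a θ e = Y.nI k a θ * (Y.lH (eps k) θ (Y.wv k a θ) e +
      Y.lD (eps k) θ (Y.wv k a θ) e ^ 2) := by
  have hm := h.mem_goodSet hθ.le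
  have h1 := hasDerivAt_lD_line (k := k) (a := a) (e := e) (t := 0) hg hmean
    (by simpa using hm) (by simpa using h.K2_posDef hθ.le)
  have h2 := (ho.nI_deriv k hk a θ e hθ).fun_mul h1
  have h3 := (ho.nI1_deriv k hk a θ e hθ).congr_of_eventuallyEq
    (show (fun t : ℝ => Y.nI k a (θ + t • scl (eps k) e) * Y.lD (eps k) (θ + t • scl (eps k) e)
        (Y.wv k a (θ + t • scl (eps k) e)) e) =ᶠ[nhds 0] _ by
      filter_upwards [OscBounds.nI_eventually (k := k) (a := a) h hθ (scl (eps k) e)] with t ht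
        using (ho.nI1_eq h hg hmean hk ht.1).symm)
  have h4 := h3.unique h2
  simp only [zero_smul, add_zero] at h4
  rw [h4, ho.nI1_eq h hg hmean hk hθ]
  ring

end Identify

end Model

theorem abs_ratio_sub_le {t n t1 n1 c K ε f : ℝ} (hc : 0 < c) (hc1 : c ≤ 1) (hK : 1 ≤ K)
    (hf : 0 ≤ f) (ht : c ≤ t) (hn : c ≤ n) (h0 : |t - n| ≤ K * ε)
    (h1 : |t1 - n1| ≤ K * ε * f) (hn1 : |n1| ≤ K * f) :
    |t1 / t - n1 / n| ≤ 2 * K ^ 2 / c ^ 2 * ε * f := by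
  have ht0 := hc.trans_le ht
  have hn0 := hc.trans_le hn
  have hKε : 0 ≤ K * ε := (abs_nonneg _).trans h0
  have hε : 0 ≤ ε := by
    by_contra hcon
    push Not at hcon
    nlinarith
  have e1 : t1 / t - n1 / n = (t1 - n1) / t - n1 * (t - n) / (t * n) := by
    field_simp
    ring
  have e2 : |(t1 - n1) / t| ≤ K * ε * f / c := by
    rw [abs_div, abs_of_pos ht0]
    gcongr
  have e3 : |n1 * (t - n) / (t * n)| ≤ K * f * (K * ε) / (c * c) := by
    rw [abs_div, abs_mul, abs_of_pos (mul_pos ht0 hn0)]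
    gcongr
  rw [e1]
  refine (abs_sub _ _).trans ((add_le_add e2 e3).trans ?_)
  have e4 : K * ε * f / c ≤ K ^ 2 * ε * f / c ^ 2 := by
    rw [div_le_div_iff₀ hc (by positivity)]
    have : K * c ^ 2 ≤ K ^ 2 * c := by
      nlinarith [mul_le_mul_of_nonneg_left (hc1.trans hK) (by positivity : 0 ≤ K * c)]
    nlinarith [mul_nonneg hε hf]
  calc _ ≤ K ^ 2 * ε * f / c ^ 2 + K * f * (K * ε) / (c * c) := by gcongr
    _ = _ := by
      field_simp
      ring

theorem second_log_deriv_sub_le {t n t1 n1 t2 n2 c K κ K' ε f : ℝ} (hc : 0 < c) (hc1 : c ≤ 1)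
    (hK : 1 ≤ K) (hf : 0 ≤ f) (ht : c ≤ t) (hn : c ≤ n) (hκ : 0 ≤ κ) (hK' : 0 ≤ K') (hε : 0 ≤ ε)
    (h0 : |t - n| ≤ K * ε) (h1 : |t1 - n1| ≤ K * ε * f) (ht1 : |t1| ≤ K * f) (hn1 : |n1| ≤ K * f)
    (hn2 : |n2| ≤ K * f ^ 2) (h2 : |t2 - n2| ≤ (κ + K' * ε) * f ^ 2) :
    |(t2 / t - (t1 / t) ^ 2) - (n2 / n - (n1 / n) ^ 2)| ≤
      (κ + (K' + 6 * K ^ 3) * ε) / c ^ 3 * f ^ 2 := by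
  have ht0 := hc.trans_le ht
  have hn0 := hc.trans_le hn
  have hr := abs_ratio_sub_le hc hc1 hK hf ht hn h0 h1 hn1
  have e1 : t2 / t - n2 / n = (t2 - n2) / t - n2 * (t - n) / (t * n) := by
    field_simp
    ring
  have e2 : |(t2 - n2) / t| ≤ (κ + K' * ε) * f ^ 2 / c := by
    rw [abs_div, abs_of_pos ht0]
    gcongr
  have e3 : |n2 * (t - n) / (t * n)| ≤ K * f ^ 2 * (K * ε) / (c * c) := by
    rw [abs_div, abs_mul, abs_of_pos (mul_pos ht0 hn0)]
    gcongr
  have e4 : |t1 / t| ≤ K * f / c := by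
    rw [abs_div, abs_of_pos ht0]
    gcongr
  have e5 : |n1 / n| ≤ K * f / c := by
    rw [abs_div, abs_of_pos hn0]
    gcongr
  have e6 : |(t1 / t) ^ 2 - (n1 / n) ^ 2| ≤ 2 * K ^ 2 / c ^ 2 * ε * f * (K * f / c + K * f / c) := by
    rw [sq_sub_sq, mul_comm, abs_mul]
    have := (abs_add_le (t1 / t) (n1 / n)).trans (add_le_add e4 e5)
    gcongr
  have e7 : (t2 / t - (t1 / t) ^ 2) - (n2 / n - (n1 / n) ^ 2) =
      (t2 - n2) / t - n2 * (t - n) / (t * n) - ((t1 / t) ^ 2 - (n1 / n) ^ 2) := by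
    linear_combination e1
  rw [e7]
  refine (abs_sub _ _).trans ((add_le_add ((abs_sub _ _).trans (add_le_add e2 e3)) e6).trans ?_)
  have e8 : (κ + K' * ε) * f ^ 2 / c ≤ (κ + K' * ε) * f ^ 2 / c ^ 3 := by
    have : c ^ 3 ≤ c := by nlinarith [mul_pos hc hc, mul_pos (mul_pos hc hc) hc]
    gcongr
  have e9 : K * f ^ 2 * (K * ε) / (c * c) ≤ K ^ 3 * ε * f ^ 2 / c ^ 3 := by
    have i1 : c ^ 3 ≤ c * c := by nlinarith [mul_pos hc hc]
    have i2 : K * f ^ 2 * (K * ε) ≤ K ^ 3 * ε * f ^ 2 := by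
      have : K ^ 2 ≤ K ^ 3 := pow_le_pow_right₀ hK (by norm_num)
      calc K * f ^ 2 * (K * ε) = K ^ 2 * (ε * f ^ 2) := by ring
        _ ≤ K ^ 3 * (ε * f ^ 2) := by gcongr
        _ = _ := by ring
    gcongr
  calc _ ≤ (κ + K' * ε) * f ^ 2 / c ^ 3 + K ^ 3 * ε * f ^ 2 / c ^ 3 +
        2 * K ^ 2 / c ^ 2 * ε * f * (K * f / c + K * f / c) := by gcongr
    _ ≤ _ := by
      have : 0 ≤ K ^ 3 * ε * f ^ 2 / c ^ 3 := by positivity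
      have e10 : 2 * K ^ 2 / c ^ 2 * ε * f * (K * f / c + K * f / c) =
        4 * (K ^ 3 * ε * f ^ 2 / c ^ 3) := by
        field_simp
        ring
      have e11 : (κ + (K' + 6 * K ^ 3) * ε) / c ^ 3 * f ^ 2 =
        (κ + K' * ε) * f ^ 2 / c ^ 3 + 6 * (K ^ 3 * ε * f ^ 2 / c ^ 3) := by
        field_simp
        ring
      rw [e10, e11]
      linarith


namespace Model

variable {m p q : ℕ} {Y : Model m p q} {θ₀ θ : Param p q} {ρ C δ K : ℝ} {Γ N k : ℕ}

theorem Reg.exists_nI_ge (h : Y.Reg θ₀ ρ C δ Γ) (hg : Y.GrowthBound) (W : ℝ) :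
    ∃ c, 0 < c ∧ c ≤ 1 ∧ ∀ k a θ, ‖θ - θ₀‖ ≤ ρ → ‖Y.wv k a θ‖ ≤ W → c ≤ Y.nI k a θ := by
  set s : Set (Param p q × Vec m) := closedBall θ₀ ρ ×ˢ closedBall 0 W
  have hmem : ∀ z ∈ s, ‖z.1 - θ₀‖ ≤ ρ := fun z hz => by simpa [dist_eq_norm] using hz.1
  have hcomp : IsCompact s := (isCompact_closedBall _ _).prod (isCompact_closedBall _ _)
  have hcont : ContinuousOn (fun z : Param p q × Vec m =>
      gc m * Real.exp (gLog (Y.K2 z.1) z.2.ofLp)) s := by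
    intro z hz
    have h0 : ContinuousAt (fun z : Param p q × Vec m => gLog (Y.K2 z.1) z.2.ofLp) z :=
      continuousAt_gLog (A := fun z : Param p q × Vec m => Y.K2 z.1)
        (w := fun z : Param p q × Vec m => z.2.ofLp)
        (continuousAt_of_entry fun k l => ContinuousAt.comp
          (g := fun θ => Y.K2 θ k l) (f := fun z : Param p q × Vec m => z.1)
          (continuousAt_K2_entry hg (h.mem_goodSet (hmem z hz)) k l) (by fun_prop))
        (h.K2_posDef (hmem z hz)).det_pos.ne'
        (continuousAt_ofLp (V := fun z : Param p q × Vec m => z.2) (by fun_prop))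
    exact (h0.rexp.const_mul (gc m)).continuousWithinAt
  rcases s.eq_empty_or_nonempty with he | hne
  · refine ⟨1, one_pos, le_rfl, fun k a θ hθ hW => ?_⟩
    have : (θ, Y.wv k a θ) ∈ s := ⟨by simpa [dist_eq_norm] using hθ, by simpa using hW⟩
    rw [he] at this
    exact this.elim
  · obtain ⟨z, hz, hmin⟩ := hcomp.exists_isMinOn hne hcont
    have hpos : 0 < gc m * Real.exp (gLog (Y.K2 z.1) z.2.ofLp) := mul_pos (gc_pos m) (Real.exp_pos _)
    refine ⟨_, lt_min hpos one_pos, min_le_right _ _, fun k a θ hθ hW => ?_⟩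
    rw [nI_eq (h.mem_goodSet hθ) (h.K2_posDef hθ)]
    have h2 : (θ, Y.wv k a θ) ∈ s := ⟨by simpa [dist_eq_norm] using hθ, by simpa using hW⟩
    have h3 := isMinOn_iff.1 hmin (θ, Y.wv k a θ) h2
    dsimp only at h3
    exact (min_le_left _ _).trans h3

theorem eventually_mul_eps_le (K : ℝ) {c : ℝ} (hc : 0 < c) : ∃ N, ∀ k, N ≤ k → K * eps k ≤ c := by
  have h1 : Tendsto (fun k => K * eps k) atTop (nhds 0) := by
    simpa using tendsto_eps.const_mul K
  obtain ⟨N, hN⟩ := eventually_atTop.1 (h1.eventually_le_const hc)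
  exact ⟨N, hN⟩

theorem OscBounds.exists_compare (ho : Y.OscBounds θ₀ ρ K N) (h : Y.Reg θ₀ ρ C δ Γ)
    (hg : Y.GrowthBound) (W : ℝ) :
    ∃ c, 0 < c ∧ c ≤ 1 ∧ ∃ N', N ≤ N' ∧ ∀ k, N' ≤ k → ∀ a θ, ‖θ - θ₀‖ < ρ → ‖Y.wv k a θ‖ ≤ W →
      c ≤ Y.tI k a θ ∧ c ≤ Y.nI k a θ ∧ ∀ e,
        |Y.tI1 k a θ e / Y.tI k a θ - Y.nI1 k a θ e / Y.nI k a θ| ≤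
          2 * K ^ 2 / c ^ 2 * eps k * ‖e‖ := by
  obtain ⟨c, hc, hc1, hn⟩ := h.exists_nI_ge hg W
  obtain ⟨N', hN'⟩ := eventually_mul_eps_le K (half_pos hc)
  refine ⟨c / 2, half_pos hc, by linarith, max N N', le_max_left _ _, fun k hk a θ hθ hw => ?_⟩
  have hkN := (le_max_left _ _).trans hk
  have hkN' := hN' k ((le_max_right _ _).trans hk)
  have h1 := hn k a θ hθ.le hw
  have h2 := ho.sub_le k hkN a θ hθ
  have h3 : c / 2 ≤ Y.tI k a θ := by linarith [(abs_le.1 h2).1]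
  exact ⟨h3, by linarith, fun e => abs_ratio_sub_le (half_pos hc) (by linarith) ho.one_le_K
    (norm_nonneg e) h3 (by linarith) h2 (ho.sub1_le k hkN a θ e hθ) (ho.nI1_le k hkN a θ e hθ)⟩

/-- The data describing the limiting problem at `θ₀`: strict concavity and criticality of the
limiting log-likelihood at the value `w₀` of the standardised observation. -/
structure Crit (Y : Model m p q) (θ₀ : Param p q) (w₀ : Vec m) : Prop where
  zero : ∀ e, Y.lD 0 θ₀ w₀ e = 0
  neg : ∀ e, e ≠ 0 → Y.lH 0 θ₀ w₀ e < 0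

theorem exists_radius {E F : Type*} [NormedAddCommGroup E] [NormedAddCommGroup F] {x : E} {y : F}
    {P : ℝ → E → F → Prop} (h : ∀ᶠ z : ℝ × E × F in nhds (0, x, y), P z.1 z.2.1 z.2.2) :
    ∃ r, 0 < r ∧ ∃ N : ℕ, ∀ k, N ≤ k → ∀ x' y', ‖x' - x‖ < r → ‖y' - y‖ < r → P (eps k) x' y' := by
  obtain ⟨r, hr, hP⟩ := Metric.eventually_nhds_iff.1 h
  obtain ⟨N, hN⟩ := eventually_mul_eps_le 1 (half_pos hr)
  refine ⟨r, hr, N, fun k hk x' y' hx hy => hP (y := (eps k, x', y')) ?_⟩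
  have h1 := hN k hk
  have h2 := eps_pos k
  rw [Prod.dist_eq, Prod.dist_eq, dist_eq_norm, dist_eq_norm, dist_eq_norm, sub_zero,
    Real.norm_eq_abs, abs_of_pos h2]
  exact max_lt (by linarith) (max_lt hx hy)

section Local

variable {w₀ : Vec m}

theorem Crit.exists_concave (hcr : Y.Crit θ₀ w₀) (ho : Y.OscBounds θ₀ ρ K N)
    (h : Y.Reg θ₀ ρ C δ Γ) (hg : Y.GrowthBound) (hmean : Y.MeanCond) :
    ∃ c, 0 < c ∧ ∃ r, 0 < r ∧ r ≤ ρ ∧ ∃ N', ∀ k, N' ≤ k → ∀ a θ, ‖θ - θ₀‖ < r →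
      ‖Y.wv k a θ - w₀‖ < r → ∀ e,
        Y.nI2 k a θ e / Y.nI k a θ - (Y.nI1 k a θ e / Y.nI k a θ) ^ 2 ≤ -(c * ‖e‖ ^ 2) ∧
        Y.tI2 k a θ e / Y.tI k a θ - (Y.tI1 k a θ e / Y.tI k a θ) ^ 2 ≤ -(c * ‖e‖ ^ 2) := by
  have hθ₀ : ‖θ₀ - θ₀‖ ≤ ρ := by simpa using h.ρ_pos.le
  obtain ⟨c, hc, hev⟩ := eventually_lH_le (w₀ := w₀) hg (h.mem_goodSet hθ₀)
    (h.K2_posDef hθ₀).det_pos.ne' hcr.neg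
  obtain ⟨r, hr, N₁, hr1⟩ := exists_radius
    (P := fun ε θ w => ∀ e, Y.lH ε θ w e ≤ -(c * ‖e‖ ^ 2)) hev
  obtain ⟨c₀, hc₀, hc₀1, N₂, hNN₂, hcmp⟩ := ho.exists_compare h hg (‖w₀‖ + r)
  obtain ⟨K', hK', hsub2⟩ := ho.sub2_le (c * c₀ ^ 3 / 4) (by positivity)
  obtain ⟨N₃, hN₃⟩ := eventually_mul_eps_le (K' + 6 * K ^ 3) (c := c * c₀ ^ 3 / 4) (by positivity)
  refine ⟨c / 2, half_pos hc, min r ρ, lt_min hr h.ρ_pos, min_le_right _ _, max N₁ (max N₂ N₃),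
    fun k hk a θ hθ hw e => ?_⟩
  have hk1 := (le_max_left _ _).trans hk
  have hk2 := (le_max_left _ _).trans ((le_max_right _ _).trans hk)
  have hk3 := (le_max_right _ _).trans ((le_max_right _ _).trans hk)
  have hθρ := hθ.trans_le (min_le_right _ _)
  have hwr := hw.trans_le (min_le_left _ _)
  have hwW : ‖Y.wv k a θ‖ ≤ ‖w₀‖ + r := by
    have := norm_add_le w₀ (Y.wv k a θ - w₀)
    rw [add_sub_cancel] at this
    linarith
  obtain ⟨ht, hn, -⟩ := hcmp k hk2 a θ hθρ hwW
  have hkN := hNN₂.trans hk2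
  have hl := hr1 k hk1 θ (Y.wv k a θ) (hθ.trans_le (min_le_left _ _)) hwr e
  have hn0 := (hc₀.trans_le hn).ne'
  have h1 : Y.nI2 k a θ e / Y.nI k a θ - (Y.nI1 k a θ e / Y.nI k a θ) ^ 2 =
      Y.lH (eps k) θ (Y.wv k a θ) e := by
    rw [ho.nI1_eq h hg hmean hkN hθρ, ho.nI2_eq h hg hmean hkN hθρ]
    field_simp
    ring
  have h2 := second_log_deriv_sub_le (κ := c * c₀ ^ 3 / 4) hc₀ hc₀1 ho.one_le_K (norm_nonneg e)
    ht hn (by positivity) hK' (eps_pos k).le (ho.sub_le k hkN a θ hθρ) (ho.sub1_le k hkN a θ e hθρ)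
    (ho.tI1_le k hkN a θ e hθρ) (ho.nI1_le k hkN a θ e hθρ) (ho.nI2_le k hkN a θ e hθρ)
    (hsub2 k hkN a θ e hθρ)
  rw [h1] at h2 ⊢
  have hce : 0 ≤ c * ‖e‖ ^ 2 := by positivity
  have h3 : (c * c₀ ^ 3 / 4 + (K' + 6 * K ^ 3) * eps k) / c₀ ^ 3 * ‖e‖ ^ 2 ≤ c / 2 * ‖e‖ ^ 2 := by
    refine mul_le_mul_of_nonneg_right ?_ (sq_nonneg _)
    rw [div_le_iff₀ (by positivity)]
    linarith [hN₃ k hk3]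
  exact ⟨by linarith, by linarith [(abs_le.1 h2).2]⟩

theorem Crit.exists_small_deriv (hcr : Y.Crit θ₀ w₀) (ho : Y.OscBounds θ₀ ρ K N)
    (h : Y.Reg θ₀ ρ C δ Γ) (hg : Y.GrowthBound) (hmean : Y.MeanCond) {τ : ℝ} (hτ : 0 < τ) :
    ∃ r, 0 < r ∧ ∃ N', ∀ k, N' ≤ k → ∀ a θ, ‖θ - θ₀‖ < r → ‖Y.wv k a θ - w₀‖ < r → ∀ e,
      Y.nI1 k a θ e ≤ τ * ‖e‖ * Y.nI k a θ ∧ Y.tI1 k a θ e ≤ τ * ‖e‖ * Y.tI k a θ := by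
  have hθ₀ : ‖θ₀ - θ₀‖ ≤ ρ := by simpa using h.ρ_pos.le
  have hev := eventually_lD_le (w₀ := w₀) hg (h.mem_goodSet hθ₀)
    (h.K2_posDef hθ₀).det_pos.ne' hcr.zero (half_pos hτ)
  obtain ⟨r, hr, N₁, hr1⟩ := exists_radius
    (P := fun ε θ w => ∀ e, Y.lD ε θ w e ≤ τ / 2 * ‖e‖) hev
  obtain ⟨c₀, hc₀, hc₀1, N₂, hNN₂, hcmp⟩ := ho.exists_compare h hg (‖w₀‖ + r)
  obtain ⟨N₃, hN₃⟩ := eventually_mul_eps_le (2 * K ^ 2 / c₀ ^ 2) (half_pos hτ)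
  refine ⟨min r ρ, lt_min hr h.ρ_pos, max N₁ (max N₂ N₃), fun k hk a θ hθ hw e => ?_⟩
  have hk1 := (le_max_left _ _).trans hk
  have hk2 := (le_max_left _ _).trans ((le_max_right _ _).trans hk)
  have hk3 := (le_max_right _ _).trans ((le_max_right _ _).trans hk)
  have hθρ := hθ.trans_le (min_le_right _ _)
  have hwr := hw.trans_le (min_le_left _ _)
  have hwW : ‖Y.wv k a θ‖ ≤ ‖w₀‖ + r := by
    have := norm_add_le w₀ (Y.wv k a θ - w₀)
    rw [add_sub_cancel] at this
    linarith
  obtain ⟨ht, hn, hd⟩ := hcmp k hk2 a θ hθρ hwW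
  have hl := hr1 k hk1 θ (Y.wv k a θ) (hθ.trans_le (min_le_left _ _)) hwr e
  have hn0 := hc₀.trans_le hn
  have ht0 := hc₀.trans_le ht
  have h1 : Y.nI1 k a θ e / Y.nI k a θ = Y.lD (eps k) θ (Y.wv k a θ) e := by
    rw [ho.nI1_eq h hg hmean (hNN₂.trans hk2) hθρ]
    field_simp
  have h2 : 2 * K ^ 2 / c₀ ^ 2 * eps k * ‖e‖ ≤ τ / 2 * ‖e‖ := by
    gcongr
    exact hN₃ k hk3
  have h3 := (abs_le.1 (hd e)).2
  have hτe : 0 ≤ τ * ‖e‖ := by positivity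
  rw [← div_le_iff₀ hn0, ← div_le_iff₀ ht0]
  exact ⟨by linarith, by linarith⟩

end Local


variable (Y) in
/-- The derivative of the mean in a direction of the first block of parameters. -/
def mD (θ : Param p q) (v : Vec p) : Fin m → ℝ := (fderiv ℝ Y.K1 θ (v, 0)).ofLp

section DirForm

attribute [local instance] Matrix.linftyOpNormedAddCommGroup Matrix.linftyOpNormedSpace

variable (Y) in
/-- The derivative of the logarithm of a Gaussian density when the mean is moved in the direction
`v` and the covariance in the direction `d`. -/
def lF (θ d : Param p q) (w : Fin m → ℝ) (v : Vec p) : ℝ :=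
  gLog1 (Y.K2 θ) (fderiv ℝ Y.K2 θ d) w (-Y.mD θ v)

variable (Y) in
/-- The contribution of the determinant to `lF`. -/
def lTr (θ d : Param p q) : ℝ := ((Y.K2 θ)⁻¹ * fderiv ℝ Y.K2 θ d).trace

theorem lD_eq_lF (ε : ℝ) (θ : Param p q) (w : Vec m) (v : Vec p) :
    Y.lD ε θ w (v, 0) = Y.lF θ (ε • v, 0) w.ofLp v := rfl

theorem lF_zero (θ : Param p q) (w : Fin m → ℝ) (v : Vec p) :
    Y.lF θ 0 w v = Y.mD θ v ⬝ᵥ ((Y.K2 θ)⁻¹ *ᵥ w) := by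
  unfold lF
  rw [map_zero]
  simp [gLog1]

theorem lTr_zero (θ : Param p q) : Y.lTr θ 0 = 0 := by
  unfold lTr
  rw [map_zero]
  simp

variable {X : Type*} [TopologicalSpace X] {x : X} {T E : X → Param p q}

theorem continuousAt_lTr (hg : Y.GrowthBound) (hT : ContinuousAt T x) (hE : ContinuousAt E x)
    (hθ : T x ∈ Y.goodSet) (hdet : (Y.K2 (T x)).det ≠ 0) :
    ContinuousAt (fun z => Y.lTr (T z) (E z)) x :=
  continuousAt_trace ((continuousAt_matrix_inv (continuousAt_of_entry fun k l =>
    ContinuousAt.comp (g := fun θ => Y.K2 θ k l) (continuousAt_K2_entry hg hθ k l) hT) hdet).mul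
    (continuousAt_of_entry (continuousAt_dK2_entry hg hT hE hθ)))

theorem lF_smul (θ d : Param p q) (w : Fin m → ℝ) (v : Vec p) (t : ℝ) :
    Y.lF θ d (t • w) (t • v) + 1 / 2 * Y.lTr θ d = t ^ 2 * (Y.lF θ d w v + 1 / 2 * Y.lTr θ d) := by
  have h : ((t • v, 0) : Param p q) = t • (v, 0) := by ext1 <;> simp
  unfold lF lTr gLog1 mD
  rw [h, map_smul]
  simp only [WithLp.ofLp_smul, neg_dotProduct, smul_dotProduct, Matrix.mulVec_smul,
    dotProduct_smul, smul_eq_mul]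
  ring

end DirForm

section DirForm

variable {X : Type*} [TopologicalSpace X] {x : X} {T E : X → Param p q} {W : X → Vec m}
  {V : X → Vec p}

theorem continuousAt_mD (hg : Y.GrowthBound) (hT : ContinuousAt T x) (hV : ContinuousAt V x)
    (hθ : T x ∈ Y.goodSet) : ContinuousAt (fun z => Y.mD (T z) (V z)) x :=
  continuousAt_ofLp ((ContinuousAt.comp (g := fderiv ℝ Y.K1) (continuousAt_fderiv_K1 hg hθ)
    hT).clm_apply (hV.prodMk continuousAt_const))

theorem continuousAt_lF (hg : Y.GrowthBound) (hT : ContinuousAt T x) (hE : ContinuousAt E x)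
    (hW : ContinuousAt W x) (hV : ContinuousAt V x) (hθ : T x ∈ Y.goodSet)
    (hdet : (Y.K2 (T x)).det ≠ 0) :
    ContinuousAt (fun z => Y.lF (T z) (E z) (W z).ofLp (V z)) x :=
  continuousAt_gLog1
    (continuousAt_of_entry fun k l => ContinuousAt.comp (g := fun θ => Y.K2 θ k l)
      (continuousAt_K2_entry hg hθ k l) hT) hdet
    (continuousAt_of_entry (continuousAt_dK2_entry hg hT hE hθ))
    (continuousAt_ofLp hW) (continuousAt_mD hg hT hV hθ).neg

theorem eventually_lF_le (hg : Y.GrowthBound) (hθ : θ₀ ∈ Y.goodSet) (hdet : (Y.K2 θ₀).det ≠ 0)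
    {κ : ℝ} (hκ : 0 < κ) : ∃ r, 0 < r ∧ ∀ θ d, ‖θ - θ₀‖ < r → ‖d‖ < r → ∀ (w : Vec m) v,
      Y.lF θ d w.ofLp v ≤ Y.lF θ₀ 0 w.ofLp v + κ * (1 + ‖v‖ + ‖w‖) ^ 2 := by
  set F : (Param p q × Param p q) → (ℝ × Vec p × Vec m) → ℝ := fun z b =>
    Y.lF z.1 z.2 b.2.2.ofLp b.2.1 + 1 / 2 * Y.lTr z.1 z.2 - Y.lF θ₀ 0 b.2.2.ofLp b.2.1 -
      1 / 2 * b.1 ^ 2 * Y.lTr z.1 z.2 with hF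
  have h0 : ∀ b, F (θ₀, 0) b = 0 := fun b => by simp [hF, lTr_zero]
  have hcont : ∀ b, ContinuousAt
      (fun z : (Param p q × Param p q) × (ℝ × Vec p × Vec m) => F z.1 z.2) ((θ₀, 0), b) := by
    intro b
    have h1 := continuousAt_lF (Y := Y) (x := ((θ₀, (0 : Param p q)), b))
      (T := fun z : (Param p q × Param p q) × (ℝ × Vec p × Vec m) => z.1.1)
      (E := fun z => z.1.2) (W := fun z => z.2.2.2) (V := fun z => z.2.2.1) hg
      (by fun_prop) (by fun_prop) (by fun_prop) (by fun_prop) hθ hdet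
    have h2 := continuousAt_lF (Y := Y) (x := ((θ₀, (0 : Param p q)), b))
      (T := fun z : (Param p q × Param p q) × (ℝ × Vec p × Vec m) => θ₀)
      (E := fun z => 0) (W := fun z => z.2.2.2) (V := fun z => z.2.2.1) hg
      (by fun_prop) (by fun_prop) (by fun_prop) (by fun_prop) hθ hdet
    have h3 := continuousAt_lTr (Y := Y) (x := ((θ₀, (0 : Param p q)), b))
      (T := fun z : (Param p q × Param p q) × (ℝ × Vec p × Vec m) => z.1.1)
      (E := fun z => z.1.2) hg (by fun_prop) (by fun_prop) hθ hdet
    exact ((h1.add (h3.const_mul _)).sub h2).sub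
      (ContinuousAt.mul (f := fun z : (Param p q × Param p q) × (ℝ × Vec p × Vec m) =>
        1 / 2 * z.2.1 ^ 2) (by fun_prop) h3)
  have hev := eventually_forall_of_sphere (x := (θ₀, (0 : Param p q))) (P := fun z b => F z b < κ)
    fun b _ => (hcont b).eventually (gt_mem_nhds ((h0 b).trans_lt hκ))
  obtain ⟨r, hr, hP⟩ := Metric.eventually_nhds_iff.1 hev
  refine ⟨r, hr, fun θ d h1 h2 w v => ?_⟩
  have h3 : dist (θ, d) (θ₀, 0) < r := by
    rw [Prod.dist_eq, dist_eq_norm, dist_eq_norm, sub_zero]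
    exact max_lt h1 h2
  obtain ⟨⟨l, v', w'⟩, hu, hq⟩ := exists_unit_smul (e := ((1 : ℝ), v, w)) (fun h => by
    simpa using congrArg Prod.fst h)
  have h4 := hP h3 _ hu
  set n := ‖((1 : ℝ), v, w)‖ with hn
  have e1 : (1 : ℝ) = n * l := congrArg Prod.fst hq
  have e2 : v = n • v' := congrArg (fun b => b.2.1) hq
  have e3 : w = n • w' := congrArg (fun b => b.2.2) hq
  have h5 := lF_smul (Y := Y) θ d w'.ofLp v' n
  have h6 := lF_smul (Y := Y) θ₀ 0 w'.ofLp v' n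
  rw [← WithLp.ofLp_smul, ← e2, ← e3] at h5 h6
  rw [lTr_zero] at h6
  have h7 : n ≤ 1 + ‖v‖ + ‖w‖ := by
    rw [hn, Prod.norm_def, Prod.norm_def, norm_one]
    have := norm_nonneg v
    have := norm_nonneg w
    exact max_le (by linarith) (max_le (by linarith) (by linarith))
  have h8 : n ^ 2 * F (θ, d) (l, v', w') ≤ κ * (1 + ‖v‖ + ‖w‖) ^ 2 :=
    calc n ^ 2 * F (θ, d) (l, v', w') ≤ n ^ 2 * κ := by gcongr
      _ ≤ (1 + ‖v‖ + ‖w‖) ^ 2 * κ := by gcongr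
      _ = _ := by ring
  have h9 : n ^ 2 * F (θ, d) (l, v', w') =
      Y.lF θ d w.ofLp v - Y.lF θ₀ 0 w.ofLp v := by
    simp only [hF]
    have : n ^ 2 * l ^ 2 = 1 := by rw [← mul_pow, ← e1, one_pow]
    linear_combination -h5 + h6 - 1 / 2 * Y.lTr θ d * this
  linarith

end DirForm

section Coercive

theorem exists_coercive (hpd : (Y.K2 θ₀).PosDef) (hinj : ∀ v, Y.mD θ₀ v = 0 → v = 0) :
    ∃ c, 0 < c ∧ ∀ v, c * ‖v‖ ^ 2 ≤ Y.mD θ₀ v ⬝ᵥ ((Y.K2 θ₀)⁻¹ *ᵥ Y.mD θ₀ v) := by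
  have hsm : ∀ (t : ℝ) v, Y.mD θ₀ (t • v) = t • Y.mD θ₀ v := fun t v => by
    have h : ((t • v, 0) : Param p q) = t • (v, 0) := by ext1 <;> simp
    unfold mD
    rw [h, map_smul, WithLp.ofLp_smul]
  have hc : Continuous fun v => Y.mD θ₀ v ⬝ᵥ ((Y.K2 θ₀)⁻¹ *ᵥ Y.mD θ₀ v) := by
    have h1 : Continuous (Y.mD θ₀) :=
      (PiLp.continuous_ofLp 2 _).comp ((fderiv ℝ Y.K1 θ₀).continuous.comp (by fun_prop))
    fun_prop
  have hpos : ∀ v, v ≠ 0 → 0 < Y.mD θ₀ v ⬝ᵥ ((Y.K2 θ₀)⁻¹ *ᵥ Y.mD θ₀ v) := fun v hv => by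
    have := hpd.inv.dotProduct_mulVec_pos (x := Y.mD θ₀ v) (fun h => hv (hinj v h))
    rwa [star_trivial] at this
  rcases (sphere (0 : Vec p) 1).eq_empty_or_nonempty with h0 | h0
  · refine ⟨1, one_pos, fun v => ?_⟩
    have hv : v = 0 := by
      by_contra hv
      obtain ⟨u, hu, -⟩ := exists_unit_smul hv
      have : u ∈ sphere (0 : Vec p) 1 := by simpa using hu
      rw [h0] at this
      exact this
    have := hsm 0 0
    simp only [zero_smul] at this
    simp [hv, this]
  · obtain ⟨u, hu, hmin⟩ := (isCompact_sphere (0 : Vec p) 1).exists_isMinOn h0 hc.continuousOn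
    have hu1 : ‖u‖ = 1 := by simpa using hu
    refine ⟨_, hpos u (by rintro rfl; simp at hu1), fun v => ?_⟩
    rcases eq_or_ne v 0 with rfl | hv
    · have := hsm 0 0
      simp only [zero_smul] at this
      simp [this]
    obtain ⟨v', hv', he⟩ := exists_unit_smul hv
    have h1 := isMinOn_iff.1 hmin v' (by simpa using hv')
    have h2 : Y.mD θ₀ v ⬝ᵥ ((Y.K2 θ₀)⁻¹ *ᵥ Y.mD θ₀ v) =
        ‖v‖ ^ 2 * (Y.mD θ₀ v' ⬝ᵥ ((Y.K2 θ₀)⁻¹ *ᵥ Y.mD θ₀ v')) := by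
      conv_lhs => rw [he, hsm]
      simp only [smul_dotProduct, Matrix.mulVec_smul, dotProduct_smul, smul_eq_mul]
      ring
    rw [h2, mul_comm]
    gcongr

end Coercive

end Model

namespace Model

variable {m p q : ℕ} {Y : Model m p q} {θ₀ θ : Param p q} {ρ C δ K c : ℝ} {Γ N k : ℕ}
  {ξ₀ w₀ : Vec m} {u₀ : Vec p}

theorem exists_abs_bilin_le (S : Matrix (Fin m) (Fin m) ℝ) :
    ∃ M, 0 ≤ M ∧ ∀ x y : Vec m, |x.ofLp ⬝ᵥ (S *ᵥ y.ofLp)| ≤ M * (‖x‖ * ‖y‖) := by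
  refine ⟨∑ i, ∑ j, |S i j|, by positivity, fun x y => ?_⟩
  simp only [dotProduct, Matrix.mulVec, Finset.mul_sum, Finset.sum_mul]
  refine (Finset.abs_sum_le_sum_abs _ _).trans (Finset.sum_le_sum fun i _ =>
    (Finset.abs_sum_le_sum_abs _ _).trans (Finset.sum_le_sum fun j _ => ?_))
  rw [abs_mul, abs_mul]
  have h1 : |x.ofLp i| ≤ ‖x‖ := abs_coord_le x i
  have h2 : |y.ofLp j| ≤ ‖y‖ := abs_coord_le y j
  calc |x.ofLp i| * (|S i j| * |y.ofLp j|) ≤ ‖x‖ * (|S i j| * ‖y‖) := by gcongr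
    _ = _ := by ring

variable (Y) in
/-- The rescaled observation `√n (K₀'(0; (ω', ν₀)) + ξ / √n)`. -/
def obs (k : ℕ) (ν₀ : Vec q) (ω' : Vec p) (ξ : Vec m) : Vec m :=
  (eps k)⁻¹ • Y.K1 (ω', ν₀) + ξ

theorem exists_wv_sub_le (hg : Y.GrowthBound) (hmean : Y.MeanCond) (hθ₀ : θ₀ ∈ Y.goodSet)
    (hw₀ : w₀ = ξ₀ - fderiv ℝ Y.K1 θ₀ (u₀, 0)) {κ : ℝ} (hκ : 0 < κ) :
    ∃ r, 0 < r ∧ ∀ k ω' ξ θ v, ‖θ - θ₀‖ < r → ‖ω' - θ₀.1‖ < r → ‖ξ - ξ₀‖ < r →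
      θ.1 = ω' + eps k • (u₀ + v) →
        ‖Y.wv k (Y.obs k θ₀.2 ω' ξ) θ - (w₀ - fderiv ℝ Y.K1 θ₀ (v, 0))‖ ≤ κ * (1 + ‖v‖) := by
  set κ' := κ / (2 * (1 + ‖u₀‖)) with hκ'
  have hκ'0 : 0 < κ' := by positivity
  have hstrict : HasStrictFDerivAt Y.K1 (fderiv ℝ Y.K1 θ₀) θ₀ :=
    ((contDiffOn_K1 hg).contDiffAt (isOpen_goodSet.mem_nhds hθ₀)).hasStrictFDerivAt (by norm_num)
  obtain ⟨r₁, hr₁, h₁⟩ := Metric.eventually_nhds_iff.1 (hstrict.isLittleO.def hκ'0)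
  obtain ⟨r₂, hr₂, h₂⟩ := isOpen_iff.1 isOpen_goodSet θ₀ hθ₀
  refine ⟨min (min r₁ r₂) (κ / 2), by positivity, fun k ω' ξ θ v hθ hω hξ hv => ?_⟩
  have he := eps_pos k
  have hr1 := (min_le_left (min r₁ r₂) (κ / 2)).trans (min_le_left _ _)
  have hr2 := (min_le_left (min r₁ r₂) (κ / 2)).trans (min_le_right _ _)
  have hr3 := min_le_right (min r₁ r₂) (κ / 2)
  have hθg : θ ∈ Y.goodSet := h₂ (by
    rw [mem_ball, dist_eq_norm]
    exact hθ.trans_le hr2)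
  have hd : ∀ ω : Vec p, ‖(ω, θ₀.2) - θ₀‖ = ‖ω - θ₀.1‖ := fun ω => by
    rw [Prod.norm_def]
    simp
  have hθ1 : ‖θ.1 - θ₀.1‖ ≤ ‖θ - θ₀‖ := norm_fst_le (θ - θ₀)
  have hθg' : (θ.1, θ₀.2) ∈ Y.goodSet := h₂ (by
    rw [mem_ball, dist_eq_norm, hd]
    linarith)
  have hK : Y.K1 θ = Y.K1 (θ.1, θ₀.2) := hmean θ.1 θ.2 θ₀.2 hθg hθg'
  have h3 := h₁ (y := ((ω', θ₀.2), (θ.1, θ₀.2))) (by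
    rw [Prod.dist_eq, dist_eq_norm, dist_eq_norm]
    dsimp only
    rw [hd, hd]
    exact max_lt (by linarith) (by linarith))
  dsimp only at h3
  have h4 : ((ω', θ₀.2) : Param p q) - (θ.1, θ₀.2) = -(eps k • ((u₀, 0) + (v, 0))) := by
    rw [hv]
    ext1 <;> simp
  rw [h4, map_neg, map_smul, map_add, norm_neg, norm_smul, Real.norm_eq_abs, abs_of_pos he] at h3
  set D := fderiv ℝ Y.K1 θ₀
  have h5 : Y.wv k (Y.obs k θ₀.2 ω' ξ) θ - (w₀ - D (v, 0)) = (ξ - ξ₀) + (eps k)⁻¹ •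
      (Y.K1 (ω', θ₀.2) - Y.K1 (θ.1, θ₀.2) - -(eps k • (D (u₀, 0) + D (v, 0)))) := by
    rw [wv, obs, hK, hw₀]
    have : (eps k)⁻¹ • eps k • (D (u₀, 0) + D (v, 0)) = D (u₀, 0) + D (v, 0) := by
      rw [smul_smul, inv_mul_cancel₀ he.ne', one_smul]
    rw [sub_neg_eq_add, smul_add, this, smul_sub]
    abel
  have h6 : ‖((u₀, 0) + (v, 0) : Param p q)‖ ≤ ‖u₀‖ + ‖v‖ := by
    refine (norm_add_le _ _).trans_eq ?_
    simp [Prod.norm_def]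
  rw [h5]
  refine (norm_add_le _ _).trans ?_
  rw [norm_smul, norm_inv, Real.norm_eq_abs, abs_of_pos he]
  have h7 : (eps k)⁻¹ * ‖Y.K1 (ω', θ₀.2) - Y.K1 (θ.1, θ₀.2) - -(eps k • (D (u₀, 0) + D (v, 0)))‖ ≤
      κ' * (‖u₀‖ + ‖v‖) := by
    rw [inv_mul_le_iff₀ he]
    refine h3.trans ?_
    calc κ' * (eps k * ‖((u₀, 0) + (v, 0) : Param p q)‖) ≤ κ' * (eps k * (‖u₀‖ + ‖v‖)) := by gcongr
      _ = _ := by ring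
  have h8 : κ' * (‖u₀‖ + ‖v‖) ≤ κ / 2 * (1 + ‖v‖) := by
    have h9 : ‖u₀‖ + ‖v‖ ≤ (1 + ‖u₀‖) * (1 + ‖v‖) := by nlinarith [norm_nonneg u₀, norm_nonneg v]
    calc κ' * (‖u₀‖ + ‖v‖) ≤ κ' * ((1 + ‖u₀‖) * (1 + ‖v‖)) := by gcongr
      _ = _ := by
        rw [hκ']
        field_simp
  nlinarith [norm_nonneg v]

/-- The parameters of the limiting linear problem: `w₀ = ξ₀ - B u₀` is orthogonal to the range of
`B` with respect to `A⁻¹`, and `Bᵀ A⁻¹ B ≥ c`. -/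
structure LinData (Y : Model m p q) (θ₀ : Param p q) (ξ₀ w₀ : Vec m) (u₀ : Vec p) (c : ℝ) :
    Prop where
  pos : 0 < c
  eq : w₀ = ξ₀ - fderiv ℝ Y.K1 θ₀ (u₀, 0)
  perp : ∀ v, Y.mD θ₀ v ⬝ᵥ ((Y.K2 θ₀)⁻¹ *ᵥ w₀.ofLp) = 0
  coercive : ∀ v, c * ‖v‖ ^ 2 ≤ Y.mD θ₀ v ⬝ᵥ ((Y.K2 θ₀)⁻¹ *ᵥ Y.mD θ₀ v)

set_option maxHeartbeats 1000000 in
theorem LinData.exists_outer (hl : Y.LinData θ₀ ξ₀ w₀ u₀ c) (hg : Y.GrowthBound)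
    (hmean : Y.MeanCond) (hθ₀ : θ₀ ∈ Y.goodSet) (hdet : (Y.K2 θ₀).det ≠ 0) :
    ∃ M, 1 ≤ M ∧ ∀ κ, 0 < κ → κ ≤ 1 → ∃ r, 0 < r ∧ ∃ N, ∀ k, N ≤ k → ∀ ω' ξ θ v, ‖θ - θ₀‖ < r →
      ‖ω' - θ₀.1‖ < r → ‖ξ - ξ₀‖ < r → θ.1 = ω' + eps k • (u₀ + v) →
      ‖Y.wv k (Y.obs k θ₀.2 ω' ξ) θ - w₀‖ ≤ M * ‖v‖ + κ ∧
      eps k * (1 + ‖v‖) ≤ κ ∧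
      Y.lD (eps k) θ (Y.wv k (Y.obs k θ₀.2 ω' ξ) θ) (v, 0) ≤ -(c * ‖v‖ ^ 2) + κ * (1 + ‖v‖) ^ 2 ∧
      Y.lF θ 0 (Y.wv k (Y.obs k θ₀.2 ω' ξ) θ).ofLp v ≤ -(c * ‖v‖ ^ 2) + κ * (1 + ‖v‖) ^ 2 := by
  set D := fderiv ℝ Y.K1 θ₀
  have hDle : ∀ v : Vec p, ‖D (v, 0)‖ ≤ ‖D‖ * ‖v‖ := fun v => by
    have := D.le_opNorm (v, 0)
    simpa [Prod.norm_def] using this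
  obtain ⟨B, hB0, hB⟩ := exists_abs_bilin_le (Y.K2 θ₀)⁻¹
  set M := 1 + ‖D‖ with hM
  have hM1 : 1 ≤ M := by
    rw [hM]
    linarith [norm_nonneg D]
  refine ⟨M, hM1, fun κ hκ hκ1 => ?_⟩
  set W := 2 + ‖w₀‖ + M with hW
  have hW0 : 0 ≤ W := by positivity
  set κ₁ := min κ (κ / (2 * (B * ‖D‖ + 1)))
  have hκ₁0 : 0 < κ₁ := by positivity
  obtain ⟨r₁, hr₁, h₁⟩ := exists_wv_sub_le hg hmean hθ₀ hl.eq hκ₁0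
  obtain ⟨r₂, hr₂, h₂⟩ := eventually_lF_le hg hθ₀ hdet (κ := κ / (2 * (1 + W) ^ 2)) (by positivity)
  set r₃ := min r₂ κ
  obtain ⟨N, hN⟩ := eventually_mul_eps_le (1 + ‖u₀‖) (c := r₃ / 4) (by positivity)
  refine ⟨min r₁ (r₃ / 4), by positivity, N, fun k hk ω' ξ θ v hθ hω hξ hv => ?_⟩
  have he := eps_pos k
  have hrr1 := min_le_left r₁ (r₃ / 4)
  have hrr2 := min_le_right r₁ (r₃ / 4)
  have h3 := h₁ k ω' ξ θ v (hθ.trans_le hrr1) (hω.trans_le hrr1) (hξ.trans_le hrr1) hv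
  set w := Y.wv k (Y.obs k θ₀.2 ω' ξ) θ
  have hv0 := norm_nonneg v
  have hw1 : ‖w - w₀‖ ≤ M * ‖v‖ + κ := by
    have h4 : w - w₀ = (w - (w₀ - D (v, 0))) + -D (v, 0) := by abel
    rw [h4]
    refine (norm_add_le _ _).trans ?_
    rw [norm_neg]
    have := hDle v
    have h5 : κ₁ * (1 + ‖v‖) ≤ κ + ‖v‖ := by
      have := min_le_left κ (κ / (2 * (B * ‖D‖ + 1)))
      nlinarith
    rw [hM]
    linarith
  have hwW : ‖w‖ ≤ W * (1 + ‖v‖) := by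
    have h4 := norm_add_le w₀ (w - w₀)
    rw [add_sub_cancel] at h4
    rw [hW]
    nlinarith [norm_nonneg w₀]
  have hεv : eps k * ‖v‖ + eps k * (1 + ‖u₀‖) < r₃ := by
    have h4 : eps k • v = (θ.1 - θ₀.1) - (ω' - θ₀.1) - eps k • u₀ := by
      rw [hv, smul_add]
      abel
    have h5 := norm_sub_le ((θ.1 - θ₀.1) - (ω' - θ₀.1)) (eps k • u₀)
    rw [← h4, norm_smul, norm_smul, Real.norm_eq_abs, abs_of_pos he] at h5
    have h6 := norm_sub_le (θ.1 - θ₀.1) (ω' - θ₀.1)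
    have h7 : ‖θ.1 - θ₀.1‖ ≤ ‖θ - θ₀‖ := norm_fst_le (θ - θ₀)
    have h8 := hN k hk
    nlinarith
  have hεv' : ‖((eps k • v, 0) : Param p q)‖ < r₂ := by
    rw [Prod.norm_def]
    simp only [norm_zero, norm_smul, Real.norm_eq_abs, abs_of_pos he]
    refine max_lt ?_ hr₂
    have := min_le_left r₂ κ
    nlinarith [mul_nonneg he.le (norm_nonneg u₀)]
  have hlin : Y.lF θ₀ 0 w.ofLp v ≤ -(c * ‖v‖ ^ 2) + κ / 2 * (1 + ‖v‖) ^ 2 := by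
    have h4 : w.ofLp = w₀.ofLp - (D (v, 0)).ofLp + (w - (w₀ - D (v, 0))).ofLp := by
      simp
    have h5 := (abs_le.1 (hB (D (v, 0)) (w - (w₀ - D (v, 0))))).2
    have h6 := hl.coercive v
    have h7 := hl.perp v
    have hm : Y.mD θ₀ v = (D (v, 0)).ofLp := rfl
    rw [lF_zero, h4, Matrix.mulVec_add, Matrix.mulVec_sub, dotProduct_add, dotProduct_sub, h7, hm]
    rw [hm] at h6
    have h8 : B * (‖D (v, 0)‖ * ‖w - (w₀ - D (v, 0))‖) ≤ κ / 2 * (1 + ‖v‖) ^ 2 :=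
      calc B * (‖D (v, 0)‖ * ‖w - (w₀ - D (v, 0))‖)
          ≤ B * ((‖D‖ * (1 + ‖v‖)) * (κ₁ * (1 + ‖v‖))) := by
            have h9 : ‖D (v, 0)‖ ≤ ‖D‖ * (1 + ‖v‖) := (hDle v).trans (by gcongr; linarith)
            gcongr
        _ = (B * ‖D‖) * κ₁ * (1 + ‖v‖) ^ 2 := by ring
        _ ≤ κ / 2 * (1 + ‖v‖) ^ 2 := by
            gcongr
            calc B * ‖D‖ * κ₁ ≤ (B * ‖D‖ + 1) * (κ / (2 * (B * ‖D‖ + 1))) := by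
                  gcongr
                  · linarith
                  · exact min_le_right _ _
              _ = κ / 2 := by field_simp
    linarith
  have hquad : κ / (2 * (1 + W) ^ 2) * (1 + ‖v‖ + ‖w‖) ^ 2 ≤ κ / 2 * (1 + ‖v‖) ^ 2 := by
    have h4 : 1 + ‖v‖ + ‖w‖ ≤ (1 + W) * (1 + ‖v‖) := by nlinarith
    calc κ / (2 * (1 + W) ^ 2) * (1 + ‖v‖ + ‖w‖) ^ 2
        ≤ κ / (2 * (1 + W) ^ 2) * ((1 + W) * (1 + ‖v‖)) ^ 2 := by gcongr
      _ = _ := by field_simp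
  have hθ2 : ‖θ - θ₀‖ < r₂ := by
    have := min_le_left r₂ κ
    linarith
  refine ⟨hw1, ?_, ?_, ?_⟩
  · have := min_le_right r₂ κ
    nlinarith [mul_nonneg he.le (norm_nonneg u₀)]
  · rw [lD_eq_lF]
    have := h₂ θ (eps k • v, 0) hθ2 hεv' w v
    linarith
  · have := h₂ θ 0 hθ2 (by simpa using hr₂) w v
    linarith

end Model

namespace Model

variable {m p q : ℕ} {Y : Model m p q} {θ₀ : Param p q} {ρ C δ : ℝ} {Γ : ℕ}

variable (Y) in
/-- The parameter-free model given by the exponentially tilted distribution of `Y_θ`. -/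
def tilted (s : Vec m) (θ : Param p q) (h : (s, θ) ∈ Y.convSet) : Model m 0 0 where
  domain := univ
  isOpen_domain := isOpen_univ
  law _ := (Y.law θ).tilted fun x => inner ℝ s x
  isProbabilityMeasure_law _ _ := by
    have := Y.isProbabilityMeasure_law θ h.1
    exact isProbabilityMeasure_tilted h.2

section Tilted

variable {s : Vec m} {θ : Param p q} {h : (s, θ) ∈ Y.convSet}

theorem tilted_G (js : List (Fin m)) (s' φ : Vec m) (θ' : Param 0 0) :
    (Y.tilted s θ h).G js s' φ θ' = Y.G js (s + s') φ θ / Y.mgf (s, θ) := by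
  change (∫ x, momFun js s' φ x ∂((Y.law θ).tilted fun x => inner ℝ s x)) = _
  rw [integral_tilted, G, mom, ← integral_div]
  refine integral_congr_ae (Eventually.of_forall fun x => ?_)
  simp only [momFun, Complex.real_smul, inner_add_left, mgf]
  push_cast
  simp only [Complex.exp_add]
  ring

theorem tilted_mgf (s' : Vec m) (θ' : Param 0 0) :
    (Y.tilted s θ h).mgf (s', θ') = Y.mgf (s + s', θ) / Y.mgf (s, θ) := by
  have h1 := tilted_G (h := h) [] s' 0 θ'
  rw [← mgf_eq_G, ← mgf_eq_G] at h1
  exact_mod_cast h1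

theorem mem_tilted_convSet {s' : Vec m} {θ' : Param 0 0} (h' : (s + s', θ) ∈ Y.convSet) :
    (s', θ') ∈ (Y.tilted s θ h).convSet := by
  refine ⟨mem_univ _, (integrable_tilted_iff h.2 _).2 ?_⟩
  refine h'.2.congr (Eventually.of_forall fun x => ?_)
  simp only [inner_add_left, Real.exp_add, smul_eq_mul]

theorem mem_interior_tilted_convSet {s' : Vec m} {θ' : Param 0 0}
    (h' : (s + s', θ) ∈ interior Y.convSet) : (s', θ') ∈ interior (Y.tilted s θ h).convSet := by
  refine interior_maximal (s := (Y.tilted s θ h).convSet)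
    (t := {z | (s + z.1, θ) ∈ interior Y.convSet}) (fun z hz => ?_) ?_ h'
  · exact mem_tilted_convSet (interior_subset hz)
  · exact isOpen_interior.preimage (by fun_prop)

theorem Reg.tilted (hr : Y.Reg θ₀ ρ C δ Γ) (hs : ‖s‖ ≤ ρ / 2) (hθ : ‖θ - θ₀‖ ≤ ρ)
    (hM : 1 / 2 ≤ Y.mgf (s, θ)) : (Y.tilted s θ h).Reg 0 (ρ / 2) (2 * C) δ Γ := by
  have hρ := hr.ρ_pos
  have hC := hr.one_le_C
  have hs' : ∀ {s' : Vec m}, ‖s'‖ ≤ ρ / 2 → ‖s + s'‖ ≤ ρ := fun h' =>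
    (norm_add_le_of_le hs h').trans_eq (by ring)
  refine ⟨by positivity, by linarith [hr.ρ_le], by linarith, hr.δ_pos, ?_, ?_, ?_, ?_, ?_⟩
  · exact fun s' θ' h1 _ => mem_interior_tilted_convSet (hr.mem _ _ (hs' h1) hθ)
  · intro s' θ' φ h1 _
    rw [tilted_G, tilted_mgf, norm_div, Complex.norm_real, Real.norm_of_nonneg (by linarith),
      div_mul_eq_mul_div]
    gcongr
    exact hr.decay _ _ φ (hs' h1) hθ
  · intro js hjs s' θ' φ h1 _
    rw [tilted_G, norm_div, Complex.norm_real, Real.norm_of_nonneg (by linarith),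
      div_le_iff₀ (by linarith)]
    refine (hr.G_bound js hjs _ _ φ (hs' h1) hθ).trans ?_
    have : 0 ≤ C * (1 + ‖φ‖) ^ Γ := by positivity
    nlinarith
  · intro js _ s' θ' φ _ _
    refine ContinuousLinearMap.opNorm_le_bound _ (by positivity) fun e => ?_
    rw [Subsingleton.elim e 0, map_zero]
    simp
  · intro js _ s' θ' φ _ _
    refine ContinuousLinearMap.opNorm_le_bound _ (by positivity) fun e => ?_
    rw [Subsingleton.elim e 0, map_zero]
    simp

end Tilted

section RealExpansion

variable {s : Vec m} {θ e : Param p q}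

theorem cdir_right_zero (s : Vec m) (j : Fin m) : cdir s 0 j = (s j : ℂ) := by
  simp [cdir]

theorem Reg.real_ray_mem (h : Y.Reg θ₀ ρ C δ Γ) (hs : ‖s‖ ≤ ρ) (hθ : ‖θ - θ₀‖ ≤ ρ) :
    ∀ t ∈ Icc (0 : ℝ) 1, ((0 : Vec m) + t • s, θ) ∈ interior Y.convSet := fun t ht => by
  rw [zero_add]
  exact h.mem _ _ ((norm_smul_le_one ht).trans hs) hθ

theorem Reg.real_G_bound (h : Y.Reg θ₀ ρ C δ Γ) (hs : ‖s‖ ≤ ρ) (hθ : ‖θ - θ₀‖ ≤ ρ)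
    {js : List (Fin m)} (hjs : js.length ≤ 4) {t : ℝ} (ht : t ∈ Icc (0 : ℝ) 1) :
    ‖Y.G js (0 + t • s) (t • 0) θ‖ ≤ C := by
  rw [zero_add, smul_zero]
  simpa using h.G_bound js hjs (t • s) θ 0 ((norm_smul_le_one ht).trans hs) hθ

theorem Reg.real_dG_bound (h : Y.Reg θ₀ ρ C δ Γ) (hs : ‖s‖ ≤ ρ) (hθ : ‖θ - θ₀‖ ≤ ρ)
    {js : List (Fin m)} (hjs : js.length ≤ 4) {t : ℝ} (ht : t ∈ Icc (0 : ℝ) 1) :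
    ‖Y.dG js (0 + t • s) (t • 0) θ‖ ≤ C := by
  rw [zero_add, smul_zero]
  simpa using h.dG_bound js hjs (t • s) θ 0 ((norm_smul_le_one ht).trans hs) hθ

theorem Reg.R_sub_le (h : Y.Reg θ₀ ρ C δ Γ) (hs : ‖s‖ ≤ ρ) (hθ : ‖θ - θ₀‖ ≤ ρ)
    {js : List (Fin m)} (hjs : js.length ≤ 3) :
    |Y.R js (s, θ) - Y.R js (0, θ)| ≤ m * ‖s‖ * C := by
  have h1 := (isRayFamily_G (Y := Y) 4).expand_one (φ' := 0) (h.real_ray_mem hs hθ) (js := js)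
    (by omega) fun j t ht => h.real_G_bound hs hθ (by simp; omega) ht
  rwa [zero_add, G_zero_eq_R, G_zero_eq_R, ← Complex.ofReal_sub, Complex.norm_real, norm_zero,
    add_zero] at h1

theorem Reg.R_sub_sum_le (h : Y.Reg θ₀ ρ C δ Γ) (hs : ‖s‖ ≤ ρ) (hθ : ‖θ - θ₀‖ ≤ ρ)
    {js : List (Fin m)} (hjs : js.length ≤ 2) :
    |Y.R js (s, θ) - Y.R js (0, θ) - ∑ j, s j * Y.R (j :: js) (0, θ)| ≤
      m * ‖s‖ * (m * ‖s‖ * C) := by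
  have h1 := (isRayFamily_G (Y := Y) 4).expand_two (φ' := 0) (h.real_ray_mem hs hθ) (js := js)
    (by omega) fun j k t ht => h.real_G_bound hs hθ (by simp; omega) ht
  simp only [cdir_right_zero, zero_add, G_zero_eq_R, norm_zero, add_zero, smul_eq_mul,
    ← Complex.ofReal_mul, ← Complex.ofReal_sum, ← Complex.ofReal_sub, Complex.norm_real] at h1
  exact h1

theorem Reg.mgf_sub_le (h : Y.Reg θ₀ ρ C δ Γ) (hs : ‖s‖ ≤ ρ) (hθ : ‖θ - θ₀‖ ≤ ρ) :
    |Y.mgf (s, θ) - (1 + inner ℝ s (Y.K1 θ) +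
      (quad (Y.K2 θ) s + inner ℝ s (Y.K1 θ) ^ 2) / 2)| ≤ m * ‖s‖ * (m * ‖s‖ * (m * ‖s‖ * C)) := by
  have hθ' := h.mem_goodSet hθ
  have h1 := (isRayFamily_G (Y := Y) 4).expand_three (φ' := 0) (h.real_ray_mem hs hθ) (js := [])
    (by simp) fun j k l t ht => h.real_G_bound hs hθ (by simp) ht
  simp only [cdir_right_zero, zero_add, norm_zero, add_zero, smul_eq_mul] at h1
  have h2 := mP_eq s hθ'
  have h3 := mQ_sub_eq s hθ'
  rw [h2, sub_eq_iff_eq_add] at h3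
  unfold mP at h2
  unfold mQ at h3
  rw [h2, h3, ← mgf_eq_G, G_nil_zero hθ', Complex.real_smul] at h1
  rw [← Real.norm_eq_abs, ← Complex.norm_real]
  refine (le_of_eq ?_).trans h1
  congr 1
  push_cast
  ring

theorem Reg.dG_sub_sum_le (h : Y.Reg θ₀ ρ C δ Γ) (hg : Y.GrowthBound) (hs : ‖s‖ ≤ ρ)
    (hθ : ‖θ - θ₀‖ ≤ ρ) (e : Param p q) :
    ‖Y.dG [] s 0 θ e - ∑ j, (s j : ℂ) * Y.dG [j] 0 0 θ e‖ ≤ m * ‖s‖ * (m * ‖s‖ * C) * ‖e‖ := by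
  have h1 := (isRayFamily_dG hg).expand_two (φ' := 0) (h.real_ray_mem hs hθ) (js := [])
    (by simp) fun j k t ht => h.real_dG_bound hs hθ (by simp) ht
  have h2 := ContinuousLinearMap.le_of_opNorm_le _ h1 e
  simp only [cdir_right_zero, zero_add, norm_zero, add_zero, sub_apply, sum_apply, smul_apply,
    dG_nil_zero hg (h.mem_goodSet hθ), sub_zero, smul_eq_mul] at h2
  exact h2

theorem dG_single_fst (hg : Y.GrowthBound) {θ : Param p q} (hθ : θ ∈ Y.goodSet) (j : Fin m)
    (v : Vec p) : Y.dG [j] 0 0 θ (v, 0) = (mD Y θ v j : ℂ) := by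
  have h1 : HasFDerivAt (fun θ => Y.K1 θ j) ((EuclideanSpace.proj (𝕜 := ℝ) j : Vec m →L[ℝ] ℝ).comp
      (fderiv ℝ Y.K1 θ)) θ :=
    (EuclideanSpace.proj (𝕜 := ℝ) j : Vec m →L[ℝ] ℝ).hasFDerivAt.comp θ (hasFDerivAt_K1 hg hθ)
  have h2 : HasFDerivAt (fun θ => ((Y.K1 θ j : ℝ) : ℂ)) (Complex.ofRealCLM.comp
      ((EuclideanSpace.proj (𝕜 := ℝ) j : Vec m →L[ℝ] ℝ).comp (fderiv ℝ Y.K1 θ))) θ :=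
    Complex.ofRealCLM.hasFDerivAt.comp θ h1
  have h3 : Y.G [j] 0 0 =ᶠ[nhds θ] fun θ => ((Y.K1 θ j : ℝ) : ℂ) := by
    filter_upwards [isOpen_goodSet.mem_nhds hθ] with θ' hθ'
    rw [G_zero_eq_R, K1_eq hθ']
  have h4 := (hasFDerivAt_G hg (js := [j]) (s := 0) (φ := 0) (by simp) hθ).unique
    (h2.congr_of_eventuallyEq h3)
  rw [h4]
  rfl

end RealExpansion

end Model

theorem exp_le_quadratic {u b : ℝ} (h : |u| ≤ b) (hb : b ≤ 1) :
    Real.exp u ≤ 1 + u + u ^ 2 / 2 + b ^ 3 := by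
  have h1 := (abs_le.1 (Real.exp_bound (h.trans hb) (n := 3) (by norm_num))).2
  have h2 : |u| ^ 3 ≤ b ^ 3 := pow_le_pow_left₀ (abs_nonneg u) h 3
  have h3 : 0 ≤ |u| ^ 3 := by positivity
  norm_num [Finset.sum_range_succ, Nat.factorial] at h1
  linarith

theorem abs_sum_mul_le {m : ℕ} {a b : Fin m → ℝ} {A B : ℝ} (hA : 0 ≤ A) (ha : ∀ j, |a j| ≤ A)
    (hb : ∀ j, |b j| ≤ B) : |∑ j, a j * b j| ≤ m * A * B := by
  refine (Finset.abs_sum_le_sum_abs _ _).trans ((Finset.sum_le_card_nsmul _ _ (A * B)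
    fun j _ => ?_).trans_eq ?_)
  · rw [abs_mul]
    exact mul_le_mul (ha j) (hb j) (abs_nonneg _) hA
  · rw [Finset.card_univ, Fintype.card_fin, nsmul_eq_mul, mul_assoc]

namespace Model

variable {m p q : ℕ} {Y : Model m p q} {θ₀ : Param p q} {ρ C δ : ℝ} {Γ : ℕ}

section

variable {s y : Vec m} {θ : Param p q}

theorem Reg.abs_inner_K1_le (h : Y.Reg θ₀ ρ C δ Γ) (hθ : ‖θ - θ₀‖ ≤ ρ) :
    |inner ℝ s (Y.K1 θ)| ≤ momConst m C * ‖s‖ := by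
  have := h.norm_mP_le (φ := s) hθ
  rwa [mP_eq s (h.mem_goodSet hθ), Complex.norm_real] at this

theorem abs_inner_sub_inner_le (s y y' : Vec m) :
    |inner ℝ s y - inner ℝ s y'| ≤ ‖s‖ * ‖y - y'‖ := by
  rw [← inner_sub_right]
  exact abs_real_inner_le_norm _ _

theorem Reg.norm_le_of_mgf_le (h : Y.Reg θ₀ ρ C δ Γ) (hθ : ‖θ - θ₀‖ ≤ ρ) (hs : ‖s‖ ≤ ρ)
    (hs1 : (momConst m C + 1) * ‖s‖ ≤ 1)
    (hs2 : (m ^ 3 * C + (momConst m C + 1) ^ 3) * ‖s‖ ≤ δ ^ 2 / 2) (hy : ‖y - Y.K1 θ‖ ≤ 1)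
    (hle : Y.mgf (s, θ) ≤ Real.exp (inner ℝ s y)) : ‖s‖ ≤ 4 / δ ^ 2 * ‖y - Y.K1 θ‖ := by
  have hδ := h.δ_pos
  have hB := one_le_momConst m h.one_le_C
  set B := momConst m C
  set p := inner ℝ s (Y.K1 θ)
  set u := inner ℝ s y
  set σ := ‖s‖
  set d := ‖y - Y.K1 θ‖
  have hσ : 0 ≤ σ := norm_nonneg _
  have hp : |p| ≤ B * σ := h.abs_inner_K1_le hθ
  have hup : |u - p| ≤ σ * d := abs_inner_sub_inner_le s y (Y.K1 θ)
  have hu : |u| ≤ (B + 1) * σ := by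
    have : |u| ≤ |u - p| + |p| := by simpa using abs_add_le (u - p) p
    nlinarith
  have h1 := exp_le_quadratic hu hs1
  have h2 := (abs_le.1 (h.mgf_sub_le hs hθ)).1
  have h3 := h.quad_lower hθ s
  have h4 : (u - p) * (1 + (u + p) / 2) ≤ σ * d * 2 := by
    refine (le_abs_self _).trans ?_
    rw [abs_mul]
    refine mul_le_mul hup ?_ (abs_nonneg _) (by positivity)
    have := abs_le.1 hu
    have := abs_le.1 hp
    rw [abs_le]
    constructor <;> nlinarith
  have h5 : δ ^ 2 * σ ^ 2 ≤ σ * d * 2 + (m ^ 3 * C + (B + 1) ^ 3) * σ * σ ^ 2 := by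
    have : (u - p) * (1 + (u + p) / 2) = u + u ^ 2 / 2 - p - p ^ 2 / 2 := by ring
    have : (m ^ 3 * C + (B + 1) ^ 3) * σ * σ ^ 2 =
      m * σ * (m * σ * (m * σ * C)) + ((B + 1) * σ) ^ 3 := by ring
    linarith
  have h6 : (m ^ 3 * C + (B + 1) ^ 3) * σ * σ ^ 2 ≤ δ ^ 2 / 2 * σ ^ 2 :=
    mul_le_mul_of_nonneg_right hs2 (by positivity)
  rw [div_mul_eq_mul_div, le_div_iff₀ (by positivity)]
  rcases hσ.eq_or_lt with h0 | h0
  · rw [← h0, zero_mul]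
    positivity
  · refine le_of_mul_le_mul_left ?_ h0
    nlinarith

theorem Reg.continuousOn_mgf (h : Y.Reg θ₀ ρ C δ Γ) (hθ : ‖θ - θ₀‖ ≤ ρ) :
    ContinuousOn (fun s => Y.mgf (s, θ)) (closedBall 0 ρ) := by
  have hC := h.C_nonneg
  refine (LipschitzOnWith.of_dist_le_mul (K := ⟨m * C, by positivity⟩) fun a ha b hb => ?_).continuousOn
  rw [mem_closedBall_zero_iff] at ha hb
  have hseg : ∀ t ∈ Icc (0 : ℝ) 1, ‖b + t • (a - b)‖ ≤ ρ := fun t ht => by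
    have := (convex_closedBall (0 : Vec m) ρ).add_smul_sub_mem (mem_closedBall_zero_iff.2 hb)
      (mem_closedBall_zero_iff.2 ha) ht
    simpa using this
  have h1 := (isRayFamily_G (Y := Y) 4).expand_one (s := b) (s' := a - b) (φ' := 0) (b := C) (js := [])
    (fun t ht => h.mem _ _ (hseg t ht) hθ) (by simp) fun j t ht => by
      simpa using h.G_bound [j] (by simp) _ θ 0 (hseg t ht) hθ
  rw [add_sub_cancel, ← mgf_eq_G, ← mgf_eq_G, ← Complex.ofReal_sub, Complex.norm_real, norm_zero,
    add_zero] at h1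
  rw [dist_eq_norm, dist_eq_norm]
  refine h1.trans_eq ?_
  change _ = (m * C : ℝ) * ‖a - b‖
  ring

/-- The exponential tilt with mean `y`, for `y` near the mean of `Y_θ`. -/
theorem Reg.exists_saddle (h : Y.Reg θ₀ ρ C δ Γ) : ∃ r, 0 < r ∧ r ≤ 1 ∧
    ∀ (θ : Param p q) (y : Vec m), ‖θ - θ₀‖ ≤ ρ → ‖y - Y.K1 θ‖ ≤ r →
      ∃ s, ‖s‖ ≤ 4 / δ ^ 2 * ‖y - Y.K1 θ‖ ∧ ‖s‖ ≤ ρ / 2 ∧ |Y.mgf (s, θ) - 1| ≤ 1 / 2 ∧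
        ∀ j, Y.R [j] (s, θ) = y j * Y.mgf (s, θ) := by
  have hδ := h.δ_pos
  have hρ := h.ρ_pos
  have hC := h.one_le_C
  have hB := one_le_momConst m h.one_le_C
  set B := momConst m C
  set T := m ^ 3 * C + (B + 1) ^ 3 with hT
  have hT0 : 0 < T := by positivity
  set r₁ := min (ρ / 2) (min (1 / (B + 1)) (min (δ ^ 2 / 2 / T) (1 / 2 / (m * C + 1)))) with hr₁
  have hr₁0 : 0 < r₁ := by positivity
  have e1 : ∀ {σ}, σ ≤ r₁ → σ ≤ ρ / 2 := fun h' => h'.trans (min_le_left _ _)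
  have e2 : ∀ {σ}, σ ≤ r₁ → (B + 1) * σ ≤ 1 := fun h' => by
    have := h'.trans ((min_le_right _ _).trans (min_le_left _ _))
    rwa [le_div_iff₀ (by positivity), mul_comm] at this
  have e3 : ∀ {σ}, σ ≤ r₁ → T * σ ≤ δ ^ 2 / 2 := fun h' => by
    have := h'.trans ((min_le_right _ _).trans ((min_le_right _ _).trans (min_le_left _ _)))
    rwa [le_div_iff₀ (by positivity), mul_comm] at this
  have e4 : ∀ {σ}, σ ≤ r₁ → (m * C + 1) * σ ≤ 1 / 2 := fun h' => by
    have := h'.trans ((min_le_right _ _).trans ((min_le_right _ _).trans (min_le_right _ _)))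
    rwa [le_div_iff₀ (by positivity), mul_comm] at this
  refine ⟨min 1 (δ ^ 2 * r₁ / 8), by positivity, min_le_left _ _, fun θ y hθ hy => ?_⟩
  have hθ' := h.mem_goodSet hθ
  have hy1 : ‖y - Y.K1 θ‖ ≤ 1 := hy.trans (min_le_left _ _)
  have hsub : closedBall (0 : Vec m) r₁ ⊆ closedBall 0 ρ :=
    closedBall_subset_closedBall (by linarith [e1 le_rfl])
  obtain ⟨s, hs, hmin⟩ := (isCompact_closedBall (0 : Vec m) r₁).exists_isMinOn
    ⟨0, by simp [hr₁0.le]⟩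
    (f := fun s => Real.exp (-(inner ℝ s y)) * Y.mgf (s, θ))
    (ContinuousOn.mul (by fun_prop) ((h.continuousOn_mgf hθ).mono hsub))
  rw [mem_closedBall_zero_iff] at hs
  have hsρ : ‖s‖ ≤ ρ := by linarith [e1 hs]
  have hs0 := isMinOn_iff.1 hmin 0 (by simp [hr₁0.le])
  rw [inner_zero_left, neg_zero, Real.exp_zero, one_mul, mgf_zero (mem_domain_of_goodSet hθ'),
    Real.exp_neg, inv_mul_le_iff₀ (Real.exp_pos _), mul_one] at hs0
  have hsd := h.norm_le_of_mgf_le hθ hsρ (e2 hs) (e3 hs) hy1 hs0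
  have hlt : ‖s‖ < r₁ := by
    have h1 := hy.trans (min_le_right _ _)
    calc ‖s‖ ≤ 4 / δ ^ 2 * (δ ^ 2 * r₁ / 8) := hsd.trans (by gcongr)
      _ = r₁ / 2 := by field_simp; norm_num
      _ < r₁ := by linarith
  refine ⟨s, hsd, e1 hs, ?_, fun j => ?_⟩
  · have h1 := h.R_sub_le (js := []) hsρ hθ (by simp)
    rw [R_nil, R_nil_zero hθ'] at h1
    refine h1.trans ?_
    have := e4 hs
    have := norm_nonneg s
    nlinarith
  · have hz := h.mem s θ hsρ hθ
    have d1 : HasDerivAt (fun t : ℝ => Y.mgf (s + t • EuclideanSpace.single j (1 : ℝ), θ))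
        (Y.R [j] (s, θ)) 0 := by
      have := hasLineDerivAt_R [] j hz
      refine HasDerivAt.congr_of_eventuallyEq this (Eventually.of_forall fun t => ?_)
      simp [R_nil, dS]
    have d2 : HasDerivAt (fun t : ℝ => Real.exp (-(inner ℝ (s + t • EuclideanSpace.single j (1 : ℝ)) y)))
        (Real.exp (-(inner ℝ s y)) * -(y j)) 0 := by
      have h2 : HasDerivAt (fun t : ℝ => -(inner ℝ (s + t • EuclideanSpace.single j (1 : ℝ)) y))
          (-(y j)) 0 := by
        have h3 : ∀ t : ℝ, inner ℝ (s + t • EuclideanSpace.single j (1 : ℝ)) y =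
            inner ℝ s y + t * y j := fun t => by
          simp [inner_add_left, real_inner_smul_left, EuclideanSpace.inner_single_left]
        simp only [h3]
        exact ((((hasDerivAt_id (0 : ℝ)).mul_const (y j)).const_add (inner ℝ s y)).neg).congr_deriv
          (by simp)
      simpa using h2.exp
    have hmin' : IsLocalMin (fun t : ℝ =>
        Real.exp (-(inner ℝ (s + t • EuclideanSpace.single j (1 : ℝ)) y)) *
          Y.mgf (s + t • EuclideanSpace.single j (1 : ℝ), θ)) 0 := by
      filter_upwards [eventually_line_mem isOpen_ball (mem_ball_zero_iff.2 hlt)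
        (EuclideanSpace.single j (1 : ℝ))] with t ht
      have := isMinOn_iff.1 hmin _ (ball_subset_closedBall ht)
      simpa using this
    have h3 := hmin'.hasDerivAt_eq_zero (d2.fun_mul d1)
    rw [zero_smul, add_zero, mul_assoc, ← mul_add] at h3
    have h4 := (mul_eq_zero.1 h3).resolve_left (Real.exp_pos _).ne'
    linarith

theorem Reg.inv_K2_apply_le (h : Y.Reg θ₀ ρ C δ Γ) (hθ : ‖θ - θ₀‖ ≤ ρ) {c : Fin m → ℝ} {b : ℝ}
    (hc : ∀ j, |c j| ≤ b) (j : Fin m) : |((Y.K2 θ)⁻¹ *ᵥ c) j| ≤ m * b / (2 * δ ^ 2) := by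
  have hδ := h.δ_pos
  have hdet := (h.K2_posDef hθ).det_pos.ne'
  set x : Vec m := WithLp.toLp 2 ((Y.K2 θ)⁻¹ *ᵥ c) with hx
  have h1 := h.quad_lower hθ x
  have h2 : quad (Y.K2 θ) x = ∑ j, x j * c j := by
    rw [quad, hx, Matrix.mulVec_mulVec, Matrix.mul_nonsing_inv _ (Ne.isUnit hdet),
      Matrix.one_mulVec]
    rfl
  have h3 : quad (Y.K2 θ) x ≤ m * ‖x‖ * b := by
    rw [h2]
    exact (le_abs_self _).trans (abs_sum_mul_le (norm_nonneg x) (abs_coord_le x) hc)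
  refine (abs_coord_le x j).trans ?_
  rw [le_div_iff₀ (by positivity)]
  have hb : 0 ≤ b := (abs_nonneg _).trans (hc j)
  rcases (norm_nonneg x).eq_or_lt with h0 | h0
  · rw [← h0, zero_mul]
    positivity
  · refine le_of_mul_le_mul_left ?_ h0
    nlinarith

/-- At a saddle point, the logarithmic derivative of the moment generating function agrees to
second order with that of the normal approximation. -/
theorem Reg.exists_saddle_deriv_le (h : Y.Reg θ₀ ρ C δ Γ) (hg : Y.GrowthBound) (M : ℝ) (hM : 0 ≤ M) :
    ∃ K, 0 ≤ K ∧ ∀ (θ : Param p q) (s y : Vec m), ‖θ - θ₀‖ ≤ ρ → ‖y - Y.K1 θ‖ ≤ 1 →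
      ‖s‖ ≤ M * ‖y - Y.K1 θ‖ → ‖s‖ ≤ ρ → |Y.mgf (s, θ) - 1| ≤ 1 / 2 →
      (∀ j, Y.R [j] (s, θ) = y j * Y.mgf (s, θ)) → ∀ v : Vec p,
        |(Y.dG [] s 0 θ (v, 0)).re / Y.mgf (s, θ) -
          mD Y θ v ⬝ᵥ ((Y.K2 θ)⁻¹ *ᵥ (y - Y.K1 θ).ofLp)| ≤ K * ‖y - Y.K1 θ‖ ^ 2 * ‖v‖ := by
  have hδ := h.δ_pos
  have hC := h.C_nonneg
  have hB := one_le_momConst m h.one_le_C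
  set B := momConst m C
  refine ⟨2 * (m ^ 2 * M ^ 2 * C + m * M * C * (m * C * M)) +
    m * C * (m * (B * M + m ^ 2 * C * M ^ 2 * (C + 2)) / (2 * δ ^ 2)), by positivity,
    fun θ s y hθ hy hs hsρ hmg hR v => ?_⟩
  have hθ' := h.mem_goodSet hθ
  set d := ‖y - Y.K1 θ‖ with hd
  set σ := ‖s‖ with hσ
  set μ := Y.mgf (s, θ) with hμ
  have hd0 : 0 ≤ d := norm_nonneg _
  have hσ0 : 0 ≤ σ := norm_nonneg _
  have hσ2 : σ ^ 2 ≤ M ^ 2 * d ^ 2 := by rw [← mul_pow]; gcongr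
  have hμ2 : 1 / 2 ≤ μ := by linarith [(abs_le.1 hmg).1]
  set p := inner ℝ s (Y.K1 θ) with hp
  have hpB : |p| ≤ B * σ := h.abs_inner_K1_le hθ
  have hps : ∑ j, s j * Y.R [j] (0, θ) = p := by
    rw [hp, inner_eq_dotProduct, dotProduct]
    exact Finset.sum_congr rfl fun j _ => by rw [K1_eq hθ']
  have h0ρ : ‖(0 : Vec m)‖ ≤ ρ := by simpa using h.ρ_pos.le
  have hK1 : ∀ j, |Y.K1 θ j| ≤ C := fun j => by
    have := h.G_bound [j] (by simp) 0 θ 0 h0ρ hθ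
    rw [G_zero_eq_R, ← K1_eq hθ', Complex.norm_real] at this
    simpa using this
  have hyj : ∀ j, |y j - Y.K1 θ j| ≤ d := fun j => abs_coord_le (y - Y.K1 θ) j
  have hmD : ∀ j, |mD Y θ v j| ≤ C * ‖v‖ := fun j => by
    have := h.norm_dG_zero_le hθ (js := [j]) (by simp) (v, 0)
    rw [dG_single_fst hg hθ', Complex.norm_real] at this
    refine this.trans_eq ?_
    simp [Prod.norm_def]
  set c : Fin m → ℝ := (y - Y.K1 θ).ofLp - Y.K2 θ *ᵥ s.ofLp with hc
  have hcj : ∀ j, |c j| ≤ (B * M + m ^ 2 * C * M ^ 2 * (C + 2)) * d ^ 2 := by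
    intro j
    have a1 := h.R_sub_sum_le (js := []) hsρ hθ (by simp)
    rw [R_nil, R_nil_zero hθ', hps, ← hμ] at a1
    have a2 := h.R_sub_sum_le (js := [j]) hsρ hθ (by simp)
    have a3 : ∑ k, s k * Y.R [k, j] (0, θ) = (Y.K2 θ *ᵥ s.ofLp) j + Y.K1 θ j * p := by
      rw [hp, inner_eq_dotProduct, ← K2_transpose hθ', Matrix.mulVec, dotProduct, dotProduct,
        Finset.mul_sum, ← Finset.sum_add_distrib]
      refine Finset.sum_congr rfl fun k _ => ?_
      rw [Matrix.transpose_apply, K2_eq hθ']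
      ring
    rw [a3, hR j, ← K1_eq hθ'] at a2
    set E := m * σ * (m * σ * C) with hE
    have hE' : E ≤ m ^ 2 * C * M ^ 2 * d ^ 2 := by
      calc E = m ^ 2 * C * σ ^ 2 := by rw [hE]; ring
        _ ≤ m ^ 2 * C * (M ^ 2 * d ^ 2) := by gcongr
        _ = _ := by ring
    have hE0 : 0 ≤ E := by positivity
    have hcj : c j = -((y j - Y.K1 θ j) * p) + (y j * μ - Y.K1 θ j - ((Y.K2 θ *ᵥ s.ofLp) j + Y.K1 θ j * p)) -
        y j * (μ - 1 - p) := by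
      simp only [hc, Pi.sub_apply, PiLp.sub_apply]
      ring
    have b1 : |(y j - Y.K1 θ j) * p| ≤ B * M * d ^ 2 := by
      rw [abs_mul]
      calc _ ≤ d * (B * (M * d)) := by
            refine mul_le_mul (hyj j) (hpB.trans ?_) (abs_nonneg _) hd0
            gcongr
        _ = _ := by ring
    have b2 : |y j * (μ - 1 - p)| ≤ (C + 1) * E := by
      rw [abs_mul]
      refine mul_le_mul ?_ a1 (abs_nonneg _) (by positivity)
      have := abs_add_le (y j - Y.K1 θ j) (Y.K1 θ j)
      rw [sub_add_cancel] at this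
      linarith [hyj j, hK1 j]
    rw [hcj]
    refine (abs_sub _ _).trans ((add_le_add ((abs_add_le _ _).trans (add_le_add
      ((abs_neg _).trans_le b1) a2)) b2).trans ?_)
    nlinarith
  have hx := h.inv_K2_apply_le hθ hcj
  have hsum : mD Y θ v ⬝ᵥ ((Y.K2 θ)⁻¹ *ᵥ (y - Y.K1 θ).ofLp) =
      (∑ j, s j * mD Y θ v j) + mD Y θ v ⬝ᵥ ((Y.K2 θ)⁻¹ *ᵥ c) := by
    have hdet := (h.K2_posDef hθ).det_pos.ne'
    rw [hc, Matrix.mulVec_sub, Matrix.mulVec_mulVec, Matrix.nonsing_inv_mul _ (Ne.isUnit hdet),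
      Matrix.one_mulVec, dotProduct_sub]
    have : ∑ j, s j * mD Y θ v j = mD Y θ v ⬝ᵥ s.ofLp := by
      rw [dotProduct]
      exact Finset.sum_congr rfl fun j _ => mul_comm _ _
    rw [this]
    ring
  set S := ∑ j, s j * mD Y θ v j with hS
  have hSle : |S| ≤ m * σ * (C * ‖v‖) := abs_sum_mul_le hσ0 (abs_coord_le s) hmD
  have g1 : |mD Y θ v ⬝ᵥ ((Y.K2 θ)⁻¹ *ᵥ c)| ≤ m * (C * ‖v‖) *
      (m * ((B * M + m ^ 2 * C * M ^ 2 * (C + 2)) * d ^ 2) / (2 * δ ^ 2)) :=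
    abs_sum_mul_le (by positivity) hmD hx
  have g2 : |(Y.dG [] s 0 θ (v, 0)).re - S| ≤ m * σ * (m * σ * C) * ‖v‖ := by
    have := h.dG_sub_sum_le hg hsρ hθ (v, 0)
    simp only [dG_single_fst hg hθ', ← Complex.ofReal_mul, ← Complex.ofReal_sum] at this
    rw [← hS] at this
    have h2 := (Complex.abs_re_le_norm _).trans this
    rw [Complex.sub_re, Complex.ofReal_re] at h2
    refine h2.trans_eq ?_
    simp [Prod.norm_def, hσ]
  have g3 : |μ - 1| ≤ m * σ * C := by
    have := h.R_sub_le (js := []) hsρ hθ (by simp)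
    rwa [R_nil, R_nil_zero hθ'] at this
  have g4 : |(Y.dG [] s 0 θ (v, 0)).re / μ - S| ≤
      2 * (m * σ * (m * σ * C) * ‖v‖ + m * σ * C * (m * σ * (C * ‖v‖))) := by
    have hμ0 : 0 < μ := by linarith
    have : (Y.dG [] s 0 θ (v, 0)).re / μ - S =
        ((Y.dG [] s 0 θ (v, 0)).re - S - (μ - 1) * S) / μ := by
      field_simp
      ring
    rw [this, abs_div, abs_of_pos hμ0, div_le_iff₀ hμ0]
    have h5 : |(Y.dG [] s 0 θ (v, 0)).re - S - (μ - 1) * S| ≤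
        m * σ * (m * σ * C) * ‖v‖ + m * σ * C * (m * σ * (C * ‖v‖)) := by
      refine (abs_sub _ _).trans (add_le_add g2 ?_)
      rw [abs_mul]
      exact mul_le_mul g3 hSle (abs_nonneg _) (by positivity)
    have h6 : 0 ≤ m * σ * (m * σ * C) * ‖v‖ + m * σ * C * (m * σ * (C * ‖v‖)) := by positivity
    nlinarith
  rw [hsum, ← sub_sub]
  refine (abs_sub _ _).trans ((add_le_add g4 g1).trans ?_)
  have h7 : 2 * (m * σ * (m * σ * C) * ‖v‖ + m * σ * C * (m * σ * (C * ‖v‖))) =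
      2 * (m ^ 2 * C + m * C * (m * C)) * ‖v‖ * σ ^ 2 := by ring
  rw [h7]
  calc _ ≤ 2 * (m ^ 2 * C + m * C * (m * C)) * ‖v‖ * (M ^ 2 * d ^ 2) + _ := by gcongr
    _ = _ := by ring

end

end Model

namespace Model

variable {m p q : ℕ}

/-- The rescaled Fourier integral is bounded below when the observation equals the mean, uniformly
over all models with given regularity constants. -/
theorem exists_tI_mean_ge (m p q : ℕ) {C δ : ℝ} (hC : 1 ≤ C) (hδ : 0 < δ) (Γ : ℕ) :
    ∃ c, 0 < c ∧ ∃ N : ℕ, ∀ (Z : Model m p q) (θ : Param p q) (ρ : ℝ), Z.Reg θ ρ C δ Γ →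
      ∀ k, N ≤ k → ∀ a, Z.wv k a θ = 0 → c ≤ Z.tI k a θ := by
  obtain ⟨D, hD1, N, hdom⟩ := exists_decay_dom m 3 hδ
  set S := ∫ φ : Vec m, wt φ
  set K := jetConst m C Γ + 2
  set L : ℝ := (Fintype.card (Fin m)).factorial • (2 * C ^ 2) ^ Fintype.card (Fin m)
  set c := gc m * Real.exp (-(1 / 2 * Real.log L)) with hc
  have hc0 : 0 < c := mul_pos (gc_pos m) (Real.exp_pos _)
  obtain ⟨N', hN'⟩ := eventually_mul_eps_le (K * D * S) (half_pos hc0)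
  refine ⟨c / 2, half_pos hc0, max (N + 3) N', fun Z θ ρ hZ k hk a ha => ?_⟩
  have hj := hZ.jetConst_nonneg
  have hk1 : N + 3 ≤ k := (le_max_left _ _).trans hk
  have hk2 := hN' k ((le_max_right _ _).trans hk)
  have hθ : ‖θ - θ‖ ≤ ρ := by simpa using hZ.ρ_pos.le
  have hθ' := hZ.mem_goodSet hθ
  have hpd := hZ.K2_posDef hθ
  have h1 : c ≤ Z.nI k a θ := by
    rw [nI_eq hθ' hpd, ha, hc]
    have h2 : (Z.K2 θ).det ≤ L := by
      refine (le_abs_self _).trans (Matrix.det_le (abv := AbsoluteValue.abs) fun i j => ?_)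
      have hR : ∀ js : List (Fin m), js.length ≤ 4 → |Z.R js (0, θ)| ≤ C := fun js hjs => by
        have := hZ.G_bound js hjs 0 θ 0 (by simpa using hZ.ρ_pos.le) hθ
        rw [G_zero_eq_R, Complex.norm_real] at this
        simpa using this
      change |Z.K2 θ i j| ≤ _
      rw [K2_eq hθ', K1_eq hθ', K1_eq hθ']
      refine (abs_sub _ _).trans ((add_le_add (hR _ (by simp)) ?_).trans
        (by nlinarith : C + C * C ≤ _))
      rw [abs_mul]
      exact mul_le_mul (hR _ (by simp)) (hR _ (by simp)) (abs_nonneg _) (by linarith)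
    have h3 := Real.log_le_log hpd.det_pos h2
    refine mul_le_mul_of_nonneg_left (Real.exp_le_exp.2 ?_) (gc_pos m).le
    simp only [gLog, WithLp.ofLp_zero, Matrix.mulVec_zero, dotProduct_zero]
    linarith
  have he := eps_pos k
  have hg : ∀ φ : Vec m, 0 ≤ (1 + δ * ‖eps k • φ‖ ^ 2) ^ (-δ) ∧ _ := fun φ => decay_mem hδ _
  have hy : ∀ φ : Vec m, 1 ≤ (1 + ‖φ‖) ^ 3 := fun φ => one_le_pow₀ (by linarith [norm_nonneg φ])
  have h4 := norm_integral_osf_sub_le (a := a)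
    (((continuous_G hθ').comp (continuous_const_smul (eps k))).pow (k + 3))
    (((continuous_gN θ).comp (continuous_const_smul (eps k))).pow (k + 3))
    (hdom hk1 zero_le_one fun φ => pow_kernel_le (hy φ) (hg φ).1 (hg φ).2 (hZ.decay_zero hθ))
    (hdom hk1 zero_le_one fun φ => pow_kernel_le (hy φ) (hg φ).1 (hg φ).2 (hZ.norm_gN_le hθ))
    (hdom hk1 (b := K * eps k) (by positivity) fun φ => pow_kernel_sub (by linarith)
      (hy φ) (hg φ).1 (hg φ).2 he (mul_eps_sq k)
      (hZ.decay_zero hθ) (hZ.norm_gN_le hθ) (hZ.scaled_G_sub he (eps_le_one k) hθ φ))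
  have h5 := (abs_le.1 ((Complex.abs_re_le_norm _).trans h4)).1
  rw [Complex.sub_re] at h5
  have h6 : Z.nI k a θ - Z.tI k a θ ≤ K * eps k * D * S := by
    have : -(K * eps k * D * S) ≤ Z.tI k a θ - Z.nI k a θ := h5
    linarith
  linarith

end Model

namespace Model

variable {m p q : ℕ} {Y : Model m p q} {θ₀ : Param p q} {ρ C δ : ℝ} {Γ : ℕ}

section TiltedIntegral

variable {s : Vec m} {θ e : Param p q}

theorem continuous_G_real (hz : (s, θ) ∈ Y.convSet) : Continuous fun φ => Y.G [] s φ θ := by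
  simp only [G_nil]
  exact continuous_complexMGF hz

theorem continuous_dG_real (hg : Y.GrowthBound) (hz : (s, θ) ∈ interior Y.convSet)
    (e : Param p q) : Continuous fun φ => Y.dG [] s φ θ e := by
  have h1 : Continuous fun φ => Y.dG [] s φ θ := by
    rw [← continuousOn_univ]
    exact (continuousOn_dG hg (js := []) (by simp)).comp
      (f := fun φ : Vec m => (φ, (s, θ))) (by fun_prop) fun φ _ => hz
  exact (ContinuousLinearMap.apply ℝ ℂ e).continuous.comp h1

theorem dG_zero_im (hg : Y.GrowthBound) (hz : (s, θ) ∈ interior Y.convSet) (e : Param p q) :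
    (Y.dG [] s 0 θ e).im = 0 := by
  refine fderiv_apply_eq_zero_of_line (f := fun θ => (Y.G [] s 0 θ).im)
    (f' := Complex.imCLM.comp (Y.dG [] s 0 θ))
    (Complex.imCLM.hasFDerivAt.comp θ (hasFDerivAt_G hg (by simp) hz)) ?_
  exact Eventually.of_forall fun t => by simp only [G_zero_eq_R, Complex.ofReal_im]

/-- The rescaled Fourier integral expressed through an exponentially tilted distribution. -/
theorem tI_eq_tilted {k : ℕ} {μ : ℝ} (hμ : 0 < μ) (hθ : θ ∈ Y.goodSet)
    (hz : (s, θ) ∈ Y.convSet)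
    (h0 : Integrable fun φ => Y.complexMGF φ (0, θ) ^ (k + 3))
    (hs : Integrable fun φ => Y.complexMGF φ (s, θ) ^ (k + 3)) (a : Vec m) :
    Y.tI k a θ = Real.exp (-(inner ℝ s ((eps k)⁻¹ • a))) * μ ^ (k + 3) *
      (osc k a fun φ => Y.G [] s (eps k • φ) θ / μ).re := by
  have he := eps_pos k
  have h1 := (Y.likelihood_eq_integral (mem_domain_of_goodSet hθ) hz h0 hs).2 ((eps k)⁻¹ • a)
  rw [likelihood_eq_tI hθ h0, integral_rescale he] at h1
  simp only [osf_rescale, ← G_nil, smul_smul, mul_inv_cancel₀ he.ne', one_smul] at h1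
  have h2 : (∫ φ, osf a φ * Y.G [] s (eps k • φ) θ ^ (k + 3)) =
      (μ : ℂ) ^ (k + 3) * osc k a fun φ => Y.G [] s (eps k • φ) θ / μ := by
    rw [osc, ← integral_const_mul]
    refine integral_congr_ae (Eventually.of_forall fun φ => ?_)
    have : (μ : ℂ) ≠ 0 := by exact_mod_cast hμ.ne'
    dsimp only
    rw [div_pow]
    field_simp
  rw [h2] at h1
  have h3 : ((nrm m k * Y.tI k a θ : ℝ) : ℂ) = ((nrm m k *
      (Real.exp (-(inner ℝ s ((eps k)⁻¹ • a))) * μ ^ (k + 3)) : ℝ) : ℂ) *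
      osc k a fun φ => Y.G [] s (eps k • φ) θ / μ := by
    rw [h1, nrm]
    push_cast
    rw [div_pow]
    ring
  have h4 := congrArg Complex.re h3
  rw [Complex.ofReal_re, Complex.re_ofReal_mul, mul_assoc] at h4
  exact mul_left_cancel₀ (nrm_pos m k).ne' h4

theorem Reg.mgf_le (h : Y.Reg θ₀ ρ C δ Γ) (hs : ‖s‖ ≤ ρ) (hθ : ‖θ - θ₀‖ ≤ ρ) :
    Y.mgf (s, θ) ≤ C := by
  have := h.G_bound [] (by simp) s θ 0 hs hθ
  rw [← mgf_eq_G, Complex.norm_real] at this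
  exact (le_abs_self _).trans (by simpa using this)

theorem Reg.dG_sub_mul_G_le (h : Y.Reg θ₀ ρ C δ Γ) (hg : Y.GrowthBound) (hs : ‖s‖ ≤ ρ)
    (hθ : ‖θ - θ₀‖ ≤ ρ) (hM : 1 / 2 ≤ Y.mgf (s, θ)) (φ : Vec m) :
    ‖Y.dG [] s φ θ e / Y.mgf (s, θ) - ((Y.dG [] s 0 θ e).re / Y.mgf (s, θ) : ℝ) *
      (Y.G [] s φ θ / Y.mgf (s, θ))‖ ≤
      2 * (m * C) * (1 + 2 * C) * (‖φ‖ * (1 + ‖φ‖) ^ Γ) * ‖e‖ := by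
  have hC := h.C_nonneg
  have hz := h.mem s θ hs hθ
  set μ := Y.mgf (s, θ) with hμ
  have hμ0 : 0 < μ := by linarith
  have hμc : (μ : ℂ) ≠ 0 := by exact_mod_cast hμ0.ne'
  have hseg : ∀ t ∈ Icc (0 : ℝ) 1, (s + t • (0 : Vec m), θ) ∈ interior Y.convSet := fun t _ => by
    simpa using hz
  have hb : ∀ t ∈ Icc (0 : ℝ) 1, C * (1 + ‖t • φ‖) ^ Γ ≤ C * (1 + ‖φ‖) ^ Γ := fun t ht => by
    have := norm_smul_le_one (φ := φ) ht
    gcongr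
  have h1 := (isRayFamily_G (Y := Y) 4).expand_one (φ' := φ) hseg (js := []) (by simp)
    fun j t ht => by
      have := (h.G_bound [j] (by simp) s θ (t • φ) hs hθ).trans (hb t ht)
      simpa using this
  have h2 := (isRayFamily_dG hg).expand_one (φ' := φ) hseg (js := []) (by simp)
    fun j t ht => by
      have := (h.dG_bound [j] (by simp) s θ (t • φ) hs hθ).trans (hb t ht)
      simpa using this
  have h3 := ContinuousLinearMap.le_of_opNorm_le _ h2 e
  simp only [add_zero, norm_zero, zero_add, sub_apply] at h1 h3
  have h4 : |(Y.dG [] s 0 θ e).re / μ| ≤ 2 * C * ‖e‖ := by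
    rw [abs_div, abs_of_pos hμ0, div_le_iff₀ hμ0]
    have h5 := (Complex.abs_re_le_norm _).trans ((Y.dG [] s 0 θ).le_of_opNorm_le
      (h.dG_bound [] (by simp) s θ 0 hs hθ) e)
    simp only [norm_zero, add_zero, one_pow, mul_one] at h5
    have h6 : 0 ≤ C * ‖e‖ := by positivity
    nlinarith
  have h7 : Y.dG [] s 0 θ e = ((Y.dG [] s 0 θ e).re : ℂ) :=
    Complex.ext (by simp) (by simp [dG_zero_im hg hz])
  have h8 : Y.dG [] s φ θ e / μ - ((Y.dG [] s 0 θ e).re / μ : ℝ) * (Y.G [] s φ θ / μ) =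
      ((Y.dG [] s φ θ e - Y.dG [] s 0 θ e) - ((Y.dG [] s 0 θ e).re / μ : ℝ) *
        (Y.G [] s φ θ - Y.G [] s 0 θ)) / μ := by
    rw [← mgf_eq_G s θ, ← hμ]
    rw [h7, Complex.ofReal_re]
    push_cast
    field_simp
    ring
  rw [h8, norm_div, Complex.norm_real, Real.norm_of_nonneg hμ0.le, div_le_iff₀ hμ0]
  refine (norm_sub_le_of_le h3 ((norm_mul_le_of_le ((Complex.norm_real _).trans_le h4) h1))).trans ?_
  have h9 : 0 ≤ m * C * (1 + 2 * C) * (‖φ‖ * (1 + ‖φ‖) ^ Γ) * ‖e‖ := by positivity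
  nlinarith

set_option maxHeartbeats 1000000 in
theorem Reg.exists_tilt (h : Y.Reg θ₀ ρ C δ Γ) (hg : Y.GrowthBound) {K : ℝ} {N₀ : ℕ}
    (ho : Y.OscBounds θ₀ ρ K N₀) : ∃ M, 0 ≤ M ∧ ∃ r, 0 < r ∧ ∃ N : ℕ, ∀ k, N ≤ k →
      ∀ (a : Vec m) (θ : Param p q), ‖θ - θ₀‖ < ρ → eps k * ‖Y.wv k a θ‖ ≤ r →
        0 < Y.tI k a θ ∧ ∀ v : Vec p, Y.tI1 k a θ (v, 0) ≤ Y.tI k a θ *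
          (Y.lF θ 0 (Y.wv k a θ).ofLp v + M * (1 + eps k * ‖Y.wv k a θ‖ ^ 2) * ‖v‖) := by
  have hC := h.C_nonneg
  have hδ := h.δ_pos
  have hρ := h.ρ_pos
  obtain ⟨r, hr, hr1, hsad⟩ := h.exists_saddle
  obtain ⟨K', hK', hder⟩ := h.exists_saddle_deriv_le hg (4 / δ ^ 2) (by positivity)
  obtain ⟨c, hc, N₁, hlow⟩ := exists_tI_mean_ge m 0 0 (C := 2 * C) (by linarith [h.one_le_C]) hδ Γ
  obtain ⟨N₂, hint⟩ := h.exists_integrable_pow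
  obtain ⟨D, hD1, N₃, hdom⟩ := exists_decay_dom m (Γ + 1) hδ
  set S := ∫ φ : Vec m, wt φ
  have hS0 : 0 ≤ S := integral_nonneg wt_nonneg
  set B := 1 + 2 * (m * C) * (1 + 2 * C)
  have hB1 : 1 ≤ B := by
    have : 0 ≤ 2 * (m * C) * (1 + 2 * C) := by positivity
    linarith
  refine ⟨K' + B * D * S / c, by positivity, r, hr, N₀ + N₁ + N₂ + N₃ + 3,
    fun k hk a θ hθ hw => ?_⟩
  have he := eps_pos k
  have hyK : eps k • a - Y.K1 θ = eps k • Y.wv k a θ := by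
    rw [wv, smul_sub, smul_smul, mul_inv_cancel₀ he.ne', one_smul]
  have hd : ‖eps k • a - Y.K1 θ‖ = eps k * ‖Y.wv k a θ‖ := by
    rw [hyK, norm_smul, Real.norm_of_nonneg he.le]
  obtain ⟨s, hs1, hs2, hmg, hR⟩ := hsad θ (eps k • a) hθ.le (by rw [hd]; exact hw)
  have hsρ : ‖s‖ ≤ ρ := by linarith
  have hz := h.mem s θ hsρ hθ.le
  have hM : 1 / 2 ≤ Y.mgf (s, θ) := by linarith [(abs_le.1 hmg).1]
  have hκ := hder θ s (eps k • a) hθ.le (by rw [hd]; linarith) hs1 hsρ hmg hR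
  have hT := h.tilted (h := interior_subset hz) hs2 hθ.le hM
  set T := Y.tilted s θ (interior_subset hz) with hTdef
  set μ := Y.mgf (s, θ) with hμ
  have hμ0 : 0 < μ := by linarith
  have h00 : ‖(0 : Param 0 0) - 0‖ ≤ ρ / 2 := by simpa using by positivity
  have hTK : T.K1 0 = eps k • a := by
    ext j
    have h1 := tilted_G (h := interior_subset hz) [j] 0 0 (0 : Param 0 0)
    rw [G_zero_eq_R, ← hTdef, ← K1_eq (hT.mem_goodSet h00), add_zero, G_zero_eq_R, hR j, ← hμ] at h1
    have h2 : T.K1 0 j = (eps k • a) j * μ / μ := by exact_mod_cast h1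
    rw [h2, mul_div_cancel_right₀ _ hμ0.ne']
  have hTw : T.wv k a 0 = 0 := by
    rw [wv, hTK, smul_smul, inv_mul_cancel₀ he.ne', one_smul, sub_self]
  have hlo := hlow T 0 (ρ / 2) hT k (by omega) a hTw
  have htI : T.tI k a 0 = (osc k a fun φ => Y.G [] s (eps k • φ) θ / μ).re := by
    unfold tI
    congr 2
    ext φ
    rw [hTdef, tilted_G, add_zero]
  rw [htI] at hlo
  have hid : ∀ θ', ‖θ' - θ₀‖ ≤ ρ → Y.tI k a θ' =
      Real.exp (-(inner ℝ s ((eps k)⁻¹ • a))) * μ ^ (k + 3) *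
      (osc k a fun φ => Y.G [] s (eps k • φ) θ' / μ).re := fun θ' hθ' =>
    tI_eq_tilted hμ0 (h.mem_goodSet hθ') (interior_subset (h.mem s θ' hsρ hθ'))
      (hint (k + 3) (by omega) 0 θ' (by simpa using hρ.le) hθ')
      (hint (k + 3) (by omega) s θ' hsρ hθ') a
  set A := Real.exp (-(inner ℝ s ((eps k)⁻¹ • a))) * μ ^ (k + 3)
  have hA0 : 0 < A := by positivity
  set J := (osc k a fun φ => Y.G [] s (eps k • φ) θ / μ).re
  have hIJ : Y.tI k a θ = A * J := hid θ hθ.le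
  refine ⟨by rw [hIJ]; exact mul_pos hA0 (hc.trans_le hlo), fun v => ?_⟩
  set e : Param p q := scl (eps k) (v, 0) with hee
  have hev : e = eps k • (v, 0) := by simp [hee, scl]
  have hen : ‖e‖ = eps k * ‖v‖ := by
    rw [hev, norm_smul, Real.norm_of_nonneg he.le]
    simp [Prod.norm_def]
  set g : Vec m → ℝ := fun φ => (1 + δ * ‖eps k • φ‖ ^ 2) ^ (-δ)
  have hg0 : ∀ φ, 0 ≤ g φ := fun φ => (decay_mem hδ _).1
  have hg1 : ∀ φ, g φ ≤ 1 := fun φ => (decay_mem hδ _).2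
  have hy : ∀ φ : Vec m, 1 ≤ (1 + ‖φ‖) ^ (Γ + 1) := fun φ =>
    one_le_pow₀ (by linarith [norm_nonneg φ])
  have hk3 : N₃ + 3 ≤ k := by omega
  set X : Param p q → Vec m → ℂ := fun θ' φ => Y.G [] s (eps k • φ) θ' / μ with hX
  set X1 : Param p q → Vec m → ℂ := fun θ' φ => Y.dG [] s (eps k • φ) θ' e / μ with hX1
  have cX : ∀ θ', ‖θ' - θ₀‖ ≤ ρ → Continuous (X θ') := fun θ' hθ' =>
    ((continuous_G_real (interior_subset (h.mem s θ' hsρ hθ'))).comp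
      (continuous_const_smul (eps k))).div_const _
  have cX1 : ∀ θ', ‖θ' - θ₀‖ ≤ ρ → Continuous (X1 θ') := fun θ' hθ' =>
    ((continuous_dG_real hg (h.mem s θ' hsρ hθ') e).comp (continuous_const_smul (eps k))).div_const _
  have hXb : ∀ θ', ‖θ' - θ₀‖ ≤ ρ → ∀ φ, ‖X θ' φ‖ ≤ 2 * C * g φ := fun θ' hθ' φ => by
    have h1 := h.decay s θ' (eps k • φ) hsρ hθ'
    have h2 := h.mgf_le hsρ hθ'
    simp only [hX]
    rw [norm_div, Complex.norm_real, Real.norm_of_nonneg hμ0.le, div_le_iff₀ hμ0]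
    refine h1.trans ((mul_le_mul_of_nonneg_right h2 (hg0 φ)).trans ?_)
    have : 0 ≤ C * g φ := mul_nonneg hC (hg0 φ)
    nlinarith
  have hX1b : ∀ θ', ‖θ' - θ₀‖ ≤ ρ → ∀ φ, ‖X1 θ' φ‖ ≤ 2 * C * ‖e‖ * (1 + ‖φ‖) ^ (Γ + 1) :=
    fun θ' hθ' φ => by
    have h1 := (Y.dG [] s (eps k • φ) θ').le_of_opNorm_le
      (h.dG_bound [] (by simp) s θ' (eps k • φ) hsρ hθ') e
    simp only [hX1]
    rw [norm_div, Complex.norm_real, Real.norm_of_nonneg hμ0.le, div_le_iff₀ hμ0]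
    have h2 : (1 + ‖eps k • φ‖) ^ Γ ≤ (1 + ‖φ‖) ^ (Γ + 1) := by
      rw [norm_scl_phi he.le]
      calc (1 + eps k * ‖φ‖) ^ Γ ≤ (1 + ‖φ‖) ^ Γ := by
            gcongr
            exact mul_le_of_le_one_left (norm_nonneg _) (eps_le_one k)
        _ ≤ _ := pow_le_pow_right₀ (by linarith [norm_nonneg φ]) (by omega)
    refine h1.trans ((mul_le_mul_of_nonneg_right (mul_le_mul_of_nonneg_left h2 hC)
      (norm_nonneg e)).trans ?_)
    have : 0 ≤ C * (1 + ‖φ‖) ^ (Γ + 1) * ‖e‖ := by positivity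
    nlinarith
  have hy3 : ∀ φ : Vec m, (1 + ‖φ‖) ^ (Γ + 1) ≤ ((1 + ‖φ‖) ^ (Γ + 1)) ^ 3 := fun φ =>
    le_self_pow₀ (hy φ) (by norm_num)
  have hgk : ∀ φ (i : ℕ), g φ ^ (k + i) ≤ g φ ^ k := fun φ i =>
    pow_le_pow_of_le_one (hg0 φ) (hg1 φ) (by omega)
  have hderJ : HasDerivAt (fun t : ℝ => ∫ φ, osf a φ * X (θ + t • e) φ ^ (k + 3))
      (∫ φ, osf a φ * (((k + 3 : ℕ) : ℂ) * X (θ + (0 : ℝ) • e) φ ^ (k + 2) *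
        X1 (θ + (0 : ℝ) • e) φ)) 0 := by
    refine hasDerivAt_integral_osf (line_mem_ball (e := e) hθ)
      (u := fun t φ => X (θ + t • e) φ ^ (k + 3))
      (u' := fun t φ => ((k + 3 : ℕ) : ℂ) * X (θ + t • e) φ ^ (k + 2) * X1 (θ + t • e) φ)
      (fun t ht => (cX _ (le_of_lt ht)).pow _)
      (fun t ht => (((cX _ (le_of_lt ht)).pow _).const_mul _).mul (cX1 _ (le_of_lt ht)))
      (b := (2 * C) ^ (k + 3) * D) (b' := ((k + 3 : ℕ) : ℝ) * (2 * C) ^ (k + 2) * (2 * C * ‖e‖) * D)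
      (fun t ht => hdom hk3 (by positivity) fun φ => ?_) (fun t ht => hdom hk3 (by positivity) fun φ => ?_)
      fun t ht φ => ?_
    · rw [norm_pow]
      refine (pow_le_pow_left₀ (norm_nonneg _) (hXb _ (le_of_lt ht) φ) _).trans ?_
      rw [mul_pow]
      refine mul_le_mul_of_nonneg_left ((hgk φ 3).trans ?_) (by positivity)
      exact le_mul_of_one_le_left (pow_nonneg (hg0 φ) _) (one_le_pow₀ (hy φ))
    · rw [norm_mul, norm_mul, norm_pow, Complex.norm_natCast]
      calc _ ≤ ((k + 3 : ℕ) : ℝ) * ((2 * C) ^ (k + 2) * g φ ^ k) *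
            (2 * C * ‖e‖ * ((1 + ‖φ‖) ^ (Γ + 1)) ^ 3) := by
            gcongr
            · refine (pow_le_pow_left₀ (norm_nonneg _) (hXb _ (le_of_lt ht) φ) _).trans ?_
              rw [mul_pow]
              exact mul_le_mul_of_nonneg_left (hgk φ 2) (by positivity)
            · exact (hX1b _ (le_of_lt ht) φ).trans
                (mul_le_mul_of_nonneg_left (hy3 φ) (by positivity))
        _ = _ := by ring
    · exact ((hasDerivAt_line (hasFDerivAt_G hg (js := []) (by simp)
        (h.mem s _ hsρ (le_of_lt ht)))).div_const (μ : ℂ)).fun_pow (k + 3)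
  have hderI := ho.tI_deriv k (by omega) a θ (v, 0) hθ
  have hre := (Complex.reCLM.hasFDerivAt.comp_hasDerivAt 0 hderJ).const_mul A
  have hev2 : (fun t : ℝ => Y.tI k a (θ + t • e)) =ᶠ[nhds 0] fun t => A *
      (Complex.reCLM ∘ fun t : ℝ => ∫ φ, osf a φ * X (θ + t • e) φ ^ (k + 3)) t := by
    filter_upwards [line_mem_ball (e := e) hθ] with t ht
    exact hid _ (le_of_lt ht)
  have hI1 := hderI.unique (hre.congr_of_eventuallyEq hev2)
  rw [zero_smul, add_zero] at hI1
  set κ := (Y.dG [] s 0 θ (v, 0)).re / μ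
  have hκe : (Y.dG [] s 0 θ e).re / μ = eps k * κ := by
    rw [hev, map_smul, Complex.real_smul, Complex.re_ofReal_mul, mul_div_assoc]
  have hX0 : ∀ φ, ‖X θ φ‖ ≤ g φ := fun φ => by
    simp only [hX]
    rw [norm_div, Complex.norm_real, Real.norm_of_nonneg hμ0.le, div_le_iff₀ hμ0, mul_comm]
    exact h.decay s θ (eps k • φ) hsρ hθ.le
  have hΔ : ∀ φ, ‖X1 θ φ - (eps k * κ : ℝ) * X θ φ‖ ≤
      B * eps k ^ 2 * (1 + ‖φ‖) ^ (Γ + 1) * ‖v‖ := fun φ => by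
    have h1 := h.dG_sub_mul_G_le (e := e) hg hsρ hθ.le hM (eps k • φ)
    rw [← hμ, hκe, hen, norm_scl_phi he.le] at h1
    refine h1.trans ?_
    have h2 : eps k * ‖φ‖ * (1 + eps k * ‖φ‖) ^ Γ ≤ eps k * (1 + ‖φ‖) ^ (Γ + 1) := by
      calc eps k * ‖φ‖ * (1 + eps k * ‖φ‖) ^ Γ ≤ eps k * (1 + ‖φ‖) * (1 + ‖φ‖) ^ Γ := by
            gcongr
            · linarith
            · exact mul_le_of_le_one_left (norm_nonneg _) (eps_le_one k)
        _ = _ := by ring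
    calc _ ≤ B * (eps k * (1 + ‖φ‖) ^ (Γ + 1)) * (eps k * ‖v‖) := by
          gcongr
          linarith
      _ = _ := by ring
  have cΔ : Continuous fun φ => ((k + 3 : ℕ) : ℂ) * X θ φ ^ (k + 2) *
      (X1 θ φ - (eps k * κ : ℝ) * X θ φ) :=
    (((cX θ hθ.le).pow _).const_mul _).mul ((cX1 θ hθ.le).sub ((cX θ hθ.le).const_mul _))
  have bΔ : ∀ φ, ‖((k + 3 : ℕ) : ℂ) * X θ φ ^ (k + 2) * (X1 θ φ - (eps k * κ : ℝ) * X θ φ)‖ ≤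
      B * ‖v‖ * D * wt φ := hdom hk3 (by positivity) fun φ =>
    pow_kernel1_le hB1 (hy φ) (hg0 φ) (hg1 φ) (norm_nonneg v) (mul_eps_sq k) (hX0 φ) (hΔ φ)
  have bX : ∀ φ, ‖X θ φ ^ (k + 3)‖ ≤ 1 * D * wt φ := hdom hk3 zero_le_one fun φ =>
    pow_kernel_le (hy φ) (hg0 φ) (hg1 φ) (hX0 φ)
  have hsplit : ∫ φ, osf a φ * (((k + 3 : ℕ) : ℂ) * X θ φ ^ (k + 2) * X1 θ φ) =
      (((k + 3 : ℕ) * (eps k * κ) : ℝ) : ℂ) * (∫ φ, osf a φ * X θ φ ^ (k + 3)) +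
      ∫ φ, osf a φ * (((k + 3 : ℕ) : ℂ) * X θ φ ^ (k + 2) *
        (X1 θ φ - (eps k * κ : ℝ) * X θ φ)) := by
    have hi : Integrable fun φ => osf a φ * X θ φ ^ (k + 3) :=
      integrable_osf_mul ((cX θ hθ.le).pow _) bX
    rw [← integral_const_mul, ← integral_add (hi.const_mul _) (integrable_osf_mul cΔ bΔ)]
    refine integral_congr_ae (Eventually.of_forall fun φ => ?_)
    push_cast
    ring
  have herr := (Complex.re_le_norm _).trans (norm_integral_osf_le (a := a) bΔ)
  have hI2 : Y.tI1 k a θ (v, 0) ≤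
      A * (((k + 3 : ℕ) : ℝ) * (eps k * κ) * J + B * ‖v‖ * D * S) := by
    rw [hI1]
    refine mul_le_mul_of_nonneg_left ?_ hA0.le
    rw [hsplit, Complex.reCLM_apply, Complex.add_re, Complex.re_ofReal_mul]
    exact add_le_add (le_of_eq rfl) herr
  refine hI2.trans ?_
  rw [hIJ, mul_assoc A J]
  refine mul_le_mul_of_nonneg_left ?_ hA0.le
  have hJ0 : 0 < J := hc.trans_le hlo
  have h5 : B * ‖v‖ * D * S ≤ J * (B * D * S / c * ‖v‖) := by
    have : B * ‖v‖ * D * S = c * (B * D * S / c * ‖v‖) := by field_simp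
    rw [this]
    exact mul_le_mul_of_nonneg_right hlo (by positivity)
  have h6 : ((k + 3 : ℕ) : ℝ) * (eps k * κ) ≤
      Y.lF θ 0 (Y.wv k a θ).ofLp v + K' * (eps k * ‖Y.wv k a θ‖ ^ 2) * ‖v‖ := by
    have h7 := (abs_le.1 (hκ v)).2
    rw [hd, hyK, WithLp.ofLp_smul, Matrix.mulVec_smul, dotProduct_smul, ← lF_zero, smul_eq_mul] at h7
    have h8 : κ ≤ eps k * Y.lF θ 0 (Y.wv k a θ).ofLp v + K' * (eps k * ‖Y.wv k a θ‖) ^ 2 * ‖v‖ := by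
      linarith
    calc _ ≤ ((k + 3 : ℕ) : ℝ) * (eps k * (eps k * Y.lF θ 0 (Y.wv k a θ).ofLp v +
          K' * (eps k * ‖Y.wv k a θ‖) ^ 2 * ‖v‖)) := by gcongr
      _ = ((k + 3 : ℕ) : ℝ) * eps k ^ 2 * (Y.lF θ 0 (Y.wv k a θ).ofLp v +
          K' * (eps k * ‖Y.wv k a θ‖ ^ 2) * ‖v‖) := by ring
      _ = _ := by rw [mul_eps_sq, one_mul]
  have h9 : 0 ≤ K' * ‖v‖ := by positivity
  have h10 : 0 ≤ B * D * S / c * (eps k * ‖Y.wv k a θ‖ ^ 2) * ‖v‖ := by positivity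
  calc _ ≤ J * (Y.lF θ 0 (Y.wv k a θ).ofLp v + K' * (eps k * ‖Y.wv k a θ‖ ^ 2) * ‖v‖) +
        J * (B * D * S / c * ‖v‖) := by
        refine add_le_add ?_ h5
        rw [mul_comm]
        exact mul_le_mul_of_nonneg_left h6 hJ0.le
    _ ≤ _ := by
        rw [← mul_add]
        refine mul_le_mul_of_nonneg_left ?_ hJ0.le
        nlinarith

end TiltedIntegral

end Model

section Slab

variable {p q : ℕ}

/-- The part of a ball around `θ₀` in which the first block is close to `ω`. -/
def slab (θ₀ : Param p q) (r : ℝ) (ω : Vec p) (b : ℝ) : Set (Param p q) :=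
  (ball θ₀.1 r ∩ ball ω b) ×ˢ ball θ₀.2 r

variable {θ₀ θ : Param p q} {r b : ℝ} {ω : Vec p}

theorem convex_slab : Convex ℝ (slab θ₀ r ω b) :=
  ((convex_ball _ _).inter (convex_ball _ _)).prod (convex_ball _ _)

theorem mem_slab : θ ∈ slab θ₀ r ω b ↔ ‖θ - θ₀‖ < r ∧ ‖θ.1 - ω‖ < b := by
  rw [slab, mem_prod, mem_inter_iff, mem_ball_iff_norm, mem_ball_iff_norm, mem_ball_iff_norm,
    Prod.norm_def, max_lt_iff]
  simp only [Prod.fst_sub, Prod.snd_sub]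
  tauto

theorem continuousOn_of_line_deriv_le {U : Set (Param p q)} (hU : Convex ℝ U) {ε : ℝ} (hε : 0 < ε)
    (hε1 : ε ≤ 1) {f : Param p q → ℝ} {f1 : Param p q → Param p q → ℝ} {L : ℝ} (hL : 0 ≤ L)
    (hd : ∀ θ ∈ U, ∀ e, HasDerivAt (fun t : ℝ => f (θ + t • scl ε e)) (f1 θ e) 0)
    (hle : ∀ θ ∈ U, ∀ e, |f1 θ e| ≤ L * ‖e‖) : ContinuousOn f U := by
  refine (LipschitzOnWith.of_dist_le_mul (K := ⟨L / ε, by positivity⟩) fun x hx y hy => ?_).continuousOn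
  set e : Param p q := (ε⁻¹ • (x - y).1, (x - y).2) with he
  have hse : scl ε e = x - y := by ext1 <;> simp [scl, he, smul_smul, hε.ne']
  have hee : ‖e‖ ≤ ‖x - y‖ / ε := by
    rw [Prod.norm_def, max_le_iff, le_div_iff₀ hε, le_div_iff₀ hε]
    have h1 := norm_fst_le (x - y)
    have h2 := norm_snd_le (x - y)
    constructor
    · simp only [he]
      rw [norm_smul, norm_inv, Real.norm_of_nonneg hε.le]
      field_simp
      exact h1
    · exact (mul_le_of_le_one_right (norm_nonneg _) hε1).trans h2
  have hmem : ∀ t ∈ Icc (0 : ℝ) 1, y + t • scl ε e ∈ U := fun t ht => by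
    rw [hse]
    exact hU.add_smul_sub_mem hy hx ht
  have h1 := norm_sub_le_of_hasDerivAt (h := fun t : ℝ => f (y + t • scl ε e))
    (h' := fun t => f1 (y + t • scl ε e) e) (b := L * ‖e‖)
    (fun t ht => hasDerivAt_line_shift (hd _ (hmem t ht) e)) (fun t ht => hle _ (hmem t ht) e)
    (right_mem_Icc.2 zero_le_one)
  rw [one_smul, zero_smul, add_zero, hse, add_sub_cancel] at h1
  rw [dist_eq_norm, dist_eq_norm]
  refine h1.trans ?_
  change _ ≤ L / ε * ‖x - y‖
  calc L * ‖e‖ ≤ L * (‖x - y‖ / ε) := by gcongr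
    _ = _ := by ring

theorem Peak.deriv_smul {U Q : Set (Param p q)} {ε c : ℝ} {f : Param p q → ℝ}
    {f1 f2 : Param p q → Param p q → ℝ} (h : Peak U Q ε c f f1 f2) {θ : Param p q}
    (hθ : θ ∈ U) (a : ℝ) (e : Param p q) : f1 θ (a • e) = a * f1 θ e := by
  have h1 : HasDerivAt (fun t : ℝ => f (θ + (a * t) • scl ε e)) (a * f1 θ e) 0 := by
    have h2 : HasDerivAt (fun t : ℝ => f (θ + t • scl ε e)) (f1 θ e) (a * 0) := by
      rw [mul_zero]
      exact h.deriv θ hθ e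
    have h3 := h2.comp (0 : ℝ) ((hasDerivAt_id (0 : ℝ)).const_mul a)
    refine h3.congr_deriv ?_
    ring
  refine (h.deriv θ hθ (a • e)).unique (h1.congr_of_eventuallyEq
    (Eventually.of_forall fun t => ?_))
  simp only [Model.scl_smul, smul_smul, mul_comm]

theorem Peak.exists_isMaximiserIn_of_radial {ε c ρ₁ L τ : ℝ} {z : Param p q} {f : Param p q → ℝ}
    {f1 f2 : Param p q → Param p q → ℝ}
    (h : Peak (ball θ₀ r) (slab θ₀ r z.1 (2 * ρ₁ * ε)) ε c f f1 f2) (hε : 0 < ε) (hε1 : ε ≤ 1)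
    (hc : 0 < c) (hr : 0 < r) (hρ₁ : 0 < ρ₁) (hL : 0 ≤ L)
    (hle : ∀ θ ∈ ball θ₀ r, ∀ e, |f1 θ e| ≤ L * ‖e‖) (hz : ‖z - θ₀‖ < r / 2)
    (hcent : ∀ e, f1 z e ≤ τ * ‖e‖ * f z) (hτ : τ < c * min ρ₁ (r / 2) / 2)
    (hneg : ∀ θ ∈ ball θ₀ r, ∀ v : Vec p, θ.1 = z.1 + ε • v → ρ₁ ≤ ‖v‖ → f1 θ (v, 0) < 0) :
    ∃ θ ∈ slab θ₀ r z.1 (2 * ρ₁ * ε), IsMaximiserIn f (ball θ₀ r) θ := by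
  refine h.exists_isMaximiserIn isOpen_ball hε hc
    (continuousOn_of_line_deriv_le (convex_ball θ₀ r) hε hε1 hL h.deriv hle)
    (a := min ρ₁ (r / 2)) (lt_min hρ₁ (half_pos hr)) (fun q hq => ?_) hcent hτ ?_
  · rw [mem_slab]
    constructor
    · calc ‖z + scl ε q - θ₀‖ = ‖(z - θ₀) + scl ε q‖ := by rw [add_sub_right_comm]
        _ < r / 2 + r / 2 := by
          refine (norm_add_le _ _).trans_lt (add_lt_add_of_lt_of_le hz ?_)
          exact (norm_scl_le hε.le hε1 q).trans (hq.trans (min_le_right _ _))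
        _ = r := by ring
    · rw [Prod.fst_add, add_sub_cancel_left]
      refine (norm_scl_fst_le hε.le q).trans_lt ?_
      have := hq.trans (min_le_left _ _)
      nlinarith
  · intro θ hθ hθQ
    set v : Vec p := ε⁻¹ • (θ.1 - z.1) with hv
    have hθv : θ.1 = z.1 + ε • v := by
      rw [hv, smul_smul, mul_inv_cancel₀ hε.ne', one_smul, add_sub_cancel]
    have hθv' : θ.1 - z.1 = ε • v := by rw [hθv, add_sub_cancel_left]
    have hvn : 2 * ρ₁ ≤ ‖v‖ := by
      by_contra hlt
      push Not at hlt
      refine hθQ (mem_slab.2 ⟨mem_ball_iff_norm.1 hθ, ?_⟩)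
      rw [hθv', norm_smul, Real.norm_of_nonneg hε.le]
      nlinarith
    have hv0 : 0 < ‖v‖ := by linarith
    have hline : ∀ t : ℝ, (θ + t • scl ε ((-v, 0) : Param p q)).1 = z.1 + ε • ((1 - t) • v) := by
      intro t
      rw [Prod.fst_add, Prod.smul_fst, hθv]
      simp only [scl]
      module
    have hmemU : ∀ t ∈ Icc (0 : ℝ) 1, θ + t • scl ε ((-v, 0) : Param p q) ∈ ball θ₀ r := by
      intro t ht
      have hw : ((z.1, θ.2) : Param p q) ∈ ball θ₀ r := by
        rw [mem_ball_iff_norm, Prod.norm_def, max_lt_iff]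
        rw [mem_ball_iff_norm, Prod.norm_def, max_lt_iff] at hθ
        refine ⟨?_, hθ.2⟩
        have := norm_fst_le (z - θ₀)
        rw [Prod.fst_sub] at this
        simp only [Prod.fst_sub]
        linarith
      have := (convex_ball θ₀ r).add_smul_sub_mem hθ hw ht
      convert this using 2
      congr 1
      ext1
      · simp only [scl, Prod.fst_sub]
        rw [smul_neg, ← hθv', neg_sub]
      · simp [scl]
    refine ⟨(-v, 0), 1 - 3 / 2 * ρ₁ / ‖v‖, ⟨?_, ?_⟩, ?_, fun t ht => ⟨?_, ?_⟩⟩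
    · rw [sub_pos, div_lt_one hv0]
      linarith
    · have : 0 < 3 / 2 * ρ₁ / ‖v‖ := by positivity
      linarith
    · have hb : 1 - 3 / 2 * ρ₁ / ‖v‖ ∈ Icc (0 : ℝ) 1 := by
        have h1 : 0 < 3 / 2 * ρ₁ / ‖v‖ := by positivity
        have h2 : 3 / 2 * ρ₁ / ‖v‖ ≤ 1 := by
          rw [div_le_one hv0]
          linarith
        exact ⟨by linarith, by linarith⟩
      refine mem_slab.2 ⟨mem_ball_iff_norm.1 (hmemU _ hb), ?_⟩
      rw [hline, add_sub_cancel_left, sub_sub_cancel, norm_smul, norm_smul, norm_div, norm_norm,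
        Real.norm_of_nonneg hε.le, Real.norm_of_nonneg (by positivity), div_mul_cancel₀ _ hv0.ne']
      nlinarith
    all_goals
      have hbpos : 0 < 3 / 2 * ρ₁ / ‖v‖ := by positivity
      have hmem := hmemU t ⟨ht.1, by linarith [ht.2]⟩
    · exact hmem
    · have ht1 : 3 / 2 * ρ₁ / ‖v‖ ≤ 1 - t := by linarith [ht.2]
      have ht0 : 0 < 1 - t := hbpos.trans_le ht1
      have h1 := hneg _ hmem ((1 - t) • v) (hline t) (by
        rw [norm_smul, Real.norm_of_nonneg ht0.le]
        rw [div_le_iff₀ hv0] at ht1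
        linarith)
      have h2 : (((1 - t) • v, 0) : Param p q) = (-(1 - t)) • ((-v, 0) : Param p q) := by
        ext1
        · simp only [Prod.smul_fst]
          module
        · simp
      rw [h2, h.deriv_smul hmem] at h1
      nlinarith

end Slab


namespace Model

variable {m p q : ℕ} {Y : Model m p q} {θ₀ θ : Param p q} {ρ C δ K c : ℝ} {Γ N k : ℕ}
  {ξ₀ w₀ : Vec m} {u₀ : Vec p}

theorem Reg.nI_pos (h : Y.Reg θ₀ ρ C δ Γ) (hθ : ‖θ - θ₀‖ ≤ ρ) (k : ℕ) (a : Vec m) :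
    0 < Y.nI k a θ := by
  rw [nI_eq (h.mem_goodSet hθ) (h.K2_posDef hθ)]
  exact mul_pos (gc_pos m) (Real.exp_pos _)

set_option maxHeartbeats 1000000 in
theorem LinData.exists_outer_neg (hl : Y.LinData θ₀ ξ₀ w₀ u₀ c) (ho : Y.OscBounds θ₀ ρ K N)
    (h : Y.Reg θ₀ ρ C δ Γ) (hg : Y.GrowthBound) (hmean : Y.MeanCond) :
    ∃ M, 1 ≤ M ∧ ∀ ρ₁ b, 0 < ρ₁ → 0 < b → ∃ r, 0 < r ∧ r ≤ ρ ∧ ∃ N' : ℕ, ∀ k, N' ≤ k →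
      ∀ ω' ξ θ v, ‖θ - θ₀‖ < r → ‖ω' - θ₀.1‖ < r → ‖ξ - ξ₀‖ < r →
      θ.1 = ω' + eps k • (u₀ + v) →
      ‖Y.wv k (Y.obs k θ₀.2 ω' ξ) θ - w₀‖ ≤ M * ‖v‖ + b ∧
      (ρ₁ ≤ ‖v‖ → Y.nI1 k (Y.obs k θ₀.2 ω' ξ) θ (v, 0) < 0 ∧
        Y.tI1 k (Y.obs k θ₀.2 ω' ξ) θ (v, 0) < 0) := by
  have hθ₀ : ‖θ₀ - θ₀‖ ≤ ρ := by simpa using h.ρ_pos.le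
  have hc := hl.pos
  obtain ⟨M, hM, hout⟩ := hl.exists_outer hg hmean (h.mem_goodSet hθ₀) (h.K2_posDef hθ₀).det_pos.ne'
  obtain ⟨T, hT, rt, hrt, Nt, htilt⟩ := h.exists_tilt hg ho
  refine ⟨M, hM, fun ρ₁ b hρ₁ hb => ?_⟩
  set W := ‖w₀‖ + M + 1 with hW
  have hW0 : 0 < W := by positivity
  set A := 1 + 1 / ρ₁ with hA
  have hA1 : 1 ≤ A := by
    rw [hA]
    linarith [one_div_pos.2 hρ₁]
  set κ := min (min 1 b) (min (c / (8 * A ^ 2)) (min (rt / W) (c / (8 * (T + 1) * W ^ 2 * A ^ 2))))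
   
  have hκ0 : 0 < κ := by positivity
  have hκ1 : κ ≤ 1 := (min_le_left _ _).trans (min_le_left _ _)
  have hκb : κ ≤ b := (min_le_left _ _).trans (min_le_right _ _)
  have hκc : κ * A ^ 2 ≤ c / 8 := by
    have : κ ≤ c / (8 * A ^ 2) := (min_le_right _ _).trans (min_le_left _ _)
    rw [le_div_iff₀ (by positivity)] at this
    linarith
  have hκr : W * κ ≤ rt := by
    have : κ ≤ rt / W := (min_le_right _ _).trans ((min_le_right _ _).trans (min_le_left _ _))
    rw [le_div_iff₀ hW0] at this
    linarith
  have hκT : T * W ^ 2 * κ * A ^ 2 ≤ c / 8 := by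
    have : κ ≤ c / (8 * (T + 1) * W ^ 2 * A ^ 2) :=
      (min_le_right _ _).trans ((min_le_right _ _).trans (min_le_right _ _))
    rw [le_div_iff₀ (by positivity)] at this
    have h2 : 0 ≤ κ * W ^ 2 * A ^ 2 := by positivity
    nlinarith
  set R := 8 * T / c with hR
  obtain ⟨c₀, hc₀, -, N₂, hNN₂, hcmp⟩ := ho.exists_compare h hg (‖w₀‖ + M * R + 1)
  obtain ⟨N₃, hN₃⟩ := eventually_mul_eps_le (2 * K ^ 2 / c₀ ^ 2) (c := c * ρ₁ / 2) (by positivity)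
  obtain ⟨r, hr, N₁, h₁⟩ := hout κ hκ0 hκ1
  refine ⟨min r ρ, lt_min hr h.ρ_pos, min_le_right _ _, max (max N₁ Nt) (max N₂ N₃),
    fun k hk ω' ξ θ v hθ hω hξ hv => ?_⟩
  have hk1 := (le_max_left N₁ Nt).trans ((le_max_left _ _).trans hk)
  have hkt := (le_max_right N₁ Nt).trans ((le_max_left _ _).trans hk)
  have hk2 := (le_max_left N₂ N₃).trans ((le_max_right _ _).trans hk)
  have hk3 := (le_max_right N₂ N₃).trans ((le_max_right _ _).trans hk)
  have hle := min_le_left r ρ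
  have hθρ := hθ.trans_le (min_le_right r ρ)
  obtain ⟨hw, hev, hlD, hlF⟩ := h₁ k hk1 ω' ξ θ v (hθ.trans_le hle) (hω.trans_le hle)
    (hξ.trans_le hle) hv
  set a := Y.obs k θ₀.2 ω' ξ
  refine ⟨hw.trans (by linarith), fun hvρ => ?_⟩
  set x := ‖v‖ with hx
  have hx0 : 0 < x := hρ₁.trans_le hvρ
  have hAx : 1 + x ≤ A * x := by
    have : 1 ≤ 1 / ρ₁ * x := by
      rw [one_div_mul_eq_div, le_div_iff₀ hρ₁]
      linarith
    rw [hA]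
    linarith
  have hκx : κ * (1 + x) ^ 2 ≤ c / 8 * x ^ 2 := by
    calc κ * (1 + x) ^ 2 ≤ κ * (A * x) ^ 2 := by gcongr
      _ = κ * A ^ 2 * x ^ 2 := by ring
      _ ≤ _ := by gcongr
  have hcx : 0 < c * x ^ 2 := by positivity
  have hn := h.nI_pos hθρ.le k a
  have hn1 := ho.nI1_eq h hg hmean (a := a) (e := (v, 0)) (hNN₂.trans hk2) hθρ
  refine ⟨?_, ?_⟩
  · rw [hn1]
    exact mul_neg_of_pos_of_neg hn (by linarith)
  have hwn : ‖Y.wv k a θ‖ ≤ ‖w₀‖ + (M * x + κ) := by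
    have := norm_add_le w₀ (Y.wv k a θ - w₀)
    rw [add_sub_cancel] at this
    linarith
  have he := eps_pos k
  rcases lt_or_ge R x with hRx | hRx
  · have hq : ‖Y.wv k a θ‖ ≤ W * (1 + x) := by
      rw [hW]
      linarith [mul_nonneg (norm_nonneg w₀) hx0.le]
    have hq1 : eps k * ‖Y.wv k a θ‖ ≤ rt :=
      calc _ ≤ eps k * (W * (1 + x)) := by gcongr
        _ = W * (eps k * (1 + x)) := by ring
        _ ≤ W * κ := by gcongr
        _ ≤ rt := hκr
    have hq2 : T * (eps k * ‖Y.wv k a θ‖ ^ 2) * x ≤ c / 8 * x ^ 2 :=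
      calc _ ≤ T * (eps k * (W * (1 + x)) ^ 2) * x := by gcongr
        _ = T * W ^ 2 * (eps k * (1 + x)) * (1 + x) * x := by ring
        _ ≤ T * W ^ 2 * κ * (A ^ 2 * x) * x := by
          have : 1 + x ≤ A ^ 2 * x := hAx.trans (by nlinarith [mul_pos (zero_lt_one.trans_le hA1) hx0])
          gcongr
        _ = T * W ^ 2 * κ * A ^ 2 * x ^ 2 := by ring
        _ ≤ _ := by gcongr
    have hTx : T * x ≤ c / 8 * x ^ 2 := by
      have : T ≤ c / 8 * x := by
        rw [hR, div_lt_iff₀ hc] at hRx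
        linarith
      nlinarith
    obtain ⟨htp, ht⟩ := htilt k hkt a θ hθρ hq1
    refine (ht v).trans_lt (mul_neg_of_pos_of_neg htp ?_)
    linarith
  · obtain ⟨ht, -, hd⟩ := hcmp k hk2 a θ hθρ (hwn.trans (by nlinarith))
    have htp := hc₀.trans_le ht
    have h1 := (abs_le.1 (hd (v, 0))).2
    have hvn : ‖((v, 0) : Param p q)‖ = x := by simp [Prod.norm_def, hx]
    rw [hn1, mul_div_cancel_left₀ _ hn.ne', hvn] at h1
    have h2 : 2 * K ^ 2 / c₀ ^ 2 * eps k * x ≤ c / 2 * x ^ 2 := by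
      have := hN₃ k hk3
      calc _ ≤ c * ρ₁ / 2 * x := by gcongr
        _ ≤ c * x / 2 * x := by gcongr
        _ = _ := by ring
    have h3 : Y.tI1 k a θ (v, 0) / Y.tI k a θ < 0 := by linarith
    by_contra hneg
    exact absurd h3 (not_lt.2 (div_nonneg (not_lt.1 hneg) htp.le))


theorem exists_maximisers (hcr : Y.Crit θ₀ w₀) (hl : Y.LinData θ₀ ξ₀ w₀ u₀ c)
    (ho : Y.OscBounds θ₀ ρ K N) (h : Y.Reg θ₀ ρ C δ Γ) (hg : Y.GrowthBound) (hmean : Y.MeanCond) :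
    ∃ r, 0 < r ∧ r ≤ ρ ∧ ∃ r', 0 < r' ∧ ∃ D : ℝ, ∃ N' : ℕ, ∀ k, N' ≤ k → ∀ ω' ξ,
      ‖ω' - θ₀.1‖ < r' → ‖ξ - ξ₀‖ < r' → ∃ θ θ' : Param p q,
        IsMaximiserIn (Y.nI k (Y.obs k θ₀.2 ω' ξ)) (ball θ₀ r) θ ∧
        IsMaximiserIn (Y.tI k (Y.obs k θ₀.2 ω' ξ)) (ball θ₀ r) θ' ∧
        ‖θ.1 - θ'.1‖ ≤ D * eps k ^ 2 ∧ ‖θ.2 - θ'.2‖ ≤ D * eps k := by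
  obtain ⟨M, hM, hout⟩ := hl.exists_outer_neg ho h hg hmean
  obtain ⟨c₂, hc₂, r₂, hr₂, -, N₂, hconc⟩ := hcr.exists_concave ho h hg hmean
  have hM0 : 0 < M := zero_lt_one.trans_le hM
  set ρ₁ := r₂ / (4 * M) with hρ₁
  have hρ₁0 : 0 < ρ₁ := by positivity
  have hMρ : M * (2 * ρ₁) = r₂ / 2 := by
    rw [hρ₁]
    field_simp
    norm_num
  obtain ⟨ro, hro, hroρ, No, ho'⟩ := hout ρ₁ (r₂ / 4) hρ₁0 (by positivity)
  set r := min ro r₂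
  have hr0 : 0 < r := lt_min hro hr₂
  have hrro : r ≤ ro := min_le_left _ _
  have hrr₂ : r ≤ r₂ := min_le_right _ _
  set τ := c₂ * min ρ₁ (r / 2) / 4 with hτ
  have hτ0 : 0 < τ := by positivity
  obtain ⟨r₃, hr₃, N₃, hsmall⟩ := hcr.exists_small_deriv ho h hg hmean hτ0
  obtain ⟨rc, hrc, -, Nc, hc'⟩ := hout 1 (r₃ / 2) one_pos (by positivity)
  obtain ⟨c₀, hc₀, -, N₄, hNN₄, hcmp⟩ := ho.exists_compare h hg (‖w₀‖ + r₂)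
  set s := min (r / 2) (min r₃ rc)
  have hs0 : 0 < s := by positivity
  have hsr : s ≤ r / 2 := min_le_left _ _
  have hs3 : s ≤ r₃ := (min_le_right _ _).trans (min_le_left _ _)
  have hsc : s ≤ rc := (min_le_right _ _).trans (min_le_right _ _)
  obtain ⟨N₅, hN₅⟩ := eventually_mul_eps_le ‖u₀‖ (half_pos hs0)
  refine ⟨r, hr0, hrro.trans hroρ, s / 2, half_pos hs0, 2 * K ^ 2 / c₀ ^ 2 / c₂,
    max (max No N₂) (max (max N₃ Nc) (max N₄ N₅)), fun k hk ω' ξ hω hξ => ?_⟩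
  have hko := (le_max_left No N₂).trans ((le_max_left _ _).trans hk)
  have hk2 := (le_max_right No N₂).trans ((le_max_left _ _).trans hk)
  have hk' := (le_max_right _ _).trans hk
  have hk3 := (le_max_left N₃ Nc).trans ((le_max_left _ _).trans hk')
  have hkc := (le_max_right N₃ Nc).trans ((le_max_left _ _).trans hk')
  have hk4 := (le_max_left N₄ N₅).trans ((le_max_right _ _).trans hk')
  have hk5 := hN₅ k ((le_max_right N₄ N₅).trans ((le_max_right _ _).trans hk'))
  have hkN := hNN₄.trans hk4
  have he := eps_pos k
  set a := Y.obs k θ₀.2 ω' ξ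
  set z : Param p q := (ω' + eps k • u₀, θ₀.2) with hz
  have hzs : ‖z - θ₀‖ < s := by
    have h1 : ‖z - θ₀‖ = ‖(ω' - θ₀.1) + eps k • u₀‖ := by
      rw [Prod.norm_def]
      simp [hz, add_sub_right_comm]
    have h2 : ‖eps k • u₀‖ = ‖u₀‖ * eps k := by
      rw [norm_smul, Real.norm_of_nonneg he.le, mul_comm]
    rw [h1]
    refine (norm_add_le _ _).trans_lt ?_
    linarith
  have hball : ∀ {θ}, θ ∈ ball θ₀ r → ‖θ - θ₀‖ < r := fun h => mem_ball_iff_norm.1 h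
  have hballρ : ∀ {θ}, θ ∈ ball θ₀ r → ‖θ - θ₀‖ < ρ := fun h =>
    (hball h).trans_le (hrro.trans hroρ)
  have hfst : ∀ (θ : Param p q) (v : Vec p), θ.1 = z.1 + eps k • v →
      θ.1 = ω' + eps k • (u₀ + v) := fun θ v hv => by
    rw [hv, hz, smul_add, add_assoc]
  have houter : ∀ θ ∈ ball θ₀ r, ∀ v : Vec p, θ.1 = z.1 + eps k • v →
      ‖Y.wv k a θ - w₀‖ ≤ M * ‖v‖ + r₂ / 4 ∧
      (ρ₁ ≤ ‖v‖ → Y.nI1 k a θ (v, 0) < 0 ∧ Y.tI1 k a θ (v, 0) < 0) := fun θ hθ v hv =>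
    ho' k hko ω' ξ θ v ((hball hθ).trans_le hrro) (by linarith) (by linarith) (hfst θ v hv)
  have hcz : ‖Y.wv k a z - w₀‖ < r₃ := by
    have := (hc' k hkc ω' ξ z 0 (by linarith) (by linarith) (by linarith) (by simp [hz])).1
    rw [norm_zero, mul_zero, zero_add] at this
    linarith
  have hcent := hsmall k hk3 a z (by linarith) hcz
  have hQU : slab θ₀ r z.1 (2 * ρ₁ * eps k) ⊆ ball θ₀ r := fun θ hθ =>
    mem_ball_iff_norm.2 (mem_slab.1 hθ).1
  have hwQ : ∀ θ ∈ slab θ₀ r z.1 (2 * ρ₁ * eps k), ‖Y.wv k a θ - w₀‖ < r₂ := by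
    intro θ hθ
    have h1 := (mem_slab.1 hθ).2
    have h2 : θ.1 = z.1 + eps k • ((eps k)⁻¹ • (θ.1 - z.1)) := by
      rw [smul_smul, mul_inv_cancel₀ he.ne', one_smul, add_sub_cancel]
    refine (houter θ (hQU hθ) _ h2).1.trans_lt ?_
    have h3 : ‖(eps k)⁻¹ • (θ.1 - z.1)‖ ≤ 2 * ρ₁ := by
      rw [norm_smul, norm_inv, Real.norm_of_nonneg he.le, inv_mul_le_iff₀ he]
      linarith
    have := mul_le_mul_of_nonneg_left h3 hM0.le
    linarith
  have hwW : ∀ θ ∈ slab θ₀ r z.1 (2 * ρ₁ * eps k), ‖Y.wv k a θ‖ ≤ ‖w₀‖ + r₂ := fun θ hθ => by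
    have := norm_add_le w₀ (Y.wv k a θ - w₀)
    rw [add_sub_cancel] at this
    linarith [hwQ θ hθ]
  have hcQ := fun θ hθ => hconc k hk2 a θ ((hball (hQU hθ)).trans_le hrr₂) (hwQ θ hθ)
  have hmQ := fun θ hθ => hcmp k hk4 a θ (hballρ (hQU hθ)) (hwW θ hθ)
  have pn : Peak (ball θ₀ r) (slab θ₀ r z.1 (2 * ρ₁ * eps k)) (eps k) c₂ (Y.nI k a)
      (Y.nI1 k a) (Y.nI2 k a) :=
    ⟨convex_slab, hQU, fun θ hθ e => ho.nI_deriv k hkN a θ e (hballρ hθ),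
      fun θ hθ e => ho.nI1_deriv k hkN a θ e (hballρ (hQU hθ)),
      fun θ hθ => hc₀.trans_le (hmQ θ hθ).2.1, fun θ hθ e => (hcQ θ hθ e).1⟩
  have pt : Peak (ball θ₀ r) (slab θ₀ r z.1 (2 * ρ₁ * eps k)) (eps k) c₂ (Y.tI k a)
      (Y.tI1 k a) (Y.tI2 k a) :=
    ⟨convex_slab, hQU, fun θ hθ e => ho.tI_deriv k hkN a θ e (hballρ hθ),
      fun θ hθ e => ho.tI1_deriv k hkN a θ e (hballρ (hQU hθ)),
      fun θ hθ => hc₀.trans_le (hmQ θ hθ).1, fun θ hθ e => (hcQ θ hθ e).2⟩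
  have hK0 : 0 ≤ K := zero_le_one.trans ho.one_le_K
  have hτlt : τ < c₂ * min ρ₁ (r / 2) / 2 := by linarith
  obtain ⟨θ, hθ, hm⟩ := pn.exists_isMaximiserIn_of_radial he (eps_le_one k) hc₂ hr0 hρ₁0 hK0
    (fun θ hθ e => ho.nI1_le k hkN a θ e (hballρ hθ)) (by linarith) (fun e => (hcent e).1) hτlt
    (fun θ hθ v hv hn => ((houter θ hθ v hv).2 hn).1)
  obtain ⟨θ', hθ', hm'⟩ := pt.exists_isMaximiserIn_of_radial he (eps_le_one k) hc₂ hr0 hρ₁0 hK0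
    (fun θ hθ e => ho.tI1_le k hkN a θ e (hballρ hθ)) (by linarith) (fun e => (hcent e).2) hτlt
    (fun θ hθ v hv hn => ((houter θ hθ v hv).2 hn).2)
  exact ⟨θ, θ', hm, hm', pn.dist_le pt he hc₂ (by positivity) (fun θ hθ e => (hmQ θ hθ).2.2 e)
    hθ hθ' hm hm'⟩

end Model

theorem IsMaximiserIn.congr_mul {P : Type*} [TopologicalSpace P] {f g : P → ℝ} {U : Set P} {θ : P}
    {b : ℝ} (h : IsMaximiserIn f U θ) (hU : IsOpen U) (hb : 0 < b) (hfg : ∀ θ ∈ U, g θ = b * f θ) :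
    IsMaximiserIn g U θ := by
  have hev : ∀ θ ∈ U, ∀ᶠ η in nhds θ, g η = b * f η := fun θ hθ => by
    filter_upwards [hU.mem_nhds hθ] with η hη using hfg η hη
  refine ⟨h.1, ?_, fun θ' hθ' hm => h.2.2.1 θ' hθ' ?_, fun η hη => ?_⟩
  · filter_upwards [h.2.1, hev θ h.1] with η h1 h2
    rw [h2, hfg θ h.1]
    exact mul_le_mul_of_nonneg_left h1 hb.le
  · filter_upwards [hm, hev θ' hθ'] with η h1 h2
    rw [h2, hfg θ' hθ'] at h1
    exact le_of_mul_le_mul_left h1 hb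
  · change g η ≤ g θ
    rw [hfg η hη, hfg θ h.1]
    exact mul_le_mul_of_nonneg_left (h.2.2.2 hη) hb.le

namespace Model

variable {m p q : ℕ} {Y : Model m p q} {θ₀ : Param p q} {ρ C δ : ℝ} {Γ : ℕ} {ξ₀ : Vec m}

theorem exists_linData (hg : Y.GrowthBound) (hθ₀ : θ₀ ∈ Y.goodSet) (hpd : (Y.K2 θ₀).PosDef)
    (hB : Function.Injective (Y.Bomega θ₀).mulVec) :
    ∃ w₀ u₀ c, w₀.ofLp = resid (Y.K2 θ₀) (Y.Bomega θ₀) ξ₀.ofLp ∧ Y.LinData θ₀ ξ₀ w₀ u₀ c := by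
  obtain ⟨c, hc, hcoer⟩ := exists_coercive hpd fun v hv => by
    rw [mD, fderiv_K1_apply hg hθ₀] at hv
    have := hB (hv.trans (Matrix.mulVec_zero _).symm)
    exact (WithLp.ofLp_eq_zero 2).1 this
  refine ⟨WithLp.toLp 2 (resid (Y.K2 θ₀) (Y.Bomega θ₀) ξ₀.ofLp), WithLp.toLp 2
    ((((Y.Bomega θ₀)ᵀ * (Y.K2 θ₀)⁻¹ * Y.Bomega θ₀)⁻¹ * (Y.Bomega θ₀)ᵀ * (Y.K2 θ₀)⁻¹) *ᵥ ξ₀.ofLp),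
    c, rfl, hc, ?_, fun v => ?_, hcoer⟩
  · refine WithLp.ofLp_injective 2 ?_
    rw [WithLp.ofLp_sub, fderiv_K1_apply hg hθ₀]
    rfl
  · rw [mD, fderiv_K1_apply hg hθ₀]
    exact dotProduct_inv_resid hpd hB

theorem Reg.isContDensity (h : Y.Reg θ₀ ρ C δ Γ) : ∃ N : ℕ, ∀ n : ℕ, N ≤ n → ∀ θ, ‖θ - θ₀‖ ≤ ρ →
    Integrable (fun φ => Y.complexMGF φ (0, θ) ^ n) ∧
      IsContDensity (Y.sumLaw n θ) (fun x => Y.likelihood n x θ) := by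
  obtain ⟨N, hN⟩ := h.exists_integrable_pow
  refine ⟨N, fun n hn θ hθ => ?_⟩
  have h0 := hN n hn 0 θ (by simpa using h.ρ_pos.le) hθ
  have hm := h.mem_goodSet hθ
  exact ⟨h0, (likelihood_eq_integral Y (mem_domain_of_goodSet hm) (interior_subset hm) h0 h0).1⟩

theorem eps_smul_obs (k : ℕ) (ν₀ : Vec q) (ω' : Vec p) (ξ : Vec m) :
    eps k • (((k + 3 : ℕ) : ℝ) • Y.K1 (ω', ν₀) + Real.sqrt ((k + 3 : ℕ) : ℝ) • ξ) =
      Y.obs k ν₀ ω' ξ := by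
  have h1 : (eps k)⁻¹ = Real.sqrt ((k + 3 : ℕ) : ℝ) := by rw [eps, inv_inv]
  have h2 : eps k * ((k + 3 : ℕ) : ℝ) = (eps k)⁻¹ := by
    have := mul_eps_sq k
    have he := (eps_pos k).ne'
    field_simp
    linarith
  rw [obs, smul_add, smul_smul, smul_smul, h2, ← h1, mul_inv_cancel₀ (eps_pos k).ne', one_smul]

end Model
end MLE

end

theorem mainTheorem7 {m p₁ p₂ : ℕ} (Y : MLE.Model m p₁ p₂)
    (hdecay : Y.DecayBound) (hgrowth : Y.GrowthBound)
    -- the mean of `Y_θ` depends on `ω` only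
    (hmean : ∀ (ω : MLE.Vec p₁) (ν ν' : MLE.Vec p₂),
      (0, (ω, ν)) ∈ interior Y.convSet → (0, (ω, ν')) ∈ interior Y.convSet →
        Y.K1 (ω, ν) = Y.K1 (ω, ν'))
    (ω₀ : MLE.Vec p₁) (ν₀ : MLE.Vec p₂)
    (hθ₀ : (0, (ω₀, ν₀)) ∈ interior Y.convSet)
    (hrank : (Y.Bomega (ω₀, ν₀)).rank = p₁)
    (ξ₀ : MLE.Vec m)
    (hξ₀ : ∀ j : Fin p₂,
      MLE.Model.quad (Y.J (ω₀, ν₀) * Y.dK2 j (ω₀, ν₀) * Y.J (ω₀, ν₀)) ξ₀ =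
        Matrix.trace ((Y.K2 (ω₀, ν₀))⁻¹ * Y.dK2 j (ω₀, ν₀)))
    (hE : (-(Y.E (ω₀, ν₀) ξ₀)).PosDef) :
    ∃ (n₀ : ℕ) (U U' : Set (MLE.Param p₁ p₂)) (V : Set (MLE.Vec m)) (C : ℝ),
      0 < n₀ ∧
      IsOpen U ∧ (ω₀, ν₀) ∈ U ∧ U ⊆ Y.domain ∧
      IsOpen U' ∧ (ω₀, ν₀) ∈ U' ∧ U' ⊆ Y.domain ∧
      IsOpen V ∧ ξ₀ ∈ V ∧
      -- the true likelihood exists: `X_θ` has a continuous density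
      (∀ n : ℕ, n₀ ≤ n → ∀ θ ∈ U,
        MLE.IsContDensity (Y.sumLaw n θ) (fun x => Y.likelihood n x θ)) ∧
      ∀ n : ℕ, n₀ ≤ n → ∀ ω' : MLE.Vec p₁, (ω', ν₀) ∈ U' → ∀ ξ ∈ V, ∀ x : MLE.Vec m,
        x = (n : ℝ) • Y.K1 (ω', ν₀) + Real.sqrt n • ξ →
        ∃ θ_normal θ_true : MLE.Param p₁ p₂,
          MLE.IsMaximiserIn (Y.normalLikelihood n x) U θ_normal ∧
          MLE.IsMaximiserIn (Y.likelihood n x) U θ_true ∧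
          ‖θ_normal.1 - θ_true.1‖ ≤ C / n ∧
          ‖θ_normal.2 - θ_true.2‖ ≤ C / Real.sqrt n := by
  have hθ : (ω₀, ν₀) ∈ Y.goodSet := hθ₀
  have hB := MLE.mulVec_injective_of_rank hrank
  obtain ⟨ρ, C, δ, Γ, h⟩ := Y.exists_reg hdecay hgrowth hθ₀
  have hpd : (Y.K2 (ω₀, ν₀)).PosDef := h.K2_posDef (by simpa using h.ρ_pos.le)
  obtain ⟨w₀, u₀, c, hw₀, hl⟩ := MLE.Model.exists_linData (ξ₀ := ξ₀) hgrowth hθ hpd hB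
  have hcr : Y.Crit (ω₀, ν₀) w₀ :=
    ⟨MLE.Model.lD_centre_eq_zero hgrowth hθ hpd hB hξ₀ hw₀,
      fun e he => MLE.Model.lH_centre_neg hgrowth hθ hpd hB hE hw₀ he⟩
  obtain ⟨K, N, ho⟩ := h.exists_oscBounds hgrowth hmean
  obtain ⟨r, hr, hrρ, r', hr', D, N₁, hmax⟩ :=
    MLE.Model.exists_maximisers hcr hl ho h hgrowth hmean
  obtain ⟨N₂, hdens⟩ := h.isContDensity
  have hball : ∀ θ ∈ Metric.ball (ω₀, ν₀) r, ‖θ - (ω₀, ν₀)‖ ≤ ρ := fun θ hθ =>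
    ((mem_ball_iff_norm.1 hθ).le).trans hrρ
  have hdom : Metric.ball (ω₀, ν₀) r ⊆ Y.domain := fun θ hθ =>
    MLE.Model.mem_domain_of_goodSet (h.mem_goodSet (hball θ hθ))
  refine ⟨N₁ + N₂ + 3, Metric.ball (ω₀, ν₀) r, Metric.ball (ω₀, ν₀) (min r r'),
    Metric.ball ξ₀ r', D, by omega, Metric.isOpen_ball, Metric.mem_ball_self hr, hdom,
    Metric.isOpen_ball, Metric.mem_ball_self (lt_min hr hr'),
    (Metric.ball_subset_ball (min_le_left _ _)).trans hdom, Metric.isOpen_ball,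
    Metric.mem_ball_self hr', fun n hn θ hθ => (hdens n (by omega) θ (hball θ hθ)).2, ?_⟩
  rintro n hn ω' hω ξ hξ x rfl
  obtain ⟨k, rfl⟩ : ∃ k, n = k + 3 := ⟨n - 3, by omega⟩
  have hω' : ‖ω' - ω₀‖ < r' := by
    have h1 := norm_fst_le ((ω', ν₀) - (ω₀, ν₀) : MLE.Param p₁ p₂)
    exact h1.trans_lt ((mem_ball_iff_norm.1 hω).trans_le (min_le_right _ _))
  obtain ⟨θ, θ', hm, hm', h1, h2⟩ := hmax k (by omega) ω' ξ hω' (mem_ball_iff_norm.1 hξ)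
  refine ⟨θ, θ', hm.congr_mul Metric.isOpen_ball (MLE.Model.nrm_pos m k) fun η hη => ?_,
    hm'.congr_mul Metric.isOpen_ball (MLE.Model.nrm_pos m k) fun η hη => ?_, ?_, ?_⟩
  · rw [MLE.Model.normalLikelihood_eq_nI (h.mem_goodSet (hball η hη)) (h.K2_posDef (hball η hη)),
      MLE.Model.eps_smul_obs]
  · rw [MLE.Model.likelihood_eq_tI (h.mem_goodSet (hball η hη))
      (hdens (k + 3) (by omega) η (hball η hη)).1, MLE.Model.eps_smul_obs]
  · refine h1.trans_eq ?_
    rw [MLE.eps, inv_pow, Real.sq_sqrt (Nat.cast_nonneg _), div_eq_mul_inv]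
  · exact h2
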